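/- Let $\Omega\subset\mathbb{R}^3$ be a bounded $C^{1,1}$-domain (a bounded, connected, non-empty open set which near every boundary point is, in suitable Cartesian coordinates, the region below the graph of a $C^1$-function with Lipschitz continuous derivative; $\partial\Omega$ may be disconnected), with surface measure $d\sigma$ on $\partial\Omega$ and outward unit normal $\mathcal N$. Let $L^2\mathcal H(\Omega)$ be the space of all $B\in L^2(\Omega,\mathbb{R}^3)$ with $\operatorname{div}B=0$ and $\operatorname{curl}B=0$ in the weak sense, and let $\mathcal H_{\mathrm{ex}}(\Omega)$ be the set of those $B\in L^2\mathcal H(\Omega)$ for which $B=\nabla f$ for some $f\in H^1(\Omega)$. Let $W^{\frac12,2}(\partial\Omega)$ be the completion of the Lipschitz functions on $\partial\Omega$ with respect to the norm $$\|u\|^2_{W^{\frac12,2}(\partial\Omega)}=\int_{\partial\Omega}|u|^2\,d\sigma+\int_{\partial\Omega}\int_{\partial\Omega}\frac{|u(x)-u(y)|^2}{|x-y|^3}\,d\sigma(x)\,d\sigma(y),$$ and let $W^{-\frac12,2}(\partial\Omega)$ be its topological dual with the dual norm. Then every $B\in L^2\mathcal H(\Omega)$ has a unique normal trace $\mathcal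 N\cdot B\in W^{-\frac12,2}(\partial\Omega)$, characterised by Green's formula $\langle\mathcal N\cdot B,\varphi|_{\partial\Omega}\rangle=\int_\Omega B\cdot\nabla\varphi\,d^3x$ for all $\varphi\in C^1_c(\mathbb{R}^3)$, and $B$ has a representative that is continuous in $\Omega$, with which line integrals of $B$ along curves in $\Omega$ are formed. Moreover: (i) There are constants $0<c_1,c_2<\infty$, depending only on $\Omega$, such that for all $\nabla f\in\mathcal H_{\mathrm{ex}}(\Omega)$ $$c_1\|\mathcal N\cdot\nabla f\|_{W^{-\frac12,2}(\partial\Omega)}\le\|\nabla f\|_{L^2(\Omega)}\le c_2\|\mathcal N\cdot\nabla f\|_{W^{-\frac12,2}(\partial\Omega)}.$$ (ii) Suppose in addition that $\Omega$ is a solid torus, i.e. homeomorphic to the product of an open disc and a circle, and let $\sigma\subset\Omega$ be a simple closed $C^1$-loop which represents a non-trivial element of the fundamental group of $\Omega$. Then there are constants $0<c_1,c_2<\infty$ such that for all $B\in L^2\mathcal H(\Omega)$ $$\|B\|_{L^2(\Omega)}\le c_1\sqrt{\|\mathcal N\cdot B\|^2_{W^{-\frac12,2}(\partial\Omega)}+\Big(\int_\sigma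 B\Big)^2}\le c_2\|B\|_{L^2(\Omega)}.$$ The constants may depend on $\Omega$ and $\sigma$; for loops $\sigma$ whose class generates the fundamental group of $\Omega$ they can be chosen to depend only on $\Omega$. -/

import Mathlib

open MeasureTheory Set Metric Filter Topology
open scoped ContDiff NNReal ENNReal

namespace HarmonicFields

noncomputable section

/-- Euclidean three-space. -/
abbrev E3 : Type := EuclideanSpace ℝ (Fin 3)

/-- The `i`-th partial derivative of a scalar function on `ℝ³`. -/
def partialDeriv (i : Fin 3) (φ : E3 → ℝ) (x : E3) : ℝ :=
  fderiv ℝ φ x (EuclideanSpace.single i 1)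

/-- The classical curl of a vector field on `ℝ³`. -/
def curl (Ψ : E3 → E3) (x : E3) : E3 :=
  !₂[partialDeriv 1 (fun y => Ψ y 2) x - partialDeriv 2 (fun y => Ψ y 1) x,
    partialDeriv 2 (fun y => Ψ y 0) x - partialDeriv 0 (fun y => Ψ y 2) x,
    partialDeriv 0 (fun y => Ψ y 1) x - partialDeriv 1 (fun y => Ψ y 0) x]

/-- `φ ∈ C_c^∞(Ω; F)`. -/
def IsTestFunction {F : Type*} [NormedAddCommGroup F] [NormedSpace ℝ F]
    (Ω : Set E3) (φ : E3 → F) : Prop :=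
  ContDiff ℝ ∞ φ ∧ HasCompactSupport φ ∧ tsupport φ ⊆ Ω

/-- The Hilbert space `L²(Ω, ℝ³)`. -/
abbrev L2Field (Ω : Set E3) : Type := Lp E3 2 ((volume : Measure E3).restrict Ω)

/-- The Hilbert space `L²(Ω)` of scalar functions. -/
abbrev L2Fun (Ω : Set E3) : Type := Lp ℝ 2 ((volume : Measure E3).restrict Ω)

/-- `div B = d` in `Ω` in the weak sense. -/
def HasWeakDiv (Ω : Set E3) (B : L2Field Ω) (d : L2Fun Ω) : Prop :=
  ∀ φ : E3 → ℝ, IsTestFunction Ω φ →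
    ∫ x in Ω, inner ℝ (B x) (gradient φ x) = -∫ x in Ω, d x * φ x

/-- `curl B = w` in `Ω` in the weak sense. -/
def HasWeakCurl (Ω : Set E3) (B w : L2Field Ω) : Prop :=
  ∀ Ψ : E3 → E3, IsTestFunction Ω Ψ →
    ∫ x in Ω, inner ℝ (B x) (curl Ψ x) = ∫ x in Ω, inner ℝ (w x) (Ψ x)

/-- `∇f = B` in `Ω` in the weak sense; if `f` and `B` are in `L²`, this says that `f ∈ H¹(Ω)`
and that `B` is its gradient. -/
def HasWeakGradient (Ω : Set E3) (f : L2Fun Ω) (B : L2Field Ω) : Prop :=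
  ∀ φ : E3 → ℝ, IsTestFunction Ω φ → ∀ i : Fin 3,
    ∫ x in Ω, f x * partialDeriv i φ x = -∫ x in Ω, B x i * φ x

/-- `L²H(Ω)`: the square integrable fields on `Ω` that are weakly div-free and curl-free. -/
def harmonicFields (Ω : Set E3) : Set (L2Field Ω) :=
  {B | HasWeakDiv Ω B 0 ∧ HasWeakCurl Ω B 0}

/-- `H_ex(Ω)`: the fields in `L²H(Ω)` that are gradients of functions in `H¹(Ω)`. -/
def exactHarmonicFields (Ω : Set E3) : Set (L2Field Ω) :=
  {B | B ∈ harmonicFields Ω ∧ ∃ f : L2Fun Ω, HasWeakGradient Ω f B}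

/-- A bounded `C^{1,1}`-domain of `ℝ³`: a bounded, connected, non-empty open set that near each
of its boundary points is, in suitable Cartesian coordinates, the region below the graph of a
`C¹`-function with Lipschitz continuous derivative. The boundary may be disconnected. -/
structure IsBoundedC11Domain (Ω : Set E3) : Prop where
  isOpen : IsOpen Ω
  isConnected : IsConnected Ω
  isBounded : Bornology.IsBounded Ω
  localGraph : ∀ p ∈ frontier Ω, ∃ (e : E3 ≃ᵃⁱ[ℝ] E3) (r : ℝ)
    (ψ : EuclideanSpace ℝ (Fin 2) → ℝ) (K : ℝ≥0), 0 < r ∧ ContDiff ℝ 1 ψ ∧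
      LipschitzWith K (fderiv ℝ ψ) ∧
      ∀ x ∈ ball p r, x ∈ Ω ↔ e x 2 < ψ !₂[e x 0, e x 1]

/-- `Ω` is (the interior of) a solid torus: it is homeomorphic to the product of an open disc and
a circle. -/
def IsSolidTorus (Ω : Set E3) : Prop :=
  Nonempty (Ω ≃ₜ (ball (0 : ℂ) 1 × Circle))

/-- The surface measure on `∂Ω`: the two-dimensional Hausdorff measure, in the normalization that
agrees with Lebesgue measure on planes, restricted to `∂Ω`. -/
def surfaceMeasure (Ω : Set E3) : Measure E3 :=
  (μHE[2] : Measure E3).restrict (frontier Ω)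

/-- The Hilbert space `L²(∂Ω) × L²(∂Ω × ∂Ω)` with the norm `√(‖g‖² + ‖G‖²)`. -/
abbrev SurfacePairs (Ω : Set E3) : Type :=
  WithLp 2 (Lp ℝ 2 (surfaceMeasure Ω) ×
    Lp ℝ 2 ((surfaceMeasure Ω).prod (surfaceMeasure Ω)))

/-- The quotient `(u x - u y) / |x - y|^{3/2}`; the integral of its square over `∂Ω × ∂Ω` is the
squared `W^{1/2,2}`-seminorm of `u`. -/
def diffQuot (u : E3 → ℝ) (p : E3 × E3) : ℝ :=
  (u p.1 - u p.2) / dist p.1 p.2 ^ (3 / 2 : ℝ)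

/-- The Lipschitz functions on `∂Ω`, with `u` realized as the pair of `u` and its quotient
`diffQuot u`. The norm inherited from `SurfacePairs Ω` is
`√(∫ |u|² dσ + ∫∫ |u x - u y|² / |x - y|³ dσ dσ)`. -/
def lipschitzFunctions (Ω : Set E3) : Submodule ℝ (SurfacePairs Ω) where
  carrier := {w | ∃ (u : E3 → ℝ) (K : ℝ≥0), LipschitzWith K u ∧
    w.fst =ᵐ[surfaceMeasure Ω] u ∧
    w.snd =ᵐ[(surfaceMeasure Ω).prod (surfaceMeasure Ω)] diffQuot u}
  zero_mem' := by
    refine ⟨0, 0, LipschitzWith.const 0, ?_, ?_⟩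
    · exact Lp.coeFn_zero _ _ _
    · filter_upwards [Lp.coeFn_zero ℝ 2 ((surfaceMeasure Ω).prod (surfaceMeasure Ω))] with p hp
      simpa [diffQuot] using hp
  add_mem' := by
    rintro w w' ⟨u, K, hu, h1, h2⟩ ⟨u', K', hu', h1', h2'⟩
    refine ⟨fun x => u x + u' x, K + K', hu.add hu', ?_, ?_⟩
    · filter_upwards [h1, h1', Lp.coeFn_add w.fst w'.fst] with x hx hx' h
      rw [WithLp.add_fst, h, Pi.add_apply, hx, hx']
    · filter_upwards [h2, h2', Lp.coeFn_add w.snd w'.snd] with x hx hx' h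
      rw [WithLp.add_snd, h, Pi.add_apply, hx, hx']
      simp only [diffQuot]
      ring
  smul_mem' := by
    rintro c w ⟨u, K, hu, h1, h2⟩
    refine ⟨fun x => c • u x, ‖c‖₊ * K, (lipschitzWith_smul c).comp hu, ?_, ?_⟩
    · filter_upwards [h1, Lp.coeFn_smul c w.fst] with x hx h
      rw [WithLp.smul_fst, h, Pi.smul_apply, hx]
    · filter_upwards [h2, Lp.coeFn_smul c w.snd] with x hx h
      rw [WithLp.smul_snd, h, Pi.smul_apply, hx]
      simp only [diffQuot, smul_eq_mul]
      ring

/-- `W^{1/2,2}(∂Ω)`: the completion of the Lipschitz functions on `∂Ω` in the norm above, realized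
as their closure in a Hilbert space. -/
def halfSobolev (Ω : Set E3) : Submodule ℝ (SurfacePairs Ω) :=
  (lipschitzFunctions Ω).topologicalClosure

/-- `W^{-1/2,2}(∂Ω)`: the topological dual of `W^{1/2,2}(∂Ω)`, with the dual norm. -/
abbrev negHalfSobolev (Ω : Set E3) : Type := StrongDual ℝ (halfSobolev Ω)

/-- `w ∈ W^{1/2,2}(∂Ω)` is the restriction of `φ` to `∂Ω`. -/
def IsRestriction (Ω : Set E3) (φ : E3 → ℝ) (w : halfSobolev Ω) : Prop :=
  (w : SurfacePairs Ω).fst =ᵐ[surfaceMeasure Ω] φ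

/-- `T ∈ W^{-1/2,2}(∂Ω)` is the normal trace `N · B` of `B ∈ H(div, Ω)` with respect to the outward
unit normal `N`, defined by Green's formula `⟨N · B, φ⟩ = ∫_Ω (B · ∇φ + (div B) φ)`. -/
def IsNormalTrace (Ω : Set E3) (B : L2Field Ω) (T : negHalfSobolev Ω) : Prop :=
  ∃ d : L2Fun Ω, HasWeakDiv Ω B d ∧
    ∀ φ : E3 → ℝ, ContDiff ℝ 1 φ → HasCompactSupport φ →
      ∀ w : halfSobolev Ω, IsRestriction Ω φ w →
        T w = ∫ x in Ω, (inner ℝ (B x) (gradient φ x) + d x * φ x)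

/-- `B'` is a representative of the class `B` that is continuous on the open set `Ω`; its values in
`Ω` are then determined by `B`. -/
def IsContinuousRep (Ω : Set E3) (B : L2Field Ω) (B' : E3 → E3) : Prop :=
  ContinuousOn B' Ω ∧ B =ᵐ[(volume : Measure E3).restrict Ω] B'

/-- The parametrization of a path in `Ω` by the real interval `[0, 1]`. -/
def curve {Ω : Set E3} {x : Ω} (σ : Path x x) (t : ℝ) : E3 := (σ.extend t : E3)

/-- `σ` is a simple closed `C¹`-loop in `Ω`. -/
def IsSimpleC1Loop {Ω : Set E3} {x : Ω} (σ : Path x x) : Prop :=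
  ContDiffOn ℝ 1 (curve σ) (Icc 0 1) ∧ InjOn (curve σ) (Ico 0 1)

/-- The loop `σ` represents a non-trivial element of the fundamental group of `Ω`. -/
def IsNontrivialLoop {Ω : Set E3} {x : Ω} (σ : Path x x) : Prop :=
  ¬ σ.Homotopic (Path.refl x)

/-- The class of the loop `σ` generates the fundamental group of `Ω`. -/
def IsGeneratingLoop {Ω : Set E3} {x : Ω} (σ : Path x x) : Prop :=
  ∀ g : FundamentalGroup Ω x,
    g ∈ Subgroup.zpowers (FundamentalGroup.fromPath (Path.Homotopic.Quotient.mk σ))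

/-- The circulation `∫_σ B`. -/
def circulation {Ω : Set E3} {x : Ω} (σ : Path x x) (B : E3 → E3) : ℝ :=
  ∫ t in (0 : ℝ)..1, inner ℝ (B (curve σ t)) (derivWithin (curve σ) (Icc 0 1) t)

end

end HarmonicFields

open HarmonicFields

/-! Regularity comes first. By `curl curl = grad div - Δ`, the components of a field `B` in
`harmonicFields Ω` are weakly harmonic. Weyl's lemma then makes `B` smooth and classically
curl-free, and the mean value property bounds it on compact subsets of `Ω` by its `L²` norm. In
particular, circulations along `C¹` loops are bounded functionals of `B`.

The trace is bounded by the field (`exists_abs_integral_gradient_le`). Since `B` is orthogonal to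
gradients of `C¹` functions supported in `Ω`, the integral of `B · ∇φ` sees only the boundary values
of `φ`, and `φ` may be exchanged for a cheaper extension of them. The extension used is the average
over the boundary with weights `|x - y|⁻⁶`. Its Dirichlet energy is bounded by the double integral
of `|φ y - φ z|² / |y - z|³` (`exists_lintegral_bdryExtDeriv_le`), and
`integral_fderiv_eq_integral_bdryExtDeriv` justifies the exchange by a cut-off argument. Hahn–Banach
turns the bound into an element of the dual space, and density of restrictions of `C¹` functions
makes it unique.

The field is bounded by the trace if it is a gradient (`exists_norm_le_of_gradient`). For `B = ∇f`,
formally `‖B‖² = ⟨N · B, f⟩ ≤ ‖N · B‖ ‖f‖`, with the `W^{1/2,2}` norm of `f` on the boundary. The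
trace theorem bounds the latter by the `H¹` norm of `f`, and the Poincaré inequality
`hasPoincare_domain`, after subtraction of a constant, bounds this by `‖B‖`. As `f` need not be `C¹`
up to the boundary, it is first composed with a small shift that pushes the closure of `Ω` into `Ω`.

On a solid torus, a potential of `B` always exists on the universal covering `ℂ × ℝ`. One deck
transformation adds a constant to it, the period, and the circulation along a loop is the winding
number times the period (`exists_period`). A non-trivial loop has non-zero winding number, so
vanishing circulation makes `B` a gradient and the previous estimate applies. Any other `B` is
reduced to this case by subtracting a multiple of one fixed field with non-zero circulation.
Generating loops have winding number `±1`, so their circulations agree up to sign and one pair of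
constants serves them all. -/

namespace HarmonicFields

noncomputable section

/-! ### Boundary charts -/

/-- The Euclidean plane. -/
abbrev E2 : Type := EuclideanSpace ℝ (Fin 2)

/-- The identification of `ℝ² × ℝ`, with the Euclidean norm, with `ℝ³`. -/
def prodIsometry : WithLp 2 (E2 × ℝ) ≃ₗᵢ[ℝ] E3 where
  toFun z := !₂[z.fst 0, z.fst 1, z.snd]
  invFun x := WithLp.toLp 2 (!₂[x 0, x 1], x 2)
  map_add' z w := by ext i; fin_cases i <;> simp
  map_smul' c z := by ext i; fin_cases i <;> simp
  left_inv z := by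
    apply WithLp.ofLp_injective
    refine Prod.ext ?_ rfl
    ext i; fin_cases i <;> simp
  right_inv x := by ext i; fin_cases i <;> simp
  norm_map' z := by
    have h : ‖z‖ ^ 2 = ‖z.fst‖ ^ 2 + ‖z.snd‖ ^ 2 := WithLp.prod_norm_sq_eq_of_L2 z
    rw [← sq_eq_sq₀ (norm_nonneg _) (norm_nonneg _), h, EuclideanSpace.norm_sq_eq,
      EuclideanSpace.norm_sq_eq]
    simp [Fin.sum_univ_three]

/-- The identification of `ℝ² × ℝ` with `ℝ³`. -/
def prodEquiv : (E2 × ℝ) ≃L[ℝ] E3 :=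
  (WithLp.prodContinuousLinearEquiv 2 ℝ E2 ℝ).symm.trans prodIsometry.toContinuousLinearEquiv

theorem prodEquiv_apply (z : E2 × ℝ) : prodEquiv z = !₂[z.1 0, z.1 1, z.2] := rfl

theorem measurePreserving_prodEquiv : MeasurePreserving prodEquiv volume volume :=
  prodIsometry.measurePreserving.comp (WithLp.volume_preserving_toLp E2 ℝ)

theorem norm_fst_le_norm_prodEquiv (z : E2 × ℝ) : ‖z.1‖ ≤ ‖prodEquiv z‖ := by
  rw [← sq_le_sq₀ (norm_nonneg _) (norm_nonneg _), EuclideanSpace.norm_sq_eq,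
    EuclideanSpace.norm_sq_eq, prodEquiv_apply]
  simp only [Fin.sum_univ_three, Fin.sum_univ_two]
  simp
  positivity

/-- The shear `(x, s) ↦ (x, ψ x - s)`. -/
def graphShear (ψ : E2 → ℝ) (hψ : Continuous ψ) : (E2 × ℝ) ≃ₜ (E2 × ℝ) where
  toFun z := (z.1, ψ z.1 - z.2)
  invFun z := (z.1, ψ z.1 - z.2)
  left_inv z := by simp
  right_inv z := by simp
  continuous_toFun := by fun_prop
  continuous_invFun := by fun_prop

/-- On each vertical line the shear is a reflection, so Fubini gives the claim. -/
theorem measurePreserving_graphShear (ψ : E2 → ℝ) (hψ : Continuous ψ) :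
    MeasurePreserving (graphShear ψ hψ) volume volume := by
  refine (MeasurePreserving.id (volume : Measure E2)).skew_product
    (g := fun x s => ψ x - s) (by fun_prop) (ae_of_all _ fun x => ?_)
  exact (Measure.measurePreserving_sub_left volume (ψ x)).map_eq

/-- The box on which a boundary chart is controlled. -/
def chartBox (a : E2) (ρ : ℝ) : Set (E2 × ℝ) := ball a ρ ×ˢ Ioo (-(2 * ρ)) (2 * ρ)

theorem isOpen_chartBox (a : E2) (ρ : ℝ) : IsOpen (chartBox a ρ) := isOpen_ball.prod isOpen_Ioo

theorem chartBox_mono (a : E2) {ρ ρ' : ℝ} (h : ρ ≤ ρ') : chartBox a ρ ⊆ chartBox a ρ' :=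
  prod_mono (ball_subset_ball h) (Ioo_subset_Ioo (by linarith) (by linarith))

/-- Volume preserving coordinates `(x, s)` of `ℝ³` in which, over a box around `(a, 0)`, the set
`Ω` is given by `s > 0`; the `s`-lines have direction `-v`. -/
structure IsBoundaryChart (Ω : Set E3) (Γ : (E2 × ℝ) ≃ₜ E3) (v : E3) (a : E2) (ρ : ℝ)
    (L : ℝ≥0) : Prop where
  pos : 0 < ρ
  contDiff : ContDiff ℝ 1 Γ
  measurePreserving : MeasurePreserving Γ volume volume
  lipschitz : LipschitzOnWith L Γ (chartBox a ρ)
  dist_le : ∀ z w, dist z.1 w.1 ≤ dist (Γ z) (Γ w)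
  mem_iff : ∀ z ∈ chartBox a ρ, Γ z ∈ Ω ↔ 0 < z.2
  mem_frontier_iff : ∀ z ∈ chartBox a ρ, Γ z ∈ frontier Ω ↔ z.2 = 0
  translate : ∀ x s t, Γ (x, s + t) = Γ (x, s) - t • v

theorem IsBoundaryChart.mono {Ω : Set E3} {Γ : (E2 × ℝ) ≃ₜ E3} {v : E3} {a : E2} {ρ ρ' : ℝ}
    {L : ℝ≥0} (h : IsBoundaryChart Ω Γ v a ρ L) (h0 : 0 < ρ') (h1 : ρ' ≤ ρ) :
    IsBoundaryChart Ω Γ v a ρ' L where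
  pos := h0
  contDiff := h.contDiff
  measurePreserving := h.measurePreserving
  lipschitz := h.lipschitz.mono (chartBox_mono a h1)
  dist_le := h.dist_le
  mem_iff z hz := h.mem_iff z (chartBox_mono a h1 hz)
  mem_frontier_iff z hz := h.mem_frontier_iff z (chartBox_mono a h1 hz)
  translate := h.translate

theorem mk_mem_chartBox {a x : E2} {ρ s : ℝ} :
    (x, s) ∈ chartBox a ρ ↔ x ∈ ball a ρ ∧ -(2 * ρ) < s ∧ s < 2 * ρ := Iff.rfl

theorem exists_chartBox_subset {U : Set (E2 × ℝ)} {a : E2} (hU : U ∈ 𝓝 (a, (0 : ℝ))) :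
    ∃ ρ > 0, chartBox a ρ ⊆ U := by
  obtain ⟨ε, hε, h⟩ := Metric.mem_nhds_iff.1 hU
  refine ⟨ε / 2, by positivity, fun z hz => h ?_⟩
  obtain ⟨h1, h2⟩ := hz
  rw [mem_ball, Prod.dist_eq, max_lt_iff]
  refine ⟨(mem_ball.1 h1).trans (by linarith), ?_⟩
  rw [Real.dist_eq, sub_zero, abs_lt]
  exact ⟨by linarith [h2.1], by linarith [h2.2]⟩

/-- Flattening the graph by a shear and then applying a rigid motion preserves volume. Forgetting
the height contracts distances, which yields `dist_le`; the Lipschitz constant is the local one of a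
`C¹` map. -/
theorem exists_isBoundaryChart {Ω : Set E3} (hΩ : IsBoundedC11Domain Ω) {p : E3}
    (hp : p ∈ frontier Ω) :
    ∃ Γ v a ρ L, IsBoundaryChart Ω Γ v a ρ L ∧ Γ (a, 0) = p := by
  obtain ⟨e, r, ψ, K, hr, hψ, -, hmem⟩ := hΩ.localGraph p hp
  set Γ : (E2 × ℝ) ≃ₜ E3 := ((graphShear ψ hψ.continuous).trans
    prodEquiv.toHomeomorph).trans e.symm.toHomeomorph with hΓ
  have hΓa : ∀ z : E2 × ℝ, Γ z = e.symm (prodEquiv (z.1, ψ z.1 - z.2)) := fun z => rfl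
  have heΓ : ∀ z, e (Γ z) = prodEquiv (z.1, ψ z.1 - z.2) := fun z => by simp [hΓa]
  have hΓC : ContDiff ℝ 1 Γ := by
    have : (Γ : E2 × ℝ → E3) = fun z => e.symm (prodEquiv (z.1, ψ z.1 - z.2)) := rfl
    rw [this]
    refine e.symm.toContinuousAffineEquiv.toContinuousAffineMap.contDiff.comp
      (prodEquiv.contDiff.comp ?_)
    fun_prop
  have hin : ∀ z, Γ z ∈ ball p r → (Γ z ∈ Ω ↔ 0 < z.2) := fun z hz => by
    have h2 : (!₂[z.1 0, z.1 1] : E2) = z.1 := by ext i; fin_cases i <;> simp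
    rw [hmem _ hz, heΓ, prodEquiv_apply]
    simp [h2]
  set z₀ : E2 × ℝ := Γ.symm p with hz₀
  have hΓz₀ : Γ z₀ = p := by simp [hz₀]
  -- Below the graph a neighbourhood misses `Ω`, above it the point is interior, and on it the
  -- points of height `1 / (n + 1)` approach from inside.
  have hball : ∀ z, Γ z ∈ ball p r → (Γ z ∈ frontier Ω ↔ z.2 = 0) := fun z hz => by
    have hU : IsOpen (Γ ⁻¹' ball p r) := isOpen_ball.preimage Γ.continuous
    rw [← mem_preimage, Γ.preimage_frontier]
    constructor
    · intro hf
      rcases lt_trichotomy z.2 0 with h | h | h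
      · exfalso
        have hcl := hf.1
        rw [_root_.mem_closure_iff] at hcl
        obtain ⟨w, hw, hw'⟩ := hcl (Γ ⁻¹' ball p r ∩ {w | w.2 < 0})
          (hU.inter (isOpen_lt continuous_snd continuous_const)) ⟨hz, h⟩
        exact absurd ((hin w hw.1).1 hw') (not_lt.2 hw.2.le)
      · exact h
      · exfalso
        have := (hin z hz).2 h
        exact hf.2 (by rwa [(hΩ.isOpen.preimage Γ.continuous).interior_eq])
    · intro h
      constructor
      · rw [mem_closure_iff_seq_limit]
        have hlim : Tendsto (fun n : ℕ => (z.1, 1 / ((n : ℝ) + 1))) atTop (𝓝 z) := by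
          have := (tendsto_const_nhds (x := z.1)).prodMk_nhds
            (tendsto_one_div_add_atTop_nhds_zero_nat (𝕜 := ℝ))
          rwa [← h] at this
        obtain ⟨N, hN⟩ := eventually_atTop.1 (hlim.eventually (hU.mem_nhds hz))
        refine ⟨fun n => (z.1, 1 / (((n + N : ℕ) : ℝ) + 1)), fun n => ?_, ?_⟩
        · exact (hin _ (hN (n + N) (by lia))).2 (by positivity)
        · exact hlim.comp (tendsto_add_atTop_nat N)
      · intro hi
        have := (hin z hz).1 (mem_preimage.1 (interior_subset hi))
        exact this.ne' h
  have hz₀2 : z₀.2 = 0 := (hball z₀ (by rw [hΓz₀]; exact mem_ball_self hr)).1 (hΓz₀ ▸ hp)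
  have hz₀' : z₀ = (z₀.1, 0) := Prod.ext rfl hz₀2
  obtain ⟨L, t, ht, hL⟩ := (hΓC.contDiffAt (x := z₀)).exists_lipschitzOnWith
  have hnhds : t ∩ Γ ⁻¹' ball p r ∈ 𝓝 (z₀.1, (0 : ℝ)) := by
    rw [← hz₀']
    exact inter_mem ht (Γ.continuous.continuousAt (by rw [hΓz₀]; exact ball_mem_nhds p hr))
  obtain ⟨ρ, hρ, hsub⟩ := exists_chartBox_subset hnhds
  refine ⟨Γ, e.symm.linearIsometryEquiv (prodEquiv (0, 1)), z₀.1, ρ, L, ⟨hρ, hΓC, ?_,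
    hL.mono fun z hz => (hsub hz).1, ?_, fun z hz => hin z (hsub hz).2,
    fun z hz => hball z (hsub hz).2, ?_⟩, by rw [← hz₀', hΓz₀]⟩
  · have he : MeasurePreserving e.symm volume volume := by
      have := e.symm.toIsometryEquiv.measurePreserving_euclideanHausdorffMeasure 3
      rwa [EuclideanSpace.euclideanHausdorffMeasure_eq_volume] at this
    exact (he.comp measurePreserving_prodEquiv).comp
      (measurePreserving_graphShear ψ hψ.continuous)
  · intro z w
    rw [hΓa, hΓa, e.symm.dist_map, dist_eq_norm, dist_eq_norm, ← map_sub]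
    exact norm_fst_le_norm_prodEquiv ((z.1, ψ z.1 - z.2) - (w.1, ψ w.1 - w.2))
  · intro x s t
    rw [hΓa, hΓa]
    have h1 : prodEquiv (x, ψ x - (s + t)) =
        (-t) • prodEquiv ((0 : E2), (1 : ℝ)) +ᵥ prodEquiv (x, ψ x - s) := by
      rw [vadd_eq_add, ← map_smul, ← map_add]
      congr 1
      simp [Prod.ext_iff]; ring
    simp only [h1]
    rw [e.symm.map_vadd]
    simp [sub_eq_neg_add]

/-- The boxes of half the size already cover the boundary, which leaves room around each boundary
point in its chart. -/
theorem exists_finite_charts {Ω : Set E3} (hΩ : IsBoundedC11Domain Ω) :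
    ∃ (ι : Type) (_ : Fintype ι) (Γ : ι → (E2 × ℝ) ≃ₜ E3) (v : ι → E3) (a : ι → E2) (ρ : ι → ℝ)
      (L : ι → ℝ≥0), (∀ i, IsBoundaryChart Ω (Γ i) (v i) (a i) (ρ i) (L i)) ∧
      frontier Ω ⊆ ⋃ i, Γ i '' chartBox (a i) (ρ i / 2) := by
  choose Γ v a ρ L h h0 using fun p : frontier Ω => exists_isBoundaryChart hΩ p.2
  have hcomp : IsCompact (frontier Ω) :=
    hΩ.isBounded.isCompact_closure.of_isClosed_subset isClosed_frontier frontier_subset_closure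
  obtain ⟨t, htΩ⟩ := hcomp.elim_nhds_subcover'
    (fun p hp => Γ ⟨p, hp⟩ '' chartBox (a ⟨p, hp⟩) (ρ ⟨p, hp⟩ / 2))
    (fun p hp => by
      refine ((Γ ⟨p, hp⟩).isOpenMap _ (isOpen_chartBox _ _)).mem_nhds
        ⟨(a ⟨p, hp⟩, 0), ?_, h0 ⟨p, hp⟩⟩
      have := (h ⟨p, hp⟩).pos
      exact mk_mem_chartBox.2 ⟨mem_ball_self (by linarith), by linarith, by linarith⟩)
  refine ⟨t, inferInstance, fun p => Γ p.1, fun p => v p.1, fun p => a p.1, fun p => ρ p.1,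
    fun p => L p.1, fun p => h p.1, fun x hx => ?_⟩
  obtain ⟨p, hp, hxp⟩ := mem_iUnion₂.1 (htΩ hx)
  exact mem_iUnion.2 ⟨⟨p, hp⟩, hxp⟩

/-! ### Area of balls on the boundary -/

theorem isCompact_frontier {Ω : Set E3} (hΩ : IsBoundedC11Domain Ω) : IsCompact (frontier Ω) :=
  hΩ.isBounded.isCompact_closure.of_isClosed_subset isClosed_frontier frontier_subset_closure

theorem euclideanHausdorffMeasure_image_le {X Y : Type*} [EMetricSpace X] [MeasurableSpace X]
    [BorelSpace X] [EMetricSpace Y] [MeasurableSpace Y] [BorelSpace Y] {K : ℝ≥0} {f : X → Y}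
    {s : Set X} (h : LipschitzOnWith K f s) (d : ℕ) :
    (μHE[d] : Measure Y) (f '' s) ≤ (K : ℝ≥0∞) ^ d * (μHE[d] : Measure X) s := by
  simp_rw [Measure.euclideanHausdorffMeasure_def, Measure.smul_apply, ENNReal.smul_def,
    smul_eq_mul]
  calc _ ≤ _ * ((K : ℝ≥0∞) ^ (d : ℝ) * μH[d] s) := by
        gcongr; exact h.hausdorffMeasure_image_le d.cast_nonneg
    _ = _ := by rw [ENNReal.rpow_natCast]; ring

variable {Ω : Set E3} {Γ : (E2 × ℝ) ≃ₜ E3} {v : E3} {a : E2} {ρ : ℝ} {L : ℝ≥0}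

theorem IsBoundaryChart.zero_mem (h : IsBoundaryChart Ω Γ v a ρ L) {x : E2} (hx : x ∈ ball a ρ) :
    (x, (0 : ℝ)) ∈ chartBox a ρ :=
  mk_mem_chartBox.2 ⟨hx, by linarith [h.pos], by linarith [h.pos]⟩

/-- In a chart the boundary is an `L`-Lipschitz image of a planar disc, and such a map enlarges
two-dimensional Hausdorff measure by at most `L ^ 2`. -/
theorem IsBoundaryChart.surfaceMeasure_restrict_le (h : IsBoundaryChart Ω Γ v a ρ L) :
    (surfaceMeasure Ω).restrict (Γ '' chartBox a ρ) ≤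
      ((L : ℝ≥0∞) ^ 2) • ((volume.restrict (ball a ρ)).map fun x => Γ (x, 0)) := by
  have hm : Measurable fun x : E2 => Γ (x, 0) := by fun_prop
  refine Measure.le_iff.2 fun A hA => ?_
  rw [Measure.restrict_apply hA, Measure.smul_apply, Measure.map_apply hm hA,
    Measure.restrict_apply (hm hA), surfaceMeasure, Measure.restrict_apply
    (hA.inter ((Γ.isOpenMap _ (isOpen_chartBox a ρ)).measurableSet)), smul_eq_mul]
  have hsub : A ∩ Γ '' chartBox a ρ ∩ frontier Ω ⊆
      (fun x : E2 => Γ (x, 0)) '' ((fun x : E2 => Γ (x, 0)) ⁻¹' A ∩ ball a ρ) := by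
    rintro _ ⟨⟨hyA, z, hz, rfl⟩, hyF⟩
    have h0 : z = (z.1, 0) := Prod.ext rfl ((h.mem_frontier_iff z hz).1 hyF)
    rw [h0] at hyA ⊢
    exact ⟨z.1, ⟨hyA, hz.1⟩, rfl⟩
  refine (measure_mono hsub).trans ?_
  rw [← EuclideanSpace.euclideanHausdorffMeasure_eq_volume]
  refine euclideanHausdorffMeasure_image_le (LipschitzOnWith.of_dist_le_mul fun x hx y hy => ?_) 2
  refine (h.lipschitz.dist_le_mul _ (h.zero_mem hx.2) _ (h.zero_mem hy.2)).trans_eq ?_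
  simp [Prod.dist_eq]

theorem IsBoundaryChart.surfaceMeasure_inter_le (h : IsBoundaryChart Ω Γ v a ρ L) {A : Set E3}
    (hA : MeasurableSet A) : surfaceMeasure Ω (A ∩ Γ '' chartBox a ρ) ≤
      (L : ℝ≥0∞) ^ 2 * volume ({x | Γ (x, 0) ∈ A} ∩ ball a ρ) := by
  have hm : Measurable fun x : E2 => Γ (x, 0) := by fun_prop
  have := h.surfaceMeasure_restrict_le A
  rwa [Measure.restrict_apply hA, Measure.smul_apply, Measure.map_apply hm hA,
    Measure.restrict_apply (hm hA), smul_eq_mul] at this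

theorem surfaceMeasure_le_sum {ι : Type*} [Fintype ι] {N : ι → Set E3}
    (hN : frontier Ω ⊆ ⋃ i, N i) (A : Set E3) :
    surfaceMeasure Ω A ≤ ∑ i, surfaceMeasure Ω (A ∩ N i) := by
  have : surfaceMeasure Ω A = surfaceMeasure Ω (A ∩ frontier Ω) := by
    rw [surfaceMeasure, Measure.restrict_apply' isClosed_frontier.measurableSet,
      Measure.restrict_apply' isClosed_frontier.measurableSet, inter_assoc, inter_self]
  rw [this]
  refine (measure_mono (?_ : _ ⊆ ⋃ i, A ∩ N i)).trans (measure_iUnion_fintype_le _ _)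
  rw [← inter_iUnion]
  exact inter_subset_inter_right _ hN

/-- Charts do not shrink horizontal distances, so the part of a ball seen in one chart comes from a
planar disc of twice the radius. This is the upper half of Ahlfors regularity. -/
theorem surfaceMeasure_closedBall_le (hΩ : IsBoundedC11Domain Ω) :
    ∃ C : ℝ≥0, ∀ (x : E3) (r : ℝ), 0 ≤ r →
      surfaceMeasure Ω (closedBall x r) ≤ C * ENNReal.ofReal (r ^ 2) := by
  obtain ⟨ι, _, Γ, v, a, ρ, L, h, hcov⟩ := exists_finite_charts hΩ
  have hcov' : frontier Ω ⊆ ⋃ i, Γ i '' chartBox (a i) (ρ i) :=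
    hcov.trans (iUnion_mono fun i => image_mono (chartBox_mono _ (by linarith [(h i).pos])))
  set V := volume (ball (0 : E2) 1) with hV
  have hVtop : V ≠ ⊤ := measure_ball_lt_top.ne
  refine ⟨(∑ i, (L i : ℝ≥0∞) ^ 2 * (4 * V)).toNNReal, fun x r hr => ?_⟩
  rw [ENNReal.coe_toNNReal (by
    refine ENNReal.sum_ne_top.2 fun i _ => ENNReal.mul_ne_top (by simp)
      (ENNReal.mul_ne_top (by simp) hVtop))]
  refine (surfaceMeasure_le_sum hcov' _).trans ?_
  rw [Finset.sum_mul]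
  gcongr with i
  refine ((h i).surfaceMeasure_inter_le isClosed_closedBall.measurableSet).trans ?_
  rw [mul_assoc]
  gcongr
  rcases ({y : E2 | Γ i (y, 0) ∈ closedBall x r} ∩ ball (a i) (ρ i)).eq_empty_or_nonempty
    with he | ⟨y₀, hy₀, -⟩
  · rw [he, measure_empty]; exact zero_le
  · have hsub : ({y : E2 | Γ i (y, 0) ∈ closedBall x r} ∩ ball (a i) (ρ i)) ⊆
        closedBall y₀ (2 * r) := by
      rintro y ⟨hy, -⟩
      have := (h i).dist_le (y, 0) (y₀, 0)
      have h2 := dist_triangle_right (Γ i (y, 0)) (Γ i (y₀, 0)) x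
      simp only [mem_closedBall, mem_ofPred_eq] at hy hy₀ this ⊢
      linarith
    refine (measure_mono hsub).trans ?_
    rw [Measure.addHaar_closedBall _ _ (by positivity)]
    simp only [finrank_euclideanSpace, Fintype.card_fin]
    rw [mul_pow, ENNReal.ofReal_mul (by norm_num)]
    have h4 : ENNReal.ofReal ((2 : ℝ) ^ 2) = 4 := by norm_num
    rw [h4, ← hV]
    exact le_of_eq (by ring)

theorem isFiniteMeasure_surfaceMeasure (hΩ : IsBoundedC11Domain Ω) :
    IsFiniteMeasure (surfaceMeasure Ω) := by
  obtain ⟨C, hC⟩ := surfaceMeasure_closedBall_le hΩ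
  obtain ⟨R, hR⟩ := (isCompact_frontier hΩ).isBounded.subset_closedBall 0
  refine ⟨?_⟩
  have h1 : surfaceMeasure Ω univ = surfaceMeasure Ω (closedBall 0 (max R 0)) := by
    have hsub : frontier Ω ⊆ closedBall 0 (max R 0) :=
      hR.trans (closedBall_subset_closedBall (le_max_left _ _))
    rw [surfaceMeasure, Measure.restrict_apply' isClosed_frontier.measurableSet,
      Measure.restrict_apply' isClosed_frontier.measurableSet, univ_inter,
      inter_eq_right.2 hsub]
  rw [h1]
  exact (hC _ _ (le_max_right _ _)).trans_lt (ENNReal.mul_lt_top (by simp) (by simp))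

theorem exists_ball_subset_chart {ι : Type*} {N : ι → Set E3} (hΩ : IsBoundedC11Domain Ω)
    (hN : ∀ i, IsOpen (N i)) (hcov : frontier Ω ⊆ ⋃ i, N i) :
    ∃ r > 0, ∀ p ∈ frontier Ω, ∃ i, ball p r ⊆ N i :=
  lebesgue_number_lemma_of_metric (isCompact_frontier hΩ) hN hcov

/-- The chart maps a planar disc of radius `r / M` into the ball, and the projection back to the
plane is a contraction, so the image has at least the area of the disc. This is the lower half of
Ahlfors regularity. -/
theorem le_surfaceMeasure_closedBall (hΩ : IsBoundedC11Domain Ω) (R : ℝ) :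
    ∃ c : ℝ, 0 < c ∧ ∀ p ∈ frontier Ω, ∀ r, 0 < r → r ≤ R →
      ENNReal.ofReal (c * r ^ 2) ≤ surfaceMeasure Ω (closedBall p r) := by
  obtain ⟨ι, _, Γ, v, a, ρ, L, h, hcov⟩ := exists_finite_charts hΩ
  obtain ⟨r₁, hr₁, hleb⟩ := exists_ball_subset_chart hΩ
    (fun i => (Γ i).isOpenMap _ (isOpen_chartBox (a i) (ρ i / 2))) hcov
  set V := volume.real (ball (0 : E2) 1) with hV
  have hVpos : 0 < V := ENNReal.toReal_pos (measure_ball_pos _ _ one_pos).ne'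
    measure_ball_lt_top.ne
  -- a lower bound on the scale and an upper bound on the Lipschitz constants
  obtain ⟨r₀, hr₀, hr₀ρ⟩ : ∃ r₀ > 0, ∀ i, r₀ ≤ ρ i / 2 := by
    rcases isEmpty_or_nonempty ι with he | hne
    · exact ⟨1, one_pos, fun i => he.elim i⟩
    · obtain ⟨i, hi⟩ := Finite.exists_min fun i => ρ i / 2
      exact ⟨ρ i / 2, by linarith [(h i).pos], hi⟩
  set M : ℝ := 1 + ∑ i, (L i : ℝ) with hM
  have hM1 : 1 ≤ M := le_add_of_nonneg_right (Finset.sum_nonneg fun i _ => (L i).2)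
  have hLM : ∀ i, (L i : ℝ) ≤ M := fun i => by
    have := Finset.single_le_sum (f := fun i => (L i : ℝ)) (fun i _ => (L i).2) (Finset.mem_univ i)
    linarith
  -- small radii
  have hsmall : ∀ p ∈ frontier Ω, ∀ r, 0 < r → r ≤ r₀ →
      ENNReal.ofReal (V / M ^ 2 * r ^ 2) ≤ surfaceMeasure Ω (closedBall p r) := by
    intro p hp r hr hrr
    obtain ⟨i, hi⟩ := hleb p hp
    obtain ⟨z, hz, hzp⟩ := hi (mem_ball_self hr₁)
    have hzQ : z ∈ chartBox (a i) (ρ i) := chartBox_mono _ (by linarith [(h i).pos]) hz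
    have hz0 : z.2 = 0 := ((h i).mem_frontier_iff z hzQ).1 (by rw [hzp]; exact hp)
    set B := ball z.1 (r / M)
    have hBsub : B ⊆ ball (a i) (ρ i) := by
      intro y hy
      have h1 : dist y z.1 < r / M := hy
      have h2 : dist z.1 (a i) < ρ i / 2 := hz.1
      have h3 : r / M ≤ r := div_le_self hr.le hM1
      have := dist_triangle y z.1 (a i)
      rw [mem_ball]; linarith [hr₀ρ i]
    have himg : (fun y : E2 => Γ i (y, 0)) '' B ⊆ closedBall p r ∩ frontier Ω := by
      rintro _ ⟨y, hy, rfl⟩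
      have hyQ := (h i).zero_mem (hBsub hy)
      refine ⟨?_, ((h i).mem_frontier_iff _ hyQ).2 rfl⟩
      rw [mem_closedBall, ← hzp]
      refine ((h i).lipschitz.dist_le_mul _ hyQ _ hzQ).trans ?_
      have hd : dist (y, (0 : ℝ)) z = dist y z.1 := by
        rw [Prod.dist_eq, hz0]; simp
      rw [hd]
      have h1 : dist y z.1 < r / M := hy
      calc (L i : ℝ) * dist y z.1 ≤ M * (r / M) := by gcongr; exact hLM i
        _ = r := by field_simp
    have hproj : LipschitzOnWith 1 (fun x : E3 => ((Γ i).symm x).1)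
        ((fun y : E2 => Γ i (y, 0)) '' B) := by
      refine LipschitzOnWith.of_dist_le_mul fun x _ y _ => ?_
      have := (h i).dist_le ((Γ i).symm x) ((Γ i).symm y)
      simpa using this
    have hle := euclideanHausdorffMeasure_image_le hproj 2
    rw [image_image, EuclideanSpace.euclideanHausdorffMeasure_eq_volume] at hle
    simp only [Homeomorph.symm_apply_apply, image_id', ENNReal.coe_one, one_pow, one_mul] at hle
    rw [surfaceMeasure, Measure.restrict_apply isClosed_closedBall.measurableSet]
    refine le_trans ?_ (hle.trans (measure_mono himg))
    rw [Measure.addHaar_ball _ _ (by positivity)]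
    simp only [finrank_euclideanSpace, Fintype.card_fin]
    rw [← ofReal_measureReal (measure_ball_lt_top.ne), ← ENNReal.ofReal_mul (by positivity)]
    refine ENNReal.ofReal_le_ofReal (le_of_eq ?_)
    rw [← hV]; field_simp
  rcases le_or_gt R r₀ with hR | hR
  · exact ⟨V / M ^ 2, by positivity, fun p hp r hr hrR => hsmall p hp r hr (hrR.trans hR)⟩
  -- Larger radii are reduced to `r₀ / R * r ≤ r₀`, at the price of the factor `(r₀ / R) ^ 2` in the
  -- constant.
  · have hR0 : 0 < R := hr₀.trans hR
    refine ⟨V / M ^ 2 * (r₀ / R) ^ 2, by positivity, fun p hp r hr hrR => ?_⟩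
    have h1 : r₀ / R * r ≤ r₀ := by
      rw [div_mul_eq_mul_div, div_le_iff₀ hR0]; gcongr
    have h2 : r₀ / R * r ≤ r := by
      refine mul_le_of_le_one_left hr.le ?_
      rw [div_le_one hR0]; exact hR.le
    refine le_trans ?_ ((hsmall p hp (r₀ / R * r) (by positivity) h1).trans
      (measure_mono (closedBall_subset_closedBall h2)))
    refine ENNReal.ofReal_le_ofReal (le_of_eq (by ring))

/-! ### Gradients, weak harmonicity and integration by parts -/

theorem gradient_apply (φ : E3 → ℝ) (x : E3) (i : Fin 3) :
    gradient φ x i = partialDeriv i φ x := by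
  have h : inner ℝ (gradient φ x) (EuclideanSpace.single i 1) = partialDeriv i φ x :=
    InnerProductSpace.toDual_symm_apply
  rw [← h, EuclideanSpace.inner_single_right]
  simp

theorem partialDeriv_eq {φ : E3 → ℝ} {φ' : E3 →L[ℝ] ℝ} {x : E3} (h : HasFDerivAt φ φ' x)
    (i : Fin 3) : partialDeriv i φ x = φ' (EuclideanSpace.single i 1) := by
  rw [partialDeriv, h.fderiv]

theorem inner_gradient_eq (φ : E3 → ℝ) (x y : E3) :
    inner ℝ y (gradient φ x) = fderiv ℝ φ x y := by
  rw [real_inner_comm]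
  exact InnerProductSpace.toDual_symm_apply

theorem norm_gradient_eq (φ : E3 → ℝ) (x : E3) : ‖gradient φ x‖ = ‖fderiv ℝ φ x‖ :=
  (InnerProductSpace.toDual ℝ E3).symm.norm_map _

/-- The Laplacian. -/
def laplacian (φ : E3 → ℝ) (x : E3) : ℝ := ∑ i, partialDeriv i (partialDeriv i φ) x

/-- `f` is weakly harmonic in `Ω`. -/
def IsWeaklyHarmonic (Ω : Set E3) (f : E3 → ℝ) : Prop :=
  ∀ φ : E3 → ℝ, IsTestFunction Ω φ → ∫ x in Ω, f x * laplacian φ x = 0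

/-- Although `h` is differentiable only in `Ω`, the function `φ` and its derivative vanish outside a
compact subset of `Ω`. The integrals may therefore be taken over the whole space, without boundary
terms. -/
theorem integral_mul_fderiv_eq_neg {Ω : Set E3} (hΩ : IsOpen Ω) {h φ : E3 → ℝ}
    (hh : ContDiffOn ℝ 1 h Ω) (hφ : ContDiff ℝ 1 φ) (hc : HasCompactSupport φ)
    (hs : tsupport φ ⊆ Ω) (v : E3) :
    ∫ x in Ω, h x * fderiv ℝ φ x v = -∫ x in Ω, fderiv ℝ h x v * φ x := by
  have hh1 : ∀ x ∈ tsupport φ, ContDiffAt ℝ 1 h x := fun x hx =>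
    (hh x (hs hx)).contDiffAt (hΩ.mem_nhds (hs hx))
  have hfd : ContinuousOn (fun x => fderiv ℝ h x v) Ω :=
    (hh.continuousOn_fderiv_of_isOpen hΩ le_rfl).clm_apply continuousOn_const
  have hsupp' : tsupport (fun x => fderiv ℝ φ x v) ⊆ tsupport φ :=
    closure_minimal (fun x hx => support_fderiv_subset ℝ (fun h0 => hx (by simp [h0])))
      (isClosed_tsupport φ)
  have hint : ∀ {p q : E3 → ℝ}, ContinuousOn p Ω → Continuous q → tsupport q ⊆ tsupport φ →
      Integrable fun x => p x * q x := by
    intro p q hp hq hpq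
    refine Continuous.integrable_of_hasCompactSupport ?_
      (HasCompactSupport.mul_left (hc.of_isClosed_subset (isClosed_tsupport _) hpq))
    refine continuous_of_tsupport fun x hx => ?_
    have hx' : x ∈ tsupport φ := hpq (tsupport_mul_subset_right hx)
    exact (hp.continuousAt (hΩ.mem_nhds (hs hx'))).mul hq.continuousAt
  have hφ' : Continuous fun x => fderiv ℝ φ x v :=
    (hφ.continuous_fderiv one_ne_zero).clm_apply continuous_const
  have key := integral_bilinear_hasFDerivAt_right_eq_neg_left_of_integrable
    (μ := (volume : Measure E3)) (B := ContinuousLinearMap.mul ℝ ℝ) (v := v)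
    (f := h) (g := φ) (f' := fderiv ℝ h) (g' := fderiv ℝ φ)
    (hint hfd hφ.continuous subset_rfl) (hint hh.continuousOn hφ' hsupp')
    (hint hh.continuousOn hφ.continuous subset_rfl)
    (fun x hx => ((hh1 x hx).differentiableAt one_ne_zero).hasFDerivAt)
    (fun x _ => (hφ.differentiable one_ne_zero x).hasFDerivAt)
  simp only [ContinuousLinearMap.mul_apply'] at key
  have hset : ∀ {p q : E3 → ℝ}, tsupport q ⊆ tsupport φ →
      ∫ x in Ω, p x * q x = ∫ x, p x * q x := by
    intro p q hq
    refine setIntegral_eq_integral_of_forall_compl_eq_zero fun x hx => ?_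
    rw [image_eq_zero_of_notMem_tsupport fun h => hx (hs (hq h)), mul_zero]
  rw [hset hsupp', hset subset_rfl, key]

/-! ### A family of radial mollifiers -/

/-- The radial profile whose dilations serve as test functions. -/
def profile (s : ℝ) : ℝ := expNegInvGlue (1 - s)

theorem contDiff_profile {n : ℕ∞} : ContDiff ℝ n profile :=
  (expNegInvGlue.contDiff (n := n)).comp (contDiff_const.sub contDiff_id)

theorem profile_eq_zero {s : ℝ} (hs : 1 ≤ s) : profile s = 0 :=
  expNegInvGlue.zero_of_nonpos (by linarith)

theorem deriv_profile_eq_zero {s : ℝ} (hs : 1 < s) : deriv profile s = 0 := by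
  have : profile =ᶠ[𝓝 s] fun _ => 0 := by
    filter_upwards [lt_mem_nhds hs] with t ht using profile_eq_zero (le_of_lt ht)
  rw [this.deriv_eq, deriv_const]

theorem deriv_deriv_profile_eq_zero {s : ℝ} (hs : 1 < s) : deriv (deriv profile) s = 0 := by
  have : deriv profile =ᶠ[𝓝 s] fun _ => 0 := by
    filter_upwards [lt_mem_nhds hs] with t ht using deriv_profile_eq_zero ht
  rw [this.deriv_eq, deriv_const]

theorem contDiff_deriv_profile {n : ℕ∞} : ContDiff ℝ n (deriv profile) := by
  have h : ContDiff ℝ ((n : ℕ∞ω) + 1) profile := by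
    exact_mod_cast contDiff_profile (n := n + 1)
  exact (contDiff_succ_iff_deriv.1 h).2.2

theorem contDiff_deriv_deriv_profile {n : ℕ∞} : ContDiff ℝ n (deriv (deriv profile)) := by
  have h : ContDiff ℝ ((n : ℕ∞ω) + 1) (deriv profile) := by
    exact_mod_cast contDiff_deriv_profile (n := n + 1)
  exact (contDiff_succ_iff_deriv.1 h).2.2

theorem hasDerivAt_profile (s : ℝ) : HasDerivAt profile (deriv profile s) s :=
  ((contDiff_profile (n := 1)).differentiable one_ne_zero s).hasDerivAt

theorem hasDerivAt_deriv_profile (s : ℝ) :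
    HasDerivAt (deriv profile) (deriv (deriv profile) s) s :=
  ((contDiff_deriv_profile (n := 1)).differentiable one_ne_zero s).hasDerivAt

theorem deriv_profile_nonpos (s : ℝ) : deriv profile s ≤ 0 := by
  have h : Antitone profile := fun a b hab => expNegInvGlue.monotone (by linarith)
  exact h.deriv_nonpos


theorem exists_deriv_profile_neg : ∃ s ∈ Ioo (0 : ℝ) 1, deriv profile s < 0 := by
  obtain ⟨c, hc, h⟩ := exists_deriv_eq_slope profile one_pos
    (contDiff_profile (n := 1)).continuous.continuousOn
    ((contDiff_profile (n := 1)).differentiable one_ne_zero).differentiableOn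
  refine ⟨c, hc, ?_⟩
  rw [h, profile_eq_zero le_rfl]
  have : 0 < profile 0 := expNegInvGlue.pos_of_pos (by norm_num)
  simpa using this

theorem contDiff_radial (g : ℝ → ℝ) {n : ℕ∞} (hg : ContDiff ℝ n g) (c : ℝ) :
    ContDiff ℝ n fun z : E3 => g (‖z‖ ^ 2 * c) :=
  hg.comp ((contDiff_norm_sq ℝ).mul contDiff_const)

theorem hasCompactSupport_radial {g : ℝ → ℝ} (hg : ∀ s, 1 < s → g s = 0) {δ : ℝ} (hδ : 0 < δ) :
    HasCompactSupport fun z : E3 => g (‖z‖ ^ 2 * δ⁻¹ ^ 2) := by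
  refine HasCompactSupport.intro (isCompact_closedBall (0 : E3) δ) fun z hz => hg _ ?_
  rw [mem_closedBall, dist_zero_right, not_le] at hz
  rw [← mul_pow, ← div_eq_mul_inv]
  exact one_lt_pow₀ ((one_lt_div hδ).2 hz) two_ne_zero

/-- The total mass of the unnormalized mollifier. -/
def mollMass : ℝ := ∫ z : E3, -deriv profile (‖z‖ ^ 2)

theorem mollMass_pos : 0 < mollMass := by
  have hc : Continuous fun z : E3 => -deriv profile (‖z‖ ^ 2) := by
    have := (contDiff_deriv_profile (n := 0)).continuous
    fun_prop
  have hs := hasCompactSupport_radial (fun _ => deriv_profile_eq_zero) one_pos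
  simp only [inv_one, one_pow, mul_one] at hs
  obtain ⟨s, hs0, hs1⟩ := exists_deriv_profile_neg
  refine hc.integral_pos_of_hasCompactSupport_nonneg_nonzero hs.neg
    (fun z => neg_nonneg.2 (deriv_profile_nonpos _))
    (x := EuclideanSpace.single 0 (√s)) ?_
  simp [Real.sq_sqrt hs0.1.le, hs1.ne]

/-- The radial mollifier of width `δ`. -/
def moll (δ : ℝ) (z : E3) : ℝ :=
  -(mollMass⁻¹ * δ⁻¹ ^ 3 * deriv profile (‖z‖ ^ 2 * δ⁻¹ ^ 2))

theorem contDiff_moll (δ : ℝ) {n : ℕ∞} : ContDiff ℝ n (moll δ) :=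
  (contDiff_const.mul (contDiff_radial _ contDiff_deriv_profile _)).neg

theorem hasCompactSupport_moll {δ : ℝ} (hδ : 0 < δ) : HasCompactSupport (moll δ) :=
  ((hasCompactSupport_radial (fun _ => deriv_profile_eq_zero) hδ).mul_left
    (f := fun _ => mollMass⁻¹ * δ⁻¹ ^ 3)).neg

theorem integral_moll {δ : ℝ} (hδ : 0 < δ) : ∫ z, moll δ z = 1 := by
  have h := Measure.integral_comp_smul (volume : Measure E3)
    (fun z : E3 => -deriv profile (‖z‖ ^ 2)) δ⁻¹
  have h1 : ∀ z : E3, moll δ z = mollMass⁻¹ * δ⁻¹ ^ 3 * -deriv profile (‖δ⁻¹ • z‖ ^ 2) := by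
    intro z
    rw [norm_smul, Real.norm_of_nonneg (by positivity), moll]
    ring_nf
  simp_rw [h1]
  rw [integral_const_mul, h, finrank_euclideanSpace, Fintype.card_fin, ← mollMass, smul_eq_mul,
    abs_of_pos (by positivity)]
  have := mollMass_pos
  field_simp

/-- The second expression is the bracket in `laplacian_radial`. Both expressions vanish for `s > 1`,
so only a compact interval matters. -/
theorem exists_profile_bound : ∃ M : ℝ, 0 < M ∧ ∀ s, 0 ≤ s → |deriv profile s| ≤ M ∧
    |6 * deriv profile s + 4 * (s * deriv (deriv profile) s)| ≤ M := by
  have c1 := (contDiff_deriv_profile (n := 0)).continuous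
  have c2 := (contDiff_deriv_deriv_profile (n := 0)).continuous
  obtain ⟨M₁, h₁⟩ := (isCompact_Icc (a := (0 : ℝ)) (b := 1)).exists_bound_of_continuousOn
    c1.continuousOn
  obtain ⟨M₂, h₂⟩ := (isCompact_Icc (a := (0 : ℝ)) (b := 1)).exists_bound_of_continuousOn
    (f := fun s => 6 * deriv profile s + 4 * (s * deriv (deriv profile) s))
    (by fun_prop)
  refine ⟨max 1 (max M₁ M₂), by positivity, fun s hs => ?_⟩
  rcases le_or_gt s 1 with h | h
  · exact ⟨(h₁ s ⟨hs, h⟩).trans ((le_max_left _ _).trans (le_max_right _ _)),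
      (h₂ s ⟨hs, h⟩).trans ((le_max_right _ _).trans (le_max_right _ _))⟩
  · rw [deriv_profile_eq_zero h, deriv_deriv_profile_eq_zero h]
    simp

theorem norm_sq_eq_sum (z : E3) : ‖z‖ ^ 2 = z 0 ^ 2 + z 1 ^ 2 + z 2 ^ 2 := by
  rw [EuclideanSpace.norm_sq_eq]; simp [Fin.sum_univ_three]

theorem laplacian_radial (x y : E3) (c : ℝ) :
    laplacian (fun y => profile (‖x - y‖ ^ 2 * c)) y =
      c * (6 * deriv profile (‖x - y‖ ^ 2 * c) +
        4 * (‖x - y‖ ^ 2 * c * deriv (deriv profile) (‖x - y‖ ^ 2 * c))) := by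
  have hq : ∀ y : E3, HasFDerivAt (fun y : E3 => ‖x - y‖ ^ 2 * c)
      (c • (2 • (innerSL ℝ (x - y)).comp (-ContinuousLinearMap.id ℝ E3))) y := fun y => by
    have h1 : HasFDerivAt (fun y : E3 => x - y) (-ContinuousLinearMap.id ℝ E3) y :=
      (hasFDerivAt_id y).const_sub x
    exact h1.norm_sq.mul_const c
  have hval : ∀ (y : E3) (i : Fin 3), (c • (2 • (innerSL ℝ (x - y)).comp
      (-ContinuousLinearMap.id ℝ E3))) (EuclideanSpace.single i 1) = -(2 * c) * (x i - y i) := by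
    intro y i
    simp [EuclideanSpace.inner_single_right]
    ring
  have h1 : ∀ i, partialDeriv i (fun y => profile (‖x - y‖ ^ 2 * c)) =
      fun y => deriv profile (‖x - y‖ ^ 2 * c) * (-(2 * c) * (x i - y i)) := by
    intro i
    ext y
    refine (partialDeriv_eq ((hasDerivAt_profile _).comp_hasFDerivAt y (hq y)) i).trans ?_
    rw [_root_.smul_apply, hval, smul_eq_mul]
  have hcoord : ∀ (i : Fin 3) (y : E3), HasFDerivAt (fun y : E3 => -(2 * c) * (x i - y i))
      (-(2 * c) • -(EuclideanSpace.proj i : E3 →L[ℝ] ℝ)) y := fun i y =>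
    ((EuclideanSpace.proj i : E3 →L[ℝ] ℝ).hasFDerivAt.const_sub (x i)).const_mul _
  have h2 : ∀ i, partialDeriv i (partialDeriv i fun y => profile (‖x - y‖ ^ 2 * c)) y =
      2 * c * deriv profile (‖x - y‖ ^ 2 * c) +
        4 * c ^ 2 * (x i - y i) ^ 2 * deriv (deriv profile) (‖x - y‖ ^ 2 * c) := by
    intro i
    rw [h1]
    refine (partialDeriv_eq (((hasDerivAt_deriv_profile _).comp_hasFDerivAt y (hq y)).mul
      (hcoord i y)) i).trans ?_
    simp only [_root_.add_apply, _root_.smul_apply, hval, smul_eq_mul,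
      _root_.neg_apply, Function.comp_apply]
    simp
    ring
  rw [laplacian, Fin.sum_univ_three, h2, h2, h2, norm_sq_eq_sum]
  simp only [PiLp.sub_apply]
  ring

/-- This identity is the reason for building the mollifier from `deriv profile`: a change of the
width alters it by the Laplacian of a compactly supported function, which a weakly harmonic function
does not see. -/
theorem hasDerivAt_moll (x y : E3) {δ : ℝ} (hδ : 0 < δ) :
    HasDerivAt (fun δ => moll δ (x - y))
      (mollMass⁻¹ * 2⁻¹ * δ⁻¹ ^ 2 * laplacian (fun y => profile (‖x - y‖ ^ 2 * δ⁻¹ ^ 2)) y) δ := by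
  rw [laplacian_radial]
  have hinv : HasDerivAt (fun δ : ℝ => δ⁻¹) (-(δ ^ 2)⁻¹) δ := hasDerivAt_inv hδ.ne'
  have h1 := (hinv.pow 3).const_mul mollMass⁻¹
  have h2 := (hinv.pow 2).const_mul (‖x - y‖ ^ 2)
  have h3 := (hasDerivAt_deriv_profile (‖x - y‖ ^ 2 * δ⁻¹ ^ 2)).comp δ h2
  refine (h1.mul h3).neg.congr_deriv ?_
  simp only [Function.comp_apply, Pi.pow_apply]
  push_cast
  field_simp
  ring

/-- The mollification of `f` over `Ω` at scale `δ`. -/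
def mollify (Ω : Set E3) (f : E3 → ℝ) (δ : ℝ) (x : E3) : ℝ := ∫ y in Ω, f y * moll δ (x - y)

theorem isTestFunction_profile {x : E3} {δ : ℝ} (hδ : 0 < δ) (h : closedBall x δ ⊆ Ω) :
    IsTestFunction Ω fun y => profile (‖x - y‖ ^ 2 * δ⁻¹ ^ 2) := by
  have hsub : tsupport (fun y => profile (‖x - y‖ ^ 2 * δ⁻¹ ^ 2)) ⊆ closedBall x δ := by
    refine closure_minimal (fun y hy => ?_) isClosed_closedBall
    by_contra hy'
    refine hy (profile_eq_zero ?_)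
    rw [mem_closedBall, dist_comm, dist_eq_norm, not_le] at hy'
    rw [← mul_pow, ← div_eq_mul_inv]
    exact (one_lt_pow₀ ((one_lt_div hδ).2 hy') two_ne_zero).le
  refine ⟨?_, (isCompact_closedBall x δ).of_isClosed_subset (isClosed_tsupport _) hsub,
    hsub.trans h⟩
  exact (contDiff_radial profile contDiff_profile _).comp (contDiff_const.sub contDiff_id)

theorem hasDerivAt_mollify {f : E3 → ℝ} (hf : IntegrableOn f Ω) {x : E3} {δ : ℝ} (hδ : 0 < δ) :
    HasDerivAt (fun δ => mollify Ω f δ x) (mollMass⁻¹ * 2⁻¹ * δ⁻¹ ^ 2 *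
      ∫ y in Ω, f y * laplacian (fun y => profile (‖x - y‖ ^ 2 * δ⁻¹ ^ 2)) y) δ := by
  obtain ⟨M, hM, hMb⟩ := exists_profile_bound
  have hmm := mollMass_pos
  have hcont : ∀ δ, Continuous fun y => moll δ (x - y) := fun δ =>
    (contDiff_moll δ (n := 0)).continuous.comp (continuous_const.sub continuous_id)
  have hlc : Continuous fun y => laplacian (fun y => profile (‖x - y‖ ^ 2 * δ⁻¹ ^ 2)) y := by
    simp_rw [laplacian_radial]
    have c1 := (contDiff_deriv_profile (n := 0)).continuous
    have c2 := (contDiff_deriv_deriv_profile (n := 0)).continuous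
    fun_prop
  have hmb : ∀ y, |moll δ (x - y)| ≤ mollMass⁻¹ * δ⁻¹ ^ 3 * M := fun y => by
    rw [moll, abs_neg, abs_mul, abs_of_pos (by positivity)]
    gcongr
    exact (hMb _ (by positivity)).1
  have key := hasDerivAt_integral_of_dominated_loc_of_deriv_le (μ := volume.restrict Ω)
    (F := fun δ y => f y * moll δ (x - y))
    (F' := fun δ y => f y * (mollMass⁻¹ * 2⁻¹ * δ⁻¹ ^ 2 *
      laplacian (fun y => profile (‖x - y‖ ^ 2 * δ⁻¹ ^ 2)) y))
    (bound := fun y => |f y| * (mollMass⁻¹ * 2⁻¹ * (δ / 2)⁻¹ ^ 2 * ((δ / 2)⁻¹ ^ 2 * M)))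
    (s := Ioi (δ / 2)) (x₀ := δ) (Ioi_mem_nhds (by linarith))
    (Eventually.of_forall fun δ => hf.aestronglyMeasurable.mul (hcont δ).aestronglyMeasurable)
    (hf.mul_bdd (hcont δ).aestronglyMeasurable (ae_of_all _ fun y => hmb y))
    (hf.aestronglyMeasurable.mul (continuous_const.mul hlc).aestronglyMeasurable)
    (ae_of_all _ fun y t ht => ?_) (hf.abs.mul_const _)
    (ae_of_all _ fun y t ht => ?_)
  · refine key.2.congr_deriv ?_
    rw [← integral_const_mul]
    congr 1 with y; ring
  · have ht0 : 0 < t := lt_trans (by linarith) (mem_Ioi.1 ht)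
    have hle : t⁻¹ ≤ (δ / 2)⁻¹ := inv_anti₀ (by linarith) (le_of_lt ht)
    rw [Real.norm_eq_abs, laplacian_radial, abs_mul, abs_mul, abs_mul _ (_ + _),
      abs_of_pos (show 0 < mollMass⁻¹ * 2⁻¹ * t⁻¹ ^ 2 by positivity),
      abs_of_pos (show 0 < t⁻¹ ^ 2 by positivity)]
    gcongr
    exact (hMb _ (by positivity)).2
  · have ht0 : 0 < t := lt_trans (by linarith) (mem_Ioi.1 ht)
    exact (hasDerivAt_moll x y ht0).const_mul _

/-- While the ball stays in `Ω`, the function whose Laplacian appears in the derivative with respect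
to the width is an admissible test function, so the derivative is zero. This is a mean value
property. -/
theorem mollify_eq_of_le {f : E3 → ℝ} (hf : IntegrableOn f Ω) (hh : IsWeaklyHarmonic Ω f)
    {x : E3} {r s : ℝ} (hr : 0 < r) (hrs : r ≤ s) (h : closedBall x s ⊆ Ω) :
    mollify Ω f s x = mollify Ω f r x := by
  have hd : ∀ t ∈ Icc r s, HasDerivAt (fun δ => mollify Ω f δ x) 0 t := fun t ht => by
    have ht0 := hr.trans_le ht.1
    refine (hasDerivAt_mollify hf ht0).congr_deriv ?_
    rw [hh _ (isTestFunction_profile ht0 ((closedBall_subset_closedBall ht.2).trans h)), mul_zero]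
  exact constant_of_has_deriv_right_zero (fun t ht => (hd t ht).continuousAt.continuousWithinAt)
    (fun t ht => (hd t ⟨ht.1, ht.2.le⟩).hasDerivWithinAt) s (right_mem_Icc.2 hrs)

theorem contDiff_mollify (hΩ : MeasurableSet Ω) {f : E3 → ℝ} (hf : IntegrableOn f Ω) {δ : ℝ}
    (hδ : 0 < δ) {n : ℕ∞} : ContDiff ℝ n (mollify Ω f δ) := by
  have h := (hasCompactSupport_moll hδ).contDiff_convolution_right (ContinuousLinearMap.mul ℝ ℝ)
    (μ := (volume : Measure E3)) (f := Ω.indicator f)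
    ((integrable_indicator_iff hΩ).2 hf).locallyIntegrable (contDiff_moll δ (n := n))
  have he : mollify Ω f δ = fun x => ∫ t, ContinuousLinearMap.mul ℝ ℝ (Ω.indicator f t)
      (moll δ (x - t)) := by
    ext x
    rw [mollify, ← integral_indicator hΩ]
    congr 1 with y
    by_cases hy : y ∈ Ω <;> simp [hy]
  rw [he]
  exact h

theorem moll_le {δ : ℝ} (hδ : 0 < δ) {M : ℝ} (hM : ∀ s, 0 ≤ s → |deriv profile s| ≤ M) (z : E3) :
    |moll δ z| ≤ mollMass⁻¹ * δ⁻¹ ^ 3 * M := by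
  have hmm := mollMass_pos
  rw [moll, abs_neg, abs_mul, abs_of_pos (by positivity)]
  gcongr
  exact hM _ (by positivity)

/-- Convergence holds at Lebesgue points: the mollifier of width `δ` lives on the ball of radius
`δ`, has mass one, and is bounded by a multiple of the reciprocal volume of that ball. -/
theorem ae_tendsto_mollify (hΩ : MeasurableSet Ω) {f : E3 → ℝ} (hf : IntegrableOn f Ω) :
    ∀ᵐ x, Tendsto (fun δ => mollify Ω f δ x) (𝓝[>] 0) (𝓝 (Ω.indicator f x)) := by
  obtain ⟨M, hM, hMb⟩ := exists_profile_bound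
  have hint : LocallyIntegrable (Ω.indicator f) :=
    ((integrable_indicator_iff hΩ).2 hf).locallyIntegrable
  filter_upwards [(Besicovitch.vitaliFamily volume).ae_tendsto_average_norm_sub hint] with x hx
  have hx' := hx.comp (Besicovitch.tendsto_filterAt volume x)
  have he : ∀ δ, mollify Ω f δ x = ∫ y, moll δ (x - y) • Ω.indicator f y := by
    intro δ
    rw [mollify, ← integral_indicator hΩ]
    congr 1 with y
    by_cases hy : y ∈ Ω <;> simp [hy, mul_comm]
  simp_rw [he]
  refine tendsto_integral_smul_of_tendsto_average_norm_sub
    (mollMass⁻¹ * M * volume.real (ball (0 : E3) 1)) hx' ?_ ?_ ?_ ?_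
  · filter_upwards with δ using hint.integrableOn_isCompact (isCompact_closedBall _ _)
  · refine tendsto_const_nhds.congr' ?_
    filter_upwards [self_mem_nhdsWithin] with δ hδ
    rw [integral_sub_left_eq_self (fun z => moll δ z) volume x, integral_moll hδ]
  · filter_upwards [self_mem_nhdsWithin] with δ hδ y hy
    by_contra hy'
    refine hy ?_
    rw [mem_closedBall, dist_comm, dist_eq_norm, not_le] at hy'
    have : 1 < ‖x - y‖ ^ 2 * δ⁻¹ ^ 2 := by
      rw [← mul_pow, ← div_eq_mul_inv]
      exact one_lt_pow₀ ((one_lt_div hδ).2 hy') two_ne_zero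
    simp only [moll, deriv_profile_eq_zero this, mul_zero, neg_zero]
  · filter_upwards [self_mem_nhdsWithin] with δ hδ y
    have hδ0 : (0 : ℝ) < δ := hδ
    refine (moll_le hδ (fun s hs => (hMb s hs).1) (x - y)).trans_eq ?_
    have hb : 0 < volume.real (ball (0 : E3) 1) := ENNReal.toReal_pos
      (measure_ball_pos _ _ one_pos).ne' measure_ball_lt_top.ne
    rw [Measure.addHaar_real_closedBall _ _ hδ0.le, finrank_euclideanSpace, Fintype.card_fin]
    have := mollMass_pos
    field_simp

/-- **Weyl's lemma** with interior estimates. -/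
theorem IsWeaklyHarmonic.exists_smooth (hΩ : IsOpen Ω) (hb : Bornology.IsBounded Ω)
    {f : E3 → ℝ} (hf : MemLp f 2 (volume.restrict Ω)) (hh : IsWeaklyHarmonic Ω f) :
    ∃ f' : E3 → ℝ, ContDiffOn ℝ ∞ f' Ω ∧ f =ᵐ[volume.restrict Ω] f' ∧
      ∀ x r, 0 < r → closedBall x r ⊆ Ω → f' x = mollify Ω f r x := by
  have : IsFiniteMeasure ((volume : Measure E3).restrict Ω) :=
    ⟨by rw [Measure.restrict_apply_univ]; exact hb.measure_lt_top⟩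
  have hfi : IntegrableOn f Ω := hf.integrable one_le_two
  have hex : ∀ x ∈ Ω, ∃ r > 0, closedBall x r ⊆ Ω := fun x hx =>
    nhds_basis_closedBall.mem_iff.1 (hΩ.mem_nhds hx)
  choose! R hR hRΩ using hex
  have hval : ∀ x r, 0 < r → closedBall x r ⊆ Ω → mollify Ω f (R x) x = mollify Ω f r x := by
    intro x r hr hrΩ
    have hx := hrΩ (mem_closedBall_self hr.le)
    rcases le_total r (R x) with h | h
    · exact mollify_eq_of_le hfi hh hr h (hRΩ x hx)
    · exact (mollify_eq_of_le hfi hh (hR x hx) h hrΩ).symm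
  -- Each point uses its own radius, but near `x` the value agrees with the mollification at the
  -- fixed radius `R x / 2`, which is smooth.
  refine ⟨fun x => mollify Ω f (R x) x, fun x hx => ?_, ?_, hval⟩
  · refine ContDiffAt.contDiffWithinAt ?_
    have h2 : 0 < R x / 2 := half_pos (hR x hx)
    refine ((contDiff_mollify hΩ.measurableSet hfi h2).contDiffAt (n := ∞)).congr_of_eventuallyEq ?_
    filter_upwards [closedBall_mem_nhds x h2] with y hy
    refine hval y _ h2 (Subset.trans ?_ (hRΩ x hx))
    exact closedBall_subset_closedBall' (by rw [mem_closedBall] at hy; linarith)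
  · rw [Filter.EventuallyEq, ae_restrict_iff' hΩ.measurableSet]
    filter_upwards [ae_tendsto_mollify hΩ.measurableSet hfi] with x hx hxΩ
    rw [indicator_of_mem hxΩ] at hx
    refine tendsto_nhds_unique hx (tendsto_const_nhds.congr' ?_)
    filter_upwards [Ioc_mem_nhdsGT (hR x hxΩ)] with δ hδ
    exact hval x δ hδ.1 ((closedBall_subset_closedBall hδ.2).trans (hRΩ x hxΩ))

theorem exists_abs_mollify_le {δ : ℝ} (hδ : 0 < δ) :
    ∃ C : ℝ, 0 < C ∧ ∀ (f : E3 → ℝ), MemLp f 2 (volume.restrict Ω) → ∀ x,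
      |mollify Ω f δ x| ≤ C * (eLpNorm f 2 (volume.restrict Ω)).toReal := by
  have hmem : ∀ x, MemLp (fun y => moll δ (x - y)) 2 volume := fun x => by
    refine Continuous.memLp_of_hasCompactSupport ?_ ?_
    · exact (contDiff_moll δ (n := 0)).continuous.comp (continuous_const.sub continuous_id)
    · exact (hasCompactSupport_moll hδ).comp_homeomorph (Homeomorph.subLeft x)
  refine ⟨(eLpNorm (moll δ) 2 volume).toReal + 1, by positivity, fun f hf x => ?_⟩
  have hnorm : eLpNorm (fun y => moll δ (x - y)) 2 volume = eLpNorm (moll δ) 2 volume :=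
    eLpNorm_comp_measurePreserving (contDiff_moll δ (n := 0)).continuous.aestronglyMeasurable
      (Measure.measurePreserving_sub_left volume x)
  have h1 : eLpNorm (fun y => f y * moll δ (x - y)) 1 (volume.restrict Ω) ≤
      eLpNorm f 2 (volume.restrict Ω) * eLpNorm (moll δ) 2 volume := by
    refine (eLpNorm_smul_le_mul_eLpNorm (p := 2) (q := 2) (r := 1)
      ((hmem x).mono_measure Measure.restrict_le_self).1 hf.1).trans ?_
    gcongr
    rw [← hnorm]
    exact eLpNorm_mono_measure _ Measure.restrict_le_self
  have hfin : eLpNorm f 2 (volume.restrict Ω) * eLpNorm (moll δ) 2 volume ≠ ⊤ := by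
    refine ENNReal.mul_ne_top hf.2.ne ?_
    rw [← hnorm]; exact (hmem x).2.ne
  have h2 : ‖mollify Ω f δ x‖ ≤
      (eLpNorm (fun y => f y * moll δ (x - y)) 1 (volume.restrict Ω)).toReal := by
    rw [eLpNorm_one_eq_lintegral_enorm]
    exact (norm_integral_le_lintegral_norm _).trans_eq (by simp only [ofReal_norm])
  rw [← Real.norm_eq_abs]
  refine h2.trans ((ENNReal.toReal_mono hfin h1).trans ?_)
  rw [ENNReal.toReal_mul, mul_comm]
  gcongr
  linarith

/-! ### Harmonic fields: interior regularity and estimates -/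

theorem integrable_mul_of_tsupport_subset (hΩ : IsOpen Ω) {p q : E3 → ℝ} (hp : ContinuousOn p Ω)
    (hq : Continuous q) (hc : HasCompactSupport q) (hs : tsupport q ⊆ Ω) :
    Integrable fun x => p x * q x := by
  refine Continuous.integrable_of_hasCompactSupport (continuous_of_tsupport fun x hx => ?_)
    hc.mul_left
  exact (hp.continuousAt (hΩ.mem_nhds (hs (tsupport_mul_subset_right hx)))).mul hq.continuousAt

theorem isFiniteMeasure_restrict (hb : Bornology.IsBounded Ω) :
    IsFiniteMeasure ((volume : Measure E3).restrict Ω) :=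
  ⟨by rw [Measure.restrict_apply_univ]; exact hb.measure_lt_top⟩

theorem memLp_coord (B : L2Field Ω) (i : Fin 3) :
    MemLp (fun x => B x i) 2 (volume.restrict Ω) :=
  (EuclideanSpace.proj i : E3 →L[ℝ] ℝ).comp_memLp' (Lp.memLp B)

theorem eLpNorm_coord_le (B : L2Field Ω) (i : Fin 3) :
    (eLpNorm (fun x => B x i) 2 (volume.restrict Ω)).toReal ≤ ‖B‖ := by
  rw [Lp.norm_def]
  refine ENNReal.toReal_mono (Lp.memLp B).2.ne (eLpNorm_mono fun x => ?_)
  exact PiLp.norm_apply_le (B x) i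

theorem partialDeriv_neg (i : Fin 3) (φ : E3 → ℝ) (x : E3) :
    partialDeriv i (fun y => -φ y) x = -partialDeriv i φ x := by
  simp [partialDeriv, fderiv_fun_neg]

theorem partialDeriv_zero (i : Fin 3) (x : E3) : partialDeriv i (fun _ => 0) x = 0 := by
  simp [partialDeriv]

theorem partialDeriv_comm {φ : E3 → ℝ} (hφ : ContDiff ℝ 2 φ) (i j : Fin 3) (x : E3) :
    partialDeriv i (partialDeriv j φ) x = partialDeriv j (partialDeriv i φ) x := by
  have hd : DifferentiableAt ℝ (fderiv ℝ φ) x :=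
    (hφ.fderiv_right (m := 1) (by norm_num)).differentiable one_ne_zero x
  have h : ∀ i j, partialDeriv i (partialDeriv j φ) x =
      fderiv ℝ (fderiv ℝ φ) x (EuclideanSpace.single i 1) (EuclideanSpace.single j 1) := by
    intro i j
    refine (partialDeriv_eq (φ := partialDeriv j φ)
      (hd.hasFDerivAt.clm_apply (hasFDerivAt_const (EuclideanSpace.single j 1) x)) i).trans ?_
    simp
  rw [h, h]
  exact (hφ.contDiffAt.isSymmSndFDerivAt (by simp)).eq _ _

theorem contDiff_partialDeriv {φ : E3 → ℝ} (hφ : ContDiff ℝ ∞ φ) (i : Fin 3) :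
    ContDiff ℝ ∞ (partialDeriv i φ) :=
  (hφ.fderiv_right (m := ∞) (by simp)).clm_apply contDiff_const

theorem tsupport_partialDeriv_subset (φ : E3 → ℝ) (i : Fin 3) :
    tsupport (partialDeriv i φ) ⊆ tsupport φ :=
  closure_minimal (fun x hx => support_fderiv_subset ℝ
    (fun h0 => hx (by simp [partialDeriv, h0]))) (isClosed_tsupport φ)

theorem IsTestFunction.partialDeriv {φ : E3 → ℝ} (hφ : IsTestFunction Ω φ) (i : Fin 3) :
    IsTestFunction Ω (partialDeriv i φ) :=
  ⟨contDiff_partialDeriv hφ.1 i,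
    hφ.2.1.of_isClosed_subset (isClosed_tsupport _) (tsupport_partialDeriv_subset φ i),
    (tsupport_partialDeriv_subset φ i).trans hφ.2.2⟩

/-- Vector fields whose components are test functions are test functions. -/
theorem isTestFunction_vec {φ₀ φ₁ φ₂ : E3 → ℝ} (h₀ : IsTestFunction Ω φ₀)
    (h₁ : IsTestFunction Ω φ₁) (h₂ : IsTestFunction Ω φ₂) :
    IsTestFunction Ω fun x => (!₂[φ₀ x, φ₁ x, φ₂ x] : E3) := by
  set K := tsupport φ₀ ∪ tsupport φ₁ ∪ tsupport φ₂ with hK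
  have hKc : IsCompact K := (h₀.2.1.isCompact.union h₁.2.1.isCompact).union h₂.2.1.isCompact
  have hsub : tsupport (fun x => (!₂[φ₀ x, φ₁ x, φ₂ x] : E3)) ⊆ K := by
    refine closure_minimal (fun x hx => ?_) hKc.isClosed
    by_contra hxK
    simp only [hK, mem_union, not_or] at hxK
    refine hx ?_
    ext i; fin_cases i <;>
      simp [image_eq_zero_of_notMem_tsupport hxK.1.1, image_eq_zero_of_notMem_tsupport hxK.1.2,
        image_eq_zero_of_notMem_tsupport hxK.2]
  refine ⟨?_, hKc.of_isClosed_subset (isClosed_tsupport _) hsub,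
    hsub.trans (union_subset (union_subset h₀.2.2 h₁.2.2) h₂.2.2)⟩
  rw [contDiff_euclidean]
  intro i; fin_cases i
  · exact h₀.1
  · exact h₁.1
  · exact h₂.1

theorem isTestFunction_zero : IsTestFunction Ω fun _ : E3 => (0 : ℝ) :=
  ⟨contDiff_const, HasCompactSupport.zero, by simp [tsupport]⟩

theorem IsTestFunction.neg {φ : E3 → ℝ} (h : IsTestFunction Ω φ) :
    IsTestFunction Ω fun x => -φ x :=
  ⟨h.1.neg, h.2.1.neg, by
    have : tsupport (fun x => -φ x) = tsupport φ := by
      simp [tsupport, Function.support_fun_neg]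
    rw [this]; exact h.2.2⟩

theorem IsTestFunction.sub {φ ψ : E3 → ℝ} (h : IsTestFunction Ω φ) (h' : IsTestFunction Ω ψ) :
    IsTestFunction Ω fun x => φ x - ψ x :=
  ⟨h.1.sub h'.1, h.2.1.sub h'.2.1,
    (tsupport_sub φ ψ).trans (union_subset h.2.2 h'.2.2)⟩

theorem IsTestFunction.coord {Ψ : E3 → E3} (h : IsTestFunction Ω Ψ) (i : Fin 3) :
    IsTestFunction Ω fun x => Ψ x i := by
  have hsub : tsupport (fun x => Ψ x i) ⊆ tsupport Ψ :=
    closure_mono fun x hx h0 => hx (by simp [h0])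
  exact ⟨contDiff_euclidean.1 h.1 i, h.2.1.of_isClosed_subset (isClosed_tsupport _) hsub,
    hsub.trans h.2.2⟩

theorem IsTestFunction.curl {Ψ : E3 → E3} (h : IsTestFunction Ω Ψ) :
    IsTestFunction Ω (curl Ψ) :=
  isTestFunction_vec (((h.coord 2).partialDeriv 1).sub ((h.coord 1).partialDeriv 2))
    (((h.coord 0).partialDeriv 2).sub ((h.coord 2).partialDeriv 0))
    (((h.coord 1).partialDeriv 0).sub ((h.coord 0).partialDeriv 1))

theorem integral_inner_curl_eq_zero {B : L2Field Ω} (hB : HasWeakCurl Ω B 0) {Ψ : E3 → E3}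
    (hΨ : IsTestFunction Ω Ψ) : ∫ x in Ω, inner ℝ (B x) (curl Ψ x) = 0 := by
  rw [hB Ψ hΨ]
  refine integral_eq_zero_of_ae ?_
  filter_upwards [Lp.coeFn_zero E3 2 (volume.restrict Ω)] with x hx
  change inner ℝ ((0 : L2Field Ω) x) (Ψ x) = 0
  rw [hx]; simp

theorem integral_inner_gradient_eq_zero {B : L2Field Ω} (hB : HasWeakDiv Ω B 0) {φ : E3 → ℝ}
    (hφ : IsTestFunction Ω φ) : ∫ x in Ω, inner ℝ (B x) (gradient φ x) = 0 := by
  rw [hB φ hφ, neg_eq_zero]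
  refine integral_eq_zero_of_ae ?_
  filter_upwards [Lp.coeFn_zero ℝ 2 (volume.restrict Ω)] with x hx
  change (0 : L2Fun Ω) x * φ x = 0
  rw [hx]; simp

theorem inner_eq_sum (x y : E3) : inner ℝ x y = x 0 * y 0 + x 1 * y 1 + x 2 * y 2 := by
  simp [PiLp.inner_apply, Fin.sum_univ_three]
  ring

theorem integrable_inner_of_memLp {μ : Measure E3} {f g : E3 → E3} (hf : MemLp f 2 μ)
    (hg : MemLp g 2 μ) : Integrable (fun x => inner ℝ (f x) (g x)) μ := by
  refine (L2.integrable_inner (𝕜 := ℝ) (hf.toLp f) (hg.toLp g)).congr ?_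
  filter_upwards [hf.coeFn_toLp, hg.coeFn_toLp] with x h1 h2
  rw [h1, h2]

theorem abs_integral_inner_le {μ : Measure E3} {f g : E3 → E3} (hf : MemLp f 2 μ)
    (hg : MemLp g 2 μ) : |∫ x, inner ℝ (f x) (g x) ∂μ| ≤
      (eLpNorm f 2 μ).toReal * (eLpNorm g 2 μ).toReal := by
  have h := abs_real_inner_le_norm (hf.toLp f) (hg.toLp g)
  rw [Lp.norm_toLp, Lp.norm_toLp, L2.inner_def] at h
  refine le_of_eq_of_le (congrArg abs (integral_congr_ae ?_)) h
  filter_upwards [hf.coeFn_toLp, hg.coeFn_toLp] with x h1 h2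
  rw [h1, h2]

theorem integrableOn_inner_of_continuous (hb : Bornology.IsBounded Ω) (B : L2Field Ω)
    {Ψ : E3 → E3} (hΨ : Continuous Ψ) (hc : HasCompactSupport Ψ) :
    IntegrableOn (fun x => inner ℝ (B x) (Ψ x)) Ω := by
  have := isFiniteMeasure_restrict hb
  have h2 : MemLp Ψ 2 (volume.restrict Ω) := hΨ.memLp_of_hasCompactSupport hc
  exact integrable_inner_of_memLp (Lp.memLp B) h2

theorem continuous_gradient {φ : E3 → ℝ} (hφ : ContDiff ℝ 1 φ) : Continuous (gradient φ) :=
  (InnerProductSpace.toDual ℝ E3).symm.continuous.comp (hφ.continuous_fderiv one_ne_zero)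

theorem hasCompactSupport_gradient {φ : E3 → ℝ} (hφ : HasCompactSupport φ) :
    HasCompactSupport (gradient φ) :=
  (hφ.fderiv ℝ).comp_left (g := (InnerProductSpace.toDual ℝ E3).symm) (map_zero _)

/-- Apply `curl curl = grad div - Δ` to `φ e_i`: the field `Δφ e_i` is the gradient of `∂_i φ` minus
the curl of `Ψ = curl (φ e_i)`, and `B` annihilates both. In each of the three cases `Ψ` is this
curl written out. -/
theorem isWeaklyHarmonic_coord (hb : Bornology.IsBounded Ω) {B : L2Field Ω}
    (hB : B ∈ harmonicFields Ω) (i : Fin 3) : IsWeaklyHarmonic Ω fun x => B x i := by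
  intro φ hφ
  obtain ⟨Ψ, hΨ, hcurl⟩ : ∃ Ψ : E3 → E3, IsTestFunction Ω Ψ ∧ ∀ x, curl Ψ x =
      gradient (partialDeriv i φ) x - laplacian φ x • EuclideanSpace.single i (1 : ℝ) := by
    have hc : ∀ i j x, partialDeriv i (partialDeriv j φ) x = partialDeriv j (partialDeriv i φ) x :=
      fun i j x => partialDeriv_comm (contDiff_infty.1 hφ.1 2) i j x
    fin_cases i
    · refine ⟨_, isTestFunction_vec isTestFunction_zero (hφ.partialDeriv 2)
        (hφ.partialDeriv 1).neg, fun x => ?_⟩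
      ext j; fin_cases j <;>
        simp [curl, gradient_apply, laplacian, Fin.sum_univ_three, partialDeriv_neg,
          partialDeriv_zero, hc 1 0, hc 2 0]
      ring
    · refine ⟨_, isTestFunction_vec (hφ.partialDeriv 2).neg isTestFunction_zero
        (hφ.partialDeriv 0), fun x => ?_⟩
      ext j; fin_cases j <;>
        simp [curl, gradient_apply, laplacian, Fin.sum_univ_three, partialDeriv_neg,
          partialDeriv_zero, hc 1 0, hc 2 1]
      ring
    · refine ⟨_, isTestFunction_vec (hφ.partialDeriv 1) (hφ.partialDeriv 0).neg
        isTestFunction_zero, fun x => ?_⟩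
      ext j; fin_cases j <;>
        simp [curl, gradient_apply, laplacian, Fin.sum_univ_three, partialDeriv_neg,
          partialDeriv_zero, hc 2 0, hc 2 1]
      ring
  have h1 := integral_inner_curl_eq_zero hB.2 hΨ
  have hi := hφ.partialDeriv i
  have h2 := integral_inner_gradient_eq_zero hB.1 hi
  have hint : IntegrableOn (fun x => inner ℝ (B x) (gradient (partialDeriv i φ) x)) Ω :=
    integrableOn_inner_of_continuous hb B (continuous_gradient (hi.1.of_le (by simp)))
      (hasCompactSupport_gradient hi.2.1)
  have hval : ∀ x, B x i * laplacian φ x =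
      inner ℝ (B x) (gradient (partialDeriv i φ) x) - inner ℝ (B x) (curl Ψ x) := by
    intro x
    rw [hcurl, inner_sub_right, inner_smul_right, EuclideanSpace.inner_single_right]
    simp; ring
  have hcint : IntegrableOn (fun x => inner ℝ (B x) (curl Ψ x)) Ω :=
    integrableOn_inner_of_continuous hb B hΨ.curl.1.continuous hΨ.curl.2.1
  simp_rw [hval]
  rw [integral_sub hint hcint, h1, h2, sub_zero]

/-- The weak curl equation is tested with fields that have `φ` as their only non-zero component; the
remaining index pairs follow by antisymmetry. -/
theorem integral_curl_pair {B : L2Field Ω} (hB : HasWeakCurl Ω B 0) {φ : E3 → ℝ}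
    (hφ : IsTestFunction Ω φ) (i j : Fin 3) :
    ∫ x in Ω, (B x i * partialDeriv j φ x - B x j * partialDeriv i φ x) = 0 := by
  have h0 := integral_inner_curl_eq_zero hB
    (isTestFunction_vec hφ isTestFunction_zero isTestFunction_zero)
  have h1 := integral_inner_curl_eq_zero hB
    (isTestFunction_vec isTestFunction_zero hφ isTestFunction_zero)
  have h2 := integral_inner_curl_eq_zero hB
    (isTestFunction_vec isTestFunction_zero isTestFunction_zero hφ)
  simp only [inner_eq_sum, curl] at h0 h1 h2
  simp [partialDeriv_zero, ← sub_eq_add_neg] at h0 h1 h2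
  eta_reduce at h0 h1 h2
  have hneg : ∀ i j : Fin 3,
      ∫ x in Ω, (B x i * partialDeriv j φ x - B x j * partialDeriv i φ x) = 0 →
      ∫ x in Ω, (B x j * partialDeriv i φ x - B x i * partialDeriv j φ x) = 0 := by
    intro i j h
    rw [← neg_eq_zero, ← integral_neg, ← h]
    congr 1 with x; ring
  have h1' : ∫ x in Ω, (B x 2 * partialDeriv 0 φ x - B x 0 * partialDeriv 2 φ x) = 0 := by
    rw [← h1]; congr 1 with x; ring
  fin_cases i <;> fin_cases j
  · simp
  · exact h2
  · exact hneg 2 0 h1'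
  · exact hneg 0 1 h2
  · simp
  · exact h0
  · exact h1'
  · exact hneg 1 2 h0
  · simp

theorem eq_zero_of_integral_testFunction (hΩ : IsOpen Ω) {h : E3 → ℝ} (hh : ContinuousOn h Ω)
    (h0 : ∀ φ : E3 → ℝ, IsTestFunction Ω φ → ∫ x in Ω, h x * φ x = 0) : ∀ x ∈ Ω, h x = 0 := by
  have hae : ∀ᵐ x, x ∈ Ω → h x = 0 := by
    refine hΩ.ae_eq_zero_of_integral_contDiff_smul_eq_zero
      (hh.locallyIntegrableOn hΩ.measurableSet) fun g hg hc hs => ?_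
    rw [← h0 g ⟨hg, hc, hs⟩, ← setIntegral_eq_integral_of_forall_compl_eq_zero (s := Ω)]
    · congr 1 with x; rw [smul_eq_mul, mul_comm]
    · intro x hx
      rw [image_eq_zero_of_notMem_tsupport fun h => hx (hs h), zero_smul]
  exact Measure.eqOn_open_of_ae_eq ((ae_restrict_iff' hΩ.measurableSet).2 hae) hΩ hh
    continuousOn_const

theorem fderiv_coord {B' : E3 → E3} {x : E3} (h : DifferentiableAt ℝ B' x) (i : Fin 3) (v : E3) :
    fderiv ℝ (fun y => B' y i) x v = fderiv ℝ B' x v i := by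
  have := ((EuclideanSpace.proj i : E3 →L[ℝ] ℝ).hasFDerivAt.comp x h.hasFDerivAt).fderiv
  exact DFunLike.congr_fun this v

theorem eq_sum_single (v : E3) : v = v 0 • EuclideanSpace.single 0 (1 : ℝ) +
    v 1 • EuclideanSpace.single 1 (1 : ℝ) + v 2 • EuclideanSpace.single 2 (1 : ℝ) := by
  ext i; fin_cases i <;> simp

theorem contDiffOn_coord {B' : E3 → E3} (h : ContDiffOn ℝ ∞ B' Ω) (i : Fin 3) :
    ContDiffOn ℝ ∞ (fun x => B' x i) Ω :=
  (contDiffOn_euclidean.1 h) i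

/-- Square integrable harmonic fields are smooth and classically curl-free. -/
theorem exists_smooth_rep (hΩ : IsOpen Ω) (hb : Bornology.IsBounded Ω) {B : L2Field Ω}
    (hB : B ∈ harmonicFields Ω) : ∃ B' : E3 → E3, ContDiffOn ℝ ∞ B' Ω ∧
      B =ᵐ[volume.restrict Ω] B' ∧
      (∀ x r, 0 < r → closedBall x r ⊆ Ω → ∀ i, B' x i = mollify Ω (fun y => B y i) r x) ∧
      ∀ x ∈ Ω, ∀ u v, inner ℝ (fderiv ℝ B' x u) v = inner ℝ (fderiv ℝ B' x v) u := by
  have hfin := isFiniteMeasure_restrict hb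
  choose f hf hfB hfm using fun i =>
    (isWeaklyHarmonic_coord hb hB i).exists_smooth hΩ hb (memLp_coord B i)
  set B' : E3 → E3 := fun x => !₂[f 0 x, f 1 x, f 2 x] with hB'
  have hcoord : ∀ i, (fun x => B' x i) = f i := fun i => by fin_cases i <;> rfl
  have hsm : ContDiffOn ℝ ∞ B' Ω := contDiffOn_euclidean.2 fun i => by rw [hcoord]; exact hf i
  have hae : B =ᵐ[volume.restrict Ω] B' := by
    filter_upwards [hfB 0, hfB 1, hfB 2] with x h0 h1 h2
    ext i; fin_cases i
    · exact h0
    · exact h1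
    · exact h2
  refine ⟨B', hsm, hae, fun x r hr hxr i => (congrFun (hcoord i) x).trans (hfm i x r hr hxr), ?_⟩
  have hf1 : ∀ i, ContDiffOn ℝ 1 (f i) Ω := fun i => (hf i).of_le (by simp)
  -- Integration by parts moves the derivatives from the test function to the smooth representative,
  -- and the fundamental lemma makes its Jacobian symmetric.
  have hjac : ∀ i j, ∀ x ∈ Ω, fderiv ℝ (f i) x (EuclideanSpace.single j 1) -
      fderiv ℝ (f j) x (EuclideanSpace.single i 1) = 0 := by
    intro i j
    have hc : ∀ i j : Fin 3, ContinuousOn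
        (fun x => fderiv ℝ (f i) x (EuclideanSpace.single j (1 : ℝ))) Ω := fun i j =>
      ((hf1 i).continuousOn_fderiv_of_isOpen hΩ le_rfl).clm_apply continuousOn_const
    refine eq_zero_of_integral_testFunction hΩ ((hc i j).sub (hc j i)) fun φ hφ => ?_
    have hφ1 : ContDiff ℝ 1 φ := hφ.1.of_le (by simp)
    have h1 := integral_mul_fderiv_eq_neg hΩ (hf1 i) hφ1 hφ.2.1 hφ.2.2 (EuclideanSpace.single j 1)
    have h2 := integral_mul_fderiv_eq_neg hΩ (hf1 j) hφ1 hφ.2.1 hφ.2.2 (EuclideanSpace.single i 1)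
    have h3 := integral_curl_pair hB.2 hφ i j
    have hint : ∀ i j, IntegrableOn (fun x => f i x * partialDeriv j φ x) Ω := fun i j =>
      (integrable_mul_of_tsupport_subset hΩ (hf i).continuousOn (hφ.partialDeriv j).1.continuous
        (hφ.partialDeriv j).2.1 (hφ.partialDeriv j).2.2).integrableOn
    have h4 : ∫ x in Ω, (f i x * partialDeriv j φ x - f j x * partialDeriv i φ x) = 0 := by
      rw [← h3]
      refine integral_congr_ae ?_
      filter_upwards [hfB i, hfB j] with x hi hj
      rw [hi, hj]
    rw [integral_sub (hint i j) (hint j i)] at h4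
    simp only [partialDeriv] at h4
    rw [h1, h2] at h4
    have hint2 : ∀ i j : Fin 3, IntegrableOn
        (fun x => fderiv ℝ (f i) x (EuclideanSpace.single j 1) * φ x) Ω := fun i j =>
      (integrable_mul_of_tsupport_subset hΩ (hc i j) hφ.1.continuous hφ.2.1 hφ.2.2).integrableOn
    simp_rw [sub_mul]
    rw [integral_sub (hint2 i j) (hint2 j i)]
    linarith
  intro x hx u v
  have hd : DifferentiableAt ℝ B' x :=
    ((hsm x hx).contDiffAt (hΩ.mem_nhds hx)).differentiableAt (by simp)
  have hJ : ∀ i j, fderiv ℝ B' x (EuclideanSpace.single j 1) i =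
      fderiv ℝ B' x (EuclideanSpace.single i 1) j := fun i j => by
    rw [← fderiv_coord hd, ← fderiv_coord hd, hcoord, hcoord]
    exact sub_eq_zero.1 (hjac i j x hx)
  rw [inner_eq_sum, inner_eq_sum]
  conv_lhs => rw [eq_sum_single u]
  conv_rhs => rw [eq_sum_single v]
  simp only [map_add, map_smul, PiLp.add_apply, PiLp.smul_apply, smul_eq_mul, hJ 1 0, hJ 2 0,
    hJ 2 1]
  ring

theorem isContinuousRep_eqOn (hΩ : IsOpen Ω) {B : L2Field Ω} {B₁ B₂ : E3 → E3}
    (h₁ : IsContinuousRep Ω B B₁) (h₂ : IsContinuousRep Ω B B₂) : EqOn B₁ B₂ Ω :=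
  Measure.eqOn_open_of_ae_eq (h₁.2.symm.trans h₂.2) hΩ h₁.1 h₂.1

/-- The mean value property bounds harmonic fields on compact sets. -/
theorem exists_norm_rep_le (hΩ : IsOpen Ω) (hb : Bornology.IsBounded Ω) {K : Set E3}
    (hK : IsCompact K) (hKΩ : K ⊆ Ω) : ∃ C : ℝ, 0 < C ∧ ∀ B ∈ harmonicFields Ω,
      ∀ B' : E3 → E3, IsContinuousRep Ω B B' → ∀ x ∈ K, ‖B' x‖ ≤ C * ‖B‖ := by
  -- One radius serves all points of `K`, so a single mollifier controls all values there.
  obtain ⟨r, hr, hrK⟩ := hK.exists_cthickening_subset_open hΩ hKΩ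
  obtain ⟨C, hC, hCm⟩ := exists_abs_mollify_le (Ω := Ω) hr
  refine ⟨3 * C, by positivity, fun B hB B₁ hB₁ x hx => ?_⟩
  obtain ⟨B', hsm, hae, hm, -⟩ := exists_smooth_rep hΩ hb hB
  rw [isContinuousRep_eqOn hΩ hB₁ ⟨hsm.continuousOn, hae⟩ (hKΩ hx)]
  have hball : closedBall x r ⊆ Ω := (closedBall_subset_cthickening hx r).trans hrK
  have hi : ∀ i, |B' x i| ≤ C * ‖B‖ := fun i => by
    rw [hm x r hr hball i]
    refine (hCm _ (memLp_coord B i) x).trans ?_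
    gcongr
    exact eLpNorm_coord_le B i
  have h3 : ‖B' x‖ ≤ |B' x 0| + |B' x 1| + |B' x 2| := by
    conv_lhs => rw [eq_sum_single (B' x)]
    refine (norm_add₃_le).trans (le_of_eq ?_)
    simp [norm_smul]
  linarith [hi 0, hi 1, hi 2]

/-- The weak divergence equation extends to `C¹` test functions. -/
theorem integral_inner_gradient_eq_zero_of_contDiff (hΩ : IsOpen Ω) (hb : Bornology.IsBounded Ω)
    {B : L2Field Ω} (hB : B ∈ harmonicFields Ω) {χ : E3 → ℝ} (hχ : ContDiff ℝ 1 χ)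
    (hc : HasCompactSupport χ) (hs : tsupport χ ⊆ Ω) :
    ∫ x in Ω, inner ℝ (B x) (gradient χ x) = 0 := by
  obtain ⟨B', hsm, hae, -, -⟩ := exists_smooth_rep hΩ hb hB
  have hf1 : ∀ i, ContDiffOn ℝ 1 (fun x => B' x i) Ω := fun i =>
    (contDiffOn_coord hsm i).of_le (by simp)
  have hcd : ∀ i, ContinuousOn (fun x => fderiv ℝ (fun y => B' y i) x
      (EuclideanSpace.single i (1 : ℝ))) Ω := fun i =>
    ((hf1 i).continuousOn_fderiv_of_isOpen hΩ le_rfl).clm_apply continuousOn_const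
  -- For the smooth representative the pairing is an integral against its classical divergence.
  -- Smooth test functions show that this divergence vanishes, after which `C¹` functions may be
  -- inserted.
  have key : ∀ φ : E3 → ℝ, ContDiff ℝ 1 φ → HasCompactSupport φ → tsupport φ ⊆ Ω →
      ∫ x in Ω, inner ℝ (B x) (gradient φ x) = -∫ x in Ω,
        (∑ i, fderiv ℝ (fun y => B' y i) x (EuclideanSpace.single i (1 : ℝ))) * φ x := by
    intro φ hφ hc hs
    have hsub := fun i => tsupport_partialDeriv_subset φ i
    have hint : ∀ i, IntegrableOn (fun x => B' x i * partialDeriv i φ x) Ω := fun i =>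
      (integrable_mul_of_tsupport_subset hΩ (hf1 i).continuousOn
        ((hφ.continuous_fderiv one_ne_zero).clm_apply continuous_const)
        (hc.of_isClosed_subset (isClosed_tsupport _) (hsub i)) ((hsub i).trans hs)).integrableOn
    have hint2 : ∀ i, IntegrableOn (fun x => fderiv ℝ (fun y => B' y i) x
        (EuclideanSpace.single i (1 : ℝ)) * φ x) Ω := fun i =>
      (integrable_mul_of_tsupport_subset hΩ (hcd i) hφ.continuous hc hs).integrableOn
    have h1 : ∫ x in Ω, inner ℝ (B x) (gradient φ x) =
        ∫ x in Ω, ∑ i, B' x i * partialDeriv i φ x := by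
      refine integral_congr_ae ?_
      filter_upwards [hae] with x hx
      rw [hx, inner_eq_sum, Fin.sum_univ_three]
      simp only [gradient_apply]
    rw [h1, integral_finsetSum _ fun i _ => hint i]
    simp_rw [Finset.sum_mul]
    rw [integral_finsetSum _ fun i _ => hint2 i, ← Finset.sum_neg_distrib]
    exact Finset.sum_congr rfl fun i _ => integral_mul_fderiv_eq_neg hΩ (hf1 i) hφ hc hs _
  have hdiv := eq_zero_of_integral_testFunction hΩ
    (continuousOn_finsetSum Finset.univ fun i _ => hcd i) fun φ hφ => by
      rw [← neg_eq_zero, ← key φ (hφ.1.of_le (by simp)) hφ.2.1 hφ.2.2]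
      exact integral_inner_gradient_eq_zero hB.1 hφ
  rw [key χ hχ hc hs, neg_eq_zero]
  refine setIntegral_eq_zero_of_forall_eq_zero fun x hx => ?_
  rw [hdiv x hx, zero_mul]

/-! ### Potentials of the surface measure -/

theorem lintegral_Ioi_pow {n : ℕ} (hn : 0 < n) {s : ℝ} (hs : 0 < s) :
    ∫⁻ t in Ioi s, ENNReal.ofReal (n * (t⁻¹) ^ (n + 1)) = ENNReal.ofReal ((s⁻¹) ^ n) := by
  have hlt : (-((n : ℝ) + 1)) < -1 := by
    have : (0 : ℝ) < n := by exact_mod_cast hn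
    linarith
  have hEq : EqOn (fun t : ℝ => n * t ^ (-((n : ℝ) + 1))) (fun t => n * (t⁻¹) ^ (n + 1))
      (Ioi s) := fun t ht => by
    have ht0 : 0 < t := hs.trans ht
    simp only
    rw [Real.rpow_neg ht0.le, ← Nat.cast_succ, Real.rpow_natCast, inv_pow]
  have hint : IntegrableOn (fun t : ℝ => n * (t⁻¹) ^ (n + 1)) (Ioi s) :=
    IntegrableOn.congr_fun ((integrableOn_Ioi_rpow_of_lt hlt hs).const_mul (n : ℝ)) hEq
      measurableSet_Ioi
  rw [← ofReal_integral_eq_lintegral_ofReal hint, ← setIntegral_congr_fun measurableSet_Ioi hEq,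
    integral_const_mul, integral_Ioi_rpow_of_lt hlt hs]
  · congr 1
    have h1 : -((n : ℝ) + 1) + 1 = -(n : ℝ) := by ring
    have hn' : (n : ℝ) ≠ 0 := by exact_mod_cast hn.ne'
    rw [h1, Real.rpow_neg hs.le, Real.rpow_natCast, inv_pow]
    field_simp
  · filter_upwards [ae_restrict_mem measurableSet_Ioi] with t ht
    have ht0 : 0 < t := hs.trans ht
    change 0 ≤ n * (t⁻¹) ^ (n + 1)
    positivity

/-- Potentials of a measure in terms of its distribution on balls. -/
theorem lintegral_inv_dist_pow_le (σ : Measure E3) [SFinite σ] {n : ℕ} (hn : 0 < n) (x : E3) :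
    ∫⁻ y, ENNReal.ofReal ((dist x y)⁻¹ ^ n) ∂σ ≤
      ∫⁻ t in Ioi (0 : ℝ), ENNReal.ofReal (n * (t⁻¹) ^ (n + 1)) * σ (closedBall x t) := by
  have hmeas : Measurable fun t : ℝ => ENNReal.ofReal (n * (t⁻¹) ^ (n + 1)) := by fun_prop
  have hset : MeasurableSet {p : E3 × ℝ | dist x p.1 < p.2} :=
    measurableSet_lt (by fun_prop) (by fun_prop)
  -- Layer cake: `dist⁻ⁿ` is the integral of `n t⁻ⁿ⁻¹` over `t > dist`, and Tonelli exchanges the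
  -- integrals. At `y = x` the left integrand is zero by the convention `0⁻¹ = 0`.
  calc ∫⁻ y, ENNReal.ofReal ((dist x y)⁻¹ ^ n) ∂σ
      ≤ ∫⁻ y, (∫⁻ t in Ioi (0 : ℝ), {p : E3 × ℝ | dist x p.1 < p.2}.indicator
          (fun p => ENNReal.ofReal (n * (p.2⁻¹) ^ (n + 1))) (y, t)) ∂σ := by
        refine lintegral_mono fun y => ?_
        rcases (dist_nonneg (x := x) (y := y)).eq_or_lt with h | h
        · simp [← h, hn.ne']
        · rw [← lintegral_Ioi_pow hn h, ← lintegral_indicator measurableSet_Ioi,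
            ← lintegral_indicator measurableSet_Ioi]
          refine lintegral_mono fun t => ?_
          by_cases ht : dist x y < t
          · have ht0 : t ∈ Ioi (0 : ℝ) := h.trans ht
            rw [indicator_of_mem (show t ∈ Ioi (dist x y) from ht), indicator_of_mem ht0,
              indicator_of_mem (show (y, t) ∈ {p : E3 × ℝ | dist x p.1 < p.2} from ht)]
          · rw [indicator_of_notMem (show t ∉ Ioi (dist x y) from ht)]
            exact zero_le
    _ = ∫⁻ t in Ioi (0 : ℝ), ∫⁻ y, {p : E3 × ℝ | dist x p.1 < p.2}.indicator
          (fun p => ENNReal.ofReal (n * (p.2⁻¹) ^ (n + 1))) (y, t) ∂σ :=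
        lintegral_lintegral_swap
          ((hmeas.comp measurable_snd).indicator hset).aemeasurable
    _ ≤ _ := by
        refine lintegral_mono fun t => ?_
        have : ∀ y, {p : E3 × ℝ | dist x p.1 < p.2}.indicator
            (fun p => ENNReal.ofReal (n * (p.2⁻¹) ^ (n + 1))) (y, t) ≤
            (closedBall x t).indicator (fun _ => ENNReal.ofReal (n * (t⁻¹) ^ (n + 1))) y := by
          intro y
          by_cases h : dist x y < t
          · rw [indicator_of_mem (show (y, t) ∈ {p : E3 × ℝ | dist x p.1 < p.2} from h),
              indicator_of_mem (show y ∈ closedBall x t from by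
                rw [mem_closedBall, dist_comm]; exact h.le)]
          · rw [indicator_of_notMem (show (y, t) ∉ {p : E3 × ℝ | dist x p.1 < p.2} from h)]
            exact zero_le
        refine (lintegral_mono this).trans ?_
        rw [lintegral_indicator isClosed_closedBall.measurableSet, setLIntegral_const]

/-- For `t ≤ 1` the area bound `C t²` cancels the factor `t⁻²`; for `t > 1` the total area suffices.
The bound makes the `W^{1/2,2}` energy of Lipschitz functions finite. -/
theorem lintegral_inv_dist_le (hΩ : IsBoundedC11Domain Ω) :
    ∃ C : ℝ≥0, ∀ x, ∫⁻ y, ENNReal.ofReal (dist x y)⁻¹ ∂surfaceMeasure Ω ≤ C := by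
  have := isFiniteMeasure_surfaceMeasure hΩ
  obtain ⟨C, hC⟩ := surfaceMeasure_closedBall_le hΩ
  set M := surfaceMeasure Ω univ with hM
  have hMtop : M ≠ ⊤ := measure_ne_top _ _
  refine ⟨C + M.toNNReal, fun x => ?_⟩
  have h := lintegral_inv_dist_pow_le (surfaceMeasure Ω) one_pos x
  simp only [pow_one] at h
  refine h.trans ?_
  rw [← Ioc_union_Ioi_eq_Ioi zero_le_one]
  refine (lintegral_union_le _ _ _).trans ?_
  rw [ENNReal.coe_add, ENNReal.coe_toNNReal hMtop]
  gcongr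
  · calc _ ≤ ∫⁻ t in Ioc (0 : ℝ) 1, (C : ℝ≥0∞) := by
          refine setLIntegral_mono' measurableSet_Ioc fun t ht => ?_
          refine (mul_le_mul_right (hC x t ht.1.le) _).trans ?_
          rw [mul_left_comm, ← ENNReal.ofReal_mul (by have := ht.1; positivity)]
          have : ((1 : ℕ) : ℝ) * t⁻¹ ^ (1 + 1) * t ^ 2 = 1 := by
            have := ht.1.ne'; field_simp; simp [this]
          rw [this]; simp
      _ ≤ C := by simp
  · calc _ ≤ ∫⁻ t in Ioi (1 : ℝ), ENNReal.ofReal (((1 : ℕ) : ℝ) * t⁻¹ ^ (1 + 1)) * M := by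
          gcongr; exact measure_mono (subset_univ _)
      _ = M := by
          rw [lintegral_mul_const _ (by fun_prop), lintegral_Ioi_pow one_pos one_pos]; simp

/-- Balls of radius below `d` miss the boundary, so the layer cake integral starts at `d` with
integrand at most `5 C t⁻⁴`. The factor `2` is a convenient upper bound for `5 / 3`. -/
theorem lintegral_inv_dist_pow_five_le (hΩ : IsBoundedC11Domain Ω) :
    ∃ C : ℝ≥0, ∀ x d, 0 < d → (∀ y ∈ frontier Ω, d ≤ dist x y) →
      ∫⁻ y, ENNReal.ofReal ((dist x y)⁻¹ ^ 5) ∂surfaceMeasure Ω ≤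
        C * ENNReal.ofReal (d⁻¹ ^ 3) := by
  have := isFiniteMeasure_surfaceMeasure hΩ
  obtain ⟨C, hC⟩ := surfaceMeasure_closedBall_le hΩ
  refine ⟨C * 2, fun x d hd hxd => ?_⟩
  refine (lintegral_inv_dist_pow_le (surfaceMeasure Ω) (by norm_num : 0 < 5) x).trans ?_
  have hzero : ∀ t, t < d → surfaceMeasure Ω (closedBall x t) = 0 := fun t ht => by
    rw [surfaceMeasure, Measure.restrict_apply isClosed_closedBall.measurableSet]
    have : closedBall x t ∩ frontier Ω = ∅ := by
      refine eq_empty_of_forall_notMem fun y hy => ?_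
      have h1 := hxd y hy.2
      have h2 := mem_closedBall'.1 hy.1
      linarith
    rw [this, measure_empty]
  rw [← lintegral_indicator measurableSet_Ioi]
  calc _ ≤ ∫⁻ t, (Ici d).indicator (fun t => (C * 2 : ℝ≥0) *
          ENNReal.ofReal ((3 : ℕ) * t⁻¹ ^ (3 + 1))) t := by
        refine lintegral_mono fun t => ?_
        rcases lt_or_ge t d with h | h
        · have h0 : t ∉ Ici d := not_le.2 h
          rw [indicator_of_notMem h0]
          by_cases ht : t ∈ Ioi (0 : ℝ)
          · rw [indicator_of_mem ht, hzero t h, mul_zero]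
          · rw [indicator_of_notMem ht]
        · have ht0 : 0 < t := hd.trans_le h
          rw [indicator_of_mem (show t ∈ Ioi (0 : ℝ) from ht0),
            indicator_of_mem (show t ∈ Ici d from h)]
          refine (mul_le_mul_right (hC x t ht0.le) _).trans ?_
          have h2 : ((2 : ℝ≥0) : ℝ≥0∞) = ENNReal.ofReal 2 := by simp
          rw [mul_left_comm, ← ENNReal.ofReal_mul (by positivity), ENNReal.coe_mul,
            mul_assoc (C : ℝ≥0∞), h2,
            ← ENNReal.ofReal_mul (by norm_num)]
          refine mul_le_mul_right (ENNReal.ofReal_le_ofReal ?_) _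
          have h3 : ((5 : ℕ) : ℝ) * t⁻¹ ^ (5 + 1) * t ^ 2 = 5 * t⁻¹ ^ 4 := by
            push_cast; field_simp
          rw [← mul_assoc, h3]
          have : (0 : ℝ) < t⁻¹ ^ 4 := by positivity
          push_cast
          linarith
    _ = _ := by
        rw [lintegral_indicator measurableSet_Ici, setLIntegral_congr Ioi_ae_eq_Ici.symm,
          lintegral_const_mul _ (by fun_prop), lintegral_Ioi_pow (by norm_num) hd]

/-! ### The fractional Sobolev space on the boundary -/

theorem ae_mem_frontier (Ω : Set E3) : ∀ᵐ x ∂surfaceMeasure Ω, x ∈ frontier Ω :=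
  ae_restrict_mem isClosed_frontier.measurableSet

theorem measurable_diffQuot {u : E3 → ℝ} (hu : Measurable u) : Measurable (diffQuot u) := by
  unfold diffQuot; fun_prop

theorem diffQuot_sq (u : E3 → ℝ) (p : E3 × E3) :
    diffQuot u p ^ 2 = (u p.1 - u p.2) ^ 2 / dist p.1 p.2 ^ 3 := by
  rw [diffQuot, div_pow, ← Real.rpow_natCast (_ ^ (3 / 2 : ℝ)) 2, ← Real.rpow_mul dist_nonneg]
  norm_num

theorem sq_diffQuot_le {u : E3 → ℝ} {K : ℝ≥0} (hu : LipschitzWith K u) (p : E3 × E3) :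
    diffQuot u p ^ 2 ≤ K ^ 2 * (dist p.1 p.2)⁻¹ := by
  rw [diffQuot_sq]
  rcases (dist_nonneg (x := p.1) (y := p.2)).eq_or_lt with h | h
  · simp [← h]
  · have h1 : (u p.1 - u p.2) ^ 2 ≤ (K * dist p.1 p.2) ^ 2 := by
      rw [← sq_abs]
      gcongr
      exact hu.dist_le_mul _ _
    rw [div_le_iff₀ (by positivity)]
    refine h1.trans_eq ?_
    field_simp

theorem enorm_sq_eq (a : ℝ) : ‖a‖ₑ ^ 2 = ENNReal.ofReal (a ^ 2) := by
  rw [← ofReal_norm, ← ENNReal.ofReal_pow (norm_nonneg _), Real.norm_eq_abs, sq_abs]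

theorem eLpNorm_two_sq {α F : Type*} [MeasurableSpace α] [NormedAddCommGroup F] (μ : Measure α)
    (f : α → F) : eLpNorm f 2 μ ^ 2 = ∫⁻ x, ‖f x‖ₑ ^ 2 ∂μ := by
  rw [eLpNorm_eq_lintegral_rpow_enorm_toReal two_ne_zero ENNReal.ofNat_ne_top,
    ← ENNReal.rpow_natCast, ← ENNReal.rpow_mul]
  simp

theorem memLp_two_of_lintegral {α F : Type*} [MeasurableSpace α] [NormedAddCommGroup F]
    {μ : Measure α} {f : α → F} (hf : AEStronglyMeasurable f μ)
    (h : ∫⁻ x, ‖f x‖ₑ ^ 2 ∂μ ≠ ⊤) : MemLp f 2 μ := by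
  refine ⟨hf, ?_⟩
  rw [← eLpNorm_two_sq] at h
  rcases lt_or_eq_of_le (le_top : eLpNorm f 2 μ ≤ ⊤) with h1 | h1
  · exact h1
  · simp [h1] at h

theorem lintegral_lintegral_inv_dist_ne_top (hΩ : IsBoundedC11Domain Ω) :
    ∫⁻ p, ENNReal.ofReal (dist p.1 p.2)⁻¹ ∂(surfaceMeasure Ω).prod (surfaceMeasure Ω) ≠ ⊤ := by
  have := isFiniteMeasure_surfaceMeasure hΩ
  obtain ⟨C, hC⟩ := lintegral_inv_dist_le hΩ
  rw [lintegral_prod _ (by fun_prop)]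
  refine ne_top_of_le_ne_top (b := ∫⁻ _, (C : ℝ≥0∞) ∂surfaceMeasure Ω) ?_ (lintegral_mono hC)
  rw [lintegral_const]
  exact ENNReal.mul_ne_top (by simp) (measure_ne_top _ _)

theorem memLp_diffQuot (hΩ : IsBoundedC11Domain Ω) {u : E3 → ℝ} {K : ℝ≥0}
    (hu : LipschitzWith K u) :
    MemLp (diffQuot u) 2 ((surfaceMeasure Ω).prod (surfaceMeasure Ω)) := by
  refine memLp_two_of_lintegral
    (measurable_diffQuot hu.continuous.measurable).aestronglyMeasurable ?_
  refine ne_top_of_le_ne_top (b := ENNReal.ofReal (K ^ 2) * ∫⁻ p, ENNReal.ofReal (dist p.1 p.2)⁻¹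
    ∂(surfaceMeasure Ω).prod (surfaceMeasure Ω))
    (ENNReal.mul_ne_top (by simp) (lintegral_lintegral_inv_dist_ne_top hΩ)) ?_
  rw [← lintegral_const_mul _ (by fun_prop)]
  refine lintegral_mono fun p => ?_
  rw [enorm_sq_eq, ← ENNReal.ofReal_mul (by positivity)]
  exact ENNReal.ofReal_le_ofReal (sq_diffQuot_le hu p)

theorem memLp_surface_of_continuous (hΩ : IsBoundedC11Domain Ω) {u : E3 → ℝ}
    (hu : Continuous u) : MemLp u 2 (surfaceMeasure Ω) := by
  have := isFiniteMeasure_surfaceMeasure hΩ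
  obtain ⟨M, hM⟩ := (isCompact_frontier hΩ).exists_bound_of_continuousOn hu.continuousOn
  refine MemLp.of_bound hu.aestronglyMeasurable M ?_
  filter_upwards [ae_mem_frontier Ω] with x hx using hM x hx

/-- The pair of a Lipschitz function and its quotient. -/
def lipPair (hΩ : IsBoundedC11Domain Ω) {u : E3 → ℝ} {K : ℝ≥0} (hu : LipschitzWith K u) :
    SurfacePairs Ω :=
  WithLp.toLp 2 ((memLp_surface_of_continuous hΩ hu.continuous).toLp u,
    (memLp_diffQuot hΩ hu).toLp (diffQuot u))

theorem lipPair_fst (hΩ : IsBoundedC11Domain Ω) {u : E3 → ℝ} {K : ℝ≥0} (hu : LipschitzWith K u) :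
    (lipPair hΩ hu).fst =ᵐ[surfaceMeasure Ω] u :=
  (memLp_surface_of_continuous hΩ hu.continuous).coeFn_toLp

theorem lipPair_snd (hΩ : IsBoundedC11Domain Ω) {u : E3 → ℝ} {K : ℝ≥0} (hu : LipschitzWith K u) :
    (lipPair hΩ hu).snd =ᵐ[(surfaceMeasure Ω).prod (surfaceMeasure Ω)] diffQuot u :=
  (memLp_diffQuot hΩ hu).coeFn_toLp

theorem lipPair_mem (hΩ : IsBoundedC11Domain Ω) {u : E3 → ℝ} {K : ℝ≥0} (hu : LipschitzWith K u) :
    lipPair hΩ hu ∈ halfSobolev Ω :=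
  Submodule.le_topologicalClosure _ ⟨u, K, hu, lipPair_fst hΩ hu, lipPair_snd hΩ hu⟩

theorem diffQuot_congr_ae (hΩ : IsBoundedC11Domain Ω) {u v : E3 → ℝ}
    (h : u =ᵐ[surfaceMeasure Ω] v) :
    diffQuot u =ᵐ[(surfaceMeasure Ω).prod (surfaceMeasure Ω)] diffQuot v := by
  have := isFiniteMeasure_surfaceMeasure hΩ
  filter_upwards [Measure.quasiMeasurePreserving_fst.ae h, Measure.quasiMeasurePreserving_snd.ae h]
    with p h1 h2
  rw [diffQuot, diffQuot, h1, h2]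

/-- The second component of an element of `W^{1/2,2}(∂Ω)` is determined by the first. -/
theorem halfSobolev_snd (hΩ : IsBoundedC11Domain Ω) {w : SurfacePairs Ω} (hw : w ∈ halfSobolev Ω) :
    w.snd =ᵐ[(surfaceMeasure Ω).prod (surfaceMeasure Ω)] diffQuot w.fst := by
  have := isFiniteMeasure_surfaceMeasure hΩ
  obtain ⟨x, hx, hxw⟩ := mem_closure_iff_seq_limit.1 hw
  have h1 : Tendsto (fun n => (x n).fst) atTop (𝓝 w.fst) :=
    ((WithLp.continuous_fst 2 _ _).tendsto w).comp hxw
  have h2 : Tendsto (fun n => (x n).snd) atTop (𝓝 w.snd) :=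
    ((WithLp.continuous_snd 2 _ _).tendsto w).comp hxw
  -- Along a subsequence both components converge almost everywhere, and in the limit the second is
  -- still the difference quotient of the first.
  obtain ⟨k, hk, hk1⟩ := (tendstoInMeasure_of_tendsto_Lp h1).exists_seq_tendsto_ae
  obtain ⟨l, hl, hl1⟩ :=
    (tendstoInMeasure_of_tendsto_Lp (h2.comp hk.tendsto_atTop)).exists_seq_tendsto_ae
  have hsnd : ∀ n, (x n).snd =ᵐ[(surfaceMeasure Ω).prod (surfaceMeasure Ω)]
      diffQuot (x n).fst := fun n => by
    obtain ⟨u, K, -, hu1, hu2⟩ := hx n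
    exact hu2.trans (diffQuot_congr_ae hΩ hu1.symm)
  filter_upwards [Measure.quasiMeasurePreserving_fst.ae hk1,
    Measure.quasiMeasurePreserving_snd.ae hk1, hl1, ae_all_iff.2 hsnd] with p hp1 hp2 hp3 hp4
  refine tendsto_nhds_unique hp3 ?_
  have h5 := ((hp1.sub hp2).div_const (dist p.1 p.2 ^ (3 / 2 : ℝ))).comp hl.tendsto_atTop
  refine h5.congr fun n => ?_
  rw [Function.comp_apply, Function.comp_apply, hp4]
  rfl

theorem halfSobolev_norm_sq (w : SurfacePairs Ω) : ‖w‖ ^ 2 = ‖w.fst‖ ^ 2 + ‖w.snd‖ ^ 2 :=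
  WithLp.prod_norm_sq_eq_of_L2 w

open scoped Convolution in
/-- Mollification of a Lipschitz function. -/
theorem exists_smooth_lipschitz_approx {u : E3 → ℝ} {K : ℝ≥0} (hu : LipschitzWith K u) {ε : ℝ}
    (hε : 0 < ε) : ∃ g : E3 → ℝ, ContDiff ℝ 1 g ∧ LipschitzWith K g ∧
      ∀ x, |g x - u x| ≤ K * ε := by
  let φ : ContDiffBump (0 : E3) := ⟨ε / 2, ε, by positivity, by linarith⟩
  have hloc : LocallyIntegrable u := hu.continuous.locallyIntegrable
  have hcd : ContDiff ℝ 1 (φ.normed volume ⋆[ContinuousLinearMap.lsmul ℝ ℝ, volume] u) :=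
    φ.hasCompactSupport_normed.contDiff_convolution_left _ φ.contDiff_normed hloc
  have hint : ∀ x, Integrable fun t => φ.normed volume t • u (x - t) := fun x => by
    have := (φ.hasCompactSupport_normed (μ := (volume : Measure E3))).convolutionExists_left
      (μ := (volume : Measure E3)) (ContinuousLinearMap.lsmul ℝ ℝ) φ.continuous_normed hloc
    exact this x
  have hint1 : Integrable fun t => φ.normed (volume : Measure E3) t := φ.integrable_normed
  refine ⟨_, hcd, LipschitzWith.of_dist_le_mul fun x y => ?_, fun x => ?_⟩
  · rw [Real.dist_eq]
    simp only [convolution_def, ContinuousLinearMap.lsmul_apply]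
    rw [← integral_sub (hint x) (hint y), ← Real.norm_eq_abs]
    refine (norm_integral_le_of_norm_le (hint1.mul_const (K * dist x y))
      (ae_of_all _ fun t => ?_)).trans_eq ?_
    · rw [← smul_sub, norm_smul, Real.norm_of_nonneg (φ.nonneg_normed t)]
      refine mul_le_mul_of_nonneg_left ?_ (φ.nonneg_normed t)
      refine (hu.dist_le_mul (x - t) (y - t)).trans_eq ?_
      rw [dist_sub_right]
    · rw [integral_mul_const, φ.integral_normed, one_mul]
  · rw [← Real.dist_eq]
    refine φ.dist_normed_convolution_le hloc.aestronglyMeasurable fun y hy => ?_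
    refine (hu.dist_le_mul y x).trans ?_
    gcongr
    exact (mem_ball.1 hy).le

theorem exists_cutoff {S : Set E3} (hS : Bornology.IsBounded S) :
    ∃ χ : E3 → ℝ, ContDiff ℝ ∞ χ ∧ HasCompactSupport χ ∧ ∀ x ∈ S, χ x = 1 := by
  obtain ⟨R, hR⟩ := hS.subset_closedBall 0
  let χ : ContDiffBump (0 : E3) := ⟨max R 1, max R 1 + 1, by positivity, by linarith⟩
  exact ⟨χ, χ.contDiff, χ.hasCompactSupport, fun x hx =>
    χ.one_of_mem_closedBall (closedBall_subset_closedBall (le_max_left _ _) (hR hx))⟩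

theorem tendsto_eLpNorm_two_zero {α F ι : Type*} [MeasurableSpace α] [NormedAddCommGroup F]
    {μ : Measure α} {f : ι → α → F} {l : Filter ι}
    (h : Tendsto (fun n => ∫⁻ x, ‖f n x‖ₑ ^ 2 ∂μ) l (𝓝 0)) :
    Tendsto (fun n => eLpNorm (f n) 2 μ) l (𝓝 0) := by
  have h1 := (ENNReal.continuous_rpow_const (y := (1 / 2 : ℝ))).tendsto 0 |>.comp h
  rw [ENNReal.zero_rpow_of_pos (by norm_num)] at h1
  refine h1.congr fun n => ?_
  rw [Function.comp_apply, ← eLpNorm_two_sq, ← ENNReal.rpow_natCast, ← ENNReal.rpow_mul]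
  norm_num

/-- Restrictions of `C¹` functions with compact support. -/
theorem lipPair_mem_closure (hΩ : IsBoundedC11Domain Ω) {u : E3 → ℝ} {K : ℝ≥0}
    (hu : LipschitzWith K u) : lipPair hΩ hu ∈ closure {w : SurfacePairs Ω | ∃ φ : E3 → ℝ,
      ContDiff ℝ 1 φ ∧ HasCompactSupport φ ∧ w ∈ halfSobolev Ω ∧
      w.fst =ᵐ[surfaceMeasure Ω] φ} := by
  have hfin := isFiniteMeasure_surfaceMeasure hΩ
  set σ := surfaceMeasure Ω with hσ
  -- The mollified functions keep the Lipschitz constant `K`. Uniform convergence handles the first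
  -- component; for the second, the squared quotients of `g n - u` are dominated by a fixed multiple
  -- of `1 / |x - y|`.
  choose g hg1 hgK hgu using fun n : ℕ =>
    exists_smooth_lipschitz_approx hu (ε := 1 / ((n : ℝ) + 1)) (by positivity)
  obtain ⟨χ, hχ, hχc, hχ1⟩ := exists_cutoff (isCompact_frontier hΩ).isBounded
  have hlim : Tendsto (fun n : ℕ => (K : ℝ) * (1 / ((n : ℝ) + 1))) atTop (𝓝 0) := by
    simpa using tendsto_one_div_add_atTop_nhds_zero_nat.const_mul (K : ℝ)
  have hgt : ∀ x, Tendsto (fun n => g n x - u x) atTop (𝓝 0) := fun x =>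
    squeeze_zero_norm (fun n => hgu n x) hlim
  refine mem_closure_of_tendsto (f := fun n => lipPair hΩ (hgK n)) (b := atTop) ?_
    (Eventually.of_forall fun n => ⟨fun x => χ x * g n x, (hχ.of_le (by simp)).mul (hg1 n),
      hχc.mul_right, lipPair_mem hΩ _, ?_⟩)
  · refine ((WithLp.prod_continuous_toLp 2 _ _).tendsto _).comp (Tendsto.prodMk_nhds ?_ ?_)
    · refine (Lp.tendsto_Lp_iff_tendsto_eLpNorm'' _ _ _ _).2 (tendsto_eLpNorm_two_zero ?_)
      refine tendsto_of_tendsto_of_tendsto_of_le_of_le tendsto_const_nhds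
        (h := fun n : ℕ => ENNReal.ofReal ((K * (1 / ((n : ℝ) + 1))) ^ 2) * σ univ) ?_
        (fun _ => zero_le) fun n => ?_
      · have h1 := ENNReal.tendsto_ofReal (hlim.pow 2)
        rw [zero_pow two_ne_zero, ENNReal.ofReal_zero] at h1
        simpa using ENNReal.Tendsto.mul_const h1 (Or.inr (measure_ne_top σ univ))
      · dsimp only
        rw [← lintegral_const]
        refine lintegral_mono fun x => ?_
        rw [enorm_sq_eq, ← sq_abs]
        have := hgu n x
        gcongr
        exact this
    · refine (Lp.tendsto_Lp_iff_tendsto_eLpNorm'' _ _ _ _).2 (tendsto_eLpNorm_two_zero ?_)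
      have hdq : ∀ n p, (diffQuot (g n) - diffQuot u) p = diffQuot (fun x => g n x - u x) p := by
        intro n p
        simp only [Pi.sub_apply, diffQuot]; ring
      have hLip : ∀ n, LipschitzWith (K + K) fun x => g n x - u x := fun n => (hgK n).sub hu
      simp_rw [hdq]
      rw [← lintegral_zero (μ := σ.prod σ)]
      refine tendsto_lintegral_of_dominated_convergence
        (fun p => ENNReal.ofReal ((K + K : ℝ≥0) ^ 2) * ENNReal.ofReal (dist p.1 p.2)⁻¹)
        (fun n => ?_) (fun n => ae_of_all _ fun p => ?_) ?_ (ae_of_all _ fun p => ?_)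
      · exact ((measurable_diffQuot (hLip n).continuous.measurable).enorm).pow_const 2
      · dsimp only
        rw [enorm_sq_eq, ← ENNReal.ofReal_mul (by positivity)]
        exact ENNReal.ofReal_le_ofReal (sq_diffQuot_le (hLip n) p)
      · rw [lintegral_const_mul _ (by fun_prop)]
        exact ENNReal.mul_ne_top (by simp) (lintegral_lintegral_inv_dist_ne_top hΩ)
      · have h1 := (((hgt p.1).sub (hgt p.2)).div_const (dist p.1 p.2 ^ (3 / 2 : ℝ)))
        rw [sub_zero, zero_div] at h1
        have h2 := ENNReal.Tendsto.pow (n := 2) ((continuous_enorm.tendsto (0 : ℝ)).comp h1)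
        simpa [diffQuot, Function.comp_def] using h2
  · filter_upwards [lipPair_fst hΩ (hgK n), ae_mem_frontier Ω] with x hx hxF
    rw [hx, hχ1 x hxF, one_mul]

/-- A functional on `W^{1/2,2}(∂Ω)` is determined by its values on restrictions. -/
theorem negHalfSobolev_ext (hΩ : IsBoundedC11Domain Ω) {T₁ T₂ : negHalfSobolev Ω}
    (h : ∀ φ : E3 → ℝ, ContDiff ℝ 1 φ → HasCompactSupport φ → ∀ w : halfSobolev Ω,
      IsRestriction Ω φ w → T₁ w = T₂ w) : T₁ = T₂ := by
  set D : Set (SurfacePairs Ω) := {w | ∃ φ : E3 → ℝ, ContDiff ℝ 1 φ ∧ HasCompactSupport φ ∧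
    w ∈ halfSobolev Ω ∧ w.fst =ᵐ[surfaceMeasure Ω] φ} with hD
  have hsub : (halfSobolev Ω : Set (SurfacePairs Ω)) ⊆ closure D := by
    refine closure_minimal ?_ isClosed_closure
    rintro w ⟨u, K, hu, h1, h2⟩
    have : w = lipPair hΩ hu := by
      apply WithLp.ofLp_injective
      refine Prod.ext (Lp.ext ?_) (Lp.ext ?_)
      · exact h1.trans (lipPair_fst hΩ hu).symm
      · exact h2.trans (lipPair_snd hΩ hu).symm
    rw [this]
    exact lipPair_mem_closure hΩ hu
  ext w
  obtain ⟨x, hx, hxw⟩ := mem_closure_iff_seq_limit.1 (hsub w.2)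
  choose φ h1 h2 h3 h4 using hx
  have hlim : Tendsto (fun n => (⟨x n, h3 n⟩ : halfSobolev Ω)) atTop (𝓝 w) :=
    tendsto_subtype_rng.2 hxw
  refine tendsto_nhds_unique ((T₁.continuous.tendsto w).comp hlim) ?_
  refine ((T₂.continuous.tendsto w).comp hlim).congr fun n => ?_
  exact (h (φ n) (h1 n) (h2 n) ⟨x n, h3 n⟩ (h4 n)).symm

/-! ### Extending boundary values by weighted averages -/

/-- The averaging kernel `|x - y|⁻⁶`. -/
def kern (x y : E3) : ℝ := (‖x - y‖ ^ 2)⁻¹ ^ 3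

/-- The differential of the averaging kernel in its first variable. -/
def kernDeriv (x y : E3) : E3 →L[ℝ] ℝ := (-3 * (‖x - y‖ ^ 2)⁻¹ ^ 4) • (2 • innerSL ℝ (x - y))

theorem kern_nonneg (x y : E3) : 0 ≤ kern x y := by unfold kern; positivity

theorem hasFDerivAt_kern {x y : E3} (h : x ≠ y) :
    HasFDerivAt (fun x => kern x y) (kernDeriv x y) x := by
  have h0 : ‖x - y‖ ^ 2 ≠ 0 := by simpa [sub_eq_zero] using h
  have h1 : HasFDerivAt (fun x : E3 => ‖x - y‖ ^ 2) (2 • innerSL ℝ (x - y)) x := by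
    simpa using ((hasFDerivAt_id x).sub_const y).norm_sq
  have h2 : HasDerivAt (fun s : ℝ => s⁻¹ ^ 3) (-3 * (‖x - y‖ ^ 2)⁻¹ ^ 4) (‖x - y‖ ^ 2) := by
    refine ((hasDerivAt_inv h0).pow 3).congr_deriv ?_
    push_cast
    field_simp
  exact h2.comp_hasFDerivAt x h1

theorem norm_kernDeriv_le (x y : E3) : ‖kernDeriv x y‖ ≤ 6 * ‖x - y‖⁻¹ * kern x y := by
  rw [kernDeriv, norm_smul, two_smul, ← two_smul ℝ, norm_smul, innerSL_apply_norm, kern]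
  rcases eq_or_ne x y with h | h
  · simp [h]
  · have h0 : 0 < ‖x - y‖ := norm_pos_iff.2 (sub_ne_zero.2 h)
    rw [Real.norm_eq_abs, abs_mul, abs_of_pos (show 0 < (‖x - y‖ ^ 2)⁻¹ ^ 4 by positivity)]
    refine le_of_eq ?_
    norm_num
    field_simp
    norm_num

theorem continuousAt_kernDeriv {x y : E3} (h : x ≠ y) :
    ContinuousAt (fun x => kernDeriv x y) x := by
  have h0 : ‖x - y‖ ^ 2 ≠ 0 := by simpa [sub_eq_zero] using h
  unfold kernDeriv
  have h3 : ContinuousAt (fun x : E3 => ‖x - y‖ ^ 2) x := by fun_prop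
  have h1 : ContinuousAt (fun x : E3 => -3 * (‖x - y‖ ^ 2)⁻¹ ^ 4) x :=
    continuousAt_const.mul ((h3.inv₀ h0).pow 4)
  have h2 : ContinuousAt (fun x : E3 => 2 • innerSL ℝ (x - y)) x := by fun_prop
  exact h1.smul h2

theorem measurable_kern : Measurable fun p : E3 × E3 => kern p.1 p.2 := by
  unfold kern; fun_prop

theorem measurable_kernDeriv (x : E3) : Measurable (kernDeriv x) := by
  unfold kernDeriv
  have h1 : Measurable fun y : E3 => -3 * (‖x - y‖ ^ 2)⁻¹ ^ 4 := by fun_prop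
  have h2 : Continuous fun y : E3 => 2 • innerSL ℝ (x - y) := by fun_prop
  exact h1.smul h2.measurable

theorem kern_le {x y : E3} {d : ℝ} (hd : 0 < d) (h : d ≤ ‖x - y‖) : kern x y ≤ d⁻¹ ^ 6 := by
  have : (‖x - y‖ ^ 2)⁻¹ ≤ (d ^ 2)⁻¹ := inv_anti₀ (by positivity) (by gcongr)
  calc kern x y ≤ (d ^ 2)⁻¹ ^ 3 := by unfold kern; gcongr
    _ = d⁻¹ ^ 6 := by rw [inv_pow, inv_pow, ← pow_mul]

theorem norm_kernDeriv_le' {x y : E3} {d : ℝ} (hd : 0 < d) (h : d ≤ ‖x - y‖) :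
    ‖kernDeriv x y‖ ≤ 6 * d⁻¹ * kern x y :=
  (norm_kernDeriv_le x y).trans (by
    have := kern_nonneg x y
    gcongr)

/-- The distance to the boundary. -/
def bdist (Ω : Set E3) (x : E3) : ℝ := infDist x (frontier Ω)

theorem frontier_nonempty (hΩ : IsBoundedC11Domain Ω) : (frontier Ω).Nonempty := by
  rw [nonempty_frontier_iff]
  refine ⟨hΩ.isConnected.nonempty, fun h => ?_⟩
  exact NormedSpace.unbounded_univ ℝ E3 (h ▸ hΩ.isBounded)

theorem bdist_pos (hΩ : IsBoundedC11Domain Ω) {x : E3} (hx : x ∈ Ω) : 0 < bdist Ω x :=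
  (isClosed_frontier.notMem_iff_infDist_pos (frontier_nonempty hΩ)).1 fun h =>
    (hΩ.isOpen.inter_frontier_eq.subset ⟨hx, h⟩ : x ∈ (∅ : Set E3))

theorem bdist_le {x y : E3} (hy : y ∈ frontier Ω) : bdist Ω x ≤ ‖x - y‖ := by
  rw [← dist_eq_norm]; exact infDist_le_dist_of_mem hy

theorem bdist_half_le {x x' y : E3} (hy : y ∈ frontier Ω) (hx' : dist x' x < bdist Ω x / 2) :
    bdist Ω x / 2 ≤ ‖x' - y‖ := by
  have h1 := bdist_le (x := x) hy
  rw [← dist_eq_norm] at h1 ⊢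
  have := dist_triangle x x' y
  rw [dist_comm] at hx'
  linarith

theorem continuous_bdist : Continuous (bdist Ω) := continuous_infDist_pt _

/-- The weighted surface integral of `h`. -/
def kernInt (Ω : Set E3) (h : E3 → ℝ) (x : E3) : ℝ := ∫ y, h y * kern x y ∂surfaceMeasure Ω

/-- The differential of `kernInt`. -/
def kernIntDeriv (Ω : Set E3) (h : E3 → ℝ) (x : E3) : E3 →L[ℝ] ℝ :=
  ∫ y, h y • kernDeriv x y ∂surfaceMeasure Ω

theorem integrable_kern (hΩ : IsBoundedC11Domain Ω) {h : E3 → ℝ} (hh : Continuous h) {x : E3}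
    (hx : x ∈ Ω) : Integrable (fun y => h y * kern x y) (surfaceMeasure Ω) := by
  have := isFiniteMeasure_surfaceMeasure hΩ
  obtain ⟨M, hM⟩ := (isCompact_frontier hΩ).exists_bound_of_continuousOn hh.continuousOn
  refine Integrable.of_bound (hh.measurable.mul (measurable_kern.comp
    measurable_prodMk_left)).aestronglyMeasurable (M * (bdist Ω x)⁻¹ ^ 6) ?_
  filter_upwards [ae_mem_frontier Ω] with y hy
  rw [norm_mul, Real.norm_of_nonneg (kern_nonneg x y)]
  have h1 := kern_nonneg x y
  have h2 := (norm_nonneg _).trans (hM y hy)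
  gcongr
  · exact hM y hy
  · exact kern_le (bdist_pos hΩ hx) (bdist_le hy)

theorem norm_smul_kernDeriv_le {M d : ℝ} {h : E3 → ℝ} {x y : E3} (hd : 0 < d) (hM : ‖h y‖ ≤ M)
    (hxy : d ≤ ‖x - y‖) : ‖h y • kernDeriv x y‖ ≤ M * (6 * d⁻¹ * d⁻¹ ^ 6) := by
  rw [norm_smul]
  have h2 := (norm_nonneg _).trans hM
  gcongr
  exact (norm_kernDeriv_le' hd hxy).trans (by gcongr; exact kern_le hd hxy)

theorem integrable_kernDeriv (hΩ : IsBoundedC11Domain Ω) {h : E3 → ℝ} (hh : Continuous h) {x : E3}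
    (hx : x ∈ Ω) : Integrable (fun y => h y • kernDeriv x y) (surfaceMeasure Ω) := by
  have := isFiniteMeasure_surfaceMeasure hΩ
  obtain ⟨M, hM⟩ := (isCompact_frontier hΩ).exists_bound_of_continuousOn hh.continuousOn
  refine Integrable.of_bound (hh.measurable.smul (measurable_kernDeriv x)).aestronglyMeasurable
    (M * (6 * (bdist Ω x)⁻¹ * (bdist Ω x)⁻¹ ^ 6)) ?_
  filter_upwards [ae_mem_frontier Ω] with y hy
  exact norm_smul_kernDeriv_le (bdist_pos hΩ hx) (hM y hy) (bdist_le hy)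

theorem hasFDerivAt_kernInt (hΩ : IsBoundedC11Domain Ω) {h : E3 → ℝ} (hh : Continuous h) {x : E3}
    (hx : x ∈ Ω) : HasFDerivAt (kernInt Ω h) (kernIntDeriv Ω h x) x := by
  have := isFiniteMeasure_surfaceMeasure hΩ
  obtain ⟨M, hM⟩ := (isCompact_frontier hΩ).exists_bound_of_continuousOn hh.continuousOn
  have hd := bdist_pos hΩ hx
  refine hasFDerivAt_integral_of_dominated_of_fderiv_le (μ := surfaceMeasure Ω)
    (F := fun x y => h y * kern x y) (F' := fun x y => h y • kernDeriv x y)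
    (bound := fun _ => M * (6 * (bdist Ω x / 2)⁻¹ * (bdist Ω x / 2)⁻¹ ^ 6))
    (ball_mem_nhds x (half_pos hd))
    (Eventually.of_forall fun x => (hh.measurable.mul (measurable_kern.comp
      measurable_prodMk_left)).aestronglyMeasurable)
    (integrable_kern hΩ hh hx) (integrable_kernDeriv hΩ hh hx).1 ?_ (integrable_const _) ?_
  · filter_upwards [ae_mem_frontier Ω] with y hy x' hx'
    exact norm_smul_kernDeriv_le (half_pos hd) (hM y hy) (bdist_half_le hy hx')
  · filter_upwards [ae_mem_frontier Ω] with y hy x' hx'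
    have h1 := bdist_half_le hy hx'
    refine (hasFDerivAt_kern (fun h0 => ?_)).const_mul (h y)
    rw [h0, sub_self, norm_zero] at h1
    linarith

theorem continuousOn_kernIntDeriv (hΩ : IsBoundedC11Domain Ω) {h : E3 → ℝ} (hh : Continuous h) :
    ContinuousOn (kernIntDeriv Ω h) Ω := by
  have := isFiniteMeasure_surfaceMeasure hΩ
  obtain ⟨M, hM⟩ := (isCompact_frontier hΩ).exists_bound_of_continuousOn hh.continuousOn
  intro x hx
  have hd := bdist_pos hΩ hx
  refine ContinuousAt.continuousWithinAt ?_
  refine continuousAt_of_dominated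
    (bound := fun _ => M * (6 * (bdist Ω x / 2)⁻¹ * (bdist Ω x / 2)⁻¹ ^ 6))
    (Eventually.of_forall fun x => (hh.measurable.smul
      (measurable_kernDeriv x)).aestronglyMeasurable) ?_ (integrable_const _) ?_
  · filter_upwards [ball_mem_nhds x (half_pos hd)] with x' hx'
    filter_upwards [ae_mem_frontier Ω] with y hy
    exact norm_smul_kernDeriv_le (half_pos hd) (hM y hy) (bdist_half_le hy hx')
  · filter_upwards [ae_mem_frontier Ω] with y hy
    have h1 := bdist_le (x := x) hy
    refine (continuousAt_kernDeriv fun h0 => ?_).const_smul (h y)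
    rw [h0, sub_self, norm_zero, ← h0] at h1
    linarith

theorem contDiffOn_kernInt (hΩ : IsBoundedC11Domain Ω) {h : E3 → ℝ} (hh : Continuous h) :
    ContDiffOn ℝ 1 (kernInt Ω h) Ω := by
  have h0 : ContDiffOn ℝ (0 + 1) (kernInt Ω h) Ω := by
    rw [contDiffOn_succ_iff_fderiv_of_isOpen hΩ.isOpen]
    refine ⟨fun x hx => (hasFDerivAt_kernInt hΩ hh hx).differentiableAt.differentiableWithinAt,
      by simp, contDiffOn_zero.2 ?_⟩
    exact (continuousOn_kernIntDeriv hΩ hh).congr fun x hx => (hasFDerivAt_kernInt hΩ hh hx).fderiv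
  simpa using h0

/-- The total weight. -/
def kernMass (Ω : Set E3) (x : E3) : ℝ := kernInt Ω (fun _ => 1) x

theorem kernMass_eq (x : E3) : kernMass Ω x = ∫ y, kern x y ∂surfaceMeasure Ω := by
  simp [kernMass, kernInt]

/-- The part of the boundary within `d` of a boundary point nearest to `x` has area at least `c d²`,
and there the kernel is at least `(2 d)⁻⁶`; hence the constant `c / 64`. The radius `R` bounds all
distances to the boundary that occur. -/
theorem exists_kernMass_ge (hΩ : IsBoundedC11Domain Ω) :
    ∃ c : ℝ, 0 < c ∧ ∀ x ∈ Ω, c * (bdist Ω x)⁻¹ ^ 4 ≤ kernMass Ω x := by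
  have hfin := isFiniteMeasure_surfaceMeasure hΩ
  obtain ⟨q, hq⟩ := frontier_nonempty hΩ
  obtain ⟨R, hR⟩ := hΩ.isBounded.subset_closedBall q
  obtain ⟨c, hc, hcσ⟩ := le_surfaceMeasure_closedBall hΩ R
  refine ⟨c / 64, by positivity, fun x hx => ?_⟩
  have hd := bdist_pos hΩ hx
  obtain ⟨p, hp, hpx⟩ := (isCompact_frontier hΩ).exists_infDist_eq_dist (frontier_nonempty hΩ) x
  have hdR : bdist Ω x ≤ R := (infDist_le_dist_of_mem hq).trans (hR hx)
  have h1 := hcσ p hp _ hd hdR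
  set d := bdist Ω x with hdef
  have h2 : c * d ^ 2 ≤ (surfaceMeasure Ω).real (closedBall p d) := by
    rw [measureReal_def, ← ENNReal.ofReal_le_iff_le_toReal (measure_ne_top _ _)]
    exact h1
  have hpx' : dist x p = d := hpx.symm
  have hint : Integrable (fun y => kern x y) (surfaceMeasure Ω) := by
    simpa using integrable_kern hΩ (continuous_const (y := (1 : ℝ))) hx
  rw [kernMass_eq]
  calc c / 64 * d⁻¹ ^ 4 = (2 * d)⁻¹ ^ 6 * (c * d ^ 2) := by field_simp; norm_num
    _ ≤ (2 * d)⁻¹ ^ 6 * (surfaceMeasure Ω).real (closedBall p d) := by gcongr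
    _ = ∫ y in closedBall p d, (2 * d)⁻¹ ^ 6 ∂surfaceMeasure Ω := by
        rw [setIntegral_const, smul_eq_mul, mul_comm]
    _ ≤ ∫ y in closedBall p d, kern x y ∂surfaceMeasure Ω := by
        refine setIntegral_mono_on_ae (integrable_const _).integrableOn hint.integrableOn
          isClosed_closedBall.measurableSet ?_
        filter_upwards [ae_mem_frontier Ω] with y hy hyp
        have h3 : 0 < ‖x - y‖ := hd.trans_le (bdist_le hy)
        have h4 : ‖x - y‖ ≤ 2 * d := by
          rw [← dist_eq_norm]
          have := dist_triangle_right x y p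
          have := mem_closedBall.1 hyp
          linarith
        calc (2 * d)⁻¹ ^ 6 = ((2 * d) ^ 2)⁻¹ ^ 3 := by field_simp
          _ ≤ kern x y := by unfold kern; gcongr
    _ ≤ _ := setIntegral_le_integral hint (ae_of_all _ fun y => kern_nonneg x y)

/-- Cauchy–Schwarz for the measure with density `k`. -/
theorem sq_lintegral_mul_le {α : Type*} [MeasurableSpace α] {μ : Measure α} {a k : α → ℝ≥0∞}
    (ha : AEMeasurable a μ) (hk : AEMeasurable k μ) :
    (∫⁻ x, a x * k x ∂μ) ^ 2 ≤ (∫⁻ x, a x ^ 2 * k x ∂μ) * ∫⁻ x, k x ∂μ := by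
  have h := ENNReal.lintegral_mul_norm_pow_le (μ := μ) (f := fun x => a x ^ 2 * k x) (g := k)
    (p := 1 / 2) (q := 1 / 2) ((ha.pow_const 2).mul hk) hk (by norm_num) (by norm_num)
    (by norm_num)
  have h1 : ∀ x, (a x ^ 2 * k x) ^ (1 / 2 : ℝ) * k x ^ (1 / 2 : ℝ) = a x * k x := fun x => by
    rw [ENNReal.mul_rpow_of_nonneg _ _ (by norm_num), mul_assoc,
      ← ENNReal.rpow_add_of_nonneg _ _ (by norm_num) (by norm_num), ← ENNReal.rpow_natCast,
      ← ENNReal.rpow_mul]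
    norm_num
  simp_rw [h1] at h
  rw [← ENNReal.mul_rpow_of_nonneg _ _ (by norm_num : (0 : ℝ) ≤ 1 / 2)] at h
  calc _ ≤ (((∫⁻ x, a x ^ 2 * k x ∂μ) * ∫⁻ x, k x ∂μ) ^ (1 / 2 : ℝ)) ^ 2 := by gcongr
    _ = _ := by
      rw [← ENNReal.rpow_natCast, ← ENNReal.rpow_mul]; norm_num

/-- The extension of boundary values to `Ω` by weighted averages. -/
def bdryExt (Ω : Set E3) (φ : E3 → ℝ) (x : E3) : ℝ := kernInt Ω φ x / kernMass Ω x

/-- The differential of `bdryExt`. -/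
def bdryExtDeriv (Ω : Set E3) (φ : E3 → ℝ) (x : E3) : E3 →L[ℝ] ℝ :=
  (kernMass Ω x ^ 2)⁻¹ • (kernMass Ω x • kernIntDeriv Ω φ x -
    kernInt Ω φ x • kernIntDeriv Ω (fun _ => 1) x)

theorem kernMass_pos (hΩ : IsBoundedC11Domain Ω) {x : E3} (hx : x ∈ Ω) : 0 < kernMass Ω x := by
  obtain ⟨c, hc, h⟩ := exists_kernMass_ge hΩ
  have := bdist_pos hΩ hx
  exact lt_of_lt_of_le (by positivity) (h x hx)

theorem contDiffOn_bdryExt (hΩ : IsBoundedC11Domain Ω) {φ : E3 → ℝ} (hφ : Continuous φ) :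
    ContDiffOn ℝ 1 (bdryExt Ω φ) Ω :=
  (contDiffOn_kernInt hΩ hφ).div (contDiffOn_kernInt hΩ continuous_const)
    fun _ hx => (kernMass_pos hΩ hx).ne'

theorem hasFDerivAt_bdryExt (hΩ : IsBoundedC11Domain Ω) {φ : E3 → ℝ} (hφ : Continuous φ) {x : E3}
    (hx : x ∈ Ω) : HasFDerivAt (bdryExt Ω φ) (bdryExtDeriv Ω φ x) x := by
  have h0 := (kernMass_pos hΩ hx).ne'
  have h1 := hasFDerivAt_kernInt hΩ hφ hx
  have h2 : HasFDerivAt (kernMass Ω) _ x :=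
    hasFDerivAt_kernInt hΩ (continuous_const (y := (1 : ℝ))) hx
  have h3 := h1.mul ((hasDerivAt_inv h0).comp_hasFDerivAt x h2)
  refine (h3.congr_fderiv ?_).congr_of_eventuallyEq (Eventually.of_forall fun y => ?_)
  · ext v
    simp only [bdryExtDeriv, _root_.add_apply, _root_.smul_apply, _root_.sub_apply, smul_eq_mul,
      Function.comp_apply]
    field_simp
    ring
  · simp [bdryExt, div_eq_mul_inv]

/-- The numerator of the quotient rule is rewritten so that only differences `φ y - φ z` occur. This
is how the fractional seminorm enters. -/
theorem kernMass_smul_sub (hΩ : IsBoundedC11Domain Ω) {φ : E3 → ℝ} (hφ : Continuous φ) {x : E3}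
    (hx : x ∈ Ω) : kernMass Ω x • kernIntDeriv Ω φ x - kernInt Ω φ x • kernIntDeriv Ω (fun _ => 1) x
      = ∫ y, (∫ z, (φ y - φ z) * kern x z ∂surfaceMeasure Ω) • kernDeriv x y
        ∂surfaceMeasure Ω := by
  have h1 := integrable_kernDeriv hΩ hφ hx
  have h2 := integrable_kernDeriv hΩ (continuous_const (y := (1 : ℝ))) hx
  have h1' : Integrable (fun y => kernMass Ω x • φ y • kernDeriv x y) (surfaceMeasure Ω) :=
    h1.smul (kernMass Ω x)
  have h2' : Integrable (fun y => kernInt Ω φ x • (1 : ℝ) • kernDeriv x y) (surfaceMeasure Ω) :=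
    h2.smul (kernInt Ω φ x)
  rw [kernIntDeriv, kernIntDeriv, ← integral_smul, ← integral_smul, ← integral_sub h1' h2']
  congr 1 with y : 1
  have h3 : ∫ z, (φ y - φ z) * kern x z ∂surfaceMeasure Ω =
      φ y * kernMass Ω x - kernInt Ω φ x := by
    simp_rw [sub_mul]
    have h4 := integrable_kern hΩ (continuous_const (y := (1 : ℝ))) hx
    simp only [one_mul] at h4
    rw [integral_sub (h4.const_mul _) (integrable_kern hΩ hφ hx), integral_const_mul,
      kernMass_eq, kernInt]
  rw [h3, one_smul, smul_smul, mul_comm (kernMass Ω x)]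
  exact (sub_smul _ _ _).symm

/-- The kernel with values in `ℝ≥0∞`. -/
def ekern (x y : E3) : ℝ≥0∞ := ENNReal.ofReal (kern x y)

theorem measurable_ekern : Measurable fun p : E3 × E3 => ekern p.1 p.2 :=
  ENNReal.measurable_ofReal.comp measurable_kern

theorem lintegral_ekern (hΩ : IsBoundedC11Domain Ω) {x : E3} (hx : x ∈ Ω) :
    ∫⁻ y, ekern x y ∂surfaceMeasure Ω = ENNReal.ofReal (kernMass Ω x) := by
  have h4 := integrable_kern hΩ (continuous_const (y := (1 : ℝ))) hx
  simp only [one_mul] at h4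
  rw [kernMass_eq, ofReal_integral_eq_lintegral_ofReal h4 (ae_of_all _ (kern_nonneg x))]
  rfl

theorem measurable_ekern_right (x : E3) : Measurable (ekern x) := by
  have h : Measurable ((fun p : E3 × E3 => ekern p.1 p.2) ∘ Prod.mk x) :=
    measurable_ekern.comp measurable_prodMk_left
  exact h

theorem measurable_enorm_sub {φ : E3 → ℝ} (hφ : Continuous φ) :
    Measurable fun p : E3 × E3 => ‖φ p.1 - φ p.2‖ₑ :=
  measurable_enorm.comp ((hφ.measurable.comp measurable_fst).sub
    (hφ.measurable.comp measurable_snd))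

theorem enorm_kernMass_smul_sub_le_lintegral (hΩ : IsBoundedC11Domain Ω) {φ : E3 → ℝ}
    (hφ : Continuous φ) {x : E3} (hx : x ∈ Ω) :
    ‖∫ y, (∫ z, (φ y - φ z) * kern x z ∂surfaceMeasure Ω) • kernDeriv x y ∂surfaceMeasure Ω‖ₑ ≤
      ENNReal.ofReal (6 * (bdist Ω x)⁻¹) * ∫⁻ y, (∫⁻ z, ‖φ y - φ z‖ₑ * ekern x z
        ∂surfaceMeasure Ω) * ekern x y ∂surfaceMeasure Ω := by
  have hfin := isFiniteMeasure_surfaceMeasure hΩ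
  have hd := bdist_pos hΩ hx
  have hk := measurable_ekern_right x
  have hAm : Measurable fun y => ∫⁻ z, ‖φ y - φ z‖ₑ * ekern x z ∂surfaceMeasure Ω :=
    Measurable.lintegral_prod_right' (f := fun p : E3 × E3 => ‖φ p.1 - φ p.2‖ₑ * ekern x p.2)
      ((measurable_enorm_sub hφ).mul (hk.comp measurable_snd))
  refine (enorm_integral_le_lintegral_enorm _).trans ?_
  have hAk : Measurable fun y => (∫⁻ z, ‖φ y - φ z‖ₑ * ekern x z ∂surfaceMeasure Ω) * ekern x y :=
    hAm.mul hk
  rw [← lintegral_const_mul _ hAk]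
  refine lintegral_mono_ae ?_
  filter_upwards [ae_mem_frontier Ω] with y hy
  rw [enorm_smul, mul_left_comm]
  refine mul_le_mul' ((enorm_integral_le_lintegral_enorm _).trans_eq ?_) ?_
  · refine lintegral_congr fun z => ?_
    rw [enorm_mul, Real.enorm_of_nonneg (kern_nonneg x z), ekern]
  · rw [← ofReal_norm, ekern, ← ENNReal.ofReal_mul (by positivity)]
    exact ENNReal.ofReal_le_ofReal (norm_kernDeriv_le' hd (bdist_le hy))

/-- Cauchy–Schwarz is applied twice with respect to weights of total mass `S`, once in `y` and once
in `z`. -/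
theorem sq_lintegral_ekern_le {σ : Measure E3} [SFinite σ] {φ : E3 → ℝ} (hφ : Continuous φ)
    (x : E3) (S : ℝ≥0∞) (hS : ∫⁻ y, ekern x y ∂σ = S) :
    (∫⁻ y, (∫⁻ z, ‖φ y - φ z‖ₑ * ekern x z ∂σ) * ekern x y ∂σ) ^ 2 ≤ S ^ 2 *
      ∫⁻ y, ∫⁻ z, ‖φ y - φ z‖ₑ ^ 2 * (ekern x y * ekern x z) ∂σ ∂σ := by
  have hm := measurable_enorm_sub hφ
  have hk := measurable_ekern_right x
  have hAm : Measurable fun y => ∫⁻ z, ‖φ y - φ z‖ₑ * ekern x z ∂σ :=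
    Measurable.lintegral_prod_right' (f := fun p : E3 × E3 => ‖φ p.1 - φ p.2‖ₑ * ekern x p.2)
      (hm.mul (hk.comp measurable_snd))
  have hmy : ∀ y, Measurable fun z => ‖φ y - φ z‖ₑ := fun y => hm.comp measurable_prodMk_left
  have h1 := sq_lintegral_mul_le (μ := σ) hAm.aemeasurable hk.aemeasurable
  rw [hS] at h1
  have h2 : ∀ y, (∫⁻ z, ‖φ y - φ z‖ₑ * ekern x z ∂σ) ^ 2 * ekern x y ≤
      S * ∫⁻ z, ‖φ y - φ z‖ₑ ^ 2 * (ekern x y * ekern x z) ∂σ := fun y => by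
    have h3 := sq_lintegral_mul_le (μ := σ) (hmy y).aemeasurable hk.aemeasurable
    rw [hS] at h3
    refine (mul_le_mul_left h3 _).trans_eq ?_
    have h4 : Measurable fun z => ‖φ y - φ z‖ₑ ^ 2 * ekern x z := ((hmy y).pow_const 2).mul hk
    rw [mul_comm _ S, mul_assoc, ← lintegral_mul_const _ h4]
    congr 1
    refine lintegral_congr fun z => ?_
    ring
  refine h1.trans ((mul_le_mul_left (lintegral_mono h2) _).trans_eq ?_)
  rw [lintegral_const_mul]
  · ring
  · refine Measurable.lintegral_prod_right' (f := fun p : E3 × E3 =>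
      ‖φ p.1 - φ p.2‖ₑ ^ 2 * (ekern x p.1 * ekern x p.2)) ?_
    exact (hm.pow_const 2).mul ((hk.comp measurable_fst).mul (hk.comp measurable_snd))

theorem enorm_kernMass_smul_sub_le (hΩ : IsBoundedC11Domain Ω) {φ : E3 → ℝ} (hφ : Continuous φ)
    {x : E3} (hx : x ∈ Ω) :
    ‖kernMass Ω x • kernIntDeriv Ω φ x - kernInt Ω φ x • kernIntDeriv Ω (fun _ => 1) x‖ₑ ^ 2 ≤
      ENNReal.ofReal (6 * (bdist Ω x)⁻¹ * kernMass Ω x) ^ 2 *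
      ∫⁻ y, ∫⁻ z, ‖φ y - φ z‖ₑ ^ 2 * (ekern x y * ekern x z) ∂surfaceMeasure Ω
        ∂surfaceMeasure Ω := by
  have hfin := isFiniteMeasure_surfaceMeasure hΩ
  have hd := bdist_pos hΩ hx
  rw [kernMass_smul_sub hΩ hφ hx, ENNReal.ofReal_mul (by positivity), mul_pow, mul_assoc]
  refine (pow_le_pow_left' (enorm_kernMass_smul_sub_le_lintegral hΩ hφ hx) 2).trans ?_
  rw [mul_pow]
  exact mul_le_mul_right (sq_lintegral_ekern_le hφ x _ (lintegral_ekern hΩ hx)) _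

/-- Differentiating the kernel costs `6 / d`. With `S` the total weight, the prefactor is thus `36
d⁻² S⁻²`, and `S ≥ c d⁻⁴` makes it `36 c⁻² d⁶`. -/
theorem exists_enorm_bdryExtDeriv_le (hΩ : IsBoundedC11Domain Ω) : ∃ C : ℝ, 0 ≤ C ∧
    ∀ φ : E3 → ℝ, Continuous φ → ∀ x ∈ Ω, ‖bdryExtDeriv Ω φ x‖ₑ ^ 2 ≤
      ENNReal.ofReal (C * bdist Ω x ^ 6) *
      ∫⁻ y, ∫⁻ z, ‖φ y - φ z‖ₑ ^ 2 * (ekern x y * ekern x z) ∂surfaceMeasure Ω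
        ∂surfaceMeasure Ω := by
  obtain ⟨c, hc, hcS⟩ := exists_kernMass_ge hΩ
  refine ⟨36 * c⁻¹ ^ 2, by positivity, fun φ hφ x hx => ?_⟩
  have hd := bdist_pos hΩ hx
  have hS := kernMass_pos hΩ hx
  rw [bdryExtDeriv, enorm_smul, mul_pow]
  refine (mul_le_mul_right (enorm_kernMass_smul_sub_le hΩ hφ hx) _).trans ?_
  rw [← mul_assoc]
  gcongr
  rw [Real.enorm_of_nonneg (by positivity), ← mul_pow, ← ENNReal.ofReal_mul (by positivity),
    ← ENNReal.ofReal_pow (by positivity)]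
  refine ENNReal.ofReal_le_ofReal ?_
  have h1 : (kernMass Ω x)⁻¹ ≤ c⁻¹ * bdist Ω x ^ 4 := by
    refine (inv_anti₀ (by positivity) (hcS x hx)).trans_eq ?_
    field_simp
  calc ((kernMass Ω x ^ 2)⁻¹ * (6 * (bdist Ω x)⁻¹ * kernMass Ω x)) ^ 2
      = 36 * (bdist Ω x)⁻¹ ^ 2 * (kernMass Ω x)⁻¹ ^ 2 := by field_simp; norm_num
    _ ≤ 36 * (bdist Ω x)⁻¹ ^ 2 * (c⁻¹ * bdist Ω x ^ 4) ^ 2 := by gcongr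
    _ = 36 * c⁻¹ ^ 2 * bdist Ω x ^ 6 := by field_simp

theorem lintegral_one_add_norm_smul_sub (y : E3) {r : ℝ} (hr : 0 < r) :
    ∫⁻ x : E3, ENNReal.ofReal ((1 + ‖r • (x - y)‖) ^ (-6 : ℝ)) =
      ENNReal.ofReal (r⁻¹ ^ 3) * ∫⁻ x : E3, ENNReal.ofReal ((1 + ‖x‖) ^ (-6 : ℝ)) := by
  rw [lintegral_sub_right_eq_self (fun x : E3 => ENNReal.ofReal ((1 + ‖r • x‖) ^ (-6 : ℝ))) y]
  have h1 : ∫⁻ x : E3, ENNReal.ofReal ((1 + ‖r • x‖) ^ (-6 : ℝ)) =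
      ∫⁻ x : E3, ENNReal.ofReal ((1 + ‖x‖) ^ (-6 : ℝ)) ∂(Measure.map (r • ·) volume) := by
    rw [lintegral_map (by fun_prop) (by fun_prop)]
  rw [h1, Measure.map_addHaar_smul _ hr.ne', lintegral_smul_measure, smul_eq_mul]
  congr 2
  rw [finrank_euclideanSpace_fin, abs_of_pos (by positivity), inv_pow]

/-- With `a`, `b` the distances from `x` to `y` and `z`, the bounds `d ≤ min a b` and `r ≤ a + b`
give `d (r + 2 a) ≤ 4 a b`. The sixth power of this turns the product of the kernels into an
integrable function of `(x - y) / r`. -/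
theorem bdist_pow_mul_ekern_le (hΩ : IsBoundedC11Domain Ω) {x y z : E3} (hx : x ∈ Ω)
    (hy : y ∈ frontier Ω) (hz : z ∈ frontier Ω) (hyz : y ≠ z) :
    ENNReal.ofReal (bdist Ω x ^ 6) * (ekern x y * ekern x z) ≤
      ENNReal.ofReal ((4 * (dist y z)⁻¹) ^ 6) *
        ENNReal.ofReal ((1 + ‖(2 * (dist y z)⁻¹) • (x - y)‖) ^ (-6 : ℝ)) := by
  have hd := bdist_pos hΩ hx
  have hdy := bdist_le (x := x) hy
  have hdz := bdist_le (x := x) hz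
  have hr := dist_pos.2 hyz
  have hyz' : dist y z ≤ ‖x - y‖ + ‖x - z‖ := by
    rw [← dist_eq_norm, ← dist_eq_norm]; exact dist_triangle_left y z x
  set d := bdist Ω x
  set r := dist y z
  set a := ‖x - y‖ with ha
  set b := ‖x - z‖ with hb
  have ha0 := hd.trans_le hdy
  have hb0 := hd.trans_le hdz
  rw [ekern, ekern, ← ENNReal.ofReal_mul (kern_nonneg _ _), ← ENNReal.ofReal_mul (by positivity),
    ← ENNReal.ofReal_mul (by positivity)]
  refine ENNReal.ofReal_le_ofReal ?_
  rw [kern, kern, ← ha, ← hb, Real.rpow_neg (by positivity), norm_smul, ← ha,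
    Real.norm_of_nonneg (by positivity)]
  rw [show (6 : ℝ) = ((6 : ℕ) : ℝ) by norm_num, Real.rpow_natCast]
  have h1 : d * (a * b)⁻¹ ≤ 4 * r⁻¹ * (1 + 2 * r⁻¹ * a)⁻¹ := by
    have h2 : 4 * r⁻¹ * (1 + 2 * r⁻¹ * a)⁻¹ = 4 / (r + 2 * a) := by field_simp
    rw [h2, ← div_eq_mul_inv, div_le_div_iff₀ (by positivity) (by positivity)]
    rcases le_total a b with h | h
    · nlinarith
    · nlinarith
  calc d ^ 6 * ((a ^ 2)⁻¹ ^ 3 * (b ^ 2)⁻¹ ^ 3) = (d * (a * b)⁻¹) ^ 6 := by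
        field_simp
    _ ≤ (4 * r⁻¹ * (1 + 2 * r⁻¹ * a)⁻¹) ^ 6 := by gcongr
    _ = _ := by rw [mul_pow, inv_pow (1 + _)]

/-- Rescaling by `r / 2` about `y` gives `4⁶ r⁻⁶ (r / 2)³ = 512 r⁻³`, which is exactly the kernel of
the `W^{1/2,2}` seminorm. -/
theorem exists_lintegral_bdist_pow_mul_ekern_le (hΩ : IsBoundedC11Domain Ω) : ∃ C : ℝ≥0,
    ∀ y ∈ frontier Ω, ∀ z ∈ frontier Ω, y ≠ z →
      ∫⁻ x in Ω, ENNReal.ofReal (bdist Ω x ^ 6) * (ekern x y * ekern x z) ≤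
        C * ENNReal.ofReal ((dist y z ^ 3)⁻¹) := by
  have hI := finite_integral_one_add_norm (E := E3) (μ := volume) (r := 6) (by norm_num)
  set I := ∫⁻ x : E3, ENNReal.ofReal ((1 + ‖x‖) ^ (-6 : ℝ)) with hIdef
  refine ⟨512 * I.toNNReal, fun y hy z hz hyz => ?_⟩
  have hr := dist_pos.2 hyz
  calc _ ≤ ∫⁻ x in Ω, ENNReal.ofReal ((4 * (dist y z)⁻¹) ^ 6) *
        ENNReal.ofReal ((1 + ‖(2 * (dist y z)⁻¹) • (x - y)‖) ^ (-6 : ℝ)) :=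
        setLIntegral_mono' hΩ.isOpen.measurableSet fun x hx =>
          bdist_pow_mul_ekern_le hΩ hx hy hz hyz
    _ ≤ ∫⁻ x, ENNReal.ofReal ((4 * (dist y z)⁻¹) ^ 6) *
        ENNReal.ofReal ((1 + ‖(2 * (dist y z)⁻¹) • (x - y)‖) ^ (-6 : ℝ)) :=
        setLIntegral_le_lintegral _ _
    _ = ENNReal.ofReal ((4 * (dist y z)⁻¹) ^ 6) *
        (ENNReal.ofReal ((2 * (dist y z)⁻¹)⁻¹ ^ 3) * I) := by
        rw [lintegral_const_mul' _ _ ENNReal.ofReal_ne_top,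
          lintegral_one_add_norm_smul_sub y (by positivity)]
    _ = _ := by
        rw [← mul_assoc, ← ENNReal.ofReal_mul (by positivity), ENNReal.coe_mul,
          ENNReal.coe_toNNReal hI.ne, mul_right_comm]
        congr 1
        rw [show ((512 : ℝ≥0) : ℝ≥0∞) = ENNReal.ofReal 512 by simp,
          ← ENNReal.ofReal_mul (by norm_num)]
        congr 1
        field_simp
        norm_num

theorem measurable_ekern_comp {α : Type*} [MeasurableSpace α] {f g : α → E3} (hf : Measurable f)
    (hg : Measurable g) : Measurable fun a => ekern (f a) (g a) := by
  have h : Measurable ((fun p : E3 × E3 => ekern p.1 p.2) ∘ fun a => (f a, g a)) :=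
    measurable_ekern.comp (hf.prodMk hg)
  exact h

theorem measurable_bdist_mul_ekern {φ : E3 → ℝ} (hφ : Continuous φ) :
    Measurable fun q : E3 × E3 × E3 =>
      ENNReal.ofReal (bdist Ω q.1 ^ 6) * (‖φ q.2.1 - φ q.2.2‖ₑ ^ 2 *
        (ekern q.1 q.2.1 * ekern q.1 q.2.2)) := by
  have hφ := hφ.measurable
  have e1 := measurable_ekern_comp (α := E3 × E3 × E3) measurable_fst measurable_snd.fst
  have e2 := measurable_ekern_comp (α := E3 × E3 × E3) measurable_fst measurable_snd.snd
  have e3 : Measurable fun q : E3 × E3 × E3 => ‖φ q.2.1 - φ q.2.2‖ₑ :=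
    measurable_enorm.comp ((hφ.comp measurable_snd.fst).sub (hφ.comp measurable_snd.snd))
  have e4 : Measurable fun q : E3 × E3 × E3 => ENNReal.ofReal (bdist Ω q.1 ^ 6) :=
    ENNReal.measurable_ofReal.comp ((continuous_bdist.measurable.comp measurable_fst).pow_const 6)
  exact e4.mul ((e3.pow_const 2).mul (e1.mul e2))

/-- After exchanging the integrals, the integration over `Ω` comes first and replaces the two
kernels by `|y - z|⁻³`. This is the energy estimate of the extension theorem. -/
theorem exists_lintegral_bdryExtDeriv_le (hΩ : IsBoundedC11Domain Ω) : ∃ C : ℝ≥0,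
    ∀ φ : E3 → ℝ, Continuous φ → ∫⁻ x in Ω, ‖bdryExtDeriv Ω φ x‖ₑ ^ 2 ≤
      C * ∫⁻ p, ‖diffQuot φ p‖ₑ ^ 2 ∂(surfaceMeasure Ω).prod (surfaceMeasure Ω) := by
  have hfin := isFiniteMeasure_surfaceMeasure hΩ
  obtain ⟨C₁, hC₁, h1⟩ := exists_enorm_bdryExtDeriv_le hΩ
  obtain ⟨C₂, h2⟩ := exists_lintegral_bdist_pow_mul_ekern_le hΩ
  refine ⟨C₁.toNNReal * C₂, fun φ hφ => ?_⟩
  have hm := measurable_enorm_sub hφ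
  have hG := measurable_bdist_mul_ekern (Ω := Ω) hφ
  have step1 : ∀ x ∈ Ω, ‖bdryExtDeriv Ω φ x‖ₑ ^ 2 ≤ ENNReal.ofReal C₁ *
      ∫⁻ p, ENNReal.ofReal (bdist Ω x ^ 6) * (‖φ p.1 - φ p.2‖ₑ ^ 2 *
        (ekern x p.1 * ekern x p.2)) ∂(surfaceMeasure Ω).prod (surfaceMeasure Ω) := by
    intro x hx
    refine (h1 φ hφ x hx).trans_eq ?_
    have hd := bdist_pos hΩ hx
    rw [ENNReal.ofReal_mul hC₁, mul_assoc, lintegral_const_mul' _ _ ENNReal.ofReal_ne_top,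
      lintegral_prod]
    have hk := measurable_ekern_right x
    exact ((hm.pow_const 2).mul ((hk.comp measurable_fst).mul
      (hk.comp measurable_snd))).aemeasurable
  calc _ ≤ ∫⁻ x in Ω, ENNReal.ofReal C₁ *
      ∫⁻ p, ENNReal.ofReal (bdist Ω x ^ 6) * (‖φ p.1 - φ p.2‖ₑ ^ 2 *
        (ekern x p.1 * ekern x p.2)) ∂(surfaceMeasure Ω).prod (surfaceMeasure Ω) :=
        setLIntegral_mono' hΩ.isOpen.measurableSet step1
    _ = ENNReal.ofReal C₁ * ∫⁻ p, (∫⁻ x in Ω, ENNReal.ofReal (bdist Ω x ^ 6) *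
        (‖φ p.1 - φ p.2‖ₑ ^ 2 * (ekern x p.1 * ekern x p.2)))
          ∂(surfaceMeasure Ω).prod (surfaceMeasure Ω) := by
        rw [lintegral_const_mul' _ _ ENNReal.ofReal_ne_top, lintegral_lintegral_swap]
        exact hG.aemeasurable
    _ ≤ ENNReal.ofReal C₁ * ∫⁻ p, C₂ * ‖diffQuot φ p‖ₑ ^ 2
          ∂(surfaceMeasure Ω).prod (surfaceMeasure Ω) := by
        refine mul_le_mul_right (lintegral_mono_ae ?_) _
        filter_upwards [Measure.quasiMeasurePreserving_fst.ae (ae_mem_frontier Ω),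
          Measure.quasiMeasurePreserving_snd.ae (ae_mem_frontier Ω)] with p hp1 hp2
        rcases eq_or_ne p.1 p.2 with h | h
        · simp [h]
        · have h3 : ∀ x, ENNReal.ofReal (bdist Ω x ^ 6) *
              (‖φ p.1 - φ p.2‖ₑ ^ 2 * (ekern x p.1 * ekern x p.2)) = ‖φ p.1 - φ p.2‖ₑ ^ 2 *
              (ENNReal.ofReal (bdist Ω x ^ 6) * (ekern x p.1 * ekern x p.2)) :=
            fun x => mul_left_comm _ _ _
          simp_rw [h3]
          rw [lintegral_const_mul' _ _ (by finiteness)]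
          refine (mul_le_mul_right (h2 _ hp1 _ hp2 h) _).trans_eq ?_
          rw [enorm_sq_eq, enorm_sq_eq, diffQuot_sq, mul_left_comm,
            ← ENNReal.ofReal_mul (sq_nonneg _), div_eq_mul_inv]
    _ = _ := by
        rw [lintegral_const_mul' _ _ ENNReal.coe_ne_top, ← mul_assoc, ENNReal.coe_mul]
        rfl

/-- The Lipschitz bound turns `|x - y|⁻⁶` into `|x - y|⁻⁵`, whose integral is of order `d⁻³`;
division by the total weight, at least `c d⁻⁴`, leaves order `d`. -/
theorem exists_abs_sub_bdryExt_le (hΩ : IsBoundedC11Domain Ω) : ∃ C : ℝ≥0,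
    ∀ (φ : E3 → ℝ) (K : ℝ≥0), LipschitzWith K φ → ∀ x ∈ Ω,
      |φ x - bdryExt Ω φ x| ≤ K * C * bdist Ω x := by
  have hfin := isFiniteMeasure_surfaceMeasure hΩ
  obtain ⟨c, hc, hcS⟩ := exists_kernMass_ge hΩ
  obtain ⟨C, hC⟩ := lintegral_inv_dist_pow_five_le hΩ
  refine ⟨C * c⁻¹.toNNReal, fun φ K hφ x hx => ?_⟩
  have hd := bdist_pos hΩ hx
  have hS := kernMass_pos hΩ hx
  have hi := integrable_kern hΩ (continuous_const (y := (1 : ℝ))) hx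
  simp only [one_mul] at hi
  have h1 : φ x - bdryExt Ω φ x =
      (∫ y, (φ x - φ y) * kern x y ∂surfaceMeasure Ω) / kernMass Ω x := by
    simp_rw [sub_mul]
    rw [integral_sub (hi.const_mul _) (integrable_kern hΩ hφ.continuous hx), integral_const_mul,
      ← kernMass_eq, bdryExt, kernInt]
    field_simp
  have h2 : |∫ y, (φ x - φ y) * kern x y ∂surfaceMeasure Ω| ≤ K * C * (bdist Ω x)⁻¹ ^ 3 := by
    rw [← Real.norm_eq_abs, ← ENNReal.ofReal_le_ofReal_iff (by positivity), ofReal_norm]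
    calc _ ≤ ∫⁻ y, ‖(φ x - φ y) * kern x y‖ₑ ∂surfaceMeasure Ω :=
          enorm_integral_le_lintegral_enorm _
      _ ≤ ∫⁻ y, K * ENNReal.ofReal ((dist x y)⁻¹ ^ 5) ∂surfaceMeasure Ω := by
          refine lintegral_mono_ae ?_
          filter_upwards [ae_mem_frontier Ω] with y hy
          have h3 : 0 < dist x y := by
            rw [dist_eq_norm]; exact hd.trans_le (bdist_le hy)
          rw [← ofReal_norm, ← ENNReal.ofReal_coe_nnreal,
            ← ENNReal.ofReal_mul (NNReal.coe_nonneg K)]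
          refine ENNReal.ofReal_le_ofReal ?_
          rw [norm_mul, ← dist_eq_norm, Real.norm_of_nonneg (kern_nonneg x y), kern,
            ← dist_eq_norm]
          calc dist (φ x) (φ y) * (dist x y ^ 2)⁻¹ ^ 3
              ≤ (K * dist x y) * (dist x y ^ 2)⁻¹ ^ 3 := by gcongr; exact hφ.dist_le_mul x y
            _ = _ := by field_simp
      _ ≤ K * (C * ENNReal.ofReal ((bdist Ω x)⁻¹ ^ 3)) := by
          rw [lintegral_const_mul' _ _ ENNReal.coe_ne_top]
          refine mul_le_mul_right (hC x _ hd fun y hy => ?_) _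
          rw [dist_eq_norm]; exact bdist_le hy
      _ = _ := by
          rw [ENNReal.ofReal_mul (by positivity), ENNReal.ofReal_mul (NNReal.coe_nonneg K),
            ENNReal.ofReal_coe_nnreal, ENNReal.ofReal_coe_nnreal, mul_assoc]
  rw [h1, abs_div, abs_of_pos hS, div_le_iff₀ hS]
  refine h2.trans ?_
  rw [NNReal.coe_mul, Real.coe_toNNReal _ (by positivity)]
  calc K * C * (bdist Ω x)⁻¹ ^ 3 = K * (C * c⁻¹) * bdist Ω x * (c * (bdist Ω x)⁻¹ ^ 4) := by
        field_simp
    _ ≤ _ := by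
      have := hcS x hx
      gcongr

theorem norm_kernIntDeriv_one_le (hΩ : IsBoundedC11Domain Ω) {x : E3} (hx : x ∈ Ω) :
    ‖kernIntDeriv Ω (fun _ => 1) x‖ ≤ 6 * (bdist Ω x)⁻¹ * kernMass Ω x := by
  have hi := integrable_kern hΩ (continuous_const (y := (1 : ℝ))) hx
  simp only [one_mul] at hi
  rw [kernMass_eq, ← integral_const_mul, kernIntDeriv]
  refine norm_integral_le_of_norm_le (hi.const_mul _) ?_
  filter_upwards [ae_mem_frontier Ω] with y hy
  rw [one_smul]
  exact norm_kernDeriv_le' (bdist_pos hΩ hx) (bdist_le hy)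

/-- A cut-off function that vanishes near the boundary. -/
def bdryCutoff (Ω : Set E3) (n : ℕ) (x : E3) : ℝ :=
  Real.smoothTransition (2 - kernMass Ω x / n)

theorem exists_deriv_smoothTransition_le : ∃ M : ℝ, 0 ≤ M ∧
    (∀ s ≤ 2, |deriv Real.smoothTransition s| ≤ M) ∧
    ∀ s < 0, deriv Real.smoothTransition s = 0 := by
  have h0 : ∀ s < 0, deriv Real.smoothTransition s = 0 := fun s hs => by
    have : Real.smoothTransition =ᶠ[𝓝 s] fun _ => 0 := by
      filter_upwards [Iio_mem_nhds hs] with t ht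
      exact Real.smoothTransition.zero_of_nonpos (le_of_lt ht)
    rw [this.deriv_eq, deriv_const]
  have hc : Continuous (deriv Real.smoothTransition) :=
    (Real.smoothTransition.contDiff (n := 1)).continuous_deriv le_rfl
  obtain ⟨M, hM⟩ := (isCompact_Icc (a := (0 : ℝ)) (b := 2)).exists_bound_of_continuousOn
    hc.continuousOn
  have hM0 : 0 ≤ M := (norm_nonneg _).trans (hM 0 (by norm_num))
  refine ⟨M, hM0, fun s hs => ?_, h0⟩
  rcases lt_or_ge s 0 with h | h
  · rw [h0 s h, abs_zero]; exact hM0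
  · exact hM s ⟨h, hs⟩

theorem contDiffOn_bdryCutoff (hΩ : IsBoundedC11Domain Ω) (n : ℕ) :
    ContDiffOn ℝ 1 (bdryCutoff Ω n) Ω :=
  (Real.smoothTransition.contDiff (n := 1)).comp_contDiffOn
    (contDiffOn_const.sub ((contDiffOn_kernInt hΩ continuous_const).div_const _))

/-- The derivative of the transition function vanishes unless `kernMass Ω x ≤ 2 n`. There the factor
`n⁻¹` compensates the growth of the total weight, whose derivative is at most `6 / d` times itself.
The bound is therefore uniform in `n`. -/
theorem exists_norm_fderiv_bdryCutoff_le (hΩ : IsBoundedC11Domain Ω) : ∃ M : ℝ, 0 ≤ M ∧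
    ∀ n : ℕ, n ≠ 0 → ∀ x ∈ Ω, ‖fderiv ℝ (bdryCutoff Ω n) x‖ ≤ M * (bdist Ω x)⁻¹ := by
  obtain ⟨M, hM, h1, h2⟩ := exists_deriv_smoothTransition_le
  refine ⟨M * 12, by positivity, fun n hn x hx => ?_⟩
  have hn' : (0 : ℝ) < n := by positivity
  have hd := bdist_pos hΩ hx
  have hS := kernMass_pos hΩ hx
  have h3 : HasFDerivAt (kernMass Ω) (kernIntDeriv Ω (fun _ => 1) x) x :=
    hasFDerivAt_kernInt hΩ (continuous_const (y := (1 : ℝ))) hx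
  have h4 : HasFDerivAt (fun x => 2 - kernMass Ω x / n)
      (-((n : ℝ)⁻¹ • kernIntDeriv Ω (fun _ => 1) x)) x := by
    simpa [div_eq_inv_mul] using (h3.const_mul ((n : ℝ)⁻¹)).const_sub 2
  have h5 : HasFDerivAt (bdryCutoff Ω n) _ x :=
    ((Real.smoothTransition.contDiff (n := 1)).differentiable one_ne_zero
      (2 - kernMass Ω x / n)).hasDerivAt.comp_hasFDerivAt x h4
  rw [h5.fderiv, norm_smul, norm_neg, norm_smul, Real.norm_eq_abs, norm_inv,
    Real.norm_of_nonneg hn'.le]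
  rcases lt_or_ge (2 - kernMass Ω x / n) 0 with h | h
  · rw [h2 _ h]; simp; positivity
  · have h6 : kernMass Ω x / n ≤ 2 := by linarith
    calc |deriv Real.smoothTransition (2 - kernMass Ω x / n)| *
          ((n : ℝ)⁻¹ * ‖kernIntDeriv Ω (fun _ => 1) x‖)
        ≤ M * ((n : ℝ)⁻¹ * (6 * (bdist Ω x)⁻¹ * kernMass Ω x)) := by
          gcongr
          · exact h1 _ (by have : 0 ≤ kernMass Ω x / n := by positivity
                           linarith)
          · exact norm_kernIntDeriv_one_le hΩ hx
      _ = M * 6 * (bdist Ω x)⁻¹ * (kernMass Ω x / n) := by ring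
      _ ≤ M * 6 * (bdist Ω x)⁻¹ * 2 := by gcongr
      _ = _ := by ring

/-- The difference of `φ` and the extension of its boundary values, cut off near the boundary. -/
def bdryDefect (Ω : Set E3) (φ : E3 → ℝ) (n : ℕ) : E3 → ℝ :=
  indicator Ω fun x => (φ x - bdryExt Ω φ x) * bdryCutoff Ω n x

/-- Where the function is non-zero the total weight is below `2 n`, which keeps the distance to the
boundary away from zero. This condition is closed and fails on the boundary. -/
theorem tsupport_bdryDefect_subset (hΩ : IsBoundedC11Domain Ω) (φ : E3 → ℝ) {n : ℕ} (hn : n ≠ 0) :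
    tsupport (bdryDefect Ω φ n) ⊆ Ω := by
  obtain ⟨c, hc, hcS⟩ := exists_kernMass_ge hΩ
  have hn' : (0 : ℝ) < n := by positivity
  have h1 : tsupport (bdryDefect Ω φ n) ⊆ closure Ω ∩ {x | c ≤ 2 * n * bdist Ω x ^ 4} := by
    refine closure_minimal (fun x hx => ?_) (isClosed_closure.inter
      (isClosed_le continuous_const (continuous_const.mul (continuous_bdist.pow 4))))
    have hxΩ : x ∈ Ω := by
      by_contra h
      exact hx (by simp [bdryDefect, h])
    refine ⟨subset_closure hxΩ, ?_⟩
    have hd := bdist_pos hΩ hxΩ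
    have h2 : kernMass Ω x < 2 * n := by
      by_contra! h
      refine hx ?_
      rw [bdryDefect, indicator_of_mem hxΩ, bdryCutoff, Real.smoothTransition.zero_of_nonpos,
        mul_zero]
      rw [sub_nonpos, le_div_iff₀ hn']; exact h
    have h3 := (hcS x hxΩ).trans h2.le
    rw [inv_pow, ← div_eq_mul_inv, div_le_iff₀ (by positivity)] at h3
    exact h3
  intro x hx
  obtain ⟨hx1, hx2⟩ := h1 hx
  by_contra h
  have hf : x ∈ frontier Ω := by rw [hΩ.isOpen.frontier_eq]; exact ⟨hx1, h⟩
  have : bdist Ω x = 0 := infDist_zero_of_mem hf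
  simp [this] at hx2
  linarith

theorem contDiff_bdryDefect (hΩ : IsBoundedC11Domain Ω) {φ : E3 → ℝ} (hφ : ContDiff ℝ 1 φ) {n : ℕ}
    (hn : n ≠ 0) : ContDiff ℝ 1 (bdryDefect Ω φ n) := by
  refine contDiff_iff_contDiffAt.2 fun x => ?_
  by_cases hx : x ∈ tsupport (bdryDefect Ω φ n)
  swap
  · exact contDiffAt_const.congr_of_eventuallyEq (notMem_tsupport_iff_eventuallyEq.1 hx)
  have hxΩ := hΩ.isOpen.mem_nhds (tsupport_bdryDefect_subset hΩ φ hn hx)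
  have h1 : ContDiffOn ℝ 1 (fun x => (φ x - bdryExt Ω φ x) * bdryCutoff Ω n x) Ω :=
    (hφ.contDiffOn.sub (contDiffOn_bdryExt hΩ hφ.continuous)).mul (contDiffOn_bdryCutoff hΩ n)
  refine (h1.contDiffAt hxΩ).congr_of_eventuallyEq ?_
  filter_upwards [hxΩ] with y hy
  exact indicator_of_mem hy _

theorem fderiv_bdryDefect (hΩ : IsBoundedC11Domain Ω) {φ : E3 → ℝ} (hφ : ContDiff ℝ 1 φ) (n : ℕ)
    {x : E3} (hx : x ∈ Ω) : fderiv ℝ (bdryDefect Ω φ n) x =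
      (φ x - bdryExt Ω φ x) • fderiv ℝ (bdryCutoff Ω n) x +
        bdryCutoff Ω n x • (fderiv ℝ φ x - bdryExtDeriv Ω φ x) := by
  have hxΩ := hΩ.isOpen.mem_nhds hx
  have h1 := ((hφ.differentiable one_ne_zero x).hasFDerivAt.sub
    (hasFDerivAt_bdryExt hΩ hφ.continuous hx)).mul
    (((contDiffOn_bdryCutoff hΩ n).contDiffAt hxΩ).differentiableAt one_ne_zero).hasFDerivAt
  refine (h1.congr_of_eventuallyEq ?_).fderiv
  filter_upwards [hxΩ] with y hy
  exact indicator_of_mem hy _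

theorem eventually_fderiv_bdryDefect_eq (hΩ : IsBoundedC11Domain Ω) {φ : E3 → ℝ}
    (hφ : ContDiff ℝ 1 φ) {x : E3} (hx : x ∈ Ω) : ∀ᶠ n : ℕ in atTop,
      fderiv ℝ (bdryDefect Ω φ n) x = fderiv ℝ φ x - bdryExtDeriv Ω φ x := by
  have hxΩ := hΩ.isOpen.mem_nhds hx
  have hS := kernMass_pos hΩ hx
  filter_upwards [eventually_gt_atTop ⌈kernMass Ω x⌉₊] with n hn
  have hn1 := Nat.lt_of_ceil_lt hn
  have hn' := hS.trans hn1
  have hc : ContinuousAt (kernMass Ω) x :=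
    (hasFDerivAt_kernInt hΩ (continuous_const (y := (1 : ℝ))) hx).continuousAt
  have h1 := (hφ.differentiable one_ne_zero x).hasFDerivAt.sub
    (hasFDerivAt_bdryExt hΩ hφ.continuous hx)
  refine (h1.congr_of_eventuallyEq ?_).fderiv
  filter_upwards [hxΩ, hc.eventually (gt_mem_nhds hn1)] with y hy hyn
  rw [bdryDefect, indicator_of_mem hy, bdryCutoff, Real.smoothTransition.one_of_one_le, mul_one]
  · rfl
  · have : kernMass Ω y / n ≤ 1 := (div_le_one hn').2 hyn.le
    linarith

theorem exists_lipschitzWith {φ : E3 → ℝ} (hφ : ContDiff ℝ 1 φ) (hc : HasCompactSupport φ) :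
    ∃ K : ℝ≥0, LipschitzWith K φ :=
  hφ.lipschitzWith_of_hasCompactSupport hc one_ne_zero

theorem memLp_bdryExtDeriv (hΩ : IsBoundedC11Domain Ω) {φ : E3 → ℝ} {K : ℝ≥0}
    (hφ : LipschitzWith K φ) : MemLp (bdryExtDeriv Ω φ) 2 (volume.restrict Ω) := by
  refine memLp_two_of_lintegral ?_ ?_
  · have h := (contDiffOn_bdryExt hΩ hφ.continuous).continuousOn_fderiv_of_isOpen hΩ.isOpen le_rfl
    refine (h.congr fun x hx => ?_).aestronglyMeasurable hΩ.isOpen.measurableSet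
    exact (hasFDerivAt_bdryExt hΩ hφ.continuous hx).fderiv.symm
  · obtain ⟨C, hC⟩ := exists_lintegral_bdryExtDeriv_le hΩ
    refine ne_top_of_le_ne_top ?_ (hC φ hφ.continuous)
    rw [← eLpNorm_two_sq]
    have := (memLp_diffQuot hΩ hφ).2
    finiteness

/-- The function `φ` and its averaged extension agree on the boundary. Their difference, cut off
near the boundary, is an admissible test function. Its gradient stays dominated because the
difference is of order `d` and the gradient of the cut-off of order `1 / d`, so `n → ∞` is allowed.
-/
theorem integral_fderiv_eq_integral_bdryExtDeriv (hΩ : IsBoundedC11Domain Ω) {B : L2Field Ω}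
    (hB : B ∈ harmonicFields Ω) {φ : E3 → ℝ} (hφ : ContDiff ℝ 1 φ) (hc : HasCompactSupport φ) :
    ∫ x in Ω, fderiv ℝ φ x (B x) = ∫ x in Ω, bdryExtDeriv Ω φ x (B x) := by
  have hfin := isFiniteMeasure_restrict hΩ.isBounded
  obtain ⟨K, hK⟩ := exists_lipschitzWith hφ hc
  obtain ⟨C, hC⟩ := exists_abs_sub_bdryExt_le hΩ
  obtain ⟨M, hM, hM'⟩ := exists_norm_fderiv_bdryCutoff_le hΩ
  have hBm := Lp.memLp B
  have hD := memLp_bdryExtDeriv hΩ hK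
  have hφ2 : MemLp (fderiv ℝ φ) 2 (volume.restrict Ω) :=
    (hφ.continuous_fderiv one_ne_zero).memLp_of_hasCompactSupport (hc.fderiv ℝ)
  have hap : ∀ {G : E3 → E3 →L[ℝ] ℝ}, AEStronglyMeasurable G (volume.restrict Ω) →
      AEStronglyMeasurable (fun x => G x (B x)) (volume.restrict Ω) := fun {G} hG =>
    isBoundedBilinearMap_apply.continuous.comp_aestronglyMeasurable (hG.prodMk hBm.1)
  have hint : ∀ {G : E3 → E3 →L[ℝ] ℝ}, MemLp G 2 (volume.restrict Ω) →
      Integrable (fun x => G x (B x)) (volume.restrict Ω) := fun {G} hG =>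
    (hG.norm.integrable_mul hBm.norm).mono'
      (hap hG.1) (ae_of_all _ fun x => (G x).le_opNorm (B x))
  have hlim : Tendsto (fun n : ℕ => ∫ x in Ω, fderiv ℝ (bdryDefect Ω φ (n + 1)) x (B x)) atTop
      (𝓝 (∫ x in Ω, (fderiv ℝ φ x - bdryExtDeriv Ω φ x) (B x))) := by
    refine tendsto_integral_of_dominated_convergence
      (fun x => (K * C * M + (‖fderiv ℝ φ x‖ + ‖bdryExtDeriv Ω φ x‖)) * ‖B x‖) (fun n => ?_) ?_
      (fun n => ?_) ?_
    · exact hap ((contDiff_bdryDefect hΩ hφ n.succ_ne_zero).continuous_fderiv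
        one_ne_zero).aestronglyMeasurable
    · exact ((memLp_const (K * C * M)).add (hφ2.norm.add hD.norm)).integrable_mul hBm.norm
    · filter_upwards [ae_restrict_mem hΩ.isOpen.measurableSet] with x hx
      refine (ContinuousLinearMap.le_opNorm _ _).trans ?_
      gcongr
      rw [fderiv_bdryDefect hΩ hφ _ hx]
      have hd := bdist_pos hΩ hx
      refine (norm_add_le _ _).trans (add_le_add ?_ ?_)
      · rw [norm_smul, Real.norm_eq_abs]
        calc _ ≤ (K * C * bdist Ω x) * (M * (bdist Ω x)⁻¹) := by
              gcongr
              · exact hC φ K hK x hx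
              · exact hM' _ n.succ_ne_zero x hx
          _ = _ := by field_simp
      · rw [norm_smul, bdryCutoff, Real.norm_of_nonneg (Real.smoothTransition.nonneg _)]
        calc _ ≤ 1 * ‖fderiv ℝ φ x - bdryExtDeriv Ω φ x‖ := by
              gcongr; exact Real.smoothTransition.le_one _
          _ ≤ _ := by rw [one_mul]; exact norm_sub_le _ _
    · filter_upwards [ae_restrict_mem hΩ.isOpen.measurableSet] with x hx
      refine tendsto_const_nhds.congr' ?_
      filter_upwards [(tendsto_add_atTop_nat 1).eventually
        (eventually_fderiv_bdryDefect_eq hΩ hφ hx)] with n hn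
      rw [hn]
  have h0 : ∀ n : ℕ, ∫ x in Ω, fderiv ℝ (bdryDefect Ω φ (n + 1)) x (B x) = 0 := fun n => by
    have hs := tsupport_bdryDefect_subset hΩ φ n.succ_ne_zero
    have := integral_inner_gradient_eq_zero_of_contDiff hΩ.isOpen hΩ.isBounded hB
      (contDiff_bdryDefect hΩ hφ n.succ_ne_zero)
      (HasCompactSupport.of_support_subset_isCompact hΩ.isBounded.isCompact_closure
        ((subset_tsupport _).trans (hs.trans subset_closure))) hs
    simpa only [inner_gradient_eq] using this
  simp_rw [h0] at hlim
  have h1 := tendsto_nhds_unique hlim tendsto_const_nhds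
  simp only [_root_.sub_apply] at h1
  rw [integral_sub (hint hφ2) (hint hD)] at h1
  linarith

/-! ### Normal traces -/

/-- With `φ` replaced by its averaged extension, Cauchy–Schwarz leaves the energy of the extension,
which the fractional seminorm controls. -/
theorem exists_abs_integral_gradient_le (hΩ : IsBoundedC11Domain Ω) : ∃ C : ℝ, 0 ≤ C ∧
    ∀ B ∈ harmonicFields Ω, ∀ φ : E3 → ℝ, ContDiff ℝ 1 φ → HasCompactSupport φ →
      ∀ w : halfSobolev Ω, IsRestriction Ω φ w →
        |∫ x in Ω, inner ℝ (B x) (gradient φ x)| ≤ C * ‖B‖ * ‖w‖ := by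
  obtain ⟨C, hC⟩ := exists_lintegral_bdryExtDeriv_le hΩ
  refine ⟨√C, by positivity, fun B hB φ hφ hc w hw => ?_⟩
  obtain ⟨K, hK⟩ := exists_lipschitzWith hφ hc
  have hD := memLp_bdryExtDeriv hΩ hK
  simp_rw [inner_gradient_eq]
  rw [integral_fderiv_eq_integral_bdryExtDeriv hΩ hB hφ hc]
  set J := (InnerProductSpace.toDual ℝ E3).symm
  have hJ : MemLp (fun x => J (bdryExtDeriv Ω φ x)) 2 (volume.restrict Ω) :=
    hD.of_le (J.continuous.comp_aestronglyMeasurable hD.1) (ae_of_all _ fun x => (J.norm_map _).le)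
  have h1 := abs_integral_inner_le (Lp.memLp B) hJ
  have h2 : ∀ x, inner ℝ (B x) (J (bdryExtDeriv Ω φ x)) = bdryExtDeriv Ω φ x (B x) := fun x => by
    rw [real_inner_comm]; exact InnerProductSpace.toDual_symm_apply
  simp_rw [h2] at h1
  refine h1.trans ?_
  rw [← Lp.norm_def, mul_assoc, mul_left_comm]
  gcongr
  have h3 : eLpNorm (fun x => J (bdryExtDeriv Ω φ x)) 2 (volume.restrict Ω) =
      eLpNorm (bdryExtDeriv Ω φ) 2 (volume.restrict Ω) :=
    eLpNorm_congr_norm_ae (ae_of_all _ fun x => J.norm_map _)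
  have h4 := hC φ hφ.continuous
  rw [← eLpNorm_two_sq, ← eLpNorm_two_sq] at h4
  -- The seminorm of `φ` is the norm of the second component of `w`, because that component is
  -- determined by the first.
  have h5 : eLpNorm (diffQuot φ) 2 ((surfaceMeasure Ω).prod (surfaceMeasure Ω)) =
      ENNReal.ofReal ‖(w : SurfacePairs Ω).snd‖ := by
    rw [Lp.norm_def, ENNReal.ofReal_toReal (Lp.memLp _).2.ne]
    exact eLpNorm_congr_ae ((diffQuot_congr_ae hΩ hw).symm.trans
      (halfSobolev_snd hΩ w.2).symm)
  rw [h3]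
  rw [h5] at h4
  refine abs_le_of_sq_le_sq' ?_ (by positivity) |>.2
  have h6 : ‖(w : SurfacePairs Ω).snd‖ ^ 2 ≤ ‖w‖ ^ 2 := by
    have := halfSobolev_norm_sq (w : SurfacePairs Ω)
    rw [Submodule.coe_norm] at *
    nlinarith [sq_nonneg ‖(w : SurfacePairs Ω).fst‖]
  have h7 := ENNReal.toReal_mono (by finiteness) h4
  rw [ENNReal.toReal_pow, ENNReal.toReal_mul, ENNReal.toReal_pow,
    ENNReal.toReal_ofReal (norm_nonneg _), ENNReal.coe_toReal] at h7
  rw [mul_pow, Real.sq_sqrt (NNReal.coe_nonneg C)]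
  refine h7.trans ?_
  gcongr

/-- A weak divergence is unique, so the function `d` in the definition vanishes and the last term of
Green's formula drops out. -/
theorem isNormalTrace_iff (hΩ : IsBoundedC11Domain Ω) {B : L2Field Ω} (hB : B ∈ harmonicFields Ω)
    {T : negHalfSobolev Ω} : IsNormalTrace Ω B T ↔
      ∀ φ : E3 → ℝ, ContDiff ℝ 1 φ → HasCompactSupport φ → ∀ w : halfSobolev Ω,
        IsRestriction Ω φ w → T w = ∫ x in Ω, inner ℝ (B x) (gradient φ x) := by
  constructor
  · rintro ⟨d, hd, hT⟩ φ hφ hc w hw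
    rw [hT φ hφ hc w hw]
    have hd0 : d =ᵐ[volume.restrict Ω] fun _ => 0 := by
      have hint : LocallyIntegrableOn d Ω := by
        have := isFiniteMeasure_restrict hΩ.isBounded
        exact IntegrableOn.locallyIntegrableOn ((Lp.memLp d).integrable one_le_two)
      refine (ae_restrict_iff' hΩ.isOpen.measurableSet).2
        (hΩ.isOpen.ae_eq_zero_of_integral_contDiff_smul_eq_zero hint fun χ h1 h2 h3 => ?_)
      have hχ : IsTestFunction Ω χ := ⟨h1, h2, h3⟩
      rw [← setIntegral_eq_integral_of_forall_compl_eq_zero (s := Ω) fun x hx => by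
        rw [image_eq_zero_of_notMem_tsupport fun h => hx (h3 h), zero_smul]]
      simp_rw [smul_eq_mul, mul_comm (χ _)]
      have h1 := hd χ hχ
      rw [hB.1 χ hχ] at h1
      have h4 : ∫ x in Ω, (0 : L2Fun Ω) x * χ x = 0 := by
        rw [← integral_zero E3 ℝ (μ := volume.restrict Ω)]
        refine integral_congr_ae ?_
        filter_upwards [Lp.coeFn_zero ℝ 2 (volume.restrict Ω)] with x hx
        rw [hx, Pi.zero_apply, zero_mul]
      linarith
    refine integral_congr_ae ?_
    filter_upwards [hd0] with x hx
    simp [hx]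
  · intro h
    refine ⟨0, hB.1, fun φ hφ hc w hw => ?_⟩
    rw [h φ hφ hc w hw]
    refine integral_congr_ae ?_
    filter_upwards [Lp.coeFn_zero ℝ 2 (volume.restrict Ω)] with x hx
    rw [hx, Pi.zero_apply, zero_mul, add_zero]

theorem gradient_add' {φ φ' : E3 → ℝ} (hφ : ContDiff ℝ 1 φ) (hφ' : ContDiff ℝ 1 φ') (x : E3) :
    gradient (fun x => φ x + φ' x) x = gradient φ x + gradient φ' x := by
  simp only [gradient]
  rw [fderiv_fun_add (hφ.differentiable one_ne_zero x) (hφ'.differentiable one_ne_zero x), map_add]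

theorem gradient_const_mul' {φ : E3 → ℝ} (hφ : ContDiff ℝ 1 φ) (c : ℝ) (x : E3) :
    gradient (fun x => c * φ x) x = c • gradient φ x := by
  simp only [gradient]
  rw [fderiv_const_mul (hφ.differentiable one_ne_zero x)]
  simp

theorem IsRestriction.add {φ φ' : E3 → ℝ} {w w' : halfSobolev Ω} (h : IsRestriction Ω φ w)
    (h' : IsRestriction Ω φ' w') : IsRestriction Ω (fun x => φ x + φ' x) (w + w') := by
  have h0 := Lp.coeFn_add (w : SurfacePairs Ω).fst (w' : SurfacePairs Ω).fst
  filter_upwards [h, h', h0] with x h1 h2 h3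
  rw [Submodule.coe_add, WithLp.add_fst, h3, Pi.add_apply, h1, h2]

theorem IsRestriction.const_mul {φ : E3 → ℝ} {w : halfSobolev Ω} (h : IsRestriction Ω φ w)
    (c : ℝ) : IsRestriction Ω (fun x => c * φ x) (c • w) := by
  have h0 := Lp.coeFn_smul c (w : SurfacePairs Ω).fst
  filter_upwards [h, h0] with x h1 h3
  rw [Submodule.coe_smul, WithLp.smul_fst, h3, Pi.smul_apply, h1, smul_eq_mul]

/-- A bounded linear relation in `E × ℝ` extends to a continuous linear form. -/
theorem exists_strongDual_of_relation {E : Type*} [NormedAddCommGroup E] [NormedSpace ℝ E]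
    (R : E → ℝ → Prop) {C : ℝ} (hC : 0 ≤ C) (h0 : R 0 0)
    (hadd : ∀ {w w' a b}, R w a → R w' b → R (w + w') (a + b))
    (hsmul : ∀ {w a} (c : ℝ), R w a → R (c • w) (c * a))
    (hle : ∀ {w a}, R w a → |a| ≤ C * ‖w‖) :
    ∃ T : StrongDual ℝ E, (∀ w a, R w a → T w = a) ∧ ‖T‖ ≤ C := by
  -- The relation is single-valued because it relates `0` to the difference of two values of `w`,
  -- and the bound makes that difference zero.
  have huniq : ∀ {w a b}, R w a → R w b → a = b := fun {w a b} h h' => by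
    have h1 := hle (hadd h (hsmul (-1) h'))
    simp only [neg_smul, one_smul, add_neg_cancel, norm_zero, mul_zero] at h1
    have := abs_nonpos_iff.1 h1
    linarith
  let S : Submodule ℝ E :=
    { carrier := {w | ∃ a, R w a}
      zero_mem' := ⟨0, h0⟩
      add_mem' := fun ⟨_, ha⟩ ⟨_, hb⟩ => ⟨_, hadd ha hb⟩
      smul_mem' := fun c _ ⟨_, ha⟩ => ⟨_, hsmul c ha⟩ }
  choose Φ hΦ using fun w : S => w.2
  let f : S →ₗ[ℝ] ℝ :=
    { toFun := Φ
      map_add' := fun w w' => huniq (hΦ _) (hadd (hΦ w) (hΦ w'))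
      map_smul' := fun c w => huniq (hΦ _) (hsmul c (hΦ w)) }
  obtain ⟨T, hT1, hT2⟩ := exists_extension_norm_eq S (f.mkContinuous C fun w => hle (hΦ w))
  refine ⟨T, fun w a h => (hT1 ⟨w, a, h⟩).trans (huniq (hΦ ⟨w, a, h⟩) h), ?_⟩
  rw [hT2]
  exact LinearMap.mkContinuous_norm_le _ hC _

/-- The values prescribed on restrictions form a bounded linear relation. The bound also shows that
they do not depend on the choice of `φ`, and Hahn–Banach extends them without increasing the norm.
-/
theorem exists_isNormalTrace (hΩ : IsBoundedC11Domain Ω) : ∃ C : ℝ, 0 ≤ C ∧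
    ∀ B ∈ harmonicFields Ω, ∃ T, IsNormalTrace Ω B T ∧ ‖T‖ ≤ C * ‖B‖ := by
  obtain ⟨C, hC, hle⟩ := exists_abs_integral_gradient_le hΩ
  refine ⟨C, hC, fun B hB => ?_⟩
  have hint : ∀ {φ : E3 → ℝ}, ContDiff ℝ 1 φ → HasCompactSupport φ →
      Integrable (fun x => inner ℝ (B x) (gradient φ x)) (volume.restrict Ω) := fun h1 h2 =>
    integrableOn_inner_of_continuous hΩ.isBounded B (continuous_gradient h1)
      (hasCompactSupport_gradient h2)
  have hadd : ∀ {φ φ' : E3 → ℝ}, ContDiff ℝ 1 φ → HasCompactSupport φ → ContDiff ℝ 1 φ' →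
      HasCompactSupport φ' → ∫ x in Ω, inner ℝ (B x) (gradient (fun x => φ x + φ' x) x) =
        (∫ x in Ω, inner ℝ (B x) (gradient φ x)) + ∫ x in Ω, inner ℝ (B x) (gradient φ' x) :=
      fun h1 h2 h1' h2' => by
    rw [← integral_add (hint h1 h2) (hint h1' h2')]
    simp_rw [gradient_add' h1 h1', inner_add_right]
  have hmul : ∀ {φ : E3 → ℝ} (c : ℝ), ContDiff ℝ 1 φ → HasCompactSupport φ →
      ∫ x in Ω, inner ℝ (B x) (gradient (fun x => c * φ x) x) =
        c * ∫ x in Ω, inner ℝ (B x) (gradient φ x) := fun c h1 h2 => by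
    rw [← integral_const_mul]
    simp_rw [gradient_const_mul' h1, inner_smul_right]
  obtain ⟨T, hT1, hT2⟩ := exists_strongDual_of_relation (E := halfSobolev Ω) (C := C * ‖B‖)
    (fun w a => ∃ φ : E3 → ℝ, ContDiff ℝ 1 φ ∧ HasCompactSupport φ ∧ IsRestriction Ω φ w ∧
      a = ∫ x in Ω, inner ℝ (B x) (gradient φ x)) (by positivity)
    ⟨fun _ => 0, contDiff_const, HasCompactSupport.zero, Lp.coeFn_zero _ _ _, by
      simp [gradient]⟩
    (by
      rintro w w' _ _ ⟨φ, h1, h2, h3, rfl⟩ ⟨φ', h1', h2', h3', rfl⟩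
      exact ⟨_, h1.add h1', h2.add h2', h3.add h3', (hadd h1 h2 h1' h2').symm⟩)
    (by
      rintro w _ c ⟨φ, h1, h2, h3, rfl⟩
      exact ⟨_, contDiff_const.mul h1, h2.mul_left, h3.const_mul c, (hmul c h1 h2).symm⟩)
    (by
      rintro w _ ⟨φ, h1, h2, h3, rfl⟩
      exact hle B hB φ h1 h2 w h3)
  exact ⟨T, (isNormalTrace_iff hΩ hB).2 fun φ hφ hc w hw => hT1 _ _ ⟨φ, hφ, hc, hw, rfl⟩, hT2⟩

theorem isNormalTrace_unique (hΩ : IsBoundedC11Domain Ω) {B : L2Field Ω}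
    (hB : B ∈ harmonicFields Ω) {T T' : negHalfSobolev Ω} (h : IsNormalTrace Ω B T)
    (h' : IsNormalTrace Ω B T') : T = T' := by
  rw [isNormalTrace_iff hΩ hB] at h h'
  refine negHalfSobolev_ext hΩ fun φ hφ hc w hw => ?_
  rw [h φ hφ hc w hw, h' φ hφ hc w hw]

theorem exists_norm_normalTrace_le (hΩ : IsBoundedC11Domain Ω) : ∃ C : ℝ, 0 ≤ C ∧
    ∀ B ∈ harmonicFields Ω, ∀ T, IsNormalTrace Ω B T → ‖T‖ ≤ C * ‖B‖ := by
  obtain ⟨C, hC, h⟩ := exists_isNormalTrace hΩ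
  refine ⟨C, hC, fun B hB T hT => ?_⟩
  obtain ⟨T', h1, h2⟩ := h B hB
  rwa [isNormalTrace_unique hΩ hB hT h1]

/-! ### The Poincaré inequality -/

section Poincare

variable {E : Type*} [NormedAddCommGroup E] [NormedSpace ℝ E] [MeasurableSpace E] [BorelSpace E]
  [FiniteDimensional ℝ E] [SecondCountableTopology E] {μ : Measure E} [μ.IsAddHaarMeasure]

/-- The increment of a `C¹` function along a segment, squared. -/
theorem enorm_sub_sq_le_lintegral_segment {U : Set E} (hU : IsOpen U) (hc : Convex ℝ U) {f : E → ℝ}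
    (hf : ContDiffOn ℝ 1 f U) {D : ℝ} {x y : E} (hx : x ∈ U) (hy : y ∈ U) (hxy : ‖x - y‖ ≤ D) :
    ‖f x - f y‖ₑ ^ 2 ≤
      ENNReal.ofReal D ^ 2 * ∫⁻ t in Ioc (0 : ℝ) 1, ‖fderiv ℝ f (y + t • (x - y))‖ₑ ^ 2 := by
  have hmem : ∀ t ∈ Icc (0 : ℝ) 1, y + t • (x - y) ∈ U := fun t ht =>
    hc.add_smul_sub_mem hy hx ht
  have hd : ∀ t ∈ uIcc (0 : ℝ) 1, HasDerivAt (fun t : ℝ => f (y + t • (x - y)))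
      (fderiv ℝ f (y + t • (x - y)) (x - y)) t := fun t ht => by
    rw [uIcc_of_le zero_le_one] at ht
    have h1 : HasDerivAt (fun t : ℝ => y + t • (x - y)) (x - y) t := by
      simpa using ((hasDerivAt_id t).smul_const (x - y)).const_add y
    exact ((hf.contDiffAt (hU.mem_nhds (hmem t ht))).differentiableAt
      one_ne_zero).hasFDerivAt.comp_hasDerivAt t h1
  have hcont : ContinuousOn (fun t : ℝ => fderiv ℝ f (y + t • (x - y)) (x - y)) (uIcc 0 1) := by
    rw [uIcc_of_le zero_le_one]
    exact ((hf.continuousOn_fderiv_of_isOpen hU le_rfl).comp (by fun_prop) hmem).clm_apply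
      continuousOn_const
  have h1 := intervalIntegral.integral_eq_sub_of_hasDerivAt hd hcont.intervalIntegrable
  simp only [one_smul, add_sub_cancel, zero_smul, add_zero] at h1
  have hm : Measurable fun t : ℝ => ‖fderiv ℝ f (y + t • (x - y))‖ₑ :=
    (measurable_fderiv ℝ f).enorm.comp (by fun_prop)
  have h2 : ‖f x - f y‖ₑ ≤
      ENNReal.ofReal D * ∫⁻ t in Ioc (0 : ℝ) 1, ‖fderiv ℝ f (y + t • (x - y))‖ₑ := by
    rw [← h1, intervalIntegral.integral_of_le zero_le_one, ← lintegral_const_mul _ hm]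
    refine (enorm_integral_le_lintegral_enorm _).trans (lintegral_mono fun t => ?_)
    rw [mul_comm]
    refine (ContinuousLinearMap.le_opENorm _ _).trans (mul_le_mul_right ?_ _)
    rw [← ofReal_norm]
    exact ENNReal.ofReal_le_ofReal hxy
  have h3 := sq_lintegral_mul_le (μ := (volume : Measure ℝ).restrict (Ioc 0 1)) (k := fun _ => 1)
    hm.aemeasurable aemeasurable_const
  simp only [mul_one, lintegral_const, Measure.restrict_apply_univ, Real.volume_Ioc,
    sub_zero, ENNReal.ofReal_one] at h3
  calc _ ≤ (ENNReal.ofReal D * ∫⁻ t in Ioc (0 : ℝ) 1, ‖fderiv ℝ f (y + t • (x - y))‖ₑ) ^ 2 := by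
        gcongr
    _ ≤ _ := by rw [mul_pow]; exact mul_le_mul_right h3 _

theorem lintegral_smul_add_eq (h : E → ℝ≥0∞) (hh : Measurable h) {t : ℝ} (ht : 0 < t) (c : E) :
    ∫⁻ x, h (t • x + c) ∂μ =
      ENNReal.ofReal (t⁻¹ ^ Module.finrank ℝ E) * ∫⁻ x, h x ∂μ := by
  have h1 : ∫⁻ x, h (t • x + c) ∂μ = ∫⁻ x, h (x + c) ∂(Measure.map (t • ·) μ) := by
    rw [lintegral_map (by fun_prop) (by fun_prop)]
  rw [h1, Measure.map_addHaar_smul _ ht.ne', lintegral_smul_measure, smul_eq_mul,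
    lintegral_add_right_eq_self, abs_of_pos (by positivity), inv_pow]

/-- Convexity keeps the contracted points in `U`, and for `t ≥ 1 / 2` the Jacobian factor is at most
`2` to the dimension. -/
theorem setLIntegral_lineMap_le {U : Set E} (hU : IsOpen U) (hc : Convex ℝ U) {g : E → ℝ≥0∞}
    (hg : Measurable g) {t : ℝ} (ht : 1 / 2 ≤ t) (ht1 : t ≤ 1) {y : E} (hy : y ∈ U) :
    ∫⁻ x in U, g (y + t • (x - y)) ∂μ ≤ 2 ^ Module.finrank ℝ E * ∫⁻ x in U, g x ∂μ := by
  have ht0 : 0 < t := by linarith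
  have hg' : Measurable (U.indicator g) := hg.indicator hU.measurableSet
  calc _ ≤ ∫⁻ x in U, U.indicator g (t • x + (1 - t) • y) ∂μ := by
        refine setLIntegral_mono' hU.measurableSet fun x hx => ?_
        have h1 : y + t • (x - y) = t • x + (1 - t) • y := by module
        rw [← h1, indicator_of_mem (hc.add_smul_sub_mem hy hx ⟨ht0.le, ht1⟩)]
    _ ≤ ∫⁻ x, U.indicator g (t • x + (1 - t) • y) ∂μ := setLIntegral_le_lintegral _ _
    _ ≤ _ := by
        rw [lintegral_smul_add_eq _ hg' ht0, lintegral_indicator hU.measurableSet]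
        refine mul_le_mul_left ?_ _
        rw [← ENNReal.ofReal_ofNat 2, ← ENNReal.ofReal_pow (by norm_num)]
        refine ENNReal.ofReal_le_ofReal ?_
        gcongr
        rw [inv_le_comm₀ ht0 (by norm_num)]
        linarith

/-- If `t < 1 / 2`, exchanging the roles of `x` and `y` replaces `t` by `1 - t`, so the contraction
is never too strong. -/
theorem setLIntegral_setLIntegral_lineMap_le {U : Set E} (hU : IsOpen U) (hc : Convex ℝ U)
    {g : E → ℝ≥0∞} (hg : Measurable g) {t : ℝ} (ht0 : 0 ≤ t) (ht1 : t ≤ 1) :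
    ∫⁻ y in U, ∫⁻ x in U, g (y + t • (x - y)) ∂μ ∂μ ≤
      2 ^ Module.finrank ℝ E * μ U * ∫⁻ x in U, g x ∂μ := by
  have key : ∀ s : ℝ, 1 / 2 ≤ s → s ≤ 1 → ∫⁻ y in U, ∫⁻ x in U, g (y + s • (x - y)) ∂μ ∂μ ≤
      2 ^ Module.finrank ℝ E * μ U * ∫⁻ x in U, g x ∂μ := fun s hs hs1 => by
    calc _ ≤ ∫⁻ y in U, 2 ^ Module.finrank ℝ E * ∫⁻ x in U, g x ∂μ ∂μ :=
          setLIntegral_mono' hU.measurableSet fun y hy => setLIntegral_lineMap_le hU hc hg hs hs1 hy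
      _ = _ := by rw [lintegral_const, Measure.restrict_apply_univ]; ring
  rcases le_total (1 / 2) t with h | h
  · exact key t h ht1
  · have h1 := key (1 - t) (by linarith) (by linarith)
    have hm : Measurable fun p : E × E => g (p.1 + (1 - t) • (p.2 - p.1)) :=
      hg.comp (by fun_prop)
    rw [lintegral_lintegral_swap hm.aemeasurable] at h1
    refine le_of_eq_of_le ?_ h1
    refine lintegral_congr fun y => lintegral_congr fun x => ?_
    congr 1
    module

/-- The Poincaré inequality on `U`. -/
def HasPoincare (μ : Measure E) (U : Set E) : Prop :=
  ∃ C : ℝ≥0, ∀ f : E → ℝ, ContDiffOn ℝ 1 f U → ∃ a : ℝ,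
    ∫⁻ x in U, ‖f x - a‖ₑ ^ 2 ∂μ ≤ C * ∫⁻ x in U, ‖fderiv ℝ f x‖ₑ ^ 2 ∂μ

/-- Integrating the increments along segments over all pairs of points bounds an average over `y`.
Some `y` does not exceed the average, and `f y` is the constant sought. -/
theorem hasPoincare_of_convex {U : Set E} (hU : IsOpen U) (hc : Convex ℝ U)
    (hb : Bornology.IsBounded U) : HasPoincare μ U := by
  rcases U.eq_empty_or_nonempty with rfl | hne
  · exact ⟨0, fun f _ => ⟨0, by simp⟩⟩
  obtain ⟨D, hD⟩ := Metric.isBounded_iff.1 hb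
  have hμ0 : μ U ≠ 0 := (hU.measure_pos μ hne).ne'
  have hμ1 : μ U ≠ ⊤ := hb.measure_lt_top.ne
  refine ⟨D.toNNReal ^ 2 * 2 ^ Module.finrank ℝ E, fun f hf => ?_⟩
  set g : E → ℝ≥0∞ := fun x => ‖fderiv ℝ f x‖ₑ ^ 2 with hgdef
  have hg : Measurable g := (measurable_fderiv ℝ f).enorm.pow_const 2
  set Φ : E → ℝ≥0∞ := fun y => ∫⁻ x in U, (∫⁻ t in Ioc (0 : ℝ) 1, g (y + t • (x - y))) ∂μ
    with hΦ
  have hΦm : Measurable Φ := by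
    refine Measurable.lintegral_prod_right' (f := fun p : E × E =>
      ∫⁻ t in Ioc (0 : ℝ) 1, g (p.1 + t • (p.2 - p.1))) ?_
    exact Measurable.lintegral_prod_right' (f := fun q : (E × E) × ℝ =>
      g (q.1.1 + q.2 • (q.1.2 - q.1.1))) (hg.comp (by fun_prop))
  obtain ⟨y, hy, hyle⟩ := exists_le_setLAverage hμ0 hμ1 hΦm.aemeasurable
  refine ⟨f y, ?_⟩
  have h1 : ∫⁻ y in U, Φ y ∂μ ≤ 2 ^ Module.finrank ℝ E * μ U * ∫⁻ x in U, g x ∂μ := by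
    have h2 : ∀ y, Φ y = ∫⁻ t in Ioc (0 : ℝ) 1, ∫⁻ x in U, g (y + t • (x - y)) ∂μ := fun y => by
      have hm : Measurable fun p : E × ℝ => g (y + p.2 • (p.1 - y)) := hg.comp (by fun_prop)
      exact lintegral_lintegral_swap hm.aemeasurable
    simp_rw [h2]
    rw [lintegral_lintegral_swap]
    · calc _ ≤ ∫⁻ t in Ioc (0 : ℝ) 1, 2 ^ Module.finrank ℝ E * μ U * ∫⁻ x in U, g x ∂μ :=
            setLIntegral_mono' measurableSet_Ioc fun t ht =>
              setLIntegral_setLIntegral_lineMap_le hU hc hg ht.1.le ht.2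
        _ = _ := by simp
    · refine (Measurable.lintegral_prod_right' (f := fun q : (E × ℝ) × E =>
        g (q.1.1 + q.1.2 • (q.2 - q.1.1))) (hg.comp (by fun_prop))).aemeasurable
  rw [setLAverage_eq] at hyle
  have h3 : Φ y ≤ 2 ^ Module.finrank ℝ E * ∫⁻ x in U, g x ∂μ := by
    refine hyle.trans (ENNReal.div_le_of_le_mul (h1.trans_eq ?_))
    ring
  calc _ ≤ ∫⁻ x in U, (ENNReal.ofReal D ^ 2 * ∫⁻ t in Ioc (0 : ℝ) 1, g (y + t • (x - y))) ∂μ :=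
        setLIntegral_mono' hU.measurableSet fun x hx => enorm_sub_sq_le_lintegral_segment hU hc hf
          hx hy (by rw [← dist_eq_norm]; exact hD hx hy)
    _ = ENNReal.ofReal D ^ 2 * Φ y := lintegral_const_mul' _ _ (by finiteness)
    _ ≤ ENNReal.ofReal D ^ 2 * (2 ^ Module.finrank ℝ E * ∫⁻ x in U, g x ∂μ) :=
        mul_le_mul_right h3 _
    _ = _ := by rw [← mul_assoc]; push_cast; rfl

theorem enorm_sub_sq_le (a b c : ℝ) : ‖a - b‖ₑ ^ 2 ≤ 2 * (‖a - c‖ₑ ^ 2 + ‖c - b‖ₑ ^ 2) := by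
  simp_rw [enorm_sq_eq]
  rw [← ENNReal.ofReal_add (sq_nonneg _) (sq_nonneg _), ← ENNReal.ofReal_ofNat 2,
    ← ENNReal.ofReal_mul (by norm_num)]
  refine ENNReal.ofReal_le_ofReal ?_
  nlinarith [sq_nonneg (a - c - (c - b))]

/-- On the overlap `f` is close to both constants, so they are close to each other; on `V` one
writes `f - a = (f - b) + (b - a)`. The ratio `m` of the measures transfers the estimate of `b - a`
from the overlap to `V`. -/
theorem HasPoincare.union {U V : Set E} (hU : IsOpen U) (hV : IsOpen V)
    (hVf : μ V ≠ ⊤) (hne : (U ∩ V).Nonempty) (hPU : HasPoincare μ U)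
    (hPV : HasPoincare μ V) : HasPoincare μ (U ∪ V) := by
  obtain ⟨C₁, h1⟩ := hPU
  obtain ⟨C₂, h2⟩ := hPV
  set W := U ∩ V with hW
  have hW0 : μ W ≠ 0 := ((hU.inter hV).measure_pos μ hne).ne'
  have hWf : μ W ≠ ⊤ := ne_top_of_le_ne_top hVf (measure_mono inter_subset_right)
  set m := ((μ V) / (μ W)).toNNReal with hm
  have hm' : (m : ℝ≥0∞) = μ V / μ W := ENNReal.coe_toNNReal (ENNReal.div_ne_top hVf hW0)
  refine ⟨C₁ + 2 * C₂ + 4 * m * (C₁ + C₂), fun f hf => ?_⟩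
  obtain ⟨a, ha⟩ := h1 f (hf.mono subset_union_left)
  obtain ⟨b, hb⟩ := h2 f (hf.mono subset_union_right)
  refine ⟨a, ?_⟩
  set G := ∫⁻ x in U ∪ V, ‖fderiv ℝ f x‖ₑ ^ 2 ∂μ with hG
  have hma : ∀ (c : ℝ), AEMeasurable (fun x => ‖f x - c‖ₑ ^ 2) (μ.restrict (U ∪ V)) := fun c =>
    (((hf.continuousOn.sub continuousOn_const).aestronglyMeasurable
      (hU.union hV).measurableSet).enorm).pow_const 2
  have hmV : ∀ (c : ℝ), AEMeasurable (fun x => ‖f x - c‖ₑ ^ 2) (μ.restrict V) := fun c =>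
    (hma c).mono_measure (Measure.restrict_mono_set _ subset_union_right)
  have ha' : ∫⁻ x in U, ‖f x - a‖ₑ ^ 2 ∂μ ≤ C₁ * G :=
    ha.trans (mul_le_mul_right (lintegral_mono_set subset_union_left) _)
  have hb' : ∫⁻ x in V, ‖f x - b‖ₑ ^ 2 ∂μ ≤ C₂ * G :=
    hb.trans (mul_le_mul_right (lintegral_mono_set subset_union_right) _)
  have hab : ‖b - a‖ₑ ^ 2 * μ W ≤ 2 * (C₁ * G + C₂ * G) := by
    calc _ = ∫⁻ x in W, ‖b - a‖ₑ ^ 2 ∂μ := by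
          rw [lintegral_const, Measure.restrict_apply_univ]
      _ ≤ ∫⁻ x in W, 2 * (‖f x - b‖ₑ ^ 2 + ‖f x - a‖ₑ ^ 2) ∂μ :=
          lintegral_mono fun x => by
            have := enorm_sub_sq_le b a (f x)
            rwa [← enorm_neg (b - f x), neg_sub] at this
      _ = 2 * (∫⁻ x in W, ‖f x - b‖ₑ ^ 2 ∂μ + ∫⁻ x in W, ‖f x - a‖ₑ ^ 2 ∂μ) := by
          rw [lintegral_const_mul' _ _ (by finiteness), lintegral_add_left']
          exact (hmV b).mono_measure (Measure.restrict_mono_set _ inter_subset_right)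
      _ ≤ 2 * (C₂ * G + C₁ * G) :=
          mul_le_mul_right (add_le_add ((lintegral_mono_set inter_subset_right).trans hb')
            ((lintegral_mono_set inter_subset_left).trans ha')) _
      _ = _ := by ring
  have hVab : ‖b - a‖ₑ ^ 2 * μ V ≤ m * (2 * (C₁ * G + C₂ * G)) := by
    calc _ = m * (‖b - a‖ₑ ^ 2 * μ W) := by
          rw [hm', mul_left_comm, ENNReal.div_mul_cancel hW0 hWf]
      _ ≤ _ := mul_le_mul_right hab _
  calc ∫⁻ x in U ∪ V, ‖f x - a‖ₑ ^ 2 ∂μ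
      ≤ ∫⁻ x in U, ‖f x - a‖ₑ ^ 2 ∂μ + ∫⁻ x in V, ‖f x - a‖ₑ ^ 2 ∂μ := lintegral_union_le _ _ _
    _ ≤ C₁ * G + ∫⁻ x in V, 2 * (‖f x - b‖ₑ ^ 2 + ‖b - a‖ₑ ^ 2) ∂μ :=
        add_le_add ha' (lintegral_mono fun x => enorm_sub_sq_le _ _ _)
    _ = C₁ * G + 2 * (∫⁻ x in V, ‖f x - b‖ₑ ^ 2 ∂μ + ‖b - a‖ₑ ^ 2 * μ V) := by
        rw [lintegral_const_mul' _ _ (by finiteness), lintegral_add_left' (hmV b), lintegral_const,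
          Measure.restrict_apply_univ]
    _ ≤ C₁ * G + 2 * (C₂ * G + m * (2 * (C₁ * G + C₂ * G))) := by gcongr
    _ = _ := by push_cast; ring

end Poincare

variable {Ω : Set E3} {Γ : (E2 × ℝ) ≃ₜ E3} {v : E3} {a : E2} {ρ : ℝ} {L : ℝ≥0}

/-- The part of a chart box that is mapped into the domain. -/
def upperBox (a : E2) (ρ : ℝ) : Set (E2 × ℝ) := ball a ρ ×ˢ Ioo 0 (2 * ρ)

theorem isOpen_upperBox : IsOpen (upperBox a ρ) := isOpen_ball.prod isOpen_Ioo

theorem upperBox_subset_chartBox (hρ : 0 < ρ) : upperBox a ρ ⊆ chartBox a ρ :=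
  prod_mono_right (Ioo_subset_Ioo_left (by linarith))

theorem IsBoundaryChart.mapsTo_upperBox (h : IsBoundaryChart Ω Γ v a ρ L) :
    MapsTo Γ (upperBox a ρ) Ω := fun _ hz =>
  (h.mem_iff _ (upperBox_subset_chartBox h.pos hz)).2 hz.2.1

theorem IsBoundaryChart.enorm_fderiv_comp_le (h : IsBoundaryChart Ω Γ v a ρ L) {f : E3 → ℝ}
    {z : E2 × ℝ} (hz : z ∈ chartBox a ρ) (hf : DifferentiableAt ℝ f (Γ z)) :
    ‖fderiv ℝ (f ∘ Γ) z‖ₑ ≤ L * ‖fderiv ℝ f (Γ z)‖ₑ := by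
  rw [fderiv_comp z hf (h.contDiff.differentiable one_ne_zero z)]
  refine (ContinuousLinearMap.opENorm_comp_le _ _).trans ?_
  rw [mul_comm]
  refine mul_le_mul_left ?_ _
  have := norm_fderiv_le_of_lipschitzOn (𝕜 := ℝ) ((isOpen_chartBox a ρ).mem_nhds hz) h.lipschitz
  exact enorm_le_coe.2 this

/-- In chart coordinates the set is a convex box; the chart preserves volume and enlarges gradients
by at most the factor `L`. -/
theorem IsBoundaryChart.hasPoincare (h : IsBoundaryChart Ω Γ v a ρ L) :
    HasPoincare volume (Γ '' upperBox a ρ) := by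
  have hconv : Convex ℝ (upperBox a ρ) := (convex_ball a ρ).prod (convex_Ioo _ _)
  have hbdd : Bornology.IsBounded (upperBox a ρ) := isBounded_ball.prod (isBounded_Ioo _ _)
  have hhaar : (volume : Measure (E2 × ℝ)).IsAddHaarMeasure := by
    rw [Measure.volume_eq_prod]; infer_instance
  obtain ⟨C, hC⟩ := hasPoincare_of_convex (μ := (volume : Measure (E2 × ℝ)))
    isOpen_upperBox hconv hbdd
  have hemb := Γ.measurableEmbedding
  refine ⟨C * L ^ 2, fun f hf => ?_⟩
  obtain ⟨c, hc⟩ := hC (f ∘ Γ) (hf.comp h.contDiff.contDiffOn (mapsTo_image _ _))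
  refine ⟨c, ?_⟩
  rw [← h.measurePreserving.setLIntegral_comp_emb hemb, ← h.measurePreserving.setLIntegral_comp_emb
    hemb (fun x => ‖fderiv ℝ f x‖ₑ ^ 2)]
  refine hc.trans ?_
  rw [ENNReal.coe_mul, mul_assoc,
    ← lintegral_const_mul' ((L ^ 2 : ℝ≥0) : ℝ≥0∞) _ ENNReal.coe_ne_top]
  refine mul_le_mul_right (setLIntegral_mono' isOpen_upperBox.measurableSet fun z hz => ?_) _
  rw [ENNReal.coe_pow, ← mul_pow]
  gcongr
  refine h.enorm_fderiv_comp_le (upperBox_subset_chartBox h.pos hz) ?_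
  exact (hf.contDiffAt ((Γ.isOpenMap _ isOpen_upperBox).mem_nhds
    (mem_image_of_mem _ hz))).differentiableAt one_ne_zero

theorem exists_finite_poincare_cover (hΩ : IsBoundedC11Domain Ω) :
    ∃ S : Set (Set E3), S.Finite ∧ ⋃₀ S = Ω ∧
      ∀ U ∈ S, IsOpen U ∧ U.Nonempty ∧ HasPoincare volume U := by
  have key : ∀ p ∈ closure Ω, ∃ N ∈ 𝓝 p, ∃ U ⊆ Ω, N ∩ Ω ⊆ U ∧ IsOpen U ∧ U.Nonempty ∧
      HasPoincare volume U := by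
    intro p hp
    by_cases hpΩ : p ∈ Ω
    · obtain ⟨r, hr, hsub⟩ := Metric.isOpen_iff.1 hΩ.isOpen p hpΩ
      exact ⟨ball p r, ball_mem_nhds p hr, ball p r, hsub, inter_subset_left, isOpen_ball,
        nonempty_ball.2 hr, hasPoincare_of_convex isOpen_ball (convex_ball _ _) isBounded_ball⟩
    · have hpf : p ∈ frontier Ω := by rw [hΩ.isOpen.frontier_eq]; exact ⟨hp, hpΩ⟩
      obtain ⟨Γ, v, a, ρ, L, h, hΓ⟩ := exists_isBoundaryChart hΩ hpf
      have hρ := h.pos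
      refine ⟨Γ '' chartBox a ρ, ?_, Γ '' upperBox a ρ, h.mapsTo_upperBox.image_subset, ?_,
        Γ.isOpenMap _ isOpen_upperBox, ?_, h.hasPoincare⟩
      · refine (Γ.isOpenMap _ (isOpen_chartBox a ρ)).mem_nhds ⟨(a, 0), ?_, hΓ⟩
        exact ⟨mem_ball_self hρ, by constructor <;> simp <;> linarith⟩
      · rintro _ ⟨⟨z, hz, rfl⟩, hzΩ⟩
        exact ⟨z, ⟨hz.1, (h.mem_iff z hz).1 hzΩ, hz.2.2⟩, rfl⟩
      · exact ⟨_, (a, ρ), ⟨mem_ball_self hρ, by constructor <;> simp <;> linarith⟩, rfl⟩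
  choose! N hN U hU using key
  obtain ⟨t, htc, hcov⟩ := hΩ.isBounded.isCompact_closure.elim_nhds_subcover N hN
  refine ⟨U '' (t : Set E3), t.finite_toSet.image _, ?_, ?_⟩
  · refine subset_antisymm ?_ fun x hx => ?_
    · rintro x ⟨_, ⟨p, hp, rfl⟩, hx⟩
      exact (hU p (htc p hp)).1 hx
    · obtain ⟨p, hp, hxp⟩ := mem_iUnion₂.1 (hcov (subset_closure hx))
      exact ⟨_, ⟨p, hp, rfl⟩, (hU p (htc p hp)).2.1 ⟨hxp, hx⟩⟩
  · rintro _ ⟨p, hp, rfl⟩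
    exact (hU p (htc p hp)).2.2

/-- Take a maximal subfamily of a finite cover whose union has the inequality. Were a piece left
over, connectedness would make some remaining piece meet the union, and adding it would contradict
maximality. -/
theorem hasPoincare_domain (hΩ : IsBoundedC11Domain Ω) : HasPoincare volume Ω := by
  obtain ⟨S, hS, hSΩ, hSU⟩ := exists_finite_poincare_cover hΩ
  set A : Set (Set (Set E3)) := {T | T ⊆ S ∧ (⋃₀ T).Nonempty ∧ HasPoincare volume (⋃₀ T)} with hA
  have hAf : A.Finite := hS.finite_subsets.subset fun T hT => hT.1
  have hAne : A.Nonempty := by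
    obtain ⟨x, hx⟩ := hΩ.isConnected.nonempty
    rw [← hSΩ] at hx
    obtain ⟨U, hU, -⟩ := hx
    exact ⟨{U}, by simpa using hU, by simpa using (hSU U hU).2.1, by simpa using (hSU U hU).2.2⟩
  obtain ⟨T, hT⟩ := hAf.exists_maximal hAne
  obtain ⟨hTS, hTne, hTP⟩ := hT.1
  suffices h : T = S by rwa [h, hSΩ] at hTP
  refine subset_antisymm hTS fun U hU => ?_
  by_contra hUT
  have hopen : ∀ R ⊆ S, IsOpen (⋃₀ R) := fun R hR => isOpen_sUnion fun V hV => (hSU V (hR hV)).1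
  have hcov : Ω ⊆ ⋃₀ T ∪ ⋃₀ (S \ T) := by
    rw [← sUnion_union, union_sdiff_cancel hTS, hSΩ]
  have hsub : ∀ R ⊆ S, ⋃₀ R ⊆ Ω := fun R hR => hSΩ ▸ sUnion_subset_sUnion hR
  obtain ⟨y, hy⟩ := (hSU U hU).2.1
  obtain ⟨x, hxΩ, hx1, V, hV, hx2⟩ := hΩ.isConnected.isPreconnected _ _ (hopen T hTS)
    (hopen _ sdiff_subset) hcov (by rwa [inter_eq_right.2 (hsub T hTS)])
    ⟨y, hsub S subset_rfl ⟨U, hU, hy⟩, U, ⟨hU, hUT⟩, hy⟩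
  have hVS := hSU V hV.1
  have hVΩ : V ⊆ Ω := (subset_sUnion_of_mem hV.1).trans hSΩ.subset
  have h1 : HasPoincare volume (⋃₀ T ∪ V) := hTP.union (hopen T hTS) hVS.1
    (hΩ.isBounded.subset hVΩ).measure_lt_top.ne ⟨x, hx1, hx2⟩ hVS.2.2
  have h2 : insert V T ∈ A := by
    refine ⟨insert_subset hV.1 hTS, ⟨x, V, mem_insert _ _, hx2⟩, ?_⟩
    rwa [sUnion_insert, union_comm]
  exact hV.2 (hT.2 h2 (subset_insert V T) (mem_insert V T))

/-! ### The trace theorem -/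

/-- Polar coordinates in the plane; `K` is the total mass of the measure on the unit circle. -/
theorem exists_lintegral_norm_eq : ∃ K : ℝ≥0, ∀ f : ℝ → ℝ≥0∞, Measurable f →
    ∫⁻ h : E2, f ‖h‖ = K * ∫⁻ r in Ioi (0 : ℝ), ENNReal.ofReal r * f r := by
  set S := (volume : Measure E2).toSphere with hS
  refine ⟨(S univ).toNNReal, fun f hf => ?_⟩
  rw [ENNReal.coe_toNNReal (measure_ne_top _ _)]
  have h1 : ∫⁻ h : E2, f ‖h‖ =
      ∫⁻ h : ({0}ᶜ : Set E2), f ‖(h : E2)‖ ∂(volume.comap Subtype.val) := by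
    rw [lintegral_subtype_comap (measurableSet_singleton _).compl (fun h : E2 => f ‖h‖),
      restrict_compl_singleton]
  have hmp := (volume : Measure E2).measurePreserving_homeomorphUnitSphereProd
  have hfm : Measurable fun p : sphere (0 : E2) 1 × Ioi (0 : ℝ) => f p.2 :=
    hf.comp (measurable_subtype_coe.comp measurable_snd)
  have h2 := hmp.lintegral_comp hfm
  simp only [homeomorphUnitSphereProd_apply_snd_coe] at h2
  rw [h1, h2, lintegral_prod _ hfm.aemeasurable]
  simp only [lintegral_const]
  rw [mul_comm]
  congr 1
  have hw : Measurable fun r : Ioi (0 : ℝ) =>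
      ENNReal.ofReal ((r : ℝ) ^ (Module.finrank ℝ E2 - 1)) := by fun_prop
  have hf' : Measurable fun r : Ioi (0 : ℝ) => f r := hf.comp measurable_subtype_coe
  rw [Measure.volumeIoiPow, lintegral_withDensity_eq_lintegral_mul _ hw hf']
  have h3 := lintegral_subtype_comap (μ := volume) measurableSet_Ioi
    (fun r : ℝ => ENNReal.ofReal (r ^ (Module.finrank ℝ E2 - 1)) * f r) (s := Ioi (0 : ℝ))
  rw [finrank_euclideanSpace_fin] at *
  simp only [Nat.add_one_sub_one, pow_one] at *
  exact h3

/-- The weight `θ^{-1/2}`. -/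
def rootWeight (θ : ℝ) : ℝ≥0∞ := ENNReal.ofReal (θ ^ (-(1 / 2) : ℝ))

theorem measurable_rootWeight : Measurable rootWeight := by unfold rootWeight; fun_prop

theorem lintegral_rootWeight_ne_top : ∫⁻ θ in Ioc (0 : ℝ) 1, rootWeight θ ≠ ⊤ := by
  have h : IntervalIntegrable (fun θ : ℝ => θ ^ (-(1 / 2) : ℝ)) volume 0 1 :=
    intervalIntegral.intervalIntegrable_rpow' (by norm_num)
  rw [intervalIntegrable_iff_integrableOn_Ioc_of_le zero_le_one] at h
  exact h.lintegral_lt_top.ne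

/-- Cauchy–Schwarz with the integrable weight `θ^{-1/2}`. A constant weight would not do: the later
rescaling by `θ⁻¹` would then diverge at zero. -/
theorem sq_lintegral_le_rootWeight {a : ℝ → ℝ≥0∞} (ha : Measurable a) :
    (∫⁻ θ in Ioc (0 : ℝ) 1, a θ) ^ 2 ≤ (∫⁻ θ in Ioc (0 : ℝ) 1, rootWeight θ) *
      ∫⁻ θ in Ioc (0 : ℝ) 1, ENNReal.ofReal θ * rootWeight θ * a θ ^ 2 := by
  have h := sq_lintegral_mul_le (μ := volume.restrict (Ioc (0 : ℝ) 1))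
    (a := fun θ => ENNReal.ofReal (θ ^ (1 / 2 : ℝ)) * a θ) (k := rootWeight)
    ((by fun_prop : Measurable _).aemeasurable) measurable_rootWeight.aemeasurable
  have h1 : ∫⁻ θ in Ioc (0 : ℝ) 1, ENNReal.ofReal (θ ^ (1 / 2 : ℝ)) * a θ * rootWeight θ =
      ∫⁻ θ in Ioc (0 : ℝ) 1, a θ := by
    refine setLIntegral_congr_fun measurableSet_Ioc fun θ hθ => ?_
    have hθ0 : 0 < θ := hθ.1
    simp only [rootWeight]
    rw [mul_right_comm, ← ENNReal.ofReal_mul (by positivity), ← Real.rpow_add hθ0]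
    norm_num
  have h2 : ∫⁻ θ in Ioc (0 : ℝ) 1, (ENNReal.ofReal (θ ^ (1 / 2 : ℝ)) * a θ) ^ 2 * rootWeight θ =
      ∫⁻ θ in Ioc (0 : ℝ) 1, ENNReal.ofReal θ * rootWeight θ * a θ ^ 2 := by
    refine setLIntegral_congr_fun measurableSet_Ioc fun θ hθ => ?_
    have hθ0 : 0 < θ := hθ.1
    rw [mul_pow, ← ENNReal.ofReal_pow (by positivity), ← Real.rpow_natCast, ← Real.rpow_mul hθ0.le]
    norm_num
    ring
  rw [h1, h2] at h
  exact h.trans_eq (mul_comm _ _)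

/-- The weighted integral of `G` along the segment from `(x, 0)` to `(x + k, |k|)`. -/
def coneIntegral (G : E2 × ℝ → ℝ≥0∞) (x k : E2) : ℝ≥0∞ :=
  ENNReal.ofReal ‖k‖⁻¹ *
    ∫⁻ θ in Ioc (0 : ℝ) 1, ENNReal.ofReal θ * rootWeight θ * G (x + θ • k, θ * ‖k‖)

theorem measurable_coneIntegral {G : E2 × ℝ → ℝ≥0∞} (hG : Measurable G) :
    Measurable fun p : E2 × E2 => coneIntegral G p.1 p.2 := by
  have h1 : Measurable fun q : (E2 × E2) × ℝ => ENNReal.ofReal q.2 * rootWeight q.2 *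
      G (q.1.1 + q.2 • q.1.2, q.2 * ‖q.1.2‖) :=
    ((ENNReal.measurable_ofReal.comp measurable_snd).mul
      (measurable_rootWeight.comp measurable_snd)).mul (hG.comp (by fun_prop))
  have h2 : Measurable fun p : E2 × E2 => ENNReal.ofReal ‖p.2‖⁻¹ := by fun_prop
  exact h2.mul h1.lintegral_prod_right'

theorem lintegral_inv_norm_mul_smul {M : ℝ → ℝ≥0∞} (hM : Measurable M) {θ : ℝ} (hθ : 0 < θ) :
    ∫⁻ k : E2, ENNReal.ofReal ‖k‖⁻¹ * M (θ * ‖k‖) =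
      ENNReal.ofReal θ⁻¹ * ∫⁻ k : E2, ENNReal.ofReal ‖k‖⁻¹ * M ‖k‖ := by
  have h := lintegral_smul_add_eq (μ := (volume : Measure E2))
    (fun k => ENNReal.ofReal ‖k‖⁻¹ * M ‖k‖) (by fun_prop) hθ 0
  have h1 : ∀ k : E2, ENNReal.ofReal ‖θ • k + 0‖⁻¹ * M ‖θ • k + 0‖ =
      ENNReal.ofReal θ⁻¹ * (ENNReal.ofReal ‖k‖⁻¹ * M (θ * ‖k‖)) := fun k => by
    rw [add_zero, norm_smul, Real.norm_of_nonneg hθ.le, mul_inv, ENNReal.ofReal_mul (by positivity),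
      mul_assoc]
  simp_rw [h1] at h
  rw [lintegral_const_mul' _ _ ENNReal.ofReal_ne_top, finrank_euclideanSpace_fin] at h
  calc _ = ENNReal.ofReal θ * (ENNReal.ofReal θ⁻¹ *
        ∫⁻ k : E2, ENNReal.ofReal ‖k‖⁻¹ * M (θ * ‖k‖)) := by
        rw [← mul_assoc, ← ENNReal.ofReal_mul hθ.le, mul_inv_cancel₀ hθ.ne', ENNReal.ofReal_one,
          one_mul]
    _ = _ := by
        rw [h, ← mul_assoc, ← ENNReal.ofReal_mul hθ.le]
        congr 2
        field_simp

/-- Integration over `x` leaves a function of the height `θ ‖k‖` alone. Rescaling `k` costs `θ⁻¹`,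
leaving the integrable weight `θ^{-1/2}`, and in polar coordinates the area element cancels `‖k‖⁻¹`.
-/
theorem exists_lintegral_coneIntegral_le : ∃ C : ℝ≥0, ∀ G : E2 × ℝ → ℝ≥0∞, Measurable G →
    ∫⁻ x, ∫⁻ k, coneIntegral G x k ≤ C * ∫⁻ z, G z := by
  obtain ⟨K, hK⟩ := exists_lintegral_norm_eq
  set I := ∫⁻ θ in Ioc (0 : ℝ) 1, rootWeight θ with hI
  refine ⟨I.toNNReal * K, fun G hG => ?_⟩
  set M : ℝ → ℝ≥0∞ := fun s => ∫⁻ x, G (x, s) with hMdef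
  have hM : Measurable M := hG.lintegral_prod_left'
  have hMG : ∫⁻ s, M s = ∫⁻ z, G z := by
    rw [Measure.volume_eq_prod, lintegral_prod_symm' _ hG]
  have h1 : ∀ k : E2, ∫⁻ x, coneIntegral G x k =
      ∫⁻ θ in Ioc (0 : ℝ) 1, ENNReal.ofReal θ * rootWeight θ *
        (ENNReal.ofReal ‖k‖⁻¹ * M (θ * ‖k‖)) := fun k => by
    have hm : Measurable fun p : E2 × ℝ => ENNReal.ofReal p.2 * rootWeight p.2 *
        G (p.1 + p.2 • k, p.2 * ‖k‖) :=
      ((ENNReal.measurable_ofReal.comp measurable_snd).mul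
        (measurable_rootWeight.comp measurable_snd)).mul (hG.comp (by fun_prop))
    simp only [coneIntegral]
    rw [lintegral_const_mul' _ _ ENNReal.ofReal_ne_top, lintegral_lintegral_swap hm.aemeasurable,
      ← lintegral_const_mul' _ _ ENNReal.ofReal_ne_top]
    refine lintegral_congr fun θ => ?_
    have hGθ : Measurable fun x : E2 => G (x + θ • k, θ * ‖k‖) := hG.comp (by fun_prop)
    rw [lintegral_const_mul _ hGθ,
      lintegral_add_right_eq_self (fun x : E2 => G (x, θ * ‖k‖))]
    ring
  have hm2 : Measurable fun p : E2 × ℝ => ENNReal.ofReal p.2 * rootWeight p.2 *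
      (ENNReal.ofReal ‖p.1‖⁻¹ * M (p.2 * ‖p.1‖)) :=
    ((ENNReal.measurable_ofReal.comp measurable_snd).mul
      (measurable_rootWeight.comp measurable_snd)).mul
      ((by fun_prop : Measurable fun p : E2 × ℝ => ENNReal.ofReal ‖p.1‖⁻¹).mul
        (hM.comp (by fun_prop)))
  rw [lintegral_lintegral_swap (measurable_coneIntegral hG).aemeasurable]
  simp_rw [h1]
  rw [lintegral_lintegral_swap hm2.aemeasurable]
  have h2 : ∫⁻ k : E2, ENNReal.ofReal ‖k‖⁻¹ * M ‖k‖ ≤ K * ∫⁻ z, G z := by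
    rw [hK (fun r => ENNReal.ofReal r⁻¹ * M r) (by fun_prop), ← hMG]
    refine mul_le_mul_right ((setLIntegral_mono' measurableSet_Ioi fun r hr => ?_).trans
      (setLIntegral_le_lintegral (Ioi 0) M)) _
    have hr0 : 0 < r := hr
    rw [← mul_assoc, ← ENNReal.ofReal_mul hr0.le, mul_inv_cancel₀ hr0.ne', ENNReal.ofReal_one,
      one_mul]
  calc _ = ∫⁻ θ in Ioc (0 : ℝ) 1, rootWeight θ *
        ∫⁻ k : E2, ENNReal.ofReal ‖k‖⁻¹ * M ‖k‖ := by
        refine setLIntegral_congr_fun measurableSet_Ioc fun θ hθ => ?_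
        have hθ0 : 0 < θ := hθ.1
        have hm3 : Measurable fun k : E2 => ENNReal.ofReal ‖k‖⁻¹ * M (θ * ‖k‖) := by fun_prop
        rw [lintegral_const_mul _ hm3, lintegral_inv_norm_mul_smul hM hθ0,
          ← mul_assoc, mul_right_comm (ENNReal.ofReal θ), ← ENNReal.ofReal_mul hθ0.le,
          mul_inv_cancel₀ hθ0.ne', ENNReal.ofReal_one, one_mul]
    _ = I * ∫⁻ k : E2, ENNReal.ofReal ‖k‖⁻¹ * M ‖k‖ := lintegral_mul_const _ measurable_rootWeight
    _ ≤ I * (K * ∫⁻ z, G z) := mul_le_mul_right h2 _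
    _ = _ := by rw [ENNReal.coe_mul, ENNReal.coe_toNNReal lintegral_rootWeight_ne_top, mul_assoc]

theorem enorm_sub_le_lintegral_deriv {g g' : ℝ → ℝ} {a b : ℝ} (hab : a ≤ b)
    (hd : ∀ t ∈ Icc a b, HasDerivAt g (g' t) t) (hc : ContinuousOn g' (Icc a b)) :
    ‖g b - g a‖ₑ ≤ ∫⁻ t in Ioc a b, ‖g' t‖ₑ := by
  rw [← uIcc_of_le hab] at hd hc
  rw [← intervalIntegral.integral_eq_sub_of_hasDerivAt hd hc.intervalIntegrable,
    intervalIntegral.integral_of_le hab]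
  exact enorm_integral_le_lintegral_enorm _

variable {Ω : Set E3} {Γ : (E2 × ℝ) ≃ₜ E3} {v : E3} {a : E2} {ρ : ℝ} {L : ℝ≥0}

theorem IsBoundaryChart.lintegral_comp_le (h : IsBoundaryChart Ω Γ v a ρ L) (g : E3 → ℝ≥0∞) :
    ∫⁻ z in upperBox a ρ, g (Γ z) ≤ ∫⁻ x in Ω, g x := by
  rw [h.measurePreserving.setLIntegral_comp_emb Γ.measurableEmbedding g]
  exact lintegral_mono_set h.mapsTo_upperBox.image_subset

theorem enorm_sq_le_of_vertical {u : E2 × ℝ → ℝ} (hu : ContDiff ℝ 1 u) {b : ℝ} (x : E2)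
    {s : ℝ} (hs : s ∈ Ioo 0 b) : ‖u (x, 0)‖ₑ ^ 2 ≤ 2 * (‖u (x, s)‖ₑ ^ 2 +
      ENNReal.ofReal b * ∫⁻ t in Ioo 0 b, ‖fderiv ℝ u (x, t)‖ₑ ^ 2) := by
  have hd : ∀ t ∈ Icc 0 s, HasDerivAt (fun t => u (x, t)) (fderiv ℝ u (x, t) (0, 1)) t :=
    fun t _ => (hu.differentiable one_ne_zero (x, t)).hasFDerivAt.comp_hasDerivAt t
      ((hasDerivAt_const t x).prodMk (hasDerivAt_id t))
  have hc : Continuous fun t : ℝ => fderiv ℝ u (x, t) (0, 1) :=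
    ((hu.continuous_fderiv one_ne_zero).comp (by fun_prop)).clm_apply continuous_const
  have hm : Measurable fun t : ℝ => ‖fderiv ℝ u (x, t)‖ₑ :=
    ((hu.continuous_fderiv one_ne_zero).comp (by fun_prop : Continuous fun t : ℝ =>
      (x, t))).enorm.measurable
  have h1 := enorm_sub_le_lintegral_deriv hs.1.le hd hc.continuousOn
  have h2 : ‖u (x, s) - u (x, 0)‖ₑ ≤ ∫⁻ t in Ioo 0 b, ‖fderiv ℝ u (x, t)‖ₑ := by
    refine h1.trans ((lintegral_mono fun t => ?_).trans
      (lintegral_mono_set fun t ht => ⟨ht.1, ht.2.trans_lt hs.2⟩))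
    refine (ContinuousLinearMap.le_opENorm _ _).trans_eq ?_
    have : ‖((0, 1) : E2 × ℝ)‖ₑ = 1 := by rw [← ofReal_norm, Prod.norm_def]; simp
    rw [this, mul_one]
  have h3 := sq_lintegral_mul_le (μ := (volume : Measure ℝ).restrict (Ioo 0 b)) (k := fun _ => 1)
    hm.aemeasurable aemeasurable_const
  simp only [mul_one, lintegral_const, Measure.restrict_apply_univ, Real.volume_Ioo,
    sub_zero, one_mul] at h3
  have h4 := enorm_sub_sq_le (u (x, 0)) 0 (u (x, s))
  rw [sub_zero, sub_zero, ← enorm_neg (u (x, 0) - _), neg_sub, add_comm] at h4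
  refine h4.trans (mul_le_mul_right (add_le_add_right ?_ _) _)
  calc _ ≤ (∫⁻ t in Ioo 0 b, ‖fderiv ℝ u (x, t)‖ₑ) ^ 2 := by gcongr
    _ ≤ _ := h3.trans_eq (mul_comm _ _)

/-- The value at the bottom is compared with the value at height `s` on the same vertical line, and
the comparison is integrated over `s`. -/
theorem lintegral_bottom_le {u : E2 × ℝ → ℝ} (hu : ContDiff ℝ 1 u) (b : ℝ)
    (S : Set E2) : ENNReal.ofReal b * ∫⁻ x in S, ‖u (x, 0)‖ₑ ^ 2 ≤
      2 * ((∫⁻ z in S ×ˢ Ioo 0 b, ‖u z‖ₑ ^ 2) +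
        ENNReal.ofReal b ^ 2 * ∫⁻ z in S ×ˢ Ioo 0 b, ‖fderiv ℝ u z‖ₑ ^ 2) := by
  have hm1 : Measurable fun z => ‖u z‖ₑ ^ 2 := hu.continuous.enorm.measurable.pow_const 2
  have hm2 : Measurable fun z => ‖fderiv ℝ u z‖ₑ ^ 2 :=
    (hu.continuous_fderiv one_ne_zero).enorm.measurable.pow_const 2
  rw [Measure.volume_eq_prod, ← Measure.prod_restrict, lintegral_prod _ hm1.aemeasurable,
    lintegral_prod _ hm2.aemeasurable, ← lintegral_const_mul' _ _ ENNReal.ofReal_ne_top,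
    ← lintegral_const_mul' _ _ (by finiteness), ← lintegral_add_left hm1.lintegral_prod_right',
    ← lintegral_const_mul' _ _ (by finiteness)]
  refine lintegral_mono fun x => ?_
  calc ENNReal.ofReal b * ‖u (x, 0)‖ₑ ^ 2 = ∫⁻ s in Ioo 0 b, ‖u (x, 0)‖ₑ ^ 2 := by
        simp [mul_comm]
    _ ≤ ∫⁻ s in Ioo 0 b, 2 * (‖u (x, s)‖ₑ ^ 2 +
          ENNReal.ofReal b * ∫⁻ t in Ioo 0 b, ‖fderiv ℝ u (x, t)‖ₑ ^ 2) :=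
        setLIntegral_mono' measurableSet_Ioo fun s hs => enorm_sq_le_of_vertical hu x hs
    _ = _ := by
        have hm3 : Measurable fun s : ℝ => ‖u (x, s)‖ₑ ^ 2 := hm1.comp measurable_prodMk_left
        rw [lintegral_const_mul' _ _ (by finiteness), lintegral_add_left hm3, lintegral_const,
          Measure.restrict_apply_univ, Real.volume_Ioo, sub_zero]
        ring

theorem IsBoundaryChart.lintegral_surface_le (h : IsBoundaryChart Ω Γ v a ρ L) {g : E3 → ℝ≥0∞}
    (hg : Measurable g) : ∫⁻ p in Γ '' chartBox a ρ, g p ∂surfaceMeasure Ω ≤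
      (L : ℝ≥0∞) ^ 2 * ∫⁻ x in ball a ρ, g (Γ (x, 0)) := by
  refine (lintegral_mono' h.surfaceMeasure_restrict_le le_rfl).trans_eq ?_
  rw [lintegral_smul_measure, lintegral_map hg (by fun_prop), smul_eq_mul]

theorem IsBoundaryChart.lintegral_fderiv_comp_le (h : IsBoundaryChart Ω Γ v a ρ L) {φ : E3 → ℝ}
    (hφ : ContDiff ℝ 1 φ) : ∫⁻ z in upperBox a ρ, ‖fderiv ℝ (φ ∘ Γ) z‖ₑ ^ 2 ≤
      (L : ℝ≥0∞) ^ 2 * ∫⁻ x in Ω, ‖fderiv ℝ φ x‖ₑ ^ 2 := by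
  refine le_trans ?_ (mul_le_mul_right (h.lintegral_comp_le _) _)
  rw [← lintegral_const_mul' _ _ (by finiteness)]
  refine setLIntegral_mono' isOpen_upperBox.measurableSet fun z hz => ?_
  rw [← mul_pow]
  gcongr
  exact h.enorm_fderiv_comp_le (upperBox_subset_chartBox h.pos hz)
    (hφ.differentiable one_ne_zero _)

theorem IsBoundaryChart.exists_lintegral_sq_surface_le (h : IsBoundaryChart Ω Γ v a ρ L) :
    ∃ C : ℝ≥0, ∀ φ : E3 → ℝ, ContDiff ℝ 1 φ →
      ∫⁻ p in Γ '' chartBox a ρ, ‖φ p‖ₑ ^ 2 ∂surfaceMeasure Ω ≤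
        C * ((∫⁻ x in Ω, ‖φ x‖ₑ ^ 2) + ∫⁻ x in Ω, ‖fderiv ℝ φ x‖ₑ ^ 2) := by
  have hρ := h.pos
  set b : ℝ≥0 := (2 * ρ).toNNReal with hbdef
  have hb : 0 < b := by simpa [hbdef] using hρ
  refine ⟨L ^ 2 * (b⁻¹ * 2 * (1 + b ^ 2 * L ^ 2)), fun φ hφ => ?_⟩
  have hm : Measurable fun p => ‖φ p‖ₑ ^ 2 := hφ.continuous.enorm.measurable.pow_const 2
  refine (h.lintegral_surface_le hm).trans ?_
  have h1 := lintegral_bottom_le (hφ.comp h.contDiff) (2 * ρ) (ball a ρ)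
  have h2 := h.lintegral_comp_le fun x => ‖φ x‖ₑ ^ 2
  have h3 := h.lintegral_fderiv_comp_le hφ
  set X := ∫⁻ x in Ω, ‖φ x‖ₑ ^ 2
  set Y := ∫⁻ x in Ω, ‖fderiv ℝ φ x‖ₑ ^ 2
  rw [show ENNReal.ofReal (2 * ρ) = b from rfl] at h1
  have h4 : (b : ℝ≥0∞) * ∫⁻ x in ball a ρ, ‖φ (Γ (x, 0))‖ₑ ^ 2 ≤
      2 * (X + b ^ 2 * (L ^ 2 * Y)) :=
    h1.trans (mul_le_mul_right (add_le_add h2 (mul_le_mul_right h3 _)) _)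
  have h5 : ∫⁻ x in ball a ρ, ‖φ (Γ (x, 0))‖ₑ ^ 2 ≤ (b : ℝ≥0∞)⁻¹ *
      (2 * (X + b ^ 2 * (L ^ 2 * Y))) := by
    rwa [← ENNReal.mul_le_iff_le_inv (by simpa using hb.ne') ENNReal.coe_ne_top]
  rw [ENNReal.coe_mul, mul_assoc, ENNReal.coe_pow]
  refine mul_le_mul_right (h5.trans ?_) _
  rw [← ENNReal.coe_inv hb.ne']
  push_cast
  rw [mul_assoc, mul_assoc]
  refine mul_le_mul_right (mul_le_mul_right ?_ _) _
  calc X + (b : ℝ≥0∞) ^ 2 * (L ^ 2 * Y)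
      ≤ (X + (b : ℝ≥0∞) ^ 2 * (L ^ 2 * Y)) + (b ^ 2 * (L ^ 2 * X) + Y) := le_self_add
    _ = _ := by ring

theorem enorm_prod_norm_self (k : E2) : ‖((k, ‖k‖) : E2 × ℝ)‖ₑ = ENNReal.ofReal ‖k‖ := by
  rw [← ofReal_norm, Prod.norm_def, norm_norm, max_self]

/-- The direction `(k, ‖k‖)` of the segment has sup norm `‖k‖`. Its square and the factor `‖k‖`
missing from the cone integral make up `‖k‖³`. As `G` is prescribed only on the segment, it may be
cut off outside a box. -/
theorem enorm_sub_sq_le_coneIntegral {u : E2 × ℝ → ℝ} (hu : ContDiff ℝ 1 u) {G : E2 × ℝ → ℝ≥0∞}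
    {x k : E2} (hk : k ≠ 0)
    (hG : ∀ θ ∈ Ioc (0 : ℝ) 1, G (x + θ • k, θ * ‖k‖) = ‖fderiv ℝ u (x + θ • k, θ * ‖k‖)‖ₑ ^ 2) :
    ‖u (x, 0) - u (x + k, ‖k‖)‖ₑ ^ 2 ≤ ENNReal.ofReal (‖k‖ ^ 3) *
      ((∫⁻ θ in Ioc (0 : ℝ) 1, rootWeight θ) * coneIntegral G x k) := by
  have hk0 : 0 < ‖k‖ := norm_pos_iff.2 hk
  have hγ : ∀ θ : ℝ, HasDerivAt (fun θ : ℝ => (x + θ • k, θ * ‖k‖)) (k, ‖k‖) θ := fun θ => by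
    have h1 : HasDerivAt (fun θ : ℝ => x + θ • k) k θ := by
      simpa using ((hasDerivAt_id θ).smul_const k).const_add x
    have h2 : HasDerivAt (fun θ : ℝ => θ * ‖k‖) ‖k‖ θ := by
      simpa using (hasDerivAt_id θ).mul_const ‖k‖
    exact h1.prodMk h2
  have hγc : Continuous fun θ : ℝ => ((x + θ • k, θ * ‖k‖) : E2 × ℝ) := by fun_prop
  have hDc := (hu.continuous_fderiv one_ne_zero).comp hγc
  have hm : Measurable fun θ : ℝ => ‖fderiv ℝ u (x + θ • k, θ * ‖k‖)‖ₑ := hDc.enorm.measurable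
  have h1 := enorm_sub_le_lintegral_deriv zero_le_one (fun θ _ =>
    (hu.differentiable one_ne_zero (x + θ • k, θ * ‖k‖)).hasFDerivAt.comp_hasDerivAt θ (hγ θ))
    (hDc.clm_apply continuous_const).continuousOn
  simp only [Function.comp_apply, one_smul, one_mul, zero_smul, add_zero, zero_mul] at h1
  have h2 : ‖u (x, 0) - u (x + k, ‖k‖)‖ₑ ≤ ENNReal.ofReal ‖k‖ *
      ∫⁻ θ in Ioc (0 : ℝ) 1, ‖fderiv ℝ u (x + θ • k, θ * ‖k‖)‖ₑ := by
    rw [← enorm_neg, neg_sub, ← lintegral_const_mul' _ _ ENNReal.ofReal_ne_top]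
    refine h1.trans (lintegral_mono fun θ => ?_)
    refine (ContinuousLinearMap.le_opENorm _ _).trans_eq ?_
    rw [enorm_prod_norm_self, mul_comm]
  have h3 := sq_lintegral_le_rootWeight hm
  have h4 : ∫⁻ θ in Ioc (0 : ℝ) 1, ENNReal.ofReal θ * rootWeight θ *
      ‖fderiv ℝ u (x + θ • k, θ * ‖k‖)‖ₑ ^ 2 = ENNReal.ofReal ‖k‖ * coneIntegral G x k := by
    rw [coneIntegral, ← mul_assoc, ← ENNReal.ofReal_mul hk0.le, mul_inv_cancel₀ hk0.ne',
      ENNReal.ofReal_one, one_mul]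
    exact setLIntegral_congr_fun measurableSet_Ioc fun θ hθ => by rw [hG θ hθ]
  rw [h4] at h3
  calc _ ≤ (ENNReal.ofReal ‖k‖ *
        ∫⁻ θ in Ioc (0 : ℝ) 1, ‖fderiv ℝ u (x + θ • k, θ * ‖k‖)‖ₑ) ^ 2 := by gcongr
    _ ≤ ENNReal.ofReal ‖k‖ ^ 2 * ((∫⁻ θ in Ioc (0 : ℝ) 1, rootWeight θ) *
        (ENNReal.ofReal ‖k‖ * coneIntegral G x k)) := by
        rw [mul_pow]; exact mul_le_mul_right h3 _
    _ = _ := by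
        rw [show ‖k‖ ^ 3 = ‖k‖ ^ 2 * ‖k‖ by ring, ENNReal.ofReal_mul (by positivity),
          ENNReal.ofReal_pow (by positivity)]
        ring

theorem mem_upperBox_of_half {a x k : E2} {ρ θ : ℝ} (hx : x ∈ ball a (ρ / 2))
    (hk : 0 < ‖k‖) (hkρ : ‖k‖ < ρ / 2) (hθ : θ ∈ Ioc (0 : ℝ) 1) :
    (x + θ • k, θ * ‖k‖) ∈ upperBox a ρ := by
  have h1 : θ * ‖k‖ ≤ ‖k‖ := mul_le_of_le_one_left hk.le hθ.2
  refine ⟨?_, mul_pos hθ.1 hk, by linarith⟩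
  rw [mem_ball, dist_eq_norm] at hx ⊢
  calc ‖x + θ • k - a‖ = ‖(x - a) + θ • k‖ := by congr 1; module
    _ ≤ ‖x - a‖ + θ * ‖k‖ := by
        refine (norm_add_le _ _).trans_eq ?_
        rw [norm_smul, Real.norm_of_nonneg hθ.1.le]
    _ < ρ := by linarith

/-- Both points are joined to the point above their midpoint at height half their distance `d`. Each
leg contributes the factor `(d / 2)³`, which cancels `d⁻³`. -/
theorem enorm_sub_sq_bottom_le {u : E2 × ℝ → ℝ} (hu : ContDiff ℝ 1 u) {a x y : E2} {ρ : ℝ}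
    (hx : x ∈ ball a (ρ / 2)) (hy : y ∈ ball a (ρ / 2)) (hxy : x ≠ y) :
    ‖u (x, 0) - u (y, 0)‖ₑ ^ 2 * ENNReal.ofReal (dist x y ^ 3)⁻¹ ≤
      (∫⁻ θ in Ioc (0 : ℝ) 1, rootWeight θ) *
      (coneIntegral ((upperBox a ρ).indicator fun z => ‖fderiv ℝ u z‖ₑ ^ 2) x
        ((1 / 2 : ℝ) • (y - x)) +
      coneIntegral ((upperBox a ρ).indicator fun z => ‖fderiv ℝ u z‖ₑ ^ 2) y
        ((1 / 2 : ℝ) • (x - y))) := by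
  have hd : 0 < dist x y := dist_pos.2 hxy
  have key : ∀ x' y' : E2, x' ∈ ball a (ρ / 2) → y' ∈ ball a (ρ / 2) → 0 < dist x' y' →
      ‖u (x', 0) - u ((1 / 2 : ℝ) • (x' + y'), dist x' y' / 2)‖ₑ ^ 2 ≤
      ENNReal.ofReal ((dist x' y' / 2) ^ 3) * ((∫⁻ θ in Ioc (0 : ℝ) 1, rootWeight θ) *
        coneIntegral ((upperBox a ρ).indicator fun z => ‖fderiv ℝ u z‖ₑ ^ 2) x'
          ((1 / 2 : ℝ) • (y' - x'))) := fun x' y' hx' hy' hd' => by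
    have hn : ‖(1 / 2 : ℝ) • (y' - x')‖ = dist x' y' / 2 := by
      rw [norm_smul, dist_comm, dist_eq_norm, Real.norm_of_nonneg (by norm_num)]; ring
    have hlt : dist x' y' < ρ := by
      have := dist_triangle_right x' y' a
      rw [mem_ball] at hx' hy'
      linarith
    have hpos : 0 < ‖(1 / 2 : ℝ) • (y' - x')‖ := by rw [hn]; positivity
    have h := enorm_sub_sq_le_coneIntegral hu (x := x') (norm_pos_iff.1 hpos)
      (G := (upperBox a ρ).indicator fun z => ‖fderiv ℝ u z‖ₑ ^ 2) fun θ hθ =>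
        indicator_of_mem (mem_upperBox_of_half hx' hpos (by rw [hn]; linarith) hθ) _
    rw [hn, show x' + (1 / 2 : ℝ) • (y' - x') = (1 / 2 : ℝ) • (x' + y') by module] at h
    exact h
  have h4 : ∀ d : ℝ, 0 < d →
      2 * ENNReal.ofReal ((d / 2) ^ 3) * ENNReal.ofReal (d ^ 3)⁻¹ ≤ 1 := fun d hd => by
    rw [← ENNReal.ofReal_ofNat 2, ← ENNReal.ofReal_mul (by norm_num),
      ← ENNReal.ofReal_mul (by positivity)]
    refine ENNReal.ofReal_le_one.2 ?_
    rw [div_pow]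
    field_simp
    norm_num
  have h1 := key x y hx hy hd
  have h2 := key y x hy hx (by rwa [dist_comm])
  rw [add_comm y x, dist_comm y x] at h2
  have h3 := enorm_sub_sq_le (u (x, 0)) (u (y, 0)) (u ((1 / 2 : ℝ) • (x + y), dist x y / 2))
  rw [← enorm_neg (u ((1 / 2 : ℝ) • (x + y), dist x y / 2) - u (y, 0)), neg_sub] at h3
  set I := ∫⁻ θ in Ioc (0 : ℝ) 1, rootWeight θ
  set c₁ := coneIntegral ((upperBox a ρ).indicator fun z => ‖fderiv ℝ u z‖ₑ ^ 2) x
    ((1 / 2 : ℝ) • (y - x))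
  set c₂ := coneIntegral ((upperBox a ρ).indicator fun z => ‖fderiv ℝ u z‖ₑ ^ 2) y
    ((1 / 2 : ℝ) • (x - y))
  calc _ ≤ (2 * (ENNReal.ofReal ((dist x y / 2) ^ 3) * (I * c₁) +
        ENNReal.ofReal ((dist x y / 2) ^ 3) * (I * c₂))) * ENNReal.ofReal (dist x y ^ 3)⁻¹ :=
        mul_le_mul_left (h3.trans (mul_le_mul_right (add_le_add h1 h2) _)) _
    _ = (2 * ENNReal.ofReal ((dist x y / 2) ^ 3) * ENNReal.ofReal (dist x y ^ 3)⁻¹) *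
        (I * (c₁ + c₂)) := by ring
    _ ≤ 1 * (I * (c₁ + c₂)) := by
        refine mul_le_mul_left ?_ _
        exact h4 _ hd
    _ = _ := one_mul _

theorem measurable_coneIntegral_comp {α : Type*} [MeasurableSpace α] {G : E2 × ℝ → ℝ≥0∞}
    (hG : Measurable G) {f g : α → E2} (hf : Measurable f) (hg : Measurable g) :
    Measurable fun a => coneIntegral G (f a) (g a) := by
  have h : Measurable ((fun p : E2 × E2 => coneIntegral G p.1 p.2) ∘ fun a => (f a, g a)) :=
    (measurable_coneIntegral hG).comp (hf.prodMk hg)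
  exact h

theorem lintegral_coneIntegral_half {G : E2 × ℝ → ℝ≥0∞} (hG : Measurable G) :
    ∫⁻ x, ∫⁻ y, coneIntegral G x ((1 / 2 : ℝ) • (y - x)) = 4 * ∫⁻ x, ∫⁻ k, coneIntegral G x k := by
  rw [← lintegral_const_mul' _ _ (by finiteness)]
  refine lintegral_congr fun x => ?_
  have hm : Measurable fun k => coneIntegral G x k :=
    measurable_coneIntegral_comp hG measurable_const measurable_id
  have := lintegral_smul_add_eq (μ := (volume : Measure E2)) (fun k => coneIntegral G x k) hm
    (t := 1 / 2)
    (by norm_num) (-((1 / 2 : ℝ) • x))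
  simp_rw [← sub_eq_add_neg, ← smul_sub] at this
  rw [this, finrank_euclideanSpace_fin]
  norm_num

theorem measurable_coneIntegral_half {G : E2 × ℝ → ℝ≥0∞} (hG : Measurable G) :
    Measurable fun p : E2 × E2 => coneIntegral G p.1 ((1 / 2 : ℝ) • (p.2 - p.1)) :=
  measurable_coneIntegral_comp hG measurable_fst (by fun_prop)

theorem lintegral_coneIntegral_half_add {G : E2 × ℝ → ℝ≥0∞} (hG : Measurable G) :
    ∫⁻ x, ∫⁻ y, (coneIntegral G x ((1 / 2 : ℝ) • (y - x)) +
      coneIntegral G y ((1 / 2 : ℝ) • (x - y))) = 8 * ∫⁻ x, ∫⁻ k, coneIntegral G x k := by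
  have hm1 := measurable_coneIntegral_half hG
  have hm2 : Measurable fun p : E2 × E2 => coneIntegral G p.2 ((1 / 2 : ℝ) • (p.1 - p.2)) :=
    measurable_coneIntegral_comp hG measurable_snd (by fun_prop)
  have h1 : ∀ x, ∫⁻ y, (coneIntegral G x ((1 / 2 : ℝ) • (y - x)) +
      coneIntegral G y ((1 / 2 : ℝ) • (x - y))) =
      (∫⁻ y, coneIntegral G x ((1 / 2 : ℝ) • (y - x))) +
      ∫⁻ y, coneIntegral G y ((1 / 2 : ℝ) • (x - y)) := fun x => by
    have : Measurable fun y => coneIntegral G x ((1 / 2 : ℝ) • (y - x)) :=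
      measurable_coneIntegral_comp hG measurable_const (by fun_prop)
    rw [lintegral_add_left this]
  have h2 : ∫⁻ x, ∫⁻ y, coneIntegral G y ((1 / 2 : ℝ) • (x - y)) =
      ∫⁻ y, ∫⁻ x, coneIntegral G y ((1 / 2 : ℝ) • (x - y)) :=
    lintegral_lintegral_swap hm2.aemeasurable
  simp_rw [h1]
  rw [lintegral_add_left hm1.lintegral_prod_right', lintegral_coneIntegral_half hG,
    h2, lintegral_coneIntegral_half hG, ← add_mul]
  norm_num

theorem exists_lintegral_bottom_seminorm_le : ∃ C : ℝ≥0, ∀ (u : E2 × ℝ → ℝ) (a : E2) (ρ : ℝ),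
    ContDiff ℝ 1 u → ∫⁻ x in ball a (ρ / 2), ∫⁻ y in ball a (ρ / 2),
      ‖u (x, 0) - u (y, 0)‖ₑ ^ 2 * ENNReal.ofReal (dist x y ^ 3)⁻¹ ≤
        C * ∫⁻ z in upperBox a ρ, ‖fderiv ℝ u z‖ₑ ^ 2 := by
  obtain ⟨C, hC⟩ := exists_lintegral_coneIntegral_le
  refine ⟨(∫⁻ θ in Ioc (0 : ℝ) 1, rootWeight θ).toNNReal * (8 * C), fun u a ρ hu => ?_⟩
  have hG : Measurable ((upperBox a ρ).indicator fun z => ‖fderiv ℝ u z‖ₑ ^ 2) :=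
    ((hu.continuous_fderiv one_ne_zero).enorm.measurable.pow_const 2).indicator
      isOpen_upperBox.measurableSet
  have h2 := lintegral_coneIntegral_half_add hG
  have h3 := hC _ hG
  rw [lintegral_indicator isOpen_upperBox.measurableSet] at h3
  calc _ ≤ ∫⁻ x in ball a (ρ / 2), ∫⁻ y in ball a (ρ / 2),
        (∫⁻ θ in Ioc (0 : ℝ) 1, rootWeight θ) *
        (coneIntegral ((upperBox a ρ).indicator fun z => ‖fderiv ℝ u z‖ₑ ^ 2) x
          ((1 / 2 : ℝ) • (y - x)) +
        coneIntegral ((upperBox a ρ).indicator fun z => ‖fderiv ℝ u z‖ₑ ^ 2) y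
          ((1 / 2 : ℝ) • (x - y))) := by
        refine setLIntegral_mono' isOpen_ball.measurableSet fun x hx =>
          setLIntegral_mono' isOpen_ball.measurableSet fun y hy => ?_
        rcases eq_or_ne x y with rfl | hxy
        · simp
        · exact enorm_sub_sq_bottom_le hu hx hy hxy
    _ ≤ ∫⁻ x, ∫⁻ y, (∫⁻ θ in Ioc (0 : ℝ) 1, rootWeight θ) *
        (coneIntegral ((upperBox a ρ).indicator fun z => ‖fderiv ℝ u z‖ₑ ^ 2) x
          ((1 / 2 : ℝ) • (y - x)) +
        coneIntegral ((upperBox a ρ).indicator fun z => ‖fderiv ℝ u z‖ₑ ^ 2) y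
          ((1 / 2 : ℝ) • (x - y))) :=
        (setLIntegral_le_lintegral _ _).trans
          (lintegral_mono fun x => setLIntegral_le_lintegral _ _)
    _ = (∫⁻ θ in Ioc (0 : ℝ) 1, rootWeight θ) * (8 * ∫⁻ x, ∫⁻ k, coneIntegral
        ((upperBox a ρ).indicator fun z => ‖fderiv ℝ u z‖ₑ ^ 2) x k) := by
        simp_rw [lintegral_const_mul' _ _ lintegral_rootWeight_ne_top]
        rw [h2]
    _ ≤ (∫⁻ θ in Ioc (0 : ℝ) 1, rootWeight θ) * (8 * (C *
        ∫⁻ z in upperBox a ρ, ‖fderiv ℝ u z‖ₑ ^ 2)) :=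
        mul_le_mul_right (mul_le_mul_right h3 _) _
    _ = _ := by
        rw [ENNReal.coe_mul, ENNReal.coe_toNNReal lintegral_rootWeight_ne_top, ENNReal.coe_mul,
          mul_assoc, mul_assoc]
        rfl

variable {Ω : Set E3} {Γ : (E2 × ℝ) ≃ₜ E3} {v : E3} {a : E2} {ρ : ℝ} {L : ℝ≥0}

theorem IsBoundaryChart.enorm_diffQuot_sq_le (h : IsBoundaryChart Ω Γ v a ρ L) (φ : E3 → ℝ)
    (x y : E2) : ‖diffQuot φ (Γ (x, 0), Γ (y, 0))‖ₑ ^ 2 ≤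
      ‖(φ ∘ Γ) (x, 0) - (φ ∘ Γ) (y, 0)‖ₑ ^ 2 * ENNReal.ofReal (dist x y ^ 3)⁻¹ := by
  rcases eq_or_ne x y with rfl | hxy
  · simp [diffQuot]
  · have hd := dist_pos.2 hxy
    have h1 := h.dist_le (x, 0) (y, 0)
    rw [enorm_sq_eq, enorm_sq_eq, diffQuot_sq, ← ENNReal.ofReal_mul (sq_nonneg _), div_eq_mul_inv]
    refine ENNReal.ofReal_le_ofReal ?_
    simp only [Function.comp_apply]
    gcongr

theorem IsBoundaryChart.exists_lintegral_diffQuot_le (h : IsBoundaryChart Ω Γ v a ρ L) :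
    ∃ C : ℝ≥0, ∀ φ : E3 → ℝ, ContDiff ℝ 1 φ →
      ∫⁻ p in Γ '' chartBox a (ρ / 2), ∫⁻ q in Γ '' chartBox a (ρ / 2), ‖diffQuot φ (p, q)‖ₑ ^ 2
        ∂surfaceMeasure Ω ∂surfaceMeasure Ω ≤ C * ∫⁻ x in Ω, ‖fderiv ℝ φ x‖ₑ ^ 2 := by
  obtain ⟨C, hC⟩ := exists_lintegral_bottom_seminorm_le
  have hρ := h.pos
  have h' := h.mono (half_pos hρ) (half_le_self hρ.le)
  refine ⟨L ^ 2 * L ^ 2 * (C * L ^ 2), fun φ hφ => ?_⟩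
  have hm : Measurable fun p : E3 × E3 => ‖diffQuot φ p‖ₑ ^ 2 :=
    (measurable_diffQuot hφ.continuous.measurable).enorm.pow_const 2
  have h1 : ∀ p, ∫⁻ q in Γ '' chartBox a (ρ / 2), ‖diffQuot φ (p, q)‖ₑ ^ 2 ∂surfaceMeasure Ω ≤
      (L : ℝ≥0∞) ^ 2 * ∫⁻ y in ball a (ρ / 2), ‖diffQuot φ (p, Γ (y, 0))‖ₑ ^ 2 := fun p =>
    h'.lintegral_surface_le (g := fun q => ‖diffQuot φ (p, q)‖ₑ ^ 2)
      (hm.comp measurable_prodMk_left)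
  have hm2 : Measurable fun z : E3 × E2 => ‖diffQuot φ (z.1, Γ (z.2, 0))‖ₑ ^ 2 :=
    hm.comp (measurable_fst.prodMk (by fun_prop))
  have h2 := h'.lintegral_surface_le
    (g := fun p => (L : ℝ≥0∞) ^ 2 * ∫⁻ y in ball a (ρ / 2), ‖diffQuot φ (p, Γ (y, 0))‖ₑ ^ 2)
    (hm2.lintegral_prod_right'.const_mul _)
  refine (lintegral_mono h1).trans (h2.trans ?_)
  rw [lintegral_const_mul' _ _ (by finiteness), ← mul_assoc, ENNReal.coe_mul, ENNReal.coe_mul,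
    mul_assoc ((L ^ 2 : ℝ≥0) : ℝ≥0∞), mul_assoc]
  have h3 := hC (φ ∘ Γ) a ρ (hφ.comp h.contDiff)
  rw [← mul_assoc ((L : ℝ≥0∞) ^ 2)]
  calc _ ≤ (L : ℝ≥0∞) ^ 2 * L ^ 2 * (C * (L ^ 2 * ∫⁻ x in Ω, ‖fderiv ℝ φ x‖ₑ ^ 2)) := by
        refine mul_le_mul_right (le_trans ?_ (h3.trans
          (mul_le_mul_right (h.lintegral_fderiv_comp_le hφ) _))) _
        exact lintegral_mono fun x => lintegral_mono fun y => h.enorm_diffQuot_sq_le φ x y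
    _ = _ := by push_cast; ring

theorem lintegral_surface_le_sum {ι : Type*} [Fintype ι] {N : ι → Set E3}
    (hN : frontier Ω ⊆ ⋃ i, N i) (g : E3 → ℝ≥0∞) :
    ∫⁻ p, g p ∂surfaceMeasure Ω ≤ ∑ i, ∫⁻ p in N i, g p ∂surfaceMeasure Ω := by
  have h : (surfaceMeasure Ω).restrict (⋃ i, N i) = surfaceMeasure Ω :=
    Measure.restrict_eq_self_of_ae_mem ((ae_mem_frontier Ω).mono hN)
  calc _ = ∫⁻ p in ⋃ i, N i, g p ∂surfaceMeasure Ω := by rw [h]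
    _ ≤ _ := (lintegral_iUnion_le _ _).trans_eq (tsum_fintype _)

theorem exists_lintegral_sq_surface_le (hΩ : IsBoundedC11Domain Ω) :
    ∃ C : ℝ≥0, ∀ φ : E3 → ℝ, ContDiff ℝ 1 φ → ∫⁻ p, ‖φ p‖ₑ ^ 2 ∂surfaceMeasure Ω ≤
      C * ((∫⁻ x in Ω, ‖φ x‖ₑ ^ 2) + ∫⁻ x in Ω, ‖fderiv ℝ φ x‖ₑ ^ 2) := by
  obtain ⟨ι, _, Γ, v, a, ρ, L, h, hcov⟩ := exists_finite_charts hΩ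
  have hcov' : frontier Ω ⊆ ⋃ i, Γ i '' chartBox (a i) (ρ i) :=
    hcov.trans (iUnion_mono fun i => image_mono (chartBox_mono _ (by linarith [(h i).pos])))
  choose C hC using fun i => (h i).exists_lintegral_sq_surface_le
  refine ⟨∑ i, C i, fun φ hφ => (lintegral_surface_le_sum hcov' _).trans ?_⟩
  rw [ENNReal.ofNNReal_finsetSum, Finset.sum_mul]
  exact Finset.sum_le_sum fun i _ => hC i φ hφ

theorem enorm_diffQuot_sq_le_of_le_dist {φ : E3 → ℝ} {r : ℝ} (hr : 0 < r) {p : E3 × E3}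
    (hp : r ≤ dist p.1 p.2) : ‖diffQuot φ p‖ₑ ^ 2 ≤
      ENNReal.ofReal (2 * (r ^ 3)⁻¹) * (‖φ p.1‖ₑ ^ 2 + ‖φ p.2‖ₑ ^ 2) := by
  simp_rw [enorm_sq_eq]
  rw [← ENNReal.ofReal_add (sq_nonneg _) (sq_nonneg _), ← ENNReal.ofReal_mul (by positivity),
    diffQuot_sq]
  refine ENNReal.ofReal_le_ofReal ?_
  calc (φ p.1 - φ p.2) ^ 2 / dist p.1 p.2 ^ 3
      ≤ (2 * (φ p.1 ^ 2 + φ p.2 ^ 2)) / r ^ 3 := by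
        gcongr
        nlinarith [sq_nonneg (φ p.1 + φ p.2)]
    _ = _ := by ring

/-- Pairs closer than the Lebesgue number of the cover lie in a common chart. For the others the
kernel is bounded, so the `L²` norm on the boundary suffices. -/
theorem exists_lintegral_diffQuot_le (hΩ : IsBoundedC11Domain Ω) :
    ∃ C : ℝ≥0, ∀ φ : E3 → ℝ, ContDiff ℝ 1 φ →
      ∫⁻ p, ‖diffQuot φ p‖ₑ ^ 2 ∂(surfaceMeasure Ω).prod (surfaceMeasure Ω) ≤
      C * ((∫⁻ x in Ω, ‖φ x‖ₑ ^ 2) + ∫⁻ x in Ω, ‖fderiv ℝ φ x‖ₑ ^ 2) := by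
  have hfin := isFiniteMeasure_surfaceMeasure hΩ
  obtain ⟨ι, _, Γ, v, a, ρ, L, h, hcov⟩ := exists_finite_charts hΩ
  have hNo : ∀ i, IsOpen (Γ i '' chartBox (a i) (ρ i / 2)) := fun i =>
    (Γ i).isOpenMap _ (isOpen_chartBox (a i) (ρ i / 2))
  obtain ⟨r, hr, hleb⟩ := exists_ball_subset_chart hΩ hNo hcov
  obtain ⟨C₀, hC₀⟩ := exists_lintegral_sq_surface_le hΩ
  choose C hC using fun i => (h i).exists_lintegral_diffQuot_le
  set s := (surfaceMeasure Ω univ).toNNReal with hsdef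
  have hs : (s : ℝ≥0∞) = surfaceMeasure Ω univ := ENNReal.coe_toNNReal (measure_ne_top _ _)
  refine ⟨∑ i, C i + (2 * (r ^ 3)⁻¹).toNNReal * (2 * s * C₀), fun φ hφ => ?_⟩
  set X := ∫⁻ x in Ω, ‖φ x‖ₑ ^ 2
  set Y := ∫⁻ x in Ω, ‖fderiv ℝ φ x‖ₑ ^ 2
  have hm : Measurable fun p : E3 × E3 => ‖diffQuot φ p‖ₑ ^ 2 :=
    (measurable_diffQuot hφ.continuous.measurable).enorm.pow_const 2
  have hmφ : Measurable fun p => ‖φ p‖ₑ ^ 2 := hφ.continuous.enorm.measurable.pow_const 2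
  have hNm : ∀ i, MeasurableSet ((Γ i '' chartBox (a i) (ρ i / 2)) ×ˢ
      (Γ i '' chartBox (a i) (ρ i / 2))) := fun i =>
    (hNo i).measurableSet.prod (hNo i).measurableSet
  have hpt : ∀ᵐ p ∂(surfaceMeasure Ω).prod (surfaceMeasure Ω), ‖diffQuot φ p‖ₑ ^ 2 ≤
      (∑ i, ((Γ i '' chartBox (a i) (ρ i / 2)) ×ˢ (Γ i '' chartBox (a i) (ρ i / 2))).indicator
        (fun p => ‖diffQuot φ p‖ₑ ^ 2) p) +
      ENNReal.ofReal (2 * (r ^ 3)⁻¹) * (‖φ p.1‖ₑ ^ 2 + ‖φ p.2‖ₑ ^ 2) := by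
    filter_upwards [Measure.quasiMeasurePreserving_fst.ae (ae_mem_frontier Ω)] with p hp
    rcases lt_or_ge (dist p.1 p.2) r with hlt | hge
    · obtain ⟨i, hi⟩ := hleb p.1 hp
      have hmem : p ∈ (Γ i '' chartBox (a i) (ρ i / 2)) ×ˢ (Γ i '' chartBox (a i) (ρ i / 2)) :=
        ⟨hi (mem_ball_self hr), hi (by rwa [mem_ball, dist_comm])⟩
      refine le_trans ?_ le_self_add
      refine le_trans (le_of_eq ?_) (Finset.single_le_sum (fun i _ => zero_le)
        (Finset.mem_univ i))
      exact (indicator_of_mem hmem (fun p => ‖diffQuot φ p‖ₑ ^ 2)).symm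
    · exact (enorm_diffQuot_sq_le_of_le_dist hr hge).trans le_add_self
  have h1 : ∀ i, ∫⁻ p, ((Γ i '' chartBox (a i) (ρ i / 2)) ×ˢ
      (Γ i '' chartBox (a i) (ρ i / 2))).indicator (fun p => ‖diffQuot φ p‖ₑ ^ 2) p
        ∂(surfaceMeasure Ω).prod (surfaceMeasure Ω) ≤ C i * Y := fun i => by
    rw [lintegral_indicator (hNm i), ← Measure.prod_restrict, lintegral_prod _ hm.aemeasurable]
    exact hC i φ hφ
  have h2 : ∫⁻ p : E3 × E3, ‖φ p.1‖ₑ ^ 2 + ‖φ p.2‖ₑ ^ 2 ∂(surfaceMeasure Ω).prod (surfaceMeasure Ω)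
      = 2 * s * ∫⁻ p, ‖φ p‖ₑ ^ 2 ∂surfaceMeasure Ω := by
    have hm4 : Measurable fun p : E3 × E3 => ‖φ p.1‖ₑ ^ 2 + ‖φ p.2‖ₑ ^ 2 :=
      (hmφ.comp measurable_fst).add (hmφ.comp measurable_snd)
    rw [lintegral_prod _ hm4.aemeasurable]
    simp only [lintegral_add_left measurable_const, lintegral_const]
    rw [lintegral_add_right _ measurable_const, lintegral_mul_const _ hmφ, lintegral_const, hs]
    ring
  calc _ ≤ _ := lintegral_mono_ae hpt
    _ = (∑ i, ∫⁻ p, ((Γ i '' chartBox (a i) (ρ i / 2)) ×ˢ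
      (Γ i '' chartBox (a i) (ρ i / 2))).indicator (fun p => ‖diffQuot φ p‖ₑ ^ 2) p
        ∂(surfaceMeasure Ω).prod (surfaceMeasure Ω)) + ENNReal.ofReal (2 * (r ^ 3)⁻¹) *
        (2 * s * ∫⁻ p, ‖φ p‖ₑ ^ 2 ∂surfaceMeasure Ω) := by
        rw [lintegral_add_left (Finset.measurable_fun_sum _ fun i _ => hm.indicator (hNm i)),
          lintegral_const_mul' _ _ ENNReal.ofReal_ne_top, h2,
          lintegral_finsetSum _ fun i _ => hm.indicator (hNm i)]
    _ ≤ (∑ i, C i * (X + Y)) + ENNReal.ofReal (2 * (r ^ 3)⁻¹) * (2 * s * (C₀ * (X + Y))) := by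
        refine add_le_add (Finset.sum_le_sum fun i _ => (h1 i).trans
          (mul_le_mul_right le_add_self _)) ?_
        exact mul_le_mul_right (mul_le_mul_right (hC₀ φ hφ) _) _
    _ = _ := by
        rw [← Finset.sum_mul, ENNReal.coe_add, ENNReal.ofNNReal_finsetSum, ENNReal.coe_mul,
          ENNReal.ofReal]
        push_cast
        ring

/-! ### Approximation by functions that are `C¹` up to the boundary -/

theorem exists_cutoff_subset {K U : Set E3} (hK : IsCompact K) (hU : IsOpen U) (hKU : K ⊆ U) :
    ∃ χ : E3 → ℝ, ContDiff ℝ 1 χ ∧ HasCompactSupport χ ∧ tsupport χ ⊆ U ∧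
      (∀ x ∈ K, χ x = 1) ∧ ∀ x, χ x ∈ Icc (0 : ℝ) 1 := by
  obtain ⟨K', hK', h1, h2⟩ := exists_compact_between hK hU hKU
  obtain ⟨f, hf0, hf1, hf⟩ := exists_contMDiffMap_zero_one_of_isClosed (n := 1)
    (modelWithCornersSelf ℝ E3) (isOpen_interior (s := K')).isClosed_compl hK.isClosed
    (disjoint_compl_left_iff_subset.2 h1)
  have hsupp : tsupport f ⊆ K' := by
    refine closure_minimal (fun x hx => ?_) hK'.isClosed
    by_contra hn
    exact hx (hf0 fun h => hn (interior_subset h))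
  exact ⟨f, f.contMDiff.contDiff, HasCompactSupport.of_support_subset_isCompact hK'
    (subset_closure.trans hsupp), hsupp.trans h2, fun x hx => hf1 hx, hf⟩

theorem mem_frontier_of_mem_closure (hΩ : IsOpen Ω) {p : E3} (hp : p ∈ closure Ω) (hn : p ∉ Ω) :
    p ∈ frontier Ω := by rw [hΩ.frontier_eq]; exact ⟨hp, hn⟩

/-- In a chart, subtracting `c • v` raises the height by `c`. The distance `δ` keeps both end points
inside the chart. -/
theorem IsBoundaryChart.exists_step {Γ : (E2 × ℝ) ≃ₜ E3} {v : E3} {a : E2} {ρ : ℝ} {L : ℝ≥0}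
    (hΩ : IsOpen Ω) (h : IsBoundaryChart Ω Γ v a ρ L) {K : Set E3} (hK : IsCompact K)
    (hKN : K ⊆ Γ '' chartBox a ρ) :
    ∃ δ > 0, ∀ p ∈ K, ∀ q ∈ closure Ω, ∀ c : ℝ, 0 ≤ c → dist q p < δ → dist (q - c • v) p < δ →
      q - c • v ∈ closure Ω ∧ (q ∈ Ω ∨ 0 < c → q - c • v ∈ Ω) := by
  obtain ⟨δ, hδ, hs⟩ := hK.exists_thickening_subset_open (Γ.isOpenMap _ (isOpen_chartBox a ρ)) hKN
  refine ⟨δ, hδ, fun p hp q hq c hc h1 h2 => ?_⟩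
  obtain ⟨⟨x, s⟩, hz, rfl⟩ := hs (mem_thickening_iff.2 ⟨p, hp, h1⟩)
  obtain ⟨z', hz', hzz⟩ := hs (mem_thickening_iff.2 ⟨p, hp, h2⟩)
  rw [← h.translate] at hzz ⊢
  have := Γ.injective hzz
  subst this
  have hs0 : 0 ≤ s := by
    by_cases hm : Γ (x, s) ∈ Ω
    · exact ((h.mem_iff _ hz).1 hm).le
    · exact ((h.mem_frontier_iff _ hz).1 (mem_frontier_of_mem_closure hΩ hq hm)).ge
  refine ⟨?_, fun h3 => (h.mem_iff _ hz').2 ?_⟩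
  · rcases (add_nonneg hs0 hc).eq_or_lt with h0 | h0
    · exact frontier_subset_closure ((h.mem_frontier_iff _ hz').2 h0.symm)
    · exact subset_closure ((h.mem_iff _ hz').2 h0)
  · rcases h3 with h3 | h3
    · have := (h.mem_iff _ hz).1 h3
      simp only at this ⊢
      linarith
    · simp only
      linarith

/-- A field pointing into `Ω` along the boundary. -/
theorem exists_inward_field (hΩ : IsBoundedC11Domain Ω) :
    ∃ (V : E3 → E3) (K : ℝ≥0), ContDiff ℝ 1 V ∧ LipschitzWith K V ∧
      ∀ᶠ t in 𝓝[>] (0 : ℝ), ∀ p ∈ closure Ω, p - t • V p ∈ Ω := by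
  obtain ⟨ι, _, Γ, v, a, ρ, L, h, hcov⟩ := exists_finite_charts hΩ
  let C : ι → Set E3 := fun j => Γ j '' (closedBall (a j) (ρ j / 2) ×ˢ Icc (-(ρ j)) (ρ j))
  have hC : ∀ j, IsCompact (C j) := fun j =>
    ((isCompact_closedBall _ _).prod isCompact_Icc).image (Γ j).continuous
  have hCN : ∀ j, C j ⊆ Γ j '' chartBox (a j) (ρ j) := fun j => by
    have := (h j).pos
    refine image_mono (prod_mono (closedBall_subset_ball (by linarith)) fun s hs => ?_)
    exact ⟨by linarith [hs.1], by linarith [hs.2]⟩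
  have hcov' : ∀ p ∈ frontier Ω, ∃ j, p ∈ C j := fun p hp => by
    obtain ⟨j, hj⟩ := mem_iUnion.1 (hcov hp)
    refine ⟨j, image_mono (Set.prod_mono ball_subset_closedBall fun s hs => ?_) hj⟩
    exact ⟨by linarith [hs.1], by linarith [hs.2]⟩
  choose χ hχ hχc hχs hχ1 hχ01 using fun j => exists_cutoff_subset (hC j)
    ((Γ j).isOpenMap _ (isOpen_chartBox (a j) (ρ j))) (hCN j)
  choose δ hδ hstep using fun j => (h j).exists_step hΩ.isOpen (hχc j).isCompact (hχs j)
  have hVd : ContDiff ℝ 1 fun p => ∑ j, χ j p • v j :=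
    ContDiff.sum fun j _ => (hχ j).smul contDiff_const
  have hVc : HasCompactSupport fun p => ∑ j, χ j p • v j := by
    refine HasCompactSupport.of_support_subset_isCompact
      (isCompact_iUnion fun j => (hχc j).isCompact) fun p hp => ?_
    by_contra hn
    refine hp (Finset.sum_eq_zero fun j _ => ?_)
    rw [image_eq_zero_of_notMem_tsupport fun hm => hn (mem_iUnion.2 ⟨j, hm⟩), zero_smul]
  obtain ⟨K, hK⟩ := hVd.lipschitzWith_of_hasCompactSupport hVc one_ne_zero
  refine ⟨_, K, hVd, hK, ?_⟩
  have hsmall : ∀ᶠ t in 𝓝[>] (0 : ℝ), ∀ j, t * ∑ i, ‖v i‖ < δ j := by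
    refine eventually_all.2 fun j => ?_
    have : Tendsto (fun t : ℝ => t * ∑ i, ‖v i‖) (𝓝 0) (𝓝 0) := by
      have hcont : Continuous fun t : ℝ => t * ∑ i, ‖v i‖ := by fun_prop
      simpa using hcont.tendsto 0
    exact nhdsWithin_le_nhds (this.eventually_lt_const (hδ j))
  filter_upwards [hsmall, self_mem_nhdsWithin] with t ht ht0 p hp
  have ht0 : 0 < t := ht0
  have hdist : ∀ s : Finset ι, ∀ j, dist (p - t • ∑ i ∈ s, χ i p • v i) p < δ j := fun s j => by
    refine lt_of_le_of_lt ?_ (ht j)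
    rw [dist_eq_norm, sub_sub_cancel_left, norm_neg, norm_smul, Real.norm_of_nonneg ht0.le]
    gcongr
    refine (norm_sum_le _ _).trans ((Finset.sum_le_sum fun i _ => ?_).trans
      (Finset.sum_le_sum_of_subset_of_nonneg (Finset.subset_univ s) fun _ _ _ => norm_nonneg _))
    rw [norm_smul, Real.norm_of_nonneg (hχ01 i p).1]
    exact mul_le_of_le_one_left (norm_nonneg _) (hχ01 i p).2
  -- The shifts of the charts are carried out one after another. Each keeps the point in the
  -- closure, an active one moves it into `Ω`, and the later ones keep it there.
  have key : ∀ s : Finset ι, p - t • ∑ i ∈ s, χ i p • v i ∈ closure Ω ∧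
      ((p ∈ Ω ∨ ∃ j ∈ s, 0 < χ j p) → p - t • ∑ i ∈ s, χ i p • v i ∈ Ω) := by
    classical
    intro s
    induction s using Finset.induction_on with
    | empty => simpa using hp
    | insert j s hj ih =>
      have heq : p - t • ∑ i ∈ insert j s, χ i p • v i =
          (p - t • ∑ i ∈ s, χ i p • v i) - (t * χ j p) • v j := by
        rw [Finset.sum_insert hj, smul_add, mul_smul]; abel
      by_cases h0 : χ j p = 0
      · rw [heq, h0, mul_zero, zero_smul, sub_zero]
        refine ⟨ih.1, fun h1 => ih.2 (h1.imp_right ?_)⟩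
        rintro ⟨i, hi, hi0⟩
        rcases Finset.mem_insert.1 hi with rfl | hi
        · exact absurd h0 hi0.ne'
        · exact ⟨i, hi, hi0⟩
      · have hpos : 0 < χ j p := lt_of_le_of_ne (hχ01 j p).1 (Ne.symm h0)
        have := hstep j p (subset_tsupport _ h0) _ ih.1 (t * χ j p) (by positivity) (hdist s j)
          (by rw [← heq]; exact hdist _ j)
        rw [heq]
        exact ⟨this.1, fun _ => this.2 (Or.inr (by positivity))⟩
  refine (key Finset.univ).2 ?_
  by_cases hpΩ : p ∈ Ω
  · exact Or.inl hpΩ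
  · obtain ⟨j, hj⟩ := hcov' p (mem_frontier_of_mem_closure hΩ.isOpen hp hpΩ)
    exact Or.inr ⟨j, Finset.mem_univ j, by rw [hχ1 j p hj]; exact one_pos⟩

theorem antilipschitzWith_sub_smul {V : E3 → E3} {K : ℝ≥0} (hV : LipschitzWith K V) {t : ℝ}
    (ht : 0 ≤ t) (htK : t * K ≤ 1 / 2) : AntilipschitzWith 2 fun x => x - t • V x := by
  refine AntilipschitzWith.of_le_mul_dist fun x y => ?_
  have h1 := hV.dist_le_mul x y
  have h2 : dist x y ≤ dist (x - t • V x) (y - t • V y) + t * dist (V x) (V y) := by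
    simp only [dist_eq_norm]
    calc ‖x - y‖ = ‖(x - t • V x - (y - t • V y)) + t • (V x - V y)‖ := by
          rw [smul_sub]; congr 1; abel
      _ ≤ _ := (norm_add_le _ _).trans_eq (by rw [norm_smul, Real.norm_of_nonneg ht])
  have h3 : t * dist (V x) (V y) ≤ 1 / 2 * dist x y := by
    calc _ ≤ t * (K * dist x y) := by gcongr
      _ = t * K * dist x y := by ring
      _ ≤ _ := by gcongr
  push_cast
  linarith

theorem volume_preimage_le_of_antilipschitz {Φ : E3 → E3} (hΦ : AntilipschitzWith 2 Φ)
    (s : Set E3) : volume (Φ ⁻¹' s) ≤ 8 * volume s := by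
  have h := hΦ.hausdorffMeasure_preimage_le (d := (3 : ℕ)) (by positivity) s
  have hv : (volume : Measure E3) = μHE[3] :=
    (EuclideanSpace.euclideanHausdorffMeasure_eq_volume 3).symm
  rw [hv]
  simp_rw [Measure.euclideanHausdorffMeasure_def, Measure.smul_apply, ENNReal.smul_def,
    smul_eq_mul]
  calc _ ≤ _ * (((2 : ℝ≥0) : ℝ≥0∞) ^ ((3 : ℕ) : ℝ) * μH[(3 : ℕ)] s) := by gcongr
    _ = _ := by rw [ENNReal.rpow_natCast]; push_cast; ring

theorem lintegral_comp_le_of_antilipschitz {Φ : E3 → E3} (hc : Continuous Φ)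
    (hΦ : AntilipschitzWith 2 Φ) (hm : MapsTo Φ Ω Ω) (g : E3 → ℝ≥0∞) :
    ∫⁻ x in Ω, g (Φ x) ≤ 8 * ∫⁻ x in Ω, g x := by
  have hle : (volume.restrict Ω).map Φ ≤ (8 : ℝ≥0∞) • volume.restrict Ω := by
    refine Measure.le_iff.2 fun A hA => ?_
    rw [Measure.map_apply hc.measurable hA, Measure.restrict_apply (hc.measurable hA),
      Measure.smul_apply, Measure.restrict_apply hA, smul_eq_mul]
    exact (measure_mono fun x hx => ⟨hx.1, hm hx.2⟩ : _ ≤ volume (Φ ⁻¹' (A ∩ Ω))).trans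
      (volume_preimage_le_of_antilipschitz hΦ _)
  calc _ ≤ ∫⁻ x, g x ∂((volume.restrict Ω).map Φ) := by
        rw [(hc.measurableEmbedding hΦ.injective).lintegral_map]
    _ ≤ ∫⁻ x, g x ∂((8 : ℝ≥0∞) • volume.restrict Ω) := lintegral_mono' hle le_rfl
    _ = _ := by rw [lintegral_smul_measure, smul_eq_mul]

/-- Bounded sequences in `L²` that converge almost everywhere converge weakly. -/
theorem tendsto_integral_inner_of_bounded {μ : Measure E3} [IsFiniteMeasure μ] {b G : E3 → E3}
    {g : ℕ → E3 → E3} {M : ℝ≥0} (hb : MemLp b 2 μ) (hG : MemLp G 2 μ) (hg : ∀ n, MemLp (g n) 2 μ)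
    (hM : ∀ n, eLpNorm (g n) 2 μ ≤ M) (h : ∀ᵐ x ∂μ, Tendsto (fun n => g n x) atTop (𝓝 (G x))) :
    Tendsto (fun n => ∫ x, inner ℝ (b x) (g n x) ∂μ) atTop (𝓝 (∫ x, inner ℝ (b x) (G x) ∂μ)) := by
  have hint : ∀ n, Integrable (fun x => inner ℝ (b x) (g n x)) μ := fun n =>
    integrable_inner_of_memLp hb (hg n)
  refine tendsto_integral_of_L1' _ (integrable_inner_of_memLp hb hG).1 (Eventually.of_forall hint)
    (tendsto_Lp_finite_of_tendsto_ae le_rfl ENNReal.one_ne_top (fun n => (hint n).1)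
      (memLp_one_iff_integrable.2 (integrable_inner_of_memLp hb hG)) ?_ ?_)
  -- Uniform integrability of the products: the mass of `b` on small sets is small, and the `g n`
  -- are bounded in `L²`.
  · intro ε hε
    obtain ⟨δ, hδ, hδs⟩ := hb.eLpNorm_indicator_le one_le_two ENNReal.ofNat_ne_top
      (ε := ε / (M + 1)) (by positivity)
    refine ⟨δ, hδ, fun n s hs hμ => ?_⟩
    have h1 : s.indicator (fun x => (inner ℝ (b x) (g n x) : ℝ)) =
        fun x => inner ℝ (s.indicator b x) (g n x) := by
      funext x
      by_cases hx : x ∈ s <;> simp [hx]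
    rw [h1]
    have h2 := eLpNorm_le_eLpNorm_mul_eLpNorm'_of_norm (p := 2) (q := 2) (r := 1) (μ := μ)
      (hb.1.indicator hs) (hg n).1 (fun x y => (inner ℝ x y : ℝ)) 1
      (Eventually.of_forall fun x => by simpa using norm_inner_le_norm (𝕜 := ℝ) _ _)
    refine h2.trans ?_
    rw [ENNReal.coe_one, one_mul]
    calc _ ≤ ENNReal.ofReal (ε / (M + 1)) * M := by gcongr; exacts [hδs s hs hμ, hM n]
      _ = ENNReal.ofReal (ε / (M + 1) * M) := by
        rw [ENNReal.ofReal_mul (by positivity), ENNReal.ofReal_coe_nnreal]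
      _ ≤ _ := by
        refine ENNReal.ofReal_le_ofReal ?_
        rw [div_mul_eq_mul_div, div_le_iff₀ (by positivity)]
        nlinarith [NNReal.coe_nonneg M]
  · filter_upwards [h] with x hx
    exact (tendsto_const_nhds (x := b x)).inner hx

theorem contDiff_mul_of_tsupport_subset {χ f : E3 → ℝ} {U : Set E3} (hU : IsOpen U)
    (hχ : ContDiff ℝ 1 χ) (hf : ContDiffOn ℝ 1 f U) (hs : tsupport χ ⊆ U) :
    ContDiff ℝ 1 fun x => χ x * f x := by
  refine contDiff_iff_contDiffAt.2 fun x => ?_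
  by_cases hx : x ∈ tsupport χ
  · exact hχ.contDiffAt.mul (hf.contDiffAt (hU.mem_nhds (hs hx)))
  · refine (contDiffAt_const (c := (0 : ℝ))).congr_of_eventuallyEq ?_
    filter_upwards [(isClosed_tsupport χ).isOpen_compl.mem_nhds hx] with y hy
    rw [image_eq_zero_of_notMem_tsupport hy, zero_mul]

theorem enorm_sq_eq_ofReal_norm {F : Type*} [NormedAddCommGroup F] (a : F) :
    ‖a‖ₑ ^ 2 = ENNReal.ofReal (‖a‖ ^ 2) := by
  rw [← ofReal_norm, ENNReal.ofReal_pow (norm_nonneg _)]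

/-- Composed with the shift, `f` is read off strictly inside `Ω`, so the composition is `C¹` near
the closure and a cut-off makes it global. The constant is `32 = 4 * 8`: the derivative of the shift
has norm at most `2`, and preimages under the shift have at most `8` times the volume. -/
theorem exists_shifted_extension (hΩo : IsOpen Ω) (hb : Bornology.IsBounded Ω) {V : E3 → E3}
    {K : ℝ≥0} (hV : ContDiff ℝ 1 V) (hVK : LipschitzWith K V) {t : ℝ} (ht : 0 ≤ t)
    (htK : t * K ≤ 1 / 2) (hmaps : ∀ p ∈ closure Ω, p - t • V p ∈ Ω) {f : E3 → ℝ}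
    (hf : ContDiffOn ℝ 1 f Ω) : ∃ φ : E3 → ℝ, ContDiff ℝ 1 φ ∧ HasCompactSupport φ ∧
      (∫⁻ x in Ω, ‖φ x‖ₑ ^ 2 ≤ 32 * ∫⁻ x in Ω, ‖f x‖ₑ ^ 2) ∧
      (∫⁻ x in Ω, ‖fderiv ℝ φ x‖ₑ ^ 2 ≤ 32 * ∫⁻ x in Ω, ‖fderiv ℝ f x‖ₑ ^ 2) ∧
      ∀ x ∈ Ω, fderiv ℝ φ x = (fderiv ℝ f (x - t • V x)).comp
        (ContinuousLinearMap.id ℝ E3 - t • fderiv ℝ V x) := by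
  have hΦ : ContDiff ℝ 1 fun x => x - t • V x := by fun_prop
  have hanti := antilipschitzWith_sub_smul hVK ht htK
  set Φ : E3 → E3 := fun x => x - t • V x with hΦdef
  have hU : IsOpen (Φ ⁻¹' Ω) := hΩo.preimage hΦ.continuous
  obtain ⟨χ, hχ, hχc, hχs, hχ1, -⟩ := exists_cutoff_subset hb.isCompact_closure hU hmaps
  have hfΦ : ContDiffOn ℝ 1 (fun x => f (Φ x)) (Φ ⁻¹' Ω) :=
    hf.comp hΦ.contDiffOn fun x hx => hx
  have hmΩ : MapsTo Φ Ω Ω := fun x hx => hmaps x (subset_closure hx)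
  have heq : ∀ x ∈ Ω, χ x * f (Φ x) = f (Φ x) := fun x hx => by
    rw [hχ1 x (subset_closure hx), one_mul]
  have hder : ∀ x ∈ Ω, fderiv ℝ (fun x => χ x * f (Φ x)) x = (fderiv ℝ f (Φ x)).comp
      (ContinuousLinearMap.id ℝ E3 - t • fderiv ℝ V x) := fun x hx => by
    have h1 : (fun x => χ x * f (Φ x)) =ᶠ[𝓝 x] f ∘ Φ := by
      filter_upwards [hΩo.mem_nhds hx] with y hy using heq y hy
    have h2 : HasFDerivAt Φ (ContinuousLinearMap.id ℝ E3 - t • fderiv ℝ V x) x :=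
      (hasFDerivAt_id x).sub ((hV.differentiable one_ne_zero x).hasFDerivAt.const_smul t)
    have h3 : HasFDerivAt f (fderiv ℝ f (Φ x)) (Φ x) :=
      ((hf.contDiffAt (hΩo.mem_nhds (hmΩ hx))).differentiableAt one_ne_zero).hasFDerivAt
    rw [h1.fderiv_eq, (h3.comp x h2).fderiv]
  refine ⟨fun x => χ x * f (Φ x), contDiff_mul_of_tsupport_subset hU hχ hfΦ hχs, hχc.mul_right,
    ?_, ?_, hder⟩
  · calc _ = ∫⁻ x in Ω, ‖f (Φ x)‖ₑ ^ 2 :=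
          setLIntegral_congr_fun hΩo.measurableSet fun x hx => by simp only [heq x hx]
      _ ≤ 8 * ∫⁻ x in Ω, ‖f x‖ₑ ^ 2 :=
          lintegral_comp_le_of_antilipschitz hΦ.continuous hanti hmΩ fun y => ‖f y‖ₑ ^ 2
      _ ≤ _ := by gcongr; norm_num
  · calc _ ≤ ∫⁻ x in Ω, 4 * ‖fderiv ℝ f (Φ x)‖ₑ ^ 2 := by
          refine setLIntegral_mono' hΩo.measurableSet fun x hx => ?_
          rw [hder x hx, enorm_sq_eq_ofReal_norm, enorm_sq_eq_ofReal_norm, ← ENNReal.ofReal_ofNat 4,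
            ← ENNReal.ofReal_mul (by norm_num)]
          refine ENNReal.ofReal_le_ofReal ?_
          have h1 : ‖ContinuousLinearMap.id ℝ E3 - t • fderiv ℝ V x‖ ≤ 2 := by
            refine (norm_sub_le _ _).trans ?_
            have h2 : ‖t • fderiv ℝ V x‖ ≤ 1 / 2 := by
              rw [norm_smul, Real.norm_of_nonneg ht]
              exact (mul_le_mul_of_nonneg_left (norm_fderiv_le_of_lipschitz ℝ hVK) ht).trans htK
            linarith [ContinuousLinearMap.norm_id_le (𝕜 := ℝ) (E := E3)]
          calc _ ≤ (‖fderiv ℝ f (Φ x)‖ * 2) ^ 2 := by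
                gcongr
                exact (ContinuousLinearMap.opNorm_comp_le _ _).trans (by gcongr)
            _ = _ := by ring
      _ = 4 * ∫⁻ x in Ω, ‖fderiv ℝ f (Φ x)‖ₑ ^ 2 := lintegral_const_mul' _ _ (by simp)
      _ ≤ 4 * (8 * ∫⁻ x in Ω, ‖fderiv ℝ f x‖ₑ ^ 2) := by
          gcongr
          exact lintegral_comp_le_of_antilipschitz hΦ.continuous hanti hmΩ
            fun y => ‖fderiv ℝ f y‖ₑ ^ 2
      _ = _ := by rw [← mul_assoc]; norm_num

theorem exists_contDiff_approx (hΩ : IsBoundedC11Domain Ω) {f : E3 → ℝ}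
    (hf : ContDiffOn ℝ 1 f Ω) : ∃ φ : ℕ → E3 → ℝ, ∀ n, ContDiff ℝ 1 (φ n) ∧
      HasCompactSupport (φ n) ∧
      (∫⁻ x in Ω, ‖φ n x‖ₑ ^ 2 ≤ 32 * ∫⁻ x in Ω, ‖f x‖ₑ ^ 2) ∧
      (∫⁻ x in Ω, ‖fderiv ℝ (φ n) x‖ₑ ^ 2 ≤ 32 * ∫⁻ x in Ω, ‖fderiv ℝ f x‖ₑ ^ 2) ∧
      ∀ x ∈ Ω, Tendsto (fun n => fderiv ℝ (φ n) x) atTop (𝓝 (fderiv ℝ f x)) := by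
  obtain ⟨V, K, hV, hVK, hmaps⟩ := exists_inward_field hΩ
  have hK : ∀ᶠ t : ℝ in 𝓝[>] 0, t * K ≤ 1 / 2 := by
    have hcont : Continuous fun t : ℝ => t * (K : ℝ) := by fun_prop
    have : Tendsto (fun t : ℝ => t * (K : ℝ)) (𝓝 0) (𝓝 0) := by simpa using hcont.tendsto 0
    exact nhdsWithin_le_nhds (this.eventually_le_const (by norm_num))
  have hex : ∀ᶠ t : ℝ in 𝓝[>] 0, 0 < t ∧ t * K ≤ 1 / 2 ∧ ∀ p ∈ closure Ω, p - t • V p ∈ Ω := by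
    filter_upwards [self_mem_nhdsWithin, hK, hmaps] with t h1 h2 h3 using ⟨h1, h2, h3⟩
  obtain ⟨t, ht0, ht⟩ := exists_seq_forall_of_frequently hex.frequently
  choose φ h1 h2 h3 h4 h5 using fun n => exists_shifted_extension hΩ.isOpen hΩ.isBounded hV hVK
    (ht n).1.le (ht n).2.1 (ht n).2.2 hf
  refine ⟨φ, fun n => ⟨h1 n, h2 n, h3 n, h4 n, fun x hx => ?_⟩⟩
  have ht0' : Tendsto t atTop (𝓝 0) := ht0.mono_right nhdsWithin_le_nhds
  simp_rw [h5 _ x hx]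
  have hx1 : Tendsto (fun n => x - t n • V x) atTop (𝓝 x) := by
    simpa using tendsto_const_nhds.sub (ht0'.smul_const (V x)) (a := x)
  have hcont : ContinuousAt (fderiv ℝ f) x :=
    (hf.continuousOn_fderiv_of_isOpen hΩ.isOpen le_rfl).continuousAt (hΩ.isOpen.mem_nhds hx)
  have h6 : Tendsto (fun n => ContinuousLinearMap.id ℝ E3 - t n • fderiv ℝ V x) atTop
      (𝓝 (ContinuousLinearMap.id ℝ E3)) := by
    have h0 : ContinuousLinearMap.id ℝ E3 - (0 : ℝ) • fderiv ℝ V x =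
        ContinuousLinearMap.id ℝ E3 := by ext1 y; simp
    have h := (tendsto_const_nhds (x := ContinuousLinearMap.id ℝ E3)).sub
      (ht0'.smul_const (fderiv ℝ V x))
    rwa [h0] at h
  have h7 : Tendsto (fun n => fderiv ℝ f (x - t n • V x)) atTop (𝓝 (fderiv ℝ f x)) :=
    hcont.tendsto.comp hx1
  have h8 := (isBoundedBilinearMap_comp (𝕜 := ℝ) (E := E3) (F := E3)
    (G := ℝ)).continuous.tendsto (fderiv ℝ f x, ContinuousLinearMap.id ℝ E3)
  exact h8.comp (h7.prodMk_nhds h6)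

/-! ### Gradients are controlled by their normal trace -/

theorem enorm_L2_sq {α F : Type*} [MeasurableSpace α] [NormedAddCommGroup F] {μ : Measure α}
    (u : Lp F 2 μ) : ENNReal.ofReal (‖u‖ ^ 2) = ∫⁻ x, ‖u x‖ₑ ^ 2 ∂μ := by
  rw [← enorm_sq_eq_ofReal_norm, Lp.enorm_def, eLpNorm_two_sq]

theorem exists_norm_restriction_le (hΩ : IsBoundedC11Domain Ω) :
    ∃ C : ℝ≥0, ∀ φ : E3 → ℝ, ContDiff ℝ 1 φ → HasCompactSupport φ →
      ∃ w : halfSobolev Ω, IsRestriction Ω φ w ∧ ENNReal.ofReal (‖w‖ ^ 2) ≤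
        C * ((∫⁻ x in Ω, ‖φ x‖ₑ ^ 2) + ∫⁻ x in Ω, ‖fderiv ℝ φ x‖ₑ ^ 2) := by
  obtain ⟨C₁, h₁⟩ := exists_lintegral_sq_surface_le hΩ
  obtain ⟨C₂, h₂⟩ := exists_lintegral_diffQuot_le hΩ
  refine ⟨C₁ + C₂, fun φ hφ hc => ?_⟩
  obtain ⟨K, hK⟩ := exists_lipschitzWith hφ hc
  refine ⟨⟨lipPair hΩ hK, lipPair_mem hΩ hK⟩, lipPair_fst hΩ hK, ?_⟩
  rw [Submodule.coe_norm, halfSobolev_norm_sq, ENNReal.ofReal_add (sq_nonneg _) (sq_nonneg _),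
    enorm_L2_sq, enorm_L2_sq, ENNReal.coe_add, add_mul]
  refine add_le_add (le_of_eq_of_le (lintegral_congr_ae ?_) (h₁ φ hφ))
    (le_of_eq_of_le (lintegral_congr_ae ?_) (h₂ φ hφ))
  · filter_upwards [lipPair_fst hΩ hK] with x hx
    rw [hx]
  · filter_upwards [lipPair_snd hΩ hK] with x hx
    rw [hx]

/-- For `f` that is `C¹` up to the boundary, `‖B‖² = T f ≤ ‖T‖ ‖f‖`, and the trace theorem with
Poincaré bounds `‖f‖` by a multiple of `‖B‖`. In general `f` is replaced by its shifted
approximations, whose norms are uniformly bounded and whose gradients converge pointwise; this gives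
weak convergence, which is enough. -/
theorem exists_norm_le_of_gradient (hΩ : IsBoundedC11Domain Ω) :
    ∃ c : ℝ, 0 < c ∧ ∀ B ∈ harmonicFields Ω, ∀ T : negHalfSobolev Ω, IsNormalTrace Ω B T →
      ∀ f : E3 → ℝ, ContDiffOn ℝ 1 f Ω → B =ᵐ[volume.restrict Ω] gradient f →
        ‖B‖ ≤ c * ‖T‖ := by
  have hfin := isFiniteMeasure_restrict hΩ.isBounded
  obtain ⟨Cp, hCp⟩ := hasPoincare_domain hΩ
  obtain ⟨Ct, hCt⟩ := exists_norm_restriction_le hΩ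
  -- `Ct` comes from the trace theorem, `Cp` from Poincaré and `32` from the shift.
  set D : ℝ := Ct * (32 * Cp + 32) with hD
  have hD0 : 0 ≤ D := by positivity
  refine ⟨√D + 1, by positivity, fun B hB T hT f₀ hf₀ hBf₀ => ?_⟩
  obtain ⟨a, ha⟩ := hCp f₀ hf₀
  obtain ⟨f, hf, hBf, hfa⟩ : ∃ f : E3 → ℝ, ContDiffOn ℝ 1 f Ω ∧
      B =ᵐ[volume.restrict Ω] gradient f ∧
      ∫⁻ x in Ω, ‖f x‖ₑ ^ 2 ≤ Cp * ∫⁻ x in Ω, ‖fderiv ℝ f x‖ₑ ^ 2 := by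
    have hfd : fderiv ℝ (fun x => f₀ x - a) = fderiv ℝ f₀ := by
      funext x; rw [fderiv_sub_const]
    refine ⟨fun x => f₀ x - a, hf₀.sub contDiffOn_const, ?_, ?_⟩
    · have : gradient (fun x => f₀ x - a) = gradient f₀ := by
        funext x; rw [gradient, hfd, gradient]
      rwa [this]
    · simpa only [hfd] using ha
  have hE : ∫⁻ x in Ω, ‖fderiv ℝ f x‖ₑ ^ 2 = ENNReal.ofReal (‖B‖ ^ 2) := by
    rw [enorm_L2_sq]
    refine lintegral_congr_ae ?_
    filter_upwards [hBf] with x hx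
    rw [hx, enorm_sq_eq_ofReal_norm, enorm_sq_eq_ofReal_norm, norm_gradient_eq]
  rw [hE] at hfa
  obtain ⟨φ, hφ⟩ := exists_contDiff_approx hΩ hf
  choose w hw hwn using fun n => hCt (φ n) (hφ n).1 (hφ n).2.1
  have hgn : ∀ n, ∫⁻ x in Ω, ‖fderiv ℝ (φ n) x‖ₑ ^ 2 ≤ ENNReal.ofReal (32 * ‖B‖ ^ 2) := fun n => by
    refine (hφ n).2.2.2.1.trans_eq ?_
    rw [hE, ENNReal.ofReal_mul (by norm_num), ENNReal.ofReal_ofNat]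
  have hwle : ∀ n, ‖w n‖ ≤ √D * ‖B‖ := fun n => by
    rw [← Real.sqrt_sq (norm_nonneg B), ← Real.sqrt_mul hD0]
    refine Real.le_sqrt_of_sq_le ((ENNReal.ofReal_le_ofReal_iff (by positivity)).1 ?_)
    calc _ ≤ _ := hwn n
      _ ≤ Ct * (32 * (Cp * ENNReal.ofReal (‖B‖ ^ 2)) + 32 * ENNReal.ofReal (‖B‖ ^ 2)) := by
        gcongr
        · exact (hφ n).2.2.1.trans (by gcongr)
        · exact (hφ n).2.2.2.1.trans_eq (by rw [hE])
      _ = _ := by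
        rw [hD, ENNReal.ofReal_mul (by positivity), ENNReal.ofReal_mul (by positivity),
          ENNReal.ofReal_add (by positivity) (by positivity),
          ENNReal.ofReal_mul (by norm_num), ENNReal.ofReal_coe_nnreal, ENNReal.ofReal_coe_nnreal,
          ENNReal.ofReal_ofNat]
        ring
  have hTle : ∀ n, ∫ x in Ω, inner ℝ (B x) (gradient (φ n) x) ≤ ‖T‖ * (√D * ‖B‖) := fun n => by
    rw [← (isNormalTrace_iff hΩ hB).1 hT (φ n) (hφ n).1 (hφ n).2.1 (w n) (hw n)]
    refine (le_abs_self _).trans ((T.le_opNorm (w n)).trans ?_)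
    gcongr
    exact hwle n
  have hlim : Tendsto (fun n => ∫ x in Ω, inner ℝ (B x) (gradient (φ n) x)) atTop
      (𝓝 (∫ x in Ω, inner ℝ (B x) (B x))) := by
    refine tendsto_integral_inner_of_bounded (M := Real.toNNReal (√32 * ‖B‖)) (Lp.memLp B)
      (Lp.memLp B) (fun n => (continuous_gradient (hφ n).1).memLp_of_hasCompactSupport
        (hasCompactSupport_gradient (hφ n).2.1)) (fun n => ?_) ?_
    · refine (ENNReal.pow_le_pow_left_iff two_ne_zero).1 ?_
      rw [eLpNorm_two_sq]
      calc _ = ∫⁻ x in Ω, ‖fderiv ℝ (φ n) x‖ₑ ^ 2 := lintegral_congr fun x => by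
            rw [enorm_sq_eq_ofReal_norm, enorm_sq_eq_ofReal_norm, norm_gradient_eq]
        _ ≤ _ := hgn n
        _ = _ := by
          change _ = ENNReal.ofReal (√32 * ‖B‖) ^ 2
          rw [← ENNReal.ofReal_pow (by positivity), mul_pow, Real.sq_sqrt (by norm_num)]
    · filter_upwards [hBf, ae_restrict_mem hΩ.isOpen.measurableSet] with x hx hxΩ
      rw [hx]
      -- The convergence clause does not depend on the index under which it is stored, so `0` is an
      -- arbitrary choice.
      exact ((InnerProductSpace.toDual ℝ E3).symm.continuous.tendsto _).comp
        ((hφ 0).2.2.2.2 x hxΩ)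
  have hsq : ‖B‖ ^ 2 ≤ ‖T‖ * (√D * ‖B‖) := by
    rw [← real_inner_self_eq_norm_sq, L2.inner_def]
    exact le_of_tendsto' hlim hTle
  rcases (norm_nonneg B).eq_or_lt with h0 | h0
  · rw [← h0]; positivity
  · have : ‖B‖ * ‖B‖ ≤ √D * ‖T‖ * ‖B‖ := by nlinarith
    have := le_of_mul_le_mul_right this h0
    nlinarith [norm_nonneg T]

/-- A weak potential of a divergence-free field is weakly harmonic, hence smooth by Weyl's lemma.
The fundamental lemma then identifies its classical gradient with the smooth representative of `B`.
-/
theorem exists_gradient_of_exact (hΩ : IsOpen Ω) (hb : Bornology.IsBounded Ω) {B : L2Field Ω}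
    (hB : B ∈ exactHarmonicFields Ω) :
    ∃ f : E3 → ℝ, ContDiffOn ℝ 1 f Ω ∧ B =ᵐ[volume.restrict Ω] gradient f := by
  obtain ⟨hB, f, hf⟩ := hB
  have hfin := isFiniteMeasure_restrict hb
  have hint : ∀ φ : E3 → ℝ, IsTestFunction Ω φ →
      IntegrableOn (fun x => f x * φ x) Ω := fun φ hφ =>
    (Lp.memLp f).integrable_mul (q := 2) (hφ.1.continuous.memLp_of_hasCompactSupport hφ.2.1)
  have hharm : IsWeaklyHarmonic Ω f := fun φ hφ => by
    have h1 : ∫ x in Ω, f x * laplacian φ x =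
        ∑ i, ∫ x in Ω, f x * partialDeriv i (partialDeriv i φ) x := by
      simp_rw [laplacian, Finset.mul_sum]
      exact integral_finsetSum _ fun i _ => hint _ ((hφ.partialDeriv i).partialDeriv i)
    have h2 := integral_inner_gradient_eq_zero hB.1 hφ
    have h3 : ∫ x in Ω, inner ℝ (B x) (gradient φ x) =
        ∑ i, ∫ x in Ω, B x i * partialDeriv i φ x := by
      refine Eq.trans ?_ (integral_finsetSum Finset.univ fun i _ =>
        (memLp_coord B i).integrable_mul (q := 2) ((hφ.partialDeriv
          i).1.continuous.memLp_of_hasCompactSupport (hφ.partialDeriv i).2.1))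
      refine integral_congr_ae (Eventually.of_forall fun x => ?_)
      simp only [PiLp.inner_apply, gradient_apply]
      exact Finset.sum_congr rfl fun i _ => mul_comm _ _
    rw [h1, Finset.sum_congr rfl fun i _ => hf _ (hφ.partialDeriv i) i, Finset.sum_neg_distrib,
      ← h3, h2, neg_zero]
  obtain ⟨f', hf', hff', -⟩ := hharm.exists_smooth hΩ hb (Lp.memLp f)
  obtain ⟨B', hB', hBB', -⟩ := exists_smooth_rep hΩ hb hB
  have hf1 : ContDiffOn ℝ 1 f' Ω := hf'.of_le (by simp)
  refine ⟨f', hf1, ?_⟩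
  have key : ∀ i, ∀ x ∈ Ω, partialDeriv i f' x - B' x i = 0 := fun i => by
    have hcont : ContinuousOn (partialDeriv i f') Ω :=
      (hf1.continuousOn_fderiv_of_isOpen hΩ le_rfl).clm_apply continuousOn_const
    refine eq_zero_of_integral_testFunction hΩ
      (hcont.sub (contDiffOn_coord hB' i).continuousOn) fun φ hφ => ?_
    have h1 := integral_mul_fderiv_eq_neg hΩ hf1 (hφ.1.of_le (by simp)) hφ.2.1 hφ.2.2
      (EuclideanSpace.single i 1)
    have h2 : ∫ x in Ω, f' x * partialDeriv i φ x = ∫ x in Ω, f x * partialDeriv i φ x := by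
      refine integral_congr_ae ?_
      filter_upwards [hff'] with x hx
      rw [hx]
    have h3 : ∫ x in Ω, B x i * φ x = ∫ x in Ω, B' x i * φ x := by
      refine integral_congr_ae ?_
      filter_upwards [hBB'] with x hx
      rw [hx]
    have h4 : ∫ x in Ω, partialDeriv i f' x * φ x = ∫ x in Ω, B' x i * φ x := by
      have := h1.symm.trans (h2.trans (hf φ hφ i))
      rw [h3] at this
      exact neg_injective this
    simp_rw [sub_mul]
    rw [integral_sub (integrable_mul_of_tsupport_subset hΩ hcont hφ.1.continuous hφ.2.1
      hφ.2.2).integrableOn (integrable_mul_of_tsupport_subset hΩ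
      (contDiffOn_coord hB' i).continuousOn hφ.1.continuous hφ.2.1 hφ.2.2).integrableOn, h4,
      sub_self]
  filter_upwards [hBB', ae_restrict_mem hΩ.measurableSet] with x hx hxΩ
  rw [hx]
  ext i
  rw [gradient_apply]
  linarith [key i x hxΩ]

/-! ### Line integrals and potentials along maps -/

/-- The line integral of `B` along the segment from `p` to `q`. -/
def segmentIntegral (B : E3 → E3) (p q : E3) : ℝ :=
  ∫ t in (0 : ℝ)..1, inner ℝ (B (p + t • (q - p))) (q - p)

theorem segmentIntegral_self (B : E3 → E3) (p : E3) : segmentIntegral B p p = 0 := by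
  simp [segmentIntegral]

/-- `B` is continuous on `Ω` and has a potential on each ball in `Ω`. -/
def HasLocalPotentials (Ω : Set E3) (B : E3 → E3) : Prop :=
  ContinuousOn B Ω ∧ ∀ p δ, ball p δ ⊆ Ω →
    ∃ f : E3 → ℝ, ∀ q ∈ ball p δ, HasFDerivAt f (innerSL ℝ (B q)) q

/-- The Poincaré lemma on balls: a symmetric derivative means that the one-form given by `B` is
closed. -/
theorem hasLocalPotentials_of_symmetric {Ω : Set E3} (hΩ : IsOpen Ω) {B : E3 → E3}
    (hB : ContDiffOn ℝ ∞ B Ω)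
    (hs : ∀ x ∈ Ω, ∀ u v, inner ℝ (fderiv ℝ B x u) v = inner ℝ (fderiv ℝ B x v) u) :
    HasLocalPotentials Ω B := by
  refine ⟨hB.continuousOn, fun p δ hp => ?_⟩
  have hd : ∀ q ∈ Ω, DifferentiableAt ℝ B q := fun q hq =>
    (hB.contDiffAt (hΩ.mem_nhds hq)).differentiableAt (by simp)
  have hω : ∀ q ∈ Ω, HasFDerivAt (fun q => innerSL ℝ (B q)) ((innerSL ℝ).comp (fderiv ℝ B q)) q :=
    fun q hq => (innerSL ℝ (E := E3)).hasFDerivAt.comp q (hd q hq).hasFDerivAt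
  refine (convex_ball p δ).exists_forall_hasFDerivAt_of_fderiv_symmetric isOpen_ball
    (fun q hq => (hω q (hp hq)).differentiableAt.differentiableWithinAt) fun q hq u v => ?_
  rw [(hω q (hp hq)).fderiv]
  exact hs q (hp hq) u v

theorem segmentIntegral_eq_sub {Ω : Set E3} {B : E3 → E3} {f : E3 → ℝ} {p : E3} {δ : ℝ}
    (hB : ContinuousOn B Ω) (hp : ball p δ ⊆ Ω)
    (hf : ∀ q ∈ ball p δ, HasFDerivAt f (innerSL ℝ (B q)) q) {q r : E3} (hq : q ∈ ball p δ)
    (hr : r ∈ ball p δ) : segmentIntegral B q r = f r - f q := by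
  have hmem : ∀ t ∈ Icc (0 : ℝ) 1, q + t • (r - q) ∈ ball p δ := fun t ht =>
    (convex_ball p δ).add_smul_sub_mem hq hr ht
  have hline : ∀ t : ℝ, HasDerivAt (fun t : ℝ => q + t • (r - q)) (r - q) t := fun t => by
    simpa using ((hasDerivAt_id t).smul_const (r - q)).const_add q
  have hder : ∀ t ∈ uIcc (0 : ℝ) 1, HasDerivAt (fun t : ℝ => f (q + t • (r - q)))
      (inner ℝ (B (q + t • (r - q))) (r - q)) t := fun t ht => by
    rw [uIcc_of_le zero_le_one] at ht
    exact (hf _ (hmem t ht)).comp_hasDerivAt t (hline t)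
  have hcont : ContinuousOn (fun t : ℝ => (inner ℝ (B (q + t • (r - q))) (r - q) : ℝ))
      (uIcc 0 1) := by
    rw [uIcc_of_le zero_le_one]
    refine ContinuousOn.inner (𝕜 := ℝ) ?_ continuousOn_const
    exact hB.comp (by fun_prop) fun t ht => hp (hmem t ht)
  rw [segmentIntegral, intervalIntegral.integral_eq_sub_of_hasDerivAt hder
    hcont.intervalIntegrable]
  simp

theorem HasLocalPotentials.segmentIntegral_add {Ω : Set E3} {B : E3 → E3}
    (hB : HasLocalPotentials Ω B) {p q r s : E3} {δ : ℝ} (hp : ball p δ ⊆ Ω)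
    (hq : q ∈ ball p δ) (hr : r ∈ ball p δ) (hs : s ∈ ball p δ) :
    segmentIntegral B q r + segmentIntegral B r s = segmentIntegral B q s := by
  obtain ⟨f, hf⟩ := hB.2 p δ hp
  rw [segmentIntegral_eq_sub hB.1 hp hf hq hr, segmentIntegral_eq_sub hB.1 hp hf hr hs,
    segmentIntegral_eq_sub hB.1 hp hf hq hs]
  ring

/-- `g` is a potential of `B` along the map `u`. -/
def IsPotentialAlong {X : Type*} [TopologicalSpace X] (B : E3 → E3) (u : X → E3) (g : X → ℝ) :
    Prop :=
  ∀ x, ∀ᶠ y in 𝓝 x, g y - g x = segmentIntegral B (u x) (u y)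

section

variable {X Y : Type*} [TopologicalSpace X] [TopologicalSpace Y] {B : E3 → E3} {u : X → E3}
  {g g' : X → ℝ}

theorem IsPotentialAlong.comp (h : IsPotentialAlong B u g) {φ : Y → X} (hφ : Continuous φ) :
    IsPotentialAlong B (u ∘ φ) (g ∘ φ) :=
  fun y => (hφ.tendsto y).eventually (h (φ y))

/-- Both functions have the same local increments, so their difference is locally constant. -/
theorem IsPotentialAlong.sub_eq_sub [PreconnectedSpace X] (h : IsPotentialAlong B u g)
    (h' : IsPotentialAlong B u g') (x y : X) : g y - g' y = g x - g' x := by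
  have hl : IsLocallyConstant fun x => g x - g' x := by
    refine (IsLocallyConstant.iff_eventually_eq _).2 fun x => ?_
    filter_upwards [h x, h' x] with y h1 h2
    linarith
  exact hl.apply_eq_of_preconnectedSpace y x

end

section

variable {X : Type*} [NormedAddCommGroup X] [NormedSpace ℝ X] [ProperSpace X] {Ω : Set E3}
  {B : E3 → E3} {u : X → E3}

/-- Sum the segment integrals through the images of the points `(k / M) • x` of a ray. For nearby
`x` and `y`, consecutive points on the two rays span quadrilaterals that lie in balls inside `Ω`,
where `B` has a potential, so the differences of the terms telescope. -/
theorem exists_potential_on_closedBall (hΩ : IsOpen Ω) (hB : HasLocalPotentials Ω B)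
    (hu : Continuous u) (huΩ : ∀ x, u x ∈ Ω) (R : ℝ) : ∃ g : X → ℝ, g 0 = 0 ∧ ∃ η > 0,
      ∀ x ∈ closedBall (0 : X) R, ∀ y ∈ closedBall (0 : X) R, dist x y < η →
        g y - g x = segmentIntegral B (u x) (u y) := by
  have hK : IsCompact (closedBall (0 : X) R) := isCompact_closedBall 0 R
  obtain ⟨δ, hδ, hδΩ⟩ := (hK.image hu).exists_thickening_subset_open hΩ
    (image_subset_iff.2 fun x _ => huΩ x)
  have hball : ∀ x ∈ closedBall (0 : X) R, ball (u x) δ ⊆ Ω := fun x hx =>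
    (ball_subset_thickening (mem_image_of_mem u hx) δ).trans hδΩ
  obtain ⟨η, hη, hηδ⟩ := Metric.uniformContinuousOn_iff.1
    (hK.uniformContinuousOn_of_continuous hu.continuousOn) (δ / 2) (by positivity)
  -- With `N + 1` subdivisions, consecutive points of a ray are closer than `η`, and their images
  -- closer than `δ / 2`.
  obtain ⟨N, hN⟩ := exists_nat_gt (R / η)
  have hRN : R < (N + 1 : ℕ) * η := by
    rw [div_lt_iff₀ hη] at hN; push_cast; nlinarith
  set M : ℕ := N + 1 with hM
  have hM0 : (0 : ℝ) < M := by positivity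
  have hmem : ∀ x ∈ closedBall (0 : X) R, ∀ k : ℕ, k ≤ M →
      ((k : ℝ) / M) • x ∈ closedBall (0 : X) R := fun x hx k hk => by
    rw [mem_closedBall_zero_iff] at hx ⊢
    rw [norm_smul, Real.norm_of_nonneg (by positivity)]
    have : (k : ℝ) / M ≤ 1 := (div_le_one hM0).2 (by exact_mod_cast hk)
    exact (mul_le_of_le_one_left (norm_nonneg x) this).trans hx
  have hstep : ∀ x ∈ closedBall (0 : X) R, ∀ k : ℕ, k < M →
      dist (u (((k : ℝ) / M) • x)) (u ((((k + 1 : ℕ) : ℝ) / M) • x)) < δ / 2 := fun x hx k hk => by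
    refine hηδ _ (hmem x hx k hk.le) _ (hmem x hx (k + 1) hk) ?_
    rw [dist_eq_norm, ← sub_smul, norm_smul]
    have : ((k : ℝ) / M - ((k + 1 : ℕ) : ℝ) / M) = -(1 / M) := by push_cast; ring
    rw [this, norm_neg, Real.norm_of_nonneg (by positivity), one_div_mul_eq_div, div_lt_iff₀ hM0,
      mul_comm]
    exact (mem_closedBall_zero_iff.1 hx).trans_lt hRN
  refine ⟨fun x => ∑ k ∈ Finset.range M,
    segmentIntegral B (u (((k : ℝ) / M) • x)) (u ((((k + 1 : ℕ) : ℝ) / M) • x)),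
    by simp [segmentIntegral_self], η, hη, fun x hx y hy hxy => ?_⟩
  have hside : ∀ k : ℕ, k ≤ M → dist (u (((k : ℝ) / M) • x)) (u (((k : ℝ) / M) • y)) < δ / 2 :=
    fun k hk => by
      refine hηδ _ (hmem x hx k hk) _ (hmem y hy k hk) ?_
      rw [dist_eq_norm, ← smul_sub, norm_smul, Real.norm_of_nonneg (by positivity)]
      have : (k : ℝ) / M ≤ 1 := (div_le_one hM0).2 (by exact_mod_cast hk)
      rw [dist_eq_norm] at hxy
      exact (mul_le_of_le_one_left (norm_nonneg _) this).trans_lt hxy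
  have hterm : ∀ k ∈ Finset.range M,
      segmentIntegral B (u (((k : ℝ) / M) • y)) (u ((((k + 1 : ℕ) : ℝ) / M) • y)) -
        segmentIntegral B (u (((k : ℝ) / M) • x)) (u ((((k + 1 : ℕ) : ℝ) / M) • x)) =
      segmentIntegral B (u ((((k + 1 : ℕ) : ℝ) / M) • x)) (u ((((k + 1 : ℕ) : ℝ) / M) • y)) -
        segmentIntegral B (u (((k : ℝ) / M) • x)) (u (((k : ℝ) / M) • y)) := fun k hk => by
    have hk := Finset.mem_range.1 hk
    have hb := hball _ (hmem x hx k hk.le)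
    have h0 := mem_ball_self (x := u (((k : ℝ) / M) • x)) hδ
    have h1 : u ((((k + 1 : ℕ) : ℝ) / M) • x) ∈ ball (u (((k : ℝ) / M) • x)) δ := by
      rw [mem_ball']; linarith [hstep x hx k hk]
    have h2 : u (((k : ℝ) / M) • y) ∈ ball (u (((k : ℝ) / M) • x)) δ := by
      rw [mem_ball']; linarith [hside k hk.le]
    have h3 : u ((((k + 1 : ℕ) : ℝ) / M) • y) ∈ ball (u (((k : ℝ) / M) • x)) δ := by
      rw [mem_ball']
      linarith [dist_triangle (u (((k : ℝ) / M) • x)) (u (((k : ℝ) / M) • y))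
        (u ((((k + 1 : ℕ) : ℝ) / M) • y)), hside k hk.le, hstep y hy k hk]
    linarith [hB.segmentIntegral_add hb h0 h1 h3, hB.segmentIntegral_add hb h0 h2 h3]
  rw [← Finset.sum_sub_distrib, Finset.sum_congr rfl hterm, Finset.sum_range_sub
    fun k : ℕ => segmentIntegral B (u (((k : ℝ) / M) • x)) (u (((k : ℝ) / M) • y))]
  simp [segmentIntegral_self]

/-- The potentials on balls about the origin all vanish there, so by connectedness they agree on
common balls and glue. -/
theorem exists_isPotentialAlong (hΩ : IsOpen Ω) (hB : HasLocalPotentials Ω B)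
    (hu : Continuous u) (huΩ : ∀ x, u x ∈ Ω) : ∃ g : X → ℝ, IsPotentialAlong B u g := by
  choose G hG0 η hη hG using fun n : ℕ =>
    exists_potential_on_closedBall hΩ hB hu huΩ ((n : ℝ) + 1)
  have hpot : ∀ m n : ℕ, m ≤ n → IsPotentialAlong B (fun x : ball (0 : X) (m + 1) => u x)
      fun x => G n x := fun m n hmn x => by
    have hsub : ∀ z : ball (0 : X) (m + 1), (z : X) ∈ closedBall (0 : X) (n + 1) := fun z =>
      ball_subset_closedBall (ball_subset_ball (by exact_mod_cast Nat.succ_le_succ hmn) z.2)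
    filter_upwards [ball_mem_nhds x (hη n)] with y hy
    exact hG n x (hsub x) y (hsub y) (by rw [mem_ball'] at hy; exact hy)
  have heq : ∀ m n : ℕ, m ≤ n → ∀ x ∈ ball (0 : X) (m + 1), G m x = G n x := fun m n hmn x hx => by
    have : PreconnectedSpace (ball (0 : X) ((m : ℝ) + 1)) :=
      Subtype.preconnectedSpace (convex_ball _ _).isPreconnected
    have h0 : (0 : X) ∈ ball (0 : X) ((m : ℝ) + 1) := mem_ball_self (by positivity)
    have := (hpot m m le_rfl).sub_eq_sub (hpot m n hmn) ⟨0, h0⟩ ⟨x, hx⟩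
    simp only [hG0] at this
    linarith
  have hmem : ∀ x : X, x ∈ ball (0 : X) ((⌈‖x‖⌉₊ : ℝ) + 1) := fun x => by
    rw [mem_ball_zero_iff]
    linarith [Nat.le_ceil ‖x‖]
  refine ⟨fun x => G ⌈‖x‖⌉₊ x, fun x => ?_⟩
  set n : ℕ := ⌈‖x‖⌉₊ + 1 with hn
  filter_upwards [ball_mem_nhds x (hη n), ball_mem_nhds x one_pos] with y hy hy1
  have hxn : ‖x‖ + 1 ≤ n := by rw [hn]; push_cast; linarith [Nat.le_ceil ‖x‖]
  have hyn : ‖y‖ ≤ n := by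
    have h1 : ‖y - x‖ < 1 := by rwa [mem_ball, dist_eq_norm] at hy1
    linarith [norm_sub_norm_le y x]
  rw [heq _ n (Nat.ceil_le.2 hyn) y (hmem y), heq _ n (Nat.le_succ _) x (hmem x)]
  refine hG n x ?_ y ?_ (by rwa [mem_ball'] at hy)
  · rw [mem_closedBall_zero_iff]; linarith
  · rw [mem_closedBall_zero_iff]; linarith

end

/-- Near each parameter `G` differs by a constant from a local potential of `B` along the curve, so
its derivative is the integrand of the circulation. -/
theorem circulation_eq_sub (hΩ : IsOpen Ω) {B : E3 → E3} (hB : HasLocalPotentials Ω B) {x : Ω}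
    {σ : Path x x} (hσ : ContDiffOn ℝ 1 (curve σ) (Icc 0 1)) {G : unitInterval → ℝ}
    (hG : IsPotentialAlong B (fun t => (σ t : E3)) G) : circulation σ B = G 1 - G 0 := by
  have hext : IsPotentialAlong B (curve σ) fun t => G (projIcc 0 1 zero_le_one t) :=
    hG.comp continuous_projIcc
  have hmem : ∀ t, curve σ t ∈ Ω := fun t => Subtype.coe_prop _
  have hder : ∀ t ∈ Icc (0 : ℝ) 1, HasDerivWithinAt (fun t => G (projIcc 0 1 zero_le_one t))
      (inner ℝ (B (curve σ t)) (derivWithin (curve σ) (Icc 0 1) t)) (Icc 0 1) t := fun t ht => by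
    obtain ⟨δ, hδ, hδΩ⟩ := Metric.isOpen_iff.1 hΩ _ (hmem t)
    obtain ⟨f, hf⟩ := hB.2 _ δ hδΩ
    have h0 := mem_ball_self (x := curve σ t) hδ
    have h1 : HasDerivWithinAt (fun s => f (curve σ s))
        (inner ℝ (B (curve σ t)) (derivWithin (curve σ) (Icc 0 1) t)) (Icc 0 1) t :=
      (hf _ h0).comp_hasDerivWithinAt t
        ((hσ t ht).differentiableWithinAt one_ne_zero).hasDerivWithinAt
    have h2 := h1.add_const (G (projIcc 0 1 zero_le_one t) - f (curve σ t))
    refine h2.congr_of_eventuallyEq ?_ (by simp)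
    have hc : Tendsto (curve σ) (𝓝[Icc 0 1] t) (𝓝 (curve σ t)) := hσ.continuousOn t ht
    filter_upwards [nhdsWithin_le_nhds (hext t), hc.eventually (ball_mem_nhds _ hδ)] with s hs hs'
    rw [segmentIntegral_eq_sub hB.1 hδΩ hf h0 hs'] at hs
    linarith
  have hint : ContinuousOn (fun t => (inner ℝ (B (curve σ t))
      (derivWithin (curve σ) (Icc 0 1) t) : ℝ)) (uIcc 0 1) := by
    rw [uIcc_of_le zero_le_one]
    exact ContinuousOn.inner (𝕜 := ℝ) (hB.1.comp hσ.continuousOn fun t _ => hmem t)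
      (hσ.continuousOn_derivWithin (uniqueDiffOn_Icc zero_lt_one) le_rfl)
  rw [circulation, intervalIntegral.integral_eq_sub_of_hasDerivAt_of_le zero_le_one
    (fun t ht => (hder t ht).continuousWithinAt)
    (fun t ht => (hder t (Ioo_subset_Icc_self ht)).hasDerivAt (Icc_mem_nhds ht.1 ht.2))
    hint.intervalIntegrable]
  simp

/-! ### The universal covering of a solid torus -/

/-- The map `ℂ × ℝ → Ω` unrolling the circle factor. -/
def torusCover (H : Ω ≃ₜ ℂ × Circle) (z : ℂ × ℝ) : Ω := H.symm (z.1, Circle.exp z.2)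

theorem continuous_torusCover (H : Ω ≃ₜ ℂ × Circle) : Continuous (torusCover H) := by
  unfold torusCover
  fun_prop

theorem torusCover_add (H : Ω ≃ₜ ℂ × Circle) (w : ℂ) (t : ℝ) :
    torusCover H (w, t + 2 * Real.pi) = torusCover H (w, t) := by
  simp [torusCover]

theorem torusCover_eq_iff (H : Ω ≃ₜ ℂ × Circle) {z : ℂ × ℝ} {x : Ω} :
    torusCover H z = x ↔ z.1 = (H x).1 ∧ Circle.exp z.2 = (H x).2 := by
  rw [torusCover, Homeomorph.symm_apply_eq, Prod.ext_iff]

/-- Only the circle component needs lifting, through the covering `Circle.exp`; the planar component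
is kept. -/
theorem exists_torusCover_lift (H : Ω ≃ₜ ℂ × Circle) {x y : Ω} (σ : Path x y) {z : ℂ × ℝ}
    (hz : torusCover H z = x) :
    ∃ h : C(unitInterval, ℂ × ℝ), (∀ t, torusCover H (h t) = σ t) ∧ h 0 = z := by
  obtain ⟨h1, h2⟩ := (torusCover_eq_iff H).1 hz
  let γ : C(unitInterval, Circle) := ⟨fun t => (H (σ t)).2, by fun_prop⟩
  have h0 : γ 0 = Circle.exp z.2 := by simp [γ, h2]
  have hl := Circle.isCoveringMap_exp.liftPath_lifts γ z.2 h0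
  refine ⟨⟨fun t => ((H (σ t)).1, Circle.isCoveringMap_exp.liftPath γ z.2 h0 t), by fun_prop⟩,
    fun t => (torusCover_eq_iff H).2 ⟨rfl, congrFun hl t⟩, Prod.ext ?_ ?_⟩
  · simp [h1]
  · exact Circle.isCoveringMap_exp.liftPath_zero γ z.2 h0

/-- The homomorphism from the fundamental group of a solid torus to the deck transformations. -/
def torusDeckHom (H : Ω ≃ₜ ℂ × Circle) (x : Ω) (e : Circle.exp ⁻¹' {(H x).2}) :
    FundamentalGroup Ω x →* (Multiplicative (AddSubgroup.zmultiples (2 * Real.pi)))ᵐᵒᵖ :=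
  (Circle.isAddQuotientCoveringMap_exp.fundamentalGroupToMulOpposite e).comp
    (FundamentalGroup.map (⟨fun y => (H y).2, by fun_prop⟩ : C(Ω, Circle)) x)

/-- The second component of `h` lifts the circle component of the loop, so its end point computes
the monodromy. -/
theorem torusDeckHom_apply (H : Ω ≃ₜ ℂ × Circle) {x : Ω} (e : Circle.exp ⁻¹' {(H x).2})
    (σ : Path x x) (h : C(unitInterval, ℂ × ℝ)) (hσ : ∀ t, torusCover H (h t) = σ t)
    (h0 : (h 0).2 = e)
    (a : AddSubgroup.zmultiples (2 * Real.pi)) (h1 : (h 1).2 = a + e) :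
    torusDeckHom H x e (FundamentalGroup.fromPath (Path.Homotopic.Quotient.mk σ)) =
      MulOpposite.op (Multiplicative.ofAdd a) := by
  have hx : ∀ t, Circle.exp (h t).2 = (H (σ t)).2 := fun t => ((torusCover_eq_iff H).1 (hσ t)).2
  have hend : Circle.exp (h 1).2 = (H x).2 := by rw [hx, σ.target]
  refine (Circle.isAddQuotientCoveringMap_exp.fundamentalGroupToMulOpposite_apply_eq_Iff).2 ?_
  let e' : Circle.exp ⁻¹' {(H x).2} := ⟨(h 1).2, hend⟩
  let Γ : Path (e : ℝ) (e' : ℝ) := ⟨⟨fun t => (h t).2, by fun_prop⟩, h0, rfl⟩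
  have key : Circle.isCoveringMap_exp.monodromy
      (FundamentalGroup.map (⟨fun y => (H y).2, by fun_prop⟩ : C(Ω, Circle)) x
        (FundamentalGroup.fromPath (Path.Homotopic.Quotient.mk σ))) e = e' := by
    refine Circle.isCoveringMap_exp.monodromy_eq_of_map_eq (Path.Homotopic.Quotient.mk Γ) ?_
    refine congrArg Path.Homotopic.Quotient.mk ?_
    ext1
    funext t
    exact hx t
  change (a : ℝ) + e = _
  rw [← h1]
  exact congrArg Subtype.val key.symm

theorem homotopic_refl_of_eq {X : Type*} [TopologicalSpace X] {x y : X} (hxy : x = y)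
    {p : Path x x} {q : Path y y} (hq : q.Homotopic (Path.refl y)) (h : ∀ t, p t = q t) :
    p.Homotopic (Path.refl x) := by
  subst hxy
  rwa [Path.ext (funext h)]

/-- The number `k` counts the turns made by a lift. If it is zero, the lift is a loop in the simply
connected space `ℂ × ℝ`, and contracting it contracts `σ`. If `σ` generates, the loop `τ` that goes
round once is homotopic to a power of `σ`, so some integer times `k` equals `1`. -/
theorem exists_winding_number (H : Ω ≃ₜ ℂ × Circle) {x : Ω} (σ : Path x x) :
    ∃ (k : ℤ) (h : C(unitInterval, ℂ × ℝ)), (∀ t, torusCover H (h t) = σ t) ∧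
      h 1 = ((h 0).1, (h 0).2 + k * (2 * Real.pi)) ∧
      (IsNontrivialLoop σ → k ≠ 0) ∧ (IsGeneratingLoop σ → |k| = 1) := by
  obtain ⟨e, he⟩ : ∃ e : ℝ, Circle.exp e = (H x).2 := ⟨_, Circle.exp_arg _⟩
  obtain ⟨h, hh, h0⟩ := exists_torusCover_lift H σ (z := ((H x).1, e))
    ((torusCover_eq_iff H).2 ⟨rfl, he⟩)
  have h1 := (torusCover_eq_iff H).1 ((hh 1).trans σ.target)
  obtain ⟨k, hk⟩ := Circle.exp_eq_exp.1 (h1.2.trans he.symm)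
  have hend : h 1 = ((h 0).1, (h 0).2 + k * (2 * Real.pi)) := by
    rw [h0]; exact Prod.ext h1.1 hk
  refine ⟨k, h, hh, hend, fun hσ hk0 => hσ ?_, fun hσ => ?_⟩
  · rw [hk0, Int.cast_zero, zero_mul, add_zero] at hend
    let Γ : Path (h 0) (h 0) := ⟨h, rfl, hend⟩
    have hΓ : Γ.Homotopic (Path.refl (h 0)) := SimplyConnectedSpace.paths_homotopic _ _
    have hmap := hΓ.map ⟨torusCover H, continuous_torusCover H⟩
    have hx : x = torusCover H (h 0) := by rw [hh, σ.source]
    exact homotopic_refl_of_eq hx hmap fun t => (hh t).symm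
  · have hpi : (2 * Real.pi) ≠ 0 := by positivity
    let a : AddSubgroup.zmultiples (2 * Real.pi) := ⟨2 * Real.pi, AddSubgroup.mem_zmultiples _⟩
    let ee : Circle.exp ⁻¹' {(H x).2} := ⟨e, he⟩
    have hσ1 := torusDeckHom_apply H ee σ h hh (by rw [h0]) (k • a) (by
      rw [hend, h0]; simp [a, ee]; ring)
    let γ : C(unitInterval, ℂ × ℝ) := ⟨fun t => ((H x).1, e + t * (2 * Real.pi)), by fun_prop⟩
    let τ : Path x x := ⟨⟨fun t => torusCover H (γ t),
      (continuous_torusCover H).comp γ.continuous⟩,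
      (torusCover_eq_iff H).2 (by simp [γ, he]),
      (torusCover_eq_iff H).2 (by simp [γ, he])⟩
    have hτ1 := torusDeckHom_apply H ee τ γ (fun t => rfl) (by simp [γ, ee]) a
      (by simp [γ, a, ee, add_comm])
    obtain ⟨n, hn⟩ := Subgroup.mem_zpowers_iff.1
      (hσ (FundamentalGroup.fromPath (Path.Homotopic.Quotient.mk τ)))
    have h3 := congrArg (torusDeckHom H x ee) hn
    rw [map_zpow, hσ1, hτ1] at h3
    have h4 : n • (k • a) = a :=
      congrArg (fun g => Multiplicative.toAdd (MulOpposite.unop g)) h3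
    have h5 : (n * k : ℝ) * (2 * Real.pi) = 2 * Real.pi := by
      have := congrArg Subtype.val h4
      simpa [a, mul_assoc] using this
    have h6 : n * k = 1 := by
      have : (n * k : ℝ) = 1 := by
        have := mul_right_cancel₀ hpi (h5.trans (one_mul _).symm)
        exact this
      exact_mod_cast this
    exact Int.isUnit_iff_abs_eq.1 (IsUnit.of_mul_eq_one n (by rw [mul_comm]; exact h6))

theorem isOpenMap_torusCover (H : Ω ≃ₜ ℂ × Circle) : IsOpenMap (torusCover H) :=
  H.symm.isOpenMap.comp (IsOpenMap.id.prodMap Circle.isCoveringMap_exp.isOpenMap)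

theorem add_int_mul_of_period {g : ℂ × ℝ → ℝ} {c : ℝ}
    (hg : ∀ w t, g (w, t + 2 * Real.pi) = g (w, t) + c) (w : ℂ) (t : ℝ) (k : ℤ) :
    g (w, t + k * (2 * Real.pi)) = g (w, t) + k * c := by
  induction k using Int.induction_on with
  | zero => simp
  | succ n ih =>
    have := hg w (t + n * (2 * Real.pi))
    push_cast at ih ⊢
    rw [show t + (n + 1) * (2 * Real.pi) = t + n * (2 * Real.pi) + 2 * Real.pi by ring, this, ih]
    ring
  | pred n ih =>
    have := hg w (t + (-n - 1) * (2 * Real.pi))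
    push_cast at ih ⊢
    rw [show t + (-n - 1) * (2 * Real.pi) + 2 * Real.pi = t + -n * (2 * Real.pi) by ring,
      ih] at this
    linarith

/-- The circulations of a curl-free field on a solid torus are multiples of a single period, and
the field is a gradient if the period vanishes. -/
theorem exists_period (hΩ : IsOpen Ω) (H : Ω ≃ₜ ℂ × Circle) {B : E3 → E3}
    (hB : HasLocalPotentials Ω B) : ∃ c : ℝ,
      (∀ (x : Ω) (σ : Path x x) (k : ℤ) (h : C(unitInterval, ℂ × ℝ)),
        ContDiffOn ℝ 1 (curve σ) (Icc 0 1) → (∀ t, torusCover H (h t) = σ t) →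
        h 1 = ((h 0).1, (h 0).2 + k * (2 * Real.pi)) → circulation σ B = k * c) ∧
      (c = 0 → ∃ f : E3 → ℝ, ∀ x ∈ Ω, HasFDerivAt f (innerSL ℝ (B x)) x) := by
  have hu : Continuous fun z => (torusCover H z : E3) :=
    continuous_subtype_val.comp (continuous_torusCover H)
  obtain ⟨g, hg⟩ := exists_isPotentialAlong hΩ hB hu fun z => Subtype.coe_prop _
  have hshift : IsPotentialAlong B (fun z => (torusCover H z : E3))
      fun z => g (z.1, z.2 + 2 * Real.pi) := by
    have := hg.comp (φ := fun z : ℂ × ℝ => (z.1, z.2 + 2 * Real.pi)) (by fun_prop)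
    have he : (fun z => (torusCover H z : E3)) ∘ (fun z : ℂ × ℝ => (z.1, z.2 + 2 * Real.pi)) =
        fun z => (torusCover H z : E3) := by
      funext z
      simp only [Function.comp_apply, torusCover_add]
    rwa [he] at this
  -- Translation by `2π` produces another potential along the same covering map, so it changes `g`
  -- by a constant.
  set c : ℝ := g (0, 0 + 2 * Real.pi) - g (0, 0) with hc
  have hper : ∀ w t, g (w, t + 2 * Real.pi) = g (w, t) + c := fun w t => by
    have := hshift.sub_eq_sub hg (0, 0) (w, t)
    simp only at this
    linarith
  refine ⟨c, fun x σ k h hσ hh hend => ?_, fun hc0 => ?_⟩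
  · have hG : IsPotentialAlong B (fun t => (σ t : E3)) (g ∘ h) := by
      have := hg.comp h.continuous
      have he : (fun z => (torusCover H z : E3)) ∘ h = fun t => (σ t : E3) := by
        funext t
        simp only [Function.comp_apply, hh]
      rwa [he] at this
    rw [circulation_eq_sub hΩ hB hσ hG, Function.comp_apply, Function.comp_apply, hend,
      add_int_mul_of_period hper]
    simp
  · classical
    -- This section of the covering need not be continuous. With period zero, however, `g` takes the
    -- same value at all points of a fibre, so `g` composed with it is independent of the choice.
    let lift : Ω → ℂ × ℝ := fun x => ((H x).1, Complex.arg ((H x).2 : ℂ))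
    have hlift : ∀ x, torusCover H (lift x) = x := fun x =>
      (torusCover_eq_iff H).2 ⟨rfl, Circle.exp_arg _⟩
    have hglift : ∀ z, g (lift (torusCover H z)) = g z := fun z => by
      have h1 := (torusCover_eq_iff H).1 (hlift (torusCover H z))
      have h2 := (torusCover_eq_iff H (z := z)).1 rfl
      obtain ⟨k, hk⟩ := Circle.exp_eq_exp.1 (h1.2.trans h2.2.symm)
      have h3 : lift (torusCover H z) = (z.1, z.2 + k * (2 * Real.pi)) :=
        Prod.ext (h1.1.trans h2.1.symm) hk
      rw [h3, add_int_mul_of_period hper, hc0, mul_zero, add_zero]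
    refine ⟨fun q => if hq : q ∈ Ω then g (lift ⟨q, hq⟩) else 0, fun p hp => ?_⟩
    obtain ⟨δ, hδ, hδΩ⟩ := Metric.isOpen_iff.1 hΩ p hp
    obtain ⟨f, hf⟩ := hB.2 p δ hδΩ
    have hev : ∀ᶠ y in 𝓝 (⟨p, hp⟩ : Ω), g (lift y) - g (lift ⟨p, hp⟩) =
        segmentIntegral B p y := by
      -- As the covering map is open, the increment formula near a lifted point descends to a
      -- neighbourhood in `Ω`.
      have h1 := (isOpenMap_torusCover H).nhds_le (lift ⟨p, hp⟩)
      rw [hlift] at h1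
      refine h1 (mem_map.2 ?_)
      filter_upwards [hg (lift ⟨p, hp⟩)] with z hz
      rw [mem_preimage, mem_ofPred_eq, hglift, hz, hlift]
    have hev' : ∀ᶠ q in 𝓝 p, ∀ hq : q ∈ Ω, g (lift ⟨q, hq⟩) - g (lift ⟨p, hp⟩) =
        segmentIntegral B p q := by
      rw [← map_nhds_subtype_coe_eq_nhds hp (hΩ.mem_nhds hp)]
      exact eventually_map.2 (hev.mono fun y hy hq => hy)
    refine ((hf p (mem_ball_self hδ)).add_const (g (lift ⟨p, hp⟩) - f p)).congr_of_eventuallyEq ?_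
    filter_upwards [hev', hΩ.mem_nhds hp, ball_mem_nhds p hδ] with q h1 hq hqb
    have h2 := h1 hq
    rw [segmentIntegral_eq_sub hB.1 hδΩ hf (mem_ball_self hδ) hqb] at h2
    rw [dif_pos hq]
    linarith

/-! ### Estimates on solid tori -/

theorem contDiffOn_of_hasFDerivAt_inner (hΩ : IsOpen Ω) {B : E3 → E3} (hB : ContinuousOn B Ω)
    {f : E3 → ℝ} (hf : ∀ x ∈ Ω, HasFDerivAt f (innerSL ℝ (B x)) x) : ContDiffOn ℝ 1 f Ω := by
  rw [← zero_add (1 : ℕ∞ω), contDiffOn_succ_iff_fderiv_of_isOpen hΩ]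
  refine ⟨fun x hx => (hf x hx).differentiableAt.differentiableWithinAt, by simp,
    contDiffOn_zero.2 ?_⟩
  exact ((innerSL ℝ (E := E3)).continuous.comp_continuousOn hB).congr fun x hx => (hf x hx).fderiv

theorem gradient_eq_of_hasFDerivAt_inner {f : E3 → ℝ} {v x : E3}
    (hf : HasFDerivAt f (innerSL ℝ v) x) : gradient f x = v :=
  HasGradientAt.gradient (hasGradientAt_iff_hasFDerivAt.2 hf)

theorem hasLocalPotentials_of_isContinuousRep (hΩ : IsBoundedC11Domain Ω) {B : L2Field Ω}
    (hB : B ∈ harmonicFields Ω) {B' : E3 → E3} (h : IsContinuousRep Ω B B') :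
    HasLocalPotentials Ω B' := by
  obtain ⟨B₁, hsm, hae, -, hsymm⟩ := exists_smooth_rep hΩ.isOpen hΩ.isBounded hB
  have hpot := hasLocalPotentials_of_symmetric hΩ.isOpen hsm hsymm
  have heq := isContinuousRep_eqOn hΩ.isOpen h ⟨hsm.continuousOn, hae⟩
  refine ⟨h.1, fun p δ hp => ?_⟩
  obtain ⟨f, hf⟩ := hpot.2 p δ hp
  exact ⟨f, fun q hq => by rw [heq (hp hq)]; exact hf q hq⟩

theorem coeFn_sub_smul (B B₀ : L2Field Ω) (l : ℝ) :
    ⇑(B - l • B₀) =ᵐ[volume.restrict Ω] fun x => B x - l • B₀ x := by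
  filter_upwards [Lp.coeFn_sub B (l • B₀), Lp.coeFn_smul l B₀] with x h1 h2
  rw [h1, Pi.sub_apply, h2, Pi.smul_apply]

theorem integral_inner_sub_smul (hb : Bornology.IsBounded Ω) (B B₀ : L2Field Ω) (l : ℝ)
    {Ψ : E3 → E3} (hΨ : Continuous Ψ) (hc : HasCompactSupport Ψ) :
    ∫ x in Ω, inner ℝ ((B - l • B₀) x) (Ψ x) =
      (∫ x in Ω, inner ℝ (B x) (Ψ x)) - l * ∫ x in Ω, inner ℝ (B₀ x) (Ψ x) := by
  have h1 : ∫ x in Ω, inner ℝ ((B - l • B₀) x) (Ψ x) =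
      ∫ x in Ω, (inner ℝ (B x) (Ψ x) - l * inner ℝ (B₀ x) (Ψ x) : ℝ) := by
    refine integral_congr_ae ?_
    filter_upwards [coeFn_sub_smul B B₀ l] with x hx
    rw [hx, inner_sub_left, real_inner_smul_left]
  rw [h1, integral_sub (integrableOn_inner_of_continuous hb B hΨ hc)
    ((integrableOn_inner_of_continuous hb B₀ hΨ hc).const_mul l), integral_const_mul]

theorem sub_smul_mem_harmonicFields (hb : Bornology.IsBounded Ω) {B B₀ : L2Field Ω}
    (hB : B ∈ harmonicFields Ω) (hB₀ : B₀ ∈ harmonicFields Ω) (l : ℝ) :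
    B - l • B₀ ∈ harmonicFields Ω := by
  refine ⟨fun φ hφ => ?_, fun Ψ hΨ => ?_⟩
  · rw [← hB.1 φ hφ, integral_inner_sub_smul hb B B₀ l (continuous_gradient (hφ.1.of_le (by simp)))
      (hasCompactSupport_gradient hφ.2.1), integral_inner_gradient_eq_zero hB₀.1 hφ]
    ring
  · rw [← hB.2 Ψ hΨ, integral_inner_sub_smul hb B B₀ l hΨ.curl.1.continuous hΨ.curl.2.1,
      integral_inner_curl_eq_zero hB₀.2 hΨ]
    ring

theorem IsNormalTrace.sub_smul (hΩ : IsBoundedC11Domain Ω) {B B₀ : L2Field Ω}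
    (hB : B ∈ harmonicFields Ω) (hB₀ : B₀ ∈ harmonicFields Ω) {T T₀ : negHalfSobolev Ω}
    (hT : IsNormalTrace Ω B T) (hT₀ : IsNormalTrace Ω B₀ T₀) (l : ℝ) :
    IsNormalTrace Ω (B - l • B₀) (T - l • T₀) := by
  rw [isNormalTrace_iff hΩ hB] at hT
  rw [isNormalTrace_iff hΩ hB₀] at hT₀
  refine (isNormalTrace_iff hΩ (sub_smul_mem_harmonicFields hΩ.isBounded hB hB₀ l)).2
    fun φ hφ hc w hw => ?_
  rw [integral_inner_sub_smul hΩ.isBounded B B₀ l (continuous_gradient hφ)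
    (hasCompactSupport_gradient hc), ← hT φ hφ hc w hw, ← hT₀ φ hφ hc w hw]
  rfl

theorem IsContinuousRep.sub_smul {B B₀ : L2Field Ω} {B' B₀' : E3 → E3}
    (h : IsContinuousRep Ω B B') (h₀ : IsContinuousRep Ω B₀ B₀') (l : ℝ) :
    IsContinuousRep Ω (B - l • B₀) fun x => B' x - l • B₀' x := by
  refine ⟨h.1.sub (h₀.1.const_smul l), ?_⟩
  filter_upwards [coeFn_sub_smul B B₀ l, h.2, h₀.2] with x h1 h2 h3
  rw [h1, h2, h3]

theorem continuousOn_circulation_integrand {x : Ω} {σ : Path x x}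
    (hσ : ContDiffOn ℝ 1 (curve σ) (Icc 0 1)) {B : E3 → E3} (hB : ContinuousOn B Ω) :
    ContinuousOn (fun t => (inner ℝ (B (curve σ t)) (derivWithin (curve σ) (Icc 0 1) t) : ℝ))
      (uIcc 0 1) := by
  rw [uIcc_of_le zero_le_one]
  exact ContinuousOn.inner (𝕜 := ℝ) (hB.comp hσ.continuousOn fun t _ => Subtype.coe_prop _)
    (hσ.continuousOn_derivWithin (uniqueDiffOn_Icc zero_lt_one) le_rfl)

theorem circulation_sub_smul {x : Ω} {σ : Path x x} (hσ : ContDiffOn ℝ 1 (curve σ) (Icc 0 1))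
    {B B₀ : E3 → E3} (hB : ContinuousOn B Ω) (hB₀ : ContinuousOn B₀ Ω) (l : ℝ) :
    circulation σ (fun x => B x - l • B₀ x) = circulation σ B - l * circulation σ B₀ := by
  simp only [circulation, inner_sub_left, real_inner_smul_left]
  rw [intervalIntegral.integral_sub
    (continuousOn_circulation_integrand hσ hB).intervalIntegrable
    ((continuousOn_circulation_integrand hσ hB₀).intervalIntegrable.const_mul l),
    intervalIntegral.integral_const_mul]

/-- The loop has compact image in `Ω`, where the interior estimate bounds `B`, and its velocity is
bounded. -/
theorem exists_abs_circulation_le (hΩ : IsBoundedC11Domain Ω) {x : Ω} {σ : Path x x}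
    (hσ : ContDiffOn ℝ 1 (curve σ) (Icc 0 1)) : ∃ C : ℝ, 0 ≤ C ∧ ∀ B ∈ harmonicFields Ω,
      ∀ B' : E3 → E3, IsContinuousRep Ω B B' → |circulation σ B'| ≤ C * ‖B‖ := by
  obtain ⟨C, hC, hCB⟩ := exists_norm_rep_le hΩ.isOpen hΩ.isBounded
    (isCompact_Icc.image_of_continuousOn hσ.continuousOn)
    (image_subset_iff.2 fun t _ => Subtype.coe_prop _)
  obtain ⟨M, hM⟩ := isCompact_Icc.exists_bound_of_continuousOn
    (hσ.continuousOn_derivWithin (uniqueDiffOn_Icc zero_lt_one) le_rfl)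
  have hM0 : 0 ≤ M := (norm_nonneg _).trans (hM 0 (left_mem_Icc.2 zero_le_one))
  refine ⟨C * M, by positivity, fun B hB B' hB' => ?_⟩
  have h : ∀ t ∈ Set.uIoc (0 : ℝ) 1, ‖(inner ℝ (B' (curve σ t))
      (derivWithin (curve σ) (Icc 0 1) t) : ℝ)‖ ≤ C * M * ‖B‖ := fun t ht => by
    rw [uIoc_of_le zero_le_one] at ht
    have ht' := Ioc_subset_Icc_self ht
    calc _ ≤ ‖B' (curve σ t)‖ * ‖derivWithin (curve σ) (Icc 0 1) t‖ := norm_inner_le_norm _ _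
      _ ≤ C * ‖B‖ * M := by
        gcongr
        exacts [hCB B hB B' hB' _ (mem_image_of_mem _ ht'), hM t ht']
      _ = _ := by ring
  simpa [circulation] using intervalIntegral.norm_integral_le_of_norm_le_const h

/-- The estimate for a loop with nonzero winding number. -/
theorem exists_norm_equiv_of_winding (hΩ : IsBoundedC11Domain Ω) (H : Ω ≃ₜ ℂ × Circle) {x : Ω}
    {σ : Path x x} (hσ : ContDiffOn ℝ 1 (curve σ) (Icc 0 1)) {k : ℤ} (hk : k ≠ 0)
    {h : C(unitInterval, ℂ × ℝ)} (hh : ∀ t, torusCover H (h t) = σ t)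
    (hend : h 1 = ((h 0).1, (h 0).2 + k * (2 * Real.pi))) :
    ∃ c₁ c₂ : ℝ, 0 < c₁ ∧ 0 < c₂ ∧ ∀ B ∈ harmonicFields Ω, ∀ T : negHalfSobolev Ω,
      IsNormalTrace Ω B T → ∀ B' : E3 → E3, IsContinuousRep Ω B B' →
        ‖B‖ ≤ c₁ * √(‖T‖ ^ 2 + circulation σ B' ^ 2) ∧
        c₁ * √(‖T‖ ^ 2 + circulation σ B' ^ 2) ≤ c₂ * ‖B‖ := by
  obtain ⟨a, ha, hgrad⟩ := exists_norm_le_of_gradient hΩ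
  obtain ⟨N, hN, htrace⟩ := exists_norm_normalTrace_le hΩ
  obtain ⟨C, hC, hcirc⟩ := exists_abs_circulation_le hΩ hσ
  -- The circulation is `k` times the period and `k ≠ 0`, so zero circulation makes the period
  -- vanish and `B` a gradient.
  have hexact : ∀ B ∈ harmonicFields Ω, ∀ T, IsNormalTrace Ω B T → ∀ B', IsContinuousRep Ω B B' →
      circulation σ B' = 0 → ‖B‖ ≤ a * ‖T‖ := fun B hB T hT B' hB' h0 => by
    have hpot := hasLocalPotentials_of_isContinuousRep hΩ hB hB'
    obtain ⟨c, hc, hc0⟩ := exists_period hΩ.isOpen H hpot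
    rw [hc x σ k h hσ hh hend] at h0
    obtain ⟨f, hf⟩ := hc0 ((mul_eq_zero.1 h0).resolve_left (by exact_mod_cast hk))
    refine hgrad B hB T hT f (contDiffOn_of_hasFDerivAt_inner hΩ.isOpen hB'.1 hf) ?_
    filter_upwards [hB'.2, ae_restrict_mem hΩ.isOpen.measurableSet] with y hy hyΩ
    rw [hy, gradient_eq_of_hasFDerivAt_inner (hf y hyΩ)]
  -- Subtracting a suitable multiple of a fixed field `B₀` with non-zero circulation reduces to zero
  -- circulation. If no such field exists, every field is already of that kind and `b = 0` works.
  obtain ⟨b, hb, hupper⟩ : ∃ b : ℝ, 0 ≤ b ∧ ∀ B ∈ harmonicFields Ω, ∀ T, IsNormalTrace Ω B T →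
      ∀ B', IsContinuousRep Ω B B' → ‖B‖ ≤ a * ‖T‖ + b * |circulation σ B'| := by
    by_cases h0 : ∀ B ∈ harmonicFields Ω, ∀ B', IsContinuousRep Ω B B' → circulation σ B' = 0
    · exact ⟨0, le_rfl, fun B hB T hT B' hB' => by
        simpa using hexact B hB T hT B' hB' (h0 B hB B' hB')⟩
    · push Not at h0
      obtain ⟨B₀, hB₀, B₀', hB₀', h0⟩ := h0
      obtain ⟨C₀, -, htr⟩ := exists_isNormalTrace hΩ
      obtain ⟨T₀, hT₀, -⟩ := htr B₀ hB₀
      refine ⟨(a * ‖T₀‖ + ‖B₀‖) / |circulation σ B₀'|, by positivity,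
        fun B hB T hT B' hB' => ?_⟩
      set l := circulation σ B' / circulation σ B₀' with hl
      have h1 := hexact _ (sub_smul_mem_harmonicFields hΩ.isBounded hB hB₀ l) _
        (hT.sub_smul hΩ hB hB₀ hT₀ l) _ (hB'.sub_smul hB₀' l) (by
          rw [circulation_sub_smul hσ hB'.1 hB₀'.1, hl, div_mul_cancel₀ _ h0, sub_self])
      have h2 : ‖B‖ ≤ ‖B - l • B₀‖ + |l| * ‖B₀‖ := by
        have h5 := norm_add_le (B - l • B₀) (l • B₀)
        rwa [sub_add_cancel, norm_smul, Real.norm_eq_abs] at h5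
      have h3 : ‖T - l • T₀‖ ≤ ‖T‖ + |l| * ‖T₀‖ := by
        have h5 := norm_sub_le T (l • T₀)
        have h6 := ContinuousLinearMap.opNorm_smul_le l T₀
        rw [Real.norm_eq_abs] at h6
        linarith
      have h4 : (a * ‖T₀‖ + ‖B₀‖) / |circulation σ B₀'| * |circulation σ B'| =
          (a * ‖T₀‖ + ‖B₀‖) * |l| := by rw [hl, abs_div]; ring
      rw [h4]
      nlinarith [mul_le_mul_of_nonneg_left h3 ha.le]
  -- The norm of `T` and the circulation are each at most the root, and the root is at most their
  -- sum. The summand `1` keeps the second constant positive when `N` and `C` vanish.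
  refine ⟨a + b, (a + b) * (N + C) + 1, by positivity, by positivity,
    fun B hB T hT B' hB' => ⟨?_, ?_⟩⟩
  · have h1 : ‖T‖ ≤ √(‖T‖ ^ 2 + circulation σ B' ^ 2) :=
      Real.le_sqrt_of_sq_le (le_add_of_nonneg_right (sq_nonneg _))
    have h2 : |circulation σ B'| ≤ √(‖T‖ ^ 2 + circulation σ B' ^ 2) :=
      Real.le_sqrt_of_sq_le (by rw [sq_abs]; exact le_add_of_nonneg_left (sq_nonneg _))
    calc _ ≤ _ := hupper B hB T hT B' hB'
      _ ≤ a * √(‖T‖ ^ 2 + circulation σ B' ^ 2) + b * √(‖T‖ ^ 2 + circulation σ B' ^ 2) := by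
        gcongr
      _ = _ := by ring
  · have h1 : √(‖T‖ ^ 2 + circulation σ B' ^ 2) ≤ ‖T‖ + |circulation σ B'| := by
      refine Real.sqrt_le_iff.2 ⟨add_nonneg (norm_nonneg T) (abs_nonneg _), ?_⟩
      rw [← sq_abs (circulation σ B')]
      nlinarith [norm_nonneg T, abs_nonneg (circulation σ B'),
        mul_nonneg (norm_nonneg T) (abs_nonneg (circulation σ B'))]
    have h2 := htrace B hB T hT
    have h3 := hcirc B hB B' hB'
    calc _ ≤ (a + b) * (N * ‖B‖ + C * ‖B‖) := by
          gcongr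
          exact h1.trans (add_le_add h2 h3)
      _ ≤ _ := by nlinarith [norm_nonneg B]

/-- Both loops have winding number `±1`, so both circulations equal the period of `B` up to sign. -/
theorem abs_circulation_eq_of_isGeneratingLoop (hΩ : IsBoundedC11Domain Ω) (H : Ω ≃ₜ ℂ × Circle)
    {x y : Ω} {σ : Path x x} {τ : Path y y} (hσ : IsSimpleC1Loop σ) (hσg : IsGeneratingLoop σ)
    (hτ : IsSimpleC1Loop τ) (hτg : IsGeneratingLoop τ) {B : E3 → E3}
    (hB : HasLocalPotentials Ω B) : |circulation σ B| = |circulation τ B| := by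
  obtain ⟨c, hc, -⟩ := exists_period hΩ.isOpen H hB
  obtain ⟨k, h, hh, hend, -, hk⟩ := exists_winding_number H σ
  obtain ⟨l, g, hg, gend, -, hl⟩ := exists_winding_number H τ
  rw [hc x σ k h hσ.1 hh hend, hc y τ l g hτ.1 hg gend, abs_mul, abs_mul, ← Int.cast_abs,
    ← Int.cast_abs, hk hσg, hl hτg]

theorem exists_normalTrace_equiv_of_exact (hΩ : IsBoundedC11Domain Ω) :
    ∃ c₁ c₂ : ℝ, 0 < c₁ ∧ 0 < c₂ ∧ ∀ B ∈ exactHarmonicFields Ω, ∀ T : negHalfSobolev Ω,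
      IsNormalTrace Ω B T → c₁ * ‖T‖ ≤ ‖B‖ ∧ ‖B‖ ≤ c₂ * ‖T‖ := by
  obtain ⟨a, ha, hgrad⟩ := exists_norm_le_of_gradient hΩ
  obtain ⟨N, hN, htrace⟩ := exists_norm_normalTrace_le hΩ
  refine ⟨1 / (N + 1), a, by positivity, ha, fun B hB T hT => ⟨?_, ?_⟩⟩
  · rw [one_div_mul_eq_div, div_le_iff₀ (by positivity)]
    nlinarith [htrace B hB.1 T hT, norm_nonneg B]
  · obtain ⟨f, hf, hBf⟩ := exists_gradient_of_exact hΩ.isOpen hΩ.isBounded hB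
    exact hgrad B hB.1 T hT f hf hBf

end

end HarmonicFields

theorem theoremA1 (Ω : Set E3) (hΩ : IsBoundedC11Domain Ω) :
    -- normal traces and continuous representatives are well defined
    (∀ B ∈ harmonicFields Ω, ∃! T : negHalfSobolev Ω, IsNormalTrace Ω B T) ∧
    (∀ B ∈ harmonicFields Ω, ∃ B' : E3 → E3, IsContinuousRep Ω B B') ∧
    -- exact harmonic fields
    (∃ c₁ c₂ : ℝ, 0 < c₁ ∧ 0 < c₂ ∧
      ∀ B ∈ exactHarmonicFields Ω, ∀ T : negHalfSobolev Ω, IsNormalTrace Ω B T →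
        c₁ * ‖T‖ ≤ ‖B‖ ∧ ‖B‖ ≤ c₂ * ‖T‖) ∧
    -- solid tori
    (IsSolidTorus Ω →
      (∀ (x : Ω) (σ : Path x x), IsSimpleC1Loop σ → IsNontrivialLoop σ →
        ∃ c₁ c₂ : ℝ, 0 < c₁ ∧ 0 < c₂ ∧
          ∀ B ∈ harmonicFields Ω, ∀ T : negHalfSobolev Ω, IsNormalTrace Ω B T →
            ∀ B' : E3 → E3, IsContinuousRep Ω B B' →
              ‖B‖ ≤ c₁ * √(‖T‖ ^ 2 + circulation σ B' ^ 2) ∧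
              c₁ * √(‖T‖ ^ 2 + circulation σ B' ^ 2) ≤ c₂ * ‖B‖) ∧
      -- the constants do not depend on the loop if it generates the fundamental group
      (∃ c₁ c₂ : ℝ, 0 < c₁ ∧ 0 < c₂ ∧
        ∀ (x : Ω) (σ : Path x x), IsSimpleC1Loop σ → IsGeneratingLoop σ →
          ∀ B ∈ harmonicFields Ω, ∀ T : negHalfSobolev Ω, IsNormalTrace Ω B T →
            ∀ B' : E3 → E3, IsContinuousRep Ω B B' →
              ‖B‖ ≤ c₁ * √(‖T‖ ^ 2 + circulation σ B' ^ 2) ∧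
              c₁ * √(‖T‖ ^ 2 + circulation σ B' ^ 2) ≤ c₂ * ‖B‖)) := by
  refine ⟨fun B hB => ?_, fun B hB => ?_, exists_normalTrace_equiv_of_exact hΩ, fun hT => ?_⟩
  · obtain ⟨C, -, h⟩ := exists_isNormalTrace hΩ
    obtain ⟨T, hT, -⟩ := h B hB
    exact ⟨T, hT, fun T' hT' => isNormalTrace_unique hΩ hB hT' hT⟩
  · obtain ⟨B', hsm, hae, -⟩ := exists_smooth_rep hΩ.isOpen hΩ.isBounded hB
    exact ⟨B', hsm.continuousOn, hae⟩
  · obtain ⟨Θ⟩ := hT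
    -- The disc is exchanged for the plane so that the universal covering becomes the vector space
    -- `ℂ × ℝ`, on which potentials are built along rays.
    let H : Ω ≃ₜ ℂ × Circle :=
      Θ.trans (Homeomorph.unitBall.symm.prodCongr (Homeomorph.refl Circle))
    refine ⟨fun x σ hσ hnt => ?_, ?_⟩
    · obtain ⟨k, h, hh, hend, hk, -⟩ := exists_winding_number H σ
      exact exists_norm_equiv_of_winding hΩ H hσ.1 (hk hnt) hh hend
    -- One simple generating loop, if there is any, supplies the constants for all of them;
    -- otherwise any constants do.
    · by_cases hex : ∃ (x : Ω) (σ : Path x x), IsSimpleC1Loop σ ∧ IsGeneratingLoop σ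
      · obtain ⟨x, σ, hσ, hg⟩ := hex
        obtain ⟨k, h, hh, hend, -, hk⟩ := exists_winding_number H σ
        have hk0 : k ≠ 0 := fun h0 => by simpa [h0] using hk hg
        obtain ⟨c₁, c₂, h1, h2, hle⟩ := exists_norm_equiv_of_winding hΩ H hσ.1 hk0 hh hend
        refine ⟨c₁, c₂, h1, h2, fun y τ hτ hτg B hB T hT B' hB' => ?_⟩
        have habs := abs_circulation_eq_of_isGeneratingLoop hΩ H hτ hτg hσ hg
          (hasLocalPotentials_of_isContinuousRep hΩ hB hB')
        rw [(sq_eq_sq_iff_abs_eq_abs _ _).2 habs]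
        exact hle B hB T hT B' hB'
      · exact ⟨1, 1, one_pos, one_pos, fun x σ hσ hg => absurd ⟨x, σ, hσ, hg⟩ hex⟩
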